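/- **Model.** Fix $n,N,T$ with $T\ge 1$. Let $\mathcal F_0=\sigma(Z)$ be the initial information; $x_0$, the exogenous vectors $\psi_{k,t},\psi_{y,t}$ and linearization parameters $\mu_t\in\mathbb R^n$ are $\mathcal F_0$-measurable (in the model $\mu_t$ is the $\mathcal F_0$-conditional mean of log dividend minus log price; the results hold for every $\mathcal F_0$-measurable $\mu_t$). Put $g_t=i_n+e^{\mu_t}$, $i_n=(1,\dots,1)'$, $G_t=\mathrm{diag}\,g_t$, $h_t=G_t(\ln g_t-\mu_t)+\mu_t$. Write $x_t=(\tilde P_t',y_t')'$, $y_t=(\tilde d_t',\tilde r_{t+1})'$, where $\tilde P_t=\ln P_t$ are log prices, $\tilde d_t$ log dividends and $\tilde r_{t+1}$ is the log spot rate for the period $(t,t+1]$, known at $t$; $j_r'y_t=\tilde r_{t+1}$. Under the real measure $\mathbb P$, for $t=1,\dots,T$, $$\tilde P_t=G_tC_{k,t}\psi_{k,t}-h_t-(G_t-I_n)\tilde d_t+G_t\tilde P_{t-1}+G_tu_t,\qquad y_t=C_{y,t}\psi_{y,t}+y_{t-1}+\eta_t .$$ Given $\mathcal F_0$: the stochastic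 matrix $\mathsf P$ has density $f(\mathsf P|\mathcal F_0)$; given $\mathsf P$ the regimes $s=(s_1,\dots,s_T)$ form a Markov chain on $N$ states with initial probabilities $p_{s_0s_1}$ and transition matrix $\mathsf P$; given $s$ (and $\mathsf P$) the coefficients $(C,\Gamma)=(C_{k,t},C_{y,t},\Sigma_t)_{t\le T}$ have density $f(C,\Gamma|s,\mathcal F_0)$, with all $\Sigma_t$ positive definite (densities are with respect to fixed $\sigma$-finite measures $d\mathsf P$ and $dC\,d\Gamma$); given all of these, $\xi_t=(u_t',\eta_t')'\sim\mathcal N(0,\Sigma_t)$ independently, $\Sigma_t=\begin{bmatrix}\Sigma_{uu,t}&\Sigma_{u\eta,t}\\ \Sigma_{\eta u,t}&\Sigma_{\eta\eta,t}\end{bmatrix}$. The price plus dividend is understood in its log-linearized form $P_t+d_t=P_{t-1}\odot\exp\{\tilde P_t-\tilde P_{t-1}+\ln g_t+G_t^{-1}(G_t-I_n)(\tilde d_t-\tilde P_t-\mu_t)\}$. Let $D_t=e^{-\tilde r_1-\dots-\tilde r_t}$, $\overline P_t=D_tP_t$, and let $\Delta\overline P_t+\overline d_t=D_t(P_t+d_t)-\overline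 P_{t-1}$ be the discounted gain. Let $\mathcal F_t=\mathcal F_0\vee\sigma(x_1,\dots,x_t)$, $\mathcal H_t=\mathcal F_t\vee\sigma(C,\Gamma,\mathsf P,s)$. The lifetime $T_x\ge0$ has no atom at an integer; $\mathcal T^x_t=\sigma(1_{\{T_x>u\}}:0\le u\le t)$; $\mathcal T^x_T$ is independent of $\mathcal H_T$; $\mathcal F^x_t=\mathcal F_t\vee\mathcal T^x_t$, $\mathcal H_t^x=\mathcal H_t\vee\mathcal T_t^x$; ${}_kp_{x+t}=\mathbb P(T_x>t+k)/\mathbb P(T_x>t)$, $q_{x+k}=1-{}_1p_{x+k}$, $K_x=\lfloor T_x\rfloor$. The risk-neutral measure $\tilde{\mathbb P}$ has density $\prod_{t=1}^T\exp\{\theta_t'(\mathsf G_t\Sigma_t\mathsf G_t')^{-1}\mathsf G_t\xi_t-\tfrac12\theta_t'(\mathsf G_t\Sigma_t\mathsf G_t')^{-1}\theta_t\}$ with respect to $\mathbb P$, where $\mathsf G_t=\mathrm{diag}(G_t,I_{n+1})$, $\theta_t=\begin{bmatrix}G_t\\ \Sigma_{\eta u,t}\Sigma_{uu,t}^{-1}\end{bmatrix}(\tilde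 r_ti_n-C_{k,t}\psi_{k,t}-\tfrac12\mathcal D[\Sigma_{uu,t}])$ and $\mathcal D[\cdot]$ is the vector of diagonal elements. **Moments.** Let $H_t=[G_t-I_n:0]$, $E_t=I_{n+1}+\Sigma_{\eta u,t}\Sigma_{uu,t}^{-1}i_nj_r'$, $Q_{0,t}=\begin{bmatrix}I&H_t\\0&I\end{bmatrix}$, $Q_{1,t}=\begin{bmatrix}G_t&G_ti_nj_r'\\0&E_t\end{bmatrix}$, $\tilde\nu_t=\big((-\tfrac12G_t\mathcal D[\Sigma_{uu,t}]-h_t)',(C_{y,t}\psi_{y,t}-\Sigma_{\eta u,t}\Sigma_{uu,t}^{-1}(C_{k,t}\psi_{k,t}+\tfrac12\mathcal D[\Sigma_{uu,t}]))'\big)'$, $\Pi_{\beta,i}=\prod_{\alpha=\beta+1}^iQ_{0,\alpha}^{-1}Q_{1,\alpha}$ (later factors to the left, $\Pi_{i,i}=I$), $R_{\beta,i}=\Pi_{\beta,i}Q_{0,\beta}^{-1}$, and $$\tilde\mu_{i|t}=\Pi_{t,i}x_t+\sum_{\beta=t+1}^iR_{\beta,i}\tilde\nu_\beta,\qquad \Sigma_{i_1,i_2|t}=\sum_{\beta=t+1}^{i_1\wedge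 i_2}R_{\beta,i_1}\mathsf G_\beta\Sigma_\beta\mathsf G_\beta'R_{\beta,i_2}'.$$ With $\tilde n=2n+1$ let $$B_{t,u}=\exp\Big\{-\tilde r_{t+1}-\sum_{\beta=t+1}^{u-1}(\tilde\mu_{\beta|t})_{\tilde n}+\tfrac12\sum_{\alpha,\beta=t+1}^{u-1}(\Sigma_{\alpha,\beta|t})_{\tilde n,\tilde n}\Big\},\qquad \hat\mu_{k|t,u}=\tilde\mu_{k|t}-\sum_{\beta=t+1}^{u-1}(\Sigma_{k,\beta|t})_{\tilde n}$$ ($\tilde n$-th column). Put $J_P=[I_n:0]$, $\hat\mu^{\tilde P}_{k|t,u}=J_P\hat\mu_{k|t,u}$, $\Sigma^{\tilde P}_{k|t}=J_P\Sigma_{k,k|t}J_P'$, $W_t=[G_t^{-1}:I_n-G_t^{-1}:0]$, $\pi=W_{t+1}x_{t+1}-\tilde r_{t+1}i_n+G_{t+1}^{-1}h_{t+1}$ (so that $D_{t+1}(P_{t+1}+d_{t+1})=D_te^{\pi}$), $\phi_i=\pi+\tilde P_{i,T}i_n$, $\hat\mu^\pi_{t,u}=W_{t+1}\hat\mu_{t+1|t,u}-\tilde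 r_{t+1}i_n+G_{t+1}^{-1}h_{t+1}$, $\Sigma_\pi=W_{t+1}\Sigma_{t+1,t+1|t}W_{t+1}'$, $\Sigma_{\pi,\tilde P_k}=W_{t+1}\Sigma_{t+1,k|t}J_P'$, $\hat\mu^{\phi_i}_{t,u}=\hat\mu^\pi_{t,u}+i_ne_i'\hat\mu^{\tilde P}_{T|t,u}$, $\Sigma_{\phi_i}=\Sigma_\pi+\Sigma_{\pi,\tilde P_T}e_ii_n'+i_ne_i'\Sigma_{\pi,\tilde P_T}'+(e_i'\Sigma^{\tilde P}_{T|t}e_i)i_ni_n'$. For $L>0$ let $d_1=(\mu_2+\mathcal D[\Sigma_{22}]-\ln L)\oslash\sqrt{\mathcal D[\Sigma_{22}]}$, $d_2=d_1-\sqrt{\mathcal D[\Sigma_{22}]}$, $m_i=e^{\mu_i+\frac12\mathcal D[\Sigma_{ii}]}$, $\Delta=\Sigma_{12}\,\mathrm{diag}\{\mathcal D[\Sigma_{22}]\}^{-1/2}$, $\Phi$ the standard normal distribution function (functions act componentwise), and $$\Psi^+(L;\mu_1;\mu_2;\Sigma_{11};\Sigma_{12};\Sigma_{22})=(m_1m_2')\odot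 e^{\Sigma_{12}}\odot\Phi(i\,d_1'+\Delta)-(m_1L')\odot\Phi(i\,d_2'+\Delta),$$ $$\Psi^-(L;\mu_1;\mu_2;\Sigma_{11};\Sigma_{12};\Sigma_{22})=(m_1L')\odot\Phi(-i\,d_2'-\Delta)-(m_1m_2')\odot e^{\Sigma_{12}}\odot\Phi(-i\,d_1'-\Delta),$$ where $i$ is the vector of ones. Write $\Psi^\pm_{t,k}(K)=\Psi^\pm(K;\hat\mu^\pi_{t,k};\hat\mu^{\tilde P}_{k|t,k};\Sigma_\pi;\Sigma_{\pi,\tilde P_k};\Sigma^{\tilde P}_{k|t})$. With $d_1,d_2$ for $(L,\mu_2,\Sigma_{22})=(K,\hat\mu^{\tilde P}_{k|t,k},\Sigma^{\tilde P}_{k|t})$ and $m_2$ the corresponding mean, let $C_{k|t}(K)=B_{t,k}(m_2\odot\Phi(d_1)-K\odot\Phi(d_2))$ and $P_{k|t}(K)=B_{t,k}(K\odot\Phi(-d_2)-m_2\odot\Phi(-d_1))$. **Mixing.** For a function $X$ of $(C,\Gamma)$ and the data up to $t$, let $$\langle X\rangle_t=\sum_s\int X\,f(\bar s_t^c|\mathcal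 G_t)\,\tilde f(C,\Gamma,\mathsf P,\bar s_t|\mathcal F_t)\,dC\,d\Gamma\,d\mathsf P,\qquad f(\bar s_t^c|\mathcal G_t)=\frac{f(C,\Gamma|s,\mathcal F_0)\prod_{m=t+1}^Tp_{s_{m-1}s_m}}{\sum_{\bar s_t^c}f(C,\Gamma|s,\mathcal F_0)\prod_{m=t+1}^Tp_{s_{m-1}s_m}},$$ $$\tilde f(C,\Gamma,\mathsf P,\bar s_t|\mathcal F_t)=\frac{\ell_t\big(\sum_{\bar s_t^c}f(C,\Gamma|s,\mathcal F_0)\prod_{m=t+1}^Tp_{s_{m-1}s_m}\big)\prod_{m=1}^tp_{s_{m-1}s_m}f(\mathsf P|\mathcal F_0)}{\sum_s\int\ell_t\,f(C,\Gamma|s,\mathcal F_0)\prod_{m=1}^Tp_{s_{m-1}s_m}f(\mathsf P|\mathcal F_0)\,dC\,d\Gamma\,d\mathsf P},$$ where $\bar s_t=(s_1,\dots,s_t)$, $\bar s_t^c=(s_{t+1},\dots,s_T)$ and $\ell_t=\prod_{m=1}^t\varphi_{\mathsf G_m\Sigma_m\mathsf G_m'}(Q_{0,m}x_m-\tilde\nu_m-Q_{1,m}x_{m-1})$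 is the risk-neutral density of $(x_1,\dots,x_t)$ given the coefficients ($\varphi_A$: density of $\mathcal N(0,A)$). **Hedging.** Strategies are pairs $(h^0,h)$ with $h^0$ adapted to and $h$ predictable for $(\mathcal F^x_t)$; the value is $V_t=h^0_t+h_t'(P_t+d_t)$ for $t\ge1$ and $V_0=h_0^0+h_1'P_0$. For a claim $\overline H_T\in L^2(\tilde{\mathbb P})$ a strategy is admissible if all $D_tV_t$ and $h_t'(\Delta\overline P_t+\overline d_t)$ are in $L^2(\tilde{\mathbb P})$ and $D_TV_T=\overline H_T$ a.s. It is locally risk-minimizing if for each $t<T$ it a.s. minimizes $\tilde{\mathbb E}[(D_{t+1}V_{t+1}-D_tV_t-h_{t+1}'(\Delta\overline P_{t+1}+\overline d_{t+1}))^2|\mathcal F^x_t]$ among the admissible strategies with the same $V_{t+1}$. **Theorem.** Assume that the components of $\Delta\overline P_{t+1}+\overline d_{t+1}$, $t=0,\dots,T-1$, are in $L^2(\tilde{\mathbb P})$. Let $0\le t<T$. All identities hold almost surely. (a) $\overline\Omega_{t+1}(\mathcal H_t):=\tilde{\mathbb E}[(\Delta\overline P_{t+1}+\overline d_{t+1})(\Delta\overline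 P_{t+1}+\overline d_{t+1})'|\mathcal H_t]=(\exp\{\Sigma_{uu,t+1}\}-\mathsf E_n)\odot\overline P_t\overline P_t'$ (elementwise exponential, $\mathsf E_n$ the all-ones matrix). The same conditional expectation given $\mathcal F^x_t$ is $\overline\Omega_{t+1}=\langle(\exp\{\Sigma_{uu,t+1}\}-\mathsf E_n)\odot\overline P_t\overline P_t'\rangle_t$, and it is invertible. (b) For every $\mathcal F_T^x$-measurable $\overline H_T\in L^2(\tilde{\mathbb P})$ there is an a.s. unique locally risk-minimizing strategy, namely $h_{t+1}=\overline\Omega_{t+1}^{-1}\overline\Lambda_{t+1}$, $h^0_{t+1}=V_{t+1}-h_{t+1}'(P_{t+1}+d_{t+1})$ for $0\le t<T$ and $h_0^0=V_0-h_1'P_0$, where $\overline\Lambda_{t+1}=\widetilde{\mathrm{Cov}}[\Delta\overline P_{t+1}+\overline d_{t+1},\overline H_T|\mathcal F_t^x]$ and $V_t=\tilde{\mathbb E}[\overline H_T|\mathcal F_t^x]/D_t$. (c) For $t<u\le T$, $\tilde{\mathbb E}[D_u|\mathcal H_t]=D_tB_{t,u}$; and under the forward measure $d\hat{\mathbb P}_{t,u}=\frac{D_u}{D_tB_{t,u}}d\tilde{\mathbb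 P}$, given $\mathcal H_t$, for $t<k\le T$ the vector $(\pi,\tilde P_k)$ is normal with means $\hat\mu^\pi_{t,u},\hat\mu^{\tilde P}_{k|t,u}$, covariances $\Sigma_\pi,\Sigma^{\tilde P}_{k|t}$ and cross-covariance $\Sigma_{\pi,\tilde P_k}$. (d) For the following claims (each considered componentwise and whenever in $L^2(\tilde{\mathbb P})$), $\overline\Lambda_{t+1}$ is as stated (for a vector of $n$ claims, the matrix whose columns belong to the claims), so the locally risk-minimizing $h_{t+1}$ is the inverse of the mixture in (a) times it. Here $K,F_k^*,G_k^*\in\mathbb R^n$ have positive components, $w_i,w_j>0$, $L_k=G_k^*\oslash F_k^*$, and $A\,\mathrm{diag}\{F\}$ multiplies column $i$ of $A$ by $F_i$. 1. Call, $\overline H_T=D_T(P_T-K)^+$: $\overline\Lambda_{t+1}=\langle D_t^2B_{t,T}\Psi^+_{t,T}(K)\rangle_t-\overline P_t\overline V_t'$, $\overline V_t=D_t\langle C_{T|t}(K)\rangle_t$. 2. Put, $\overline H_T=D_T(K-P_T)^+$: $\overline\Lambda_{t+1}=\langle D_t^2B_{t,T}\Psi^-_{t,T}(K)\rangle_t-\overline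 P_t\overline V_t'$, $\overline V_t=D_t\langle P_{T|t}(K)\rangle_t$. 3. Margrabe option, $\overline H_T=D_T(w_iP_{i,T}-w_jP_{j,T})^+$, $i\ne j$: the conditional covariance given $\mathcal H_t$, and also given $\mathcal H_t^x$, is $$\overline\Lambda^{ij}_{t+1}(\mathcal H_t)=D_t^2B_{t,T}\Big[w_ie^{\hat\mu^{\phi_i}_{t,T}+\frac12\mathcal D[\Sigma_{\phi_i}]}\odot\Phi(\tilde d^{ij,1})-w_je^{\hat\mu^{\phi_j}_{t,T}+\frac12\mathcal D[\Sigma_{\phi_j}]}\odot\Phi(\tilde d^{ij,2})\Big]-\overline P_tD_tO^{ij}_{T|t},$$ and $\overline\Lambda_{t+1}=\langle\overline\Lambda^{ij}_{t+1}(\mathcal H_t)\rangle_t$. Here $\mu=\hat\mu^{\tilde P}_{T|t,T}$, $V=\Sigma^{\tilde P}_{T|t}$, $\sigma=\sqrt{(e_i-e_j)'V(e_i-e_j)}$, $d^{1}=\big((e_i-e_j)'\mu+(e_i-e_j)'Ve_i-\ln(w_j/w_i)\big)/\sigma$, $d^2=d^1-\sigma$, $\tilde d^{ij,1}=d^1i_n+\Sigma_{\pi,\tilde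 P_T}(e_i-e_j)/\sigma$, $\tilde d^{ij,2}=\tilde d^{ij,1}-\sigma i_n$, $O^{ij}_{T|t}=B_{t,T}\big[w_ie^{\mu_i+\frac12V_{ii}}\Phi(d^1)-w_je^{\mu_j+\frac12V_{jj}}\Phi(d^2)\big]$. 4. Segregated-fund term insurance, $\overline H_T=\sum_{k=0}^{T-1}D_{k+1}F^*_{k+1}\odot(L_{k+1}-P_{k+1})^+1_{\{K_x=k\}}$: $\overline\Lambda_{t+1}=1_{\{T_x>t\}}\big(\langle D_t^2\sum_{k=t}^{T-1}B_{t,k+1}\Psi^-_{t,k+1}(L_{k+1})\mathrm{diag}\{F^*_{k+1}\}\,{}_{k-t}p_{x+t}q_{x+k}\rangle_t-\overline P_t\overline V_t'\big)$, $\overline V_t=D_t\langle\sum_{k=t}^{T-1}F^*_{k+1}\odot P_{k+1|t}(L_{k+1})\,{}_{k-t}p_{x+t}q_{x+k}\rangle_t$. 5. Segregated-fund pure endowment, $\overline H_T=D_TF_T^*\odot(L_T-P_T)^+1_{\{T_x>T\}}$: $\overline\Lambda_{t+1}=1_{\{T_x>t\}}\big(\langle D_t^2B_{t,T}\Psi^-_{t,T}(L_T)\mathrm{diag}\{F_T^*\}\,{}_{T-t}p_{x+t}\rangle_t-\overline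 P_t\overline V_t'\big)$, $\overline V_t=D_t\langle F_T^*\odot P_{T|t}(L_T)\,{}_{T-t}p_{x+t}\rangle_t$. 6. Unit-linked term insurance, $\overline H_T=\sum_{k=0}^{T-1}D_{k+1}\big(F^*_{k+1}\odot(P_{k+1}-L_{k+1})^++G^*_{k+1}\big)1_{\{K_x=k\}}$: $\overline\Lambda_{t+1}=1_{\{T_x>t\}}\big(\langle D_t^2\sum_{k=t}^{T-1}B_{t,k+1}\big[\Psi^+_{t,k+1}(L_{k+1})\mathrm{diag}\{F^*_{k+1}\}+e^{\hat\mu^\pi_{t,k+1}+\frac12\mathcal D[\Sigma_\pi]}(G^*_{k+1})'\big]{}_{k-t}p_{x+t}q_{x+k}\rangle_t-\overline P_t\overline V_t'\big)$, $\overline V_t=D_t\langle\sum_{k=t}^{T-1}\big[F^*_{k+1}\odot C_{k+1|t}(L_{k+1})+B_{t,k+1}G^*_{k+1}\big]{}_{k-t}p_{x+t}q_{x+k}\rangle_t$. 7. Unit-linked pure endowment, $\overline H_T=D_T\big(F_T^*\odot(P_T-L_T)^++G_T^*\big)1_{\{T_x>T\}}$: $\overline\Lambda_{t+1}=1_{\{T_x>t\}}\big(\langle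 D_t^2B_{t,T}\big[\Psi^+_{t,T}(L_T)\mathrm{diag}\{F_T^*\}+e^{\hat\mu^\pi_{t,T}+\frac12\mathcal D[\Sigma_\pi]}(G_T^*)'\big]{}_{T-t}p_{x+t}\rangle_t-\overline P_t\overline V_t'\big)$, $\overline V_t=D_t\langle\big[F_T^*\odot C_{T|t}(L_T)+B_{t,T}G_T^*\big]{}_{T-t}p_{x+t}\rangle_t$. -/

import Mathlib

open MeasureTheory ProbabilityTheory
open scoped ENNReal Matrix

noncomputable section

namespace GordonHedge

/-! ## Indices, Gaussian density, the functions `Ψ⁺` and `Ψ⁻` -/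

/-- Components of `y_t`: the `n` log dividends, then the log spot interest rate. -/
abbrev YIdx (n : ℕ) : Type := Fin n ⊕ Unit

/-- Components of `x_t = (log prices, y_t)`. -/
abbrev XIdx (n : ℕ) : Type := Fin n ⊕ YIdx n

/-- The coefficients `(C_k, C_y, Σ)` of one period (entries of the three matrices). -/
abbrev Coef (n lk ly : ℕ) : Type :=
  (Fin n → Fin lk → ℝ) × (YIdx n → Fin ly → ℝ) × (XIdx n → XIdx n → ℝ)

/-- `(C, Γ)`: the coefficients of the periods `1, …, T`. -/
abbrev CoefPath (n lk ly T : ℕ) : Type := Fin T → Coef n lk ly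

/-- Entries of an `N × N` transition probability matrix. -/
abbrev TransMat (N : ℕ) : Type := Fin N → Fin N → ℝ

/-- Position in a `T`-tuple of the entry that belongs to the date `t ∈ {1, …, T}`. -/
def dateIdx (T : ℕ) [NeZero T] (t : ℕ) : Fin T := Fin.ofNat T (t - 1)

/-- Density of the normal law `N(0, S)` on `ℝ^ι`, for a positive definite `S`. -/
def normalDensity {ι : Type*} [Fintype ι] [DecidableEq ι] (S : Matrix ι ι ℝ) (v : ι → ℝ) : ℝ :=
  Real.exp (-(v ⬝ᵥ (S⁻¹ *ᵥ v)) / 2) / Real.sqrt ((2 * Real.pi) ^ Fintype.card ι * S.det)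

/-- Cumulative standard normal distribution function. -/
def Phi (x : ℝ) : ℝ := cdf (gaussianReal 0 1) x

/-- `E[e^X]` for `X ~ N(μ, S)`. -/
def lognMean {ι : Type*} (μ : ι → ℝ) (S : Matrix ι ι ℝ) (a : ι) : ℝ :=
  Real.exp (μ a + S a a / 2)

def dOne {κ : Type*} (L μ : κ → ℝ) (S : Matrix κ κ ℝ) (b : κ) : ℝ :=
  (μ b + S b b - Real.log (L b)) / Real.sqrt (S b b)

def dTwo {κ : Type*} (L μ : κ → ℝ) (S : Matrix κ κ ℝ) (b : κ) : ℝ :=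
  dOne L μ S b - Real.sqrt (S b b)

/-- `Ψ⁺(L; μ₁; μ₂; Σ₁₁; Σ₁₂; Σ₂₂)` in closed form. -/
def PsiPlus {ι κ : Type*} (L : κ → ℝ) (μ₁ : ι → ℝ) (μ₂ : κ → ℝ) (S₁₁ : Matrix ι ι ℝ)
    (S₁₂ : Matrix ι κ ℝ) (S₂₂ : Matrix κ κ ℝ) : Matrix ι κ ℝ :=
  Matrix.of fun a b =>
    lognMean μ₁ S₁₁ a * lognMean μ₂ S₂₂ b * Real.exp (S₁₂ a b)
        * Phi (dOne L μ₂ S₂₂ b + S₁₂ a b / Real.sqrt (S₂₂ b b))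
      - lognMean μ₁ S₁₁ a * L b * Phi (dTwo L μ₂ S₂₂ b + S₁₂ a b / Real.sqrt (S₂₂ b b))

/-- `Ψ⁻(L; μ₁; μ₂; Σ₁₁; Σ₁₂; Σ₂₂)` in closed form. -/
def PsiMinus {ι κ : Type*} (L : κ → ℝ) (μ₁ : ι → ℝ) (μ₂ : κ → ℝ) (S₁₁ : Matrix ι ι ℝ)
    (S₁₂ : Matrix ι κ ℝ) (S₂₂ : Matrix κ κ ℝ) : Matrix ι κ ℝ :=
  Matrix.of fun a b =>
    lognMean μ₁ S₁₁ a * L b * Phi (-dTwo L μ₂ S₂₂ b - S₁₂ a b / Real.sqrt (S₂₂ b b))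
      - lognMean μ₁ S₁₁ a * lognMean μ₂ S₂₂ b * Real.exp (S₁₂ a b)
        * Phi (-dOne L μ₂ S₂₂ b - S₁₂ a b / Real.sqrt (S₂₂ b b))

/-! ## The specification of the model -/

/-- Everything that is a function of the initial information (a point `z : 𝓩`): initial value,
exogenous variables, linearization parameter `μ_t`, and the prior laws.  The priors are densities
with respect to the σ-finite measures `refCoef` (written `dC dΓ`) and `refTrans`
(written `d𝖯`).  A coefficient path may be tied to the regime path (`C_t = C(s_t)`), because
`fCoef` depends on the regime path and `refCoef` need not be a Lebesgue measure. -/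
structure Spec (n lk ly N T : ℕ) (𝓩 : Type*) [MeasurableSpace 𝓩] where
  x0 : 𝓩 → XIdx n → ℝ
  psiK : ℕ → 𝓩 → Fin lk → ℝ
  psiY : ℕ → 𝓩 → Fin ly → ℝ
  mu : ℕ → 𝓩 → Fin n → ℝ
  refCoef : Measure (CoefPath n lk ly T)
  refTrans : Measure (TransMat N)
  /-- `f(C, Γ | s, F₀)` -/
  fCoef : (Fin T → Fin N) → 𝓩 → CoefPath n lk ly T → ℝ
  /-- `f(𝖯 | F₀)` -/
  fTrans : 𝓩 → TransMat N → ℝ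
  /-- `p_{s₁} = P(s₁ | 𝖯, F₀)` -/
  pInit : 𝓩 → TransMat N → Fin N → ℝ
  meas_x0 : Measurable x0
  meas_psiK : ∀ t, Measurable (psiK t)
  meas_psiY : ∀ t, Measurable (psiY t)
  meas_mu : ∀ t, Measurable (mu t)
  sigmaFinite_refCoef : SigmaFinite refCoef
  sigmaFinite_refTrans : SigmaFinite refTrans
  meas_fCoef : ∀ s, Measurable (Function.uncurry (fCoef s))
  fCoef_nonneg : ∀ s z c, 0 ≤ fCoef s z c
  fCoef_total : ∀ s z, ∫⁻ c, ENNReal.ofReal (fCoef s z c) ∂refCoef = 1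
  /-- the covariance matrices `Σ_t` are positive definite -/
  fCoef_posDef : ∀ s z, ∀ᵐ c ∂refCoef, fCoef s z c ≠ 0 →
    ∀ i, (Matrix.of (c i).2.2 : Matrix (XIdx n) (XIdx n) ℝ).PosDef
  meas_fTrans : Measurable (Function.uncurry fTrans)
  fTrans_nonneg : ∀ z p, 0 ≤ fTrans z p
  fTrans_total : ∀ z, ∫⁻ p, ENNReal.ofReal (fTrans z p) ∂refTrans = 1
  /-- `𝖯` is a stochastic matrix -/
  fTrans_stochastic : ∀ z, ∀ᵐ p ∂refTrans, fTrans z p ≠ 0 →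
    (∀ i j, 0 ≤ p i j) ∧ ∀ i, ∑ j, p i j = 1
  meas_pInit : ∀ j, Measurable fun q : 𝓩 × TransMat N => pInit q.1 q.2 j
  pInit_nonneg : ∀ z p j, 0 ≤ pInit z p j
  pInit_total : ∀ z p, ∑ j, pInit z p j = 1

namespace Spec

variable {n lk ly N T : ℕ} [NeZero T] {𝓩 : Type*} [MeasurableSpace 𝓩] (S : Spec n lk ly N T 𝓩)

/-! ### Coefficients of the system, for given initial information `z` and coefficients `c` -/

def Ck (c : CoefPath n lk ly T) (t : ℕ) : Matrix (Fin n) (Fin lk) ℝ :=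
  Matrix.of (c (dateIdx T t)).1

def Cy (c : CoefPath n lk ly T) (t : ℕ) : Matrix (YIdx n) (Fin ly) ℝ :=
  Matrix.of (c (dateIdx T t)).2.1

/-- `Σ_t` -/
def Sig (c : CoefPath n lk ly T) (t : ℕ) : Matrix (XIdx n) (XIdx n) ℝ :=
  Matrix.of (c (dateIdx T t)).2.2

def Suu (c : CoefPath n lk ly T) (t : ℕ) : Matrix (Fin n) (Fin n) ℝ := (Sig c t).toBlocks₁₁

def Setau (c : CoefPath n lk ly T) (t : ℕ) : Matrix (YIdx n) (Fin n) ℝ := (Sig c t).toBlocks₂₁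

/-- `g_t = i_n + exp μ_t` -/
def g (z : 𝓩) (t : ℕ) (i : Fin n) : ℝ := 1 + Real.exp (S.mu t z i)

/-- `G_t = diag g_t` -/
def G (z : 𝓩) (t : ℕ) : Matrix (Fin n) (Fin n) ℝ := Matrix.diagonal (S.g z t)

/-- the linearization parameter `h_t = G_t (ln g_t - μ_t) + μ_t` -/
def hlin (z : 𝓩) (t : ℕ) (i : Fin n) : ℝ :=
  S.g z t i * (Real.log (S.g z t i) - S.mu t z i) + S.mu t z i

/-- `j_r`, which extracts the log spot rate from `y` -/
def jr (n : ℕ) : YIdx n → ℝ := Sum.elim (fun _ => 0) (fun _ => 1)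

/-- the last component of `x`, the log spot rate -/
def rIdx (n : ℕ) : XIdx n := Sum.inr (Sum.inr ())

/-- the system under the real-world measure: `x_t` from `x_{t-1}` and `ξ_t = (u_t, η_t)` -/
def step (z : 𝓩) (c : CoefPath n lk ly T) (t : ℕ) (x ξ : XIdx n → ℝ) : XIdx n → ℝ :=
  let y : YIdx n → ℝ := Cy c t *ᵥ S.psiY t z + (x ∘ Sum.inr) + (ξ ∘ Sum.inr)
  let d : Fin n → ℝ := y ∘ Sum.inl
  let P : Fin n → ℝ := (S.G z t *ᵥ (Ck c t *ᵥ S.psiK t z) - S.hlin z t) - (S.G z t - 1) *ᵥ d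
    + S.G z t *ᵥ (x ∘ Sum.inl) + S.G z t *ᵥ (ξ ∘ Sum.inl)
  Sum.elim P y

/-- the path `x_0, x_1, …` driven by the noise path -/
def state (z : 𝓩) (c : CoefPath n lk ly T) (ξ : Fin T → XIdx n → ℝ) : ℕ → XIdx n → ℝ
  | 0 => S.x0 z
  | t + 1 => S.step z c (t + 1) (state z c ξ t) (ξ (dateIdx T (t + 1)))

def nuTilde (z : 𝓩) (c : CoefPath n lk ly T) (t : ℕ) : XIdx n → ℝ :=
  Sum.elim (fun i => -(S.g z t i * Suu c t i i) / 2 - S.hlin z t i)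
    (Cy c t *ᵥ S.psiY t z - (Setau c t * (Suu c t)⁻¹) *ᵥ
      (Ck c t *ᵥ S.psiK t z + fun i => Suu c t i i / 2))

def H (z : 𝓩) (t : ℕ) : Matrix (Fin n) (YIdx n) ℝ := Matrix.fromCols (S.G z t - 1) 0

def E (c : CoefPath n lk ly T) (t : ℕ) : Matrix (YIdx n) (YIdx n) ℝ :=
  1 + Setau c t * (Suu c t)⁻¹ * Matrix.vecMulVec (fun _ => 1) (jr n)

def Q0 (z : 𝓩) (t : ℕ) : Matrix (XIdx n) (XIdx n) ℝ := Matrix.fromBlocks 1 (S.H z t) 0 1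

def Q1 (z : 𝓩) (c : CoefPath n lk ly T) (t : ℕ) : Matrix (XIdx n) (XIdx n) ℝ :=
  Matrix.fromBlocks (S.G z t) (S.G z t * Matrix.vecMulVec (fun _ => 1) (jr n)) 0 (E c t)

/-- the block diagonal matrix `𝖦_t = diag(G_t, I)` -/
def GG (z : 𝓩) (t : ℕ) : Matrix (XIdx n) (XIdx n) ℝ := Matrix.fromBlocks (S.G z t) 0 0 1

/-- the kernel `θ_t = Θ_t (r̃_t i_n - C_{k,t} ψ_{k,t} - ½ D[Σ_uu,t])`,
`Θ_t = [G_t ; Σ_ηu Σ_uu⁻¹]`, where `r` is the log spot rate `r̃_t` -/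
def girsanovKernel (z : 𝓩) (c : CoefPath n lk ly T) (t : ℕ) (r : ℝ) : XIdx n → ℝ :=
  Matrix.fromRows (S.G z t) (Setau c t * (Suu c t)⁻¹) *ᵥ
    fun i => r - (Ck c t *ᵥ S.psiK t z) i - Suu c t i i / 2

/-! ### Conditional moments given `H_t`; the argument `x` is the current value `x_t` -/

def transProd (z : 𝓩) (c : CoefPath n lk ly T) (β : ℕ) : ℕ → Matrix (XIdx n) (XIdx n) ℝ
  | 0 => 1
  | k + 1 => (S.Q0 z (β + k + 1))⁻¹ * S.Q1 z c (β + k + 1) * transProd z c β k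

/-- the ordered product of `Q_{0,α}⁻¹ Q_{1,α}` over `α = β + 1, …, i` (later factors left) -/
def Pi (z : 𝓩) (c : CoefPath n lk ly T) (β i : ℕ) : Matrix (XIdx n) (XIdx n) ℝ :=
  S.transProd z c β (i - β)

/-- risk-neutral conditional mean `μ̃_{i|t}` -/
def rnMean (z : 𝓩) (c : CoefPath n lk ly T) (t i : ℕ) (x : XIdx n → ℝ) : XIdx n → ℝ :=
  S.Pi z c t i *ᵥ x
    + ∑ β ∈ Finset.Ioc t i, (S.Pi z c β i * (S.Q0 z β)⁻¹) *ᵥ S.nuTilde z c β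

/-- conditional covariance `Σ_{i₁,i₂|t}` -/
def rnCov (z : 𝓩) (c : CoefPath n lk ly T) (t i₁ i₂ : ℕ) : Matrix (XIdx n) (XIdx n) ℝ :=
  ∑ β ∈ Finset.Ioc t (min i₁ i₂),
    (S.Pi z c β i₁ * (S.Q0 z β)⁻¹ * S.GG z β) * Sig c β
      * (S.Pi z c β i₂ * (S.Q0 z β)⁻¹ * S.GG z β)ᵀ

/-- zero-coupon bond price `B_{t,u}(H_t)`; the last component of `x_t` is `r̃_{t+1}` -/
def bond (z : 𝓩) (c : CoefPath n lk ly T) (t u : ℕ) (x : XIdx n → ℝ) : ℝ :=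
  Real.exp (-x (rIdx n) - ∑ β ∈ Finset.Ico (t + 1) u, S.rnMean z c t β x (rIdx n)
    + (∑ α ∈ Finset.Ico (t + 1) u, ∑ β ∈ Finset.Ico (t + 1) u,
        S.rnCov z c t α β (rIdx n) (rIdx n)) / 2)

/-- forward mean `μ̂_{k|t,u}` -/
def fwdMean (z : 𝓩) (c : CoefPath n lk ly T) (t u k : ℕ) (x : XIdx n → ℝ) : XIdx n → ℝ :=
  fun a => S.rnMean z c t k x a - ∑ β ∈ Finset.Ico (t + 1) u, S.rnCov z c t k β a (rIdx n)

/-- forward mean of the log prices at time `k` -/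
def priceMean (z : 𝓩) (c : CoefPath n lk ly T) (t u k : ℕ) (x : XIdx n → ℝ) : Fin n → ℝ :=
  S.fwdMean z c t u k x ∘ Sum.inl

/-- covariance matrix of the log prices at time `k` -/
def priceCov (z : 𝓩) (c : CoefPath n lk ly T) (t k : ℕ) : Matrix (Fin n) (Fin n) ℝ :=
  (S.rnCov z c t k k).toBlocks₁₁

/-- `W_t = [G_t⁻¹ : I - G_t⁻¹ : 0]` -/
def W (z : 𝓩) (t : ℕ) : Matrix (Fin n) (XIdx n) ℝ :=
  Matrix.fromCols (S.G z t)⁻¹ (Matrix.fromCols (1 - (S.G z t)⁻¹) 0)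

/-- `π = W_{t+1} x_{t+1} - r̃_{t+1} i_n + G_{t+1}⁻¹ h_{t+1}`, as a function of `x_t`, `x_{t+1}` -/
def piVec (z : 𝓩) (t : ℕ) (x x' : XIdx n → ℝ) : Fin n → ℝ :=
  S.W z (t + 1) *ᵥ x' - (fun _ => x (rIdx n)) + (S.G z (t + 1))⁻¹ *ᵥ S.hlin z (t + 1)

/-- forward mean of `π` -/
def piMean (z : 𝓩) (c : CoefPath n lk ly T) (t u : ℕ) (x : XIdx n → ℝ) : Fin n → ℝ :=
  S.W z (t + 1) *ᵥ S.fwdMean z c t u (t + 1) x - (fun _ => x (rIdx n))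
    + (S.G z (t + 1))⁻¹ *ᵥ S.hlin z (t + 1)

/-- `Σ_π` -/
def piCov (z : 𝓩) (c : CoefPath n lk ly T) (t : ℕ) : Matrix (Fin n) (Fin n) ℝ :=
  S.W z (t + 1) * S.rnCov z c t (t + 1) (t + 1) * (S.W z (t + 1))ᵀ

/-- covariance of `π` and the log prices at time `k` -/
def piPriceCov (z : 𝓩) (c : CoefPath n lk ly T) (t k : ℕ) : Matrix (Fin n) (Fin n) ℝ :=
  S.W z (t + 1) * S.rnCov z c t (t + 1) k * (Matrix.fromCols 1 0)ᵀ

/-- forward mean of `φ_i = π + (log P_{i,T}) i_n` -/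
def phiMean (z : 𝓩) (c : CoefPath n lk ly T) (t u : ℕ) (i : Fin n) (x : XIdx n → ℝ) :
    Fin n → ℝ :=
  fun a => S.piMean z c t u x a + S.priceMean z c t u T x i

/-- covariance of `φ_i` -/
def phiCov (z : 𝓩) (c : CoefPath n lk ly T) (t : ℕ) (i : Fin n) : Matrix (Fin n) (Fin n) ℝ :=
  Matrix.of fun a b => S.piCov z c t a b + S.piPriceCov z c t T a i + S.piPriceCov z c t T b i
    + S.priceCov z c t T i i

/-! ### Conditional prices given `H_t` -/

/-- price of a call option with strike vector `K` and maturity `k` -/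
def callPrice (z : 𝓩) (c : CoefPath n lk ly T) (t k : ℕ) (K : Fin n → ℝ) (x : XIdx n → ℝ)
    (i : Fin n) : ℝ :=
  let m := S.priceMean z c t k k x
  let V := S.priceCov z c t k
  S.bond z c t k x * (lognMean m V i * Phi (dOne K m V i) - K i * Phi (dTwo K m V i))

/-- price of a put option with strike vector `K` and maturity `k` -/
def putPrice (z : 𝓩) (c : CoefPath n lk ly T) (t k : ℕ) (K : Fin n → ℝ) (x : XIdx n → ℝ)
    (i : Fin n) : ℝ :=
  let m := S.priceMean z c t k k x
  let V := S.priceCov z c t k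
  S.bond z c t k x * (K i * Phi (-dTwo K m V i) - lognMean m V i * Phi (-dOne K m V i))

/-- standard deviation of `log (P_{i,T} / P_{j,T})` -/
def spreadSd (z : 𝓩) (c : CoefPath n lk ly T) (t : ℕ) (i j : Fin n) : ℝ :=
  Real.sqrt (S.priceCov z c t T i i - S.priceCov z c t T i j - S.priceCov z c t T j i
    + S.priceCov z c t T j j)

/-- `d^{ij,1}` -/
def margrabeD (z : 𝓩) (c : CoefPath n lk ly T) (t : ℕ) (i j : Fin n) (wi wj : ℝ)
    (x : XIdx n → ℝ) : ℝ :=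
  ((S.priceMean z c t T T x i - S.priceMean z c t T T x j)
      + (S.priceCov z c t T i i - S.priceCov z c t T j i) - Real.log (wj / wi))
    / S.spreadSd z c t i j

/-- price of the Margrabe option paying `(w_i P_{i,T} - w_j P_{j,T})⁺` -/
def margrabePrice (z : 𝓩) (c : CoefPath n lk ly T) (t : ℕ) (i j : Fin n) (wi wj : ℝ)
    (x : XIdx n → ℝ) : ℝ :=
  let m := S.priceMean z c t T T x
  let V := S.priceCov z c t T
  S.bond z c t T x * (wi * lognMean m V i * Phi (S.margrabeD z c t i j wi wj x)
    - wj * lognMean m V j * Phi (S.margrabeD z c t i j wi wj x - S.spreadSd z c t i j))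

/-- `d̃^{ij,1}`, a vector -/
def margrabeDTilde (z : 𝓩) (c : CoefPath n lk ly T) (t : ℕ) (i j : Fin n) (wi wj : ℝ)
    (x : XIdx n → ℝ) (a : Fin n) : ℝ :=
  S.margrabeD z c t i j wi wj x
    + (S.piPriceCov z c t T a i - S.piPriceCov z c t T a j) / S.spreadSd z c t i j

/-- The Margrabe conditional covariance given `H_t`, in closed form; `D` is the discount factor
`D_t` and `exp (x (inl a))` is the price `P_{a,t}`. -/
def margrabeCov (z : 𝓩) (c : CoefPath n lk ly T) (t : ℕ) (i j : Fin n) (wi wj D : ℝ)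
    (x : XIdx n → ℝ) (a : Fin n) : ℝ :=
  D ^ 2 * S.bond z c t T x *
      (wi * lognMean (S.phiMean z c t T i x) (S.phiCov z c t i) a
          * Phi (S.margrabeDTilde z c t i j wi wj x a)
        - wj * lognMean (S.phiMean z c t T j x) (S.phiCov z c t j) a
          * Phi (S.margrabeDTilde z c t i j wi wj x a - S.spreadSd z c t i j))
    - (D * Real.exp (x (Sum.inl a))) * (D * S.margrabePrice z c t i j wi wj x)

/-- `B_{t,k} Ψ⁺(K; …)` for maturity `k` -/
def bondPsiPlus (z : 𝓩) (c : CoefPath n lk ly T) (t k : ℕ) (K : Fin n → ℝ) (x : XIdx n → ℝ) :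
    Matrix (Fin n) (Fin n) ℝ :=
  S.bond z c t k x • PsiPlus K (S.piMean z c t k x) (S.priceMean z c t k k x) (S.piCov z c t)
    (S.piPriceCov z c t k) (S.priceCov z c t k)

/-- `B_{t,k} Ψ⁻(K; …)` for maturity `k` -/
def bondPsiMinus (z : 𝓩) (c : CoefPath n lk ly T) (t k : ℕ) (K : Fin n → ℝ)
    (x : XIdx n → ℝ) : Matrix (Fin n) (Fin n) ℝ :=
  S.bond z c t k x • PsiMinus K (S.piMean z c t k x) (S.priceMean z c t k k x) (S.piCov z c t)
    (S.piPriceCov z c t k) (S.priceCov z c t k)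

/-! ### Mixing over regimes, coefficients and transition matrices -/

/-- `p_{s_{m-1} s_m}`, with `p_{s_0 s_1} = p_{s_1}` -/
def stepProb (z : 𝓩) (p : TransMat N) (s : Fin T → Fin N) (m : ℕ) : ℝ :=
  if m = 1 then S.pInit z p (s (dateIdx T 1))
  else p (s (dateIdx T (m - 1))) (s (dateIdx T m))

/-- `f(C, Γ | s, F₀) ∏_{m = t+1}^T p_{s_{m-1} s_m}` -/
def tailWeight (t : ℕ) (z : 𝓩) (q : CoefPath n lk ly T × TransMat N) (s : Fin T → Fin N) : ℝ :=
  S.fCoef s z q.1 * ∏ m ∈ Finset.Icc (t + 1) T, S.stepProb z q.2 s m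

/-- the sum of `tailWeight` over all continuations of the first `t` regimes of `s` -/
def tailTotal (t : ℕ) (z : 𝓩) (q : CoefPath n lk ly T × TransMat N) (s : Fin T → Fin N) : ℝ :=
  ∑ s' : Fin T → Fin N with (∀ i : Fin T, i.val < t → s' i = s i), S.tailWeight t z q s'

/-- `f(s̄_t^c | G_t)` -/
def regimeDensity (t : ℕ) (z : 𝓩) (q : CoefPath n lk ly T × TransMat N)
    (s : Fin T → Fin N) : ℝ :=
  S.tailWeight t z q s / S.tailTotal t z q s

/-- Risk-neutral conditional density of `(x_1, …, x_t)` given the coefficients and `F₀`: under the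
risk-neutral measure `Q_{0,m} x_m - ν̃_m - Q_{1,m} x_{m-1} ~ N(0, 𝖦_m Σ_m 𝖦_m')`
independently, and `det Q_{0,m} = 1`. -/
def likelihood (t : ℕ) (z : 𝓩) (xs : ℕ → XIdx n → ℝ) (c : CoefPath n lk ly T) : ℝ :=
  ∏ m ∈ Finset.Icc 1 t, normalDensity (S.GG z m * Sig c m * (S.GG z m)ᵀ)
    (S.Q0 z m *ᵥ xs m - S.nuTilde z c m - S.Q1 z c m *ᵥ xs (m - 1))

/-- `f̃(C, Γ, 𝖯, s̄_t | F_t)`; `xs` is the observed path -/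
def posterior (t : ℕ) (z : 𝓩) (xs : ℕ → XIdx n → ℝ) (q : CoefPath n lk ly T × TransMat N)
    (s : Fin T → Fin N) : ℝ :=
  (S.likelihood t z xs q.1 * S.tailTotal t z q s * (∏ m ∈ Finset.Icc 1 t, S.stepProb z q.2 s m)
      * S.fTrans z q.2)
    / ∑ s' : Fin T → Fin N, ∫ q' : CoefPath n lk ly T × TransMat N,
        S.likelihood t z xs q'.1 * S.fCoef s' z q'.1
          * (∏ m ∈ Finset.Icc 1 T, S.stepProb z q'.2 s' m) * S.fTrans z q'.2
        ∂(S.refCoef.prod S.refTrans)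

/-- `∑_s ∫ X(C, Γ) f(s̄_t^c | G_t) f̃(C, Γ, 𝖯, s̄_t | F_t) dC dΓ d𝖯` -/
def mix (t : ℕ) (z : 𝓩) (xs : ℕ → XIdx n → ℝ) (X : CoefPath n lk ly T → ℝ) : ℝ :=
  ∑ s : Fin T → Fin N, ∫ q : CoefPath n lk ly T × TransMat N,
    X q.1 * S.regimeDensity t z q s * S.posterior t z xs q s ∂(S.refCoef.prod S.refTrans)

end Spec

/-! ## Random elements, the real-world, risk-neutral and forward measures -/

/-- The random elements of the model: initial information, transition matrix `𝖯`, regimes `s`,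
coefficients `(C, Γ)`, noise `ξ`, and the future lifetime `T_x`. -/
structure Elements (n lk ly N T : ℕ) (𝓩 Ω : Type*) where
  init : Ω → 𝓩
  trans : Ω → TransMat N
  regime : Ω → Fin T → Fin N
  coef : Ω → CoefPath n lk ly T
  noise : Ω → Fin T → XIdx n → ℝ
  life : Ω → ℝ

variable {n lk ly N T : ℕ} [NeZero T] {𝓩 : Type*} [MeasurableSpace 𝓩]

/-- conditional covariance given a σ-field `m` -/
def condCov {Ω : Type*} {m₀ : MeasurableSpace Ω} (μ : Measure Ω) (m : MeasurableSpace Ω)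
    (X Y : Ω → ℝ) : Ω → ℝ :=
  μ[fun ω => (X ω - (μ[X | m]) ω) * (Y ω - (μ[Y | m]) ω) | m]

variable {Ω : Type*} [MeasurableSpace Ω]

namespace Elements

variable (M : Elements n lk ly N T 𝓩 Ω) (S : Spec n lk ly N T 𝓩)

/-- `x_t = (log P_t, y_t)`, `y_t = (log d_t, r̃_{t+1})` -/
def x (t : ℕ) (ω : Ω) : XIdx n → ℝ := S.state (M.init ω) (M.coef ω) (M.noise ω) t

/-- log spot rate `r̃_t` for the period `(t-1, t]`, known at `t-1` -/
def rate (t : ℕ) (ω : Ω) : ℝ := M.x S (t - 1) ω (Spec.rIdx n)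

/-- discount process `D_t` -/
def D (t : ℕ) (ω : Ω) : ℝ := Real.exp (-∑ m ∈ Finset.Icc 1 t, M.rate S m ω)

/-- stock price `P_{i,t}` -/
def P (t : ℕ) (ω : Ω) (i : Fin n) : ℝ := Real.exp (M.x S t ω (Sum.inl i))

/-- log return `k̃_t` in the dynamic Gordon growth (log-linearized) form -/
def logReturn (t : ℕ) (ω : Ω) (i : Fin n) : ℝ :=
  M.x S t ω (Sum.inl i) - M.x S (t - 1) ω (Sum.inl i) + Real.log (S.g (M.init ω) t i)
    + (S.g (M.init ω) t i)⁻¹ * (S.g (M.init ω) t i - 1)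
      * (M.x S t ω (Sum.inr (Sum.inl i)) - M.x S t ω (Sum.inl i) - S.mu t (M.init ω) i)

/-- price plus dividend `P_{i,t} + d_{i,t} = P_{i,t-1} exp k̃_{i,t}` -/
def cumPrice (t : ℕ) (ω : Ω) (i : Fin n) : ℝ :=
  M.P S (t - 1) ω i * Real.exp (M.logReturn S t ω i)

/-- discounted price -/
def discP (t : ℕ) (ω : Ω) (i : Fin n) : ℝ := M.D S t ω * M.P S t ω i

/-- discounted gain `ΔP̄_t + d̄_t` of period `t` -/
def gain (t : ℕ) (ω : Ω) (i : Fin n) : ℝ :=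
  M.D S t ω * M.cumPrice S t ω i - M.discP S (t - 1) ω i

/-- `F_t` -/
abbrev sigF (t : ℕ) : MeasurableSpace Ω :=
  MeasurableSpace.comap M.init inferInstance
    ⊔ ⨆ m ∈ Finset.Icc 1 t, MeasurableSpace.comap (M.x S m) inferInstance

/-- `H_t` -/
abbrev sigH (t : ℕ) : MeasurableSpace Ω :=
  M.sigF S t ⊔ MeasurableSpace.comap M.coef inferInstance
    ⊔ MeasurableSpace.comap M.trans inferInstance ⊔ MeasurableSpace.comap M.regime inferInstance

/-- `T_t^x` -/
abbrev sigLife (t : ℕ) : MeasurableSpace Ω :=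
  MeasurableSpace.generateFrom {A | ∃ u : ℝ, 0 ≤ u ∧ u ≤ t ∧ A = {ω | u < M.life ω}}

/-- `F_t^x` -/
abbrev sigFx (t : ℕ) : MeasurableSpace Ω := M.sigF S t ⊔ M.sigLife t

/-- `H_t^x` -/
abbrev sigHx (t : ℕ) : MeasurableSpace Ω := M.sigH S t ⊔ M.sigLife t

/-- The law of the model under the real-world measure `Pr`.  `joint_law` says: given the initial
information, `𝖯` has density `f(𝖯 | F₀)`, the regimes are a Markov chain with initial
probabilities `p_{s₁}` and transition matrix `𝖯`, given the regimes `(C, Γ)` has density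
`f(C, Γ | s, F₀)` and does not depend on `𝖯`, and given all of these the noise vectors
`ξ_1, …, ξ_T` are independent with `ξ_t ~ N(0, Σ_t)`. -/
structure IsModel (Pr : Measure Ω) : Prop where
  prob : IsProbabilityMeasure Pr
  meas_init : Measurable M.init
  meas_trans : Measurable M.trans
  meas_regime : Measurable M.regime
  meas_coef : Measurable M.coef
  meas_noise : Measurable M.noise
  meas_life : Measurable M.life
  joint_law : ∀ F : 𝓩 × TransMat N × (Fin T → Fin N) × CoefPath n lk ly T
        × (Fin T → XIdx n → ℝ) → ℝ≥0∞, Measurable F →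
    ∫⁻ ω, F (M.init ω, M.trans ω, M.regime ω, M.coef ω, M.noise ω) ∂Pr
      = ∫⁻ z, ∫⁻ p, ∑ s : Fin T → Fin N, ∫⁻ c,
          ENNReal.ofReal (S.fTrans z p * (∏ m ∈ Finset.Icc 1 T, S.stepProb z p s m)
              * S.fCoef s z c)
            * ∫⁻ ξ, ENNReal.ofReal
                  (∏ m ∈ Finset.Icc 1 T, normalDensity (Spec.Sig c m) (ξ (dateIdx T m)))
                * F (z, p, s, c, ξ) ∂volume
          ∂S.refCoef ∂S.refTrans ∂(Pr.map M.init)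
  life_nonneg : ∀ ω, 0 ≤ M.life ω
  life_no_atom : ∀ k : ℕ, Pr {ω | M.life ω = k} = 0
  life_indep : Indep (M.sigH S T) (M.sigLife T) Pr

/-- state price density with the kernel `θ_t`: the Gaussian shift of `𝖦_t ξ_t` by `θ_t` -/
def density (ω : Ω) : ℝ :=
  ∏ t ∈ Finset.Icc 1 T,
    let θ := S.girsanovKernel (M.init ω) (M.coef ω) t (M.rate S t ω)
    let A := (S.GG (M.init ω) t * Spec.Sig (M.coef ω) t * (S.GG (M.init ω) t)ᵀ)⁻¹
    Real.exp (θ ⬝ᵥ (A *ᵥ (S.GG (M.init ω) t *ᵥ M.noise ω (dateIdx T t))) - θ ⬝ᵥ (A *ᵥ θ) / 2)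

/-- the risk-neutral measure `P̃` -/
def riskNeutral (Pr : Measure Ω) : Measure Ω :=
  Pr.withDensity fun ω => ENNReal.ofReal (M.density S ω)

/-- `B_{t,u}(H_t)` as a random variable -/
def B (t u : ℕ) (ω : Ω) : ℝ := S.bond (M.init ω) (M.coef ω) t u (M.x S t ω)

/-- the `(t,u)`-forward measure, `dP̂_{t,u} = D_u / (D_t B_{t,u}(H_t)) dP̃` -/
def forward (Pr : Measure Ω) (t u : ℕ) : Measure Ω :=
  (M.riskNeutral S Pr).withDensity fun ω =>
    ENNReal.ofReal (M.D S u ω / (M.D S t ω * M.B S t u ω))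

/-- `B_{t,u}(H_t)` is the bond price: `D_t B_{t,u}` is the conditional expectation of the
positive variable `D_u` given `H_t` under `P̃`. -/
def BondPricing (Pr : Measure Ω) (t u : ℕ) : Prop :=
  ∀ A : Set Ω, MeasurableSet[M.sigH S t] A →
    ∫⁻ ω in A, ENNReal.ofReal (M.D S u ω) ∂(M.riskNeutral S Pr)
      = ∫⁻ ω in A, ENNReal.ofReal (M.D S t ω * M.B S t u ω) ∂(M.riskNeutral S Pr)

/-- Under `P̂_{t,u}`, given `H_t`, the vector `(π, log P_k)` is normal with the explicit moments
`μ̂^π_{t,u}`, `μ̂^P_{k|t,u}`, `Σ_π`, `Σ_{π,P_k}`, `Σ^P_{k|t}` (conditional characteristic function). -/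
def ForwardMoments (Pr : Measure Ω) (t u k : ℕ) : Prop :=
  ∀ a b : Fin n → ℝ,
    (M.forward S Pr t u)[fun ω => Complex.exp (Complex.I *
        ((a ⬝ᵥ S.piVec (M.init ω) t (M.x S t ω) (M.x S (t + 1) ω)
          + b ⬝ᵥ (M.x S k ω ∘ Sum.inl) : ℝ) : ℂ)) | M.sigH S t]
      =ᵐ[M.riskNeutral S Pr] fun ω =>
        let z := M.init ω
        let c := M.coef ω
        Complex.exp (Complex.I *
          ((a ⬝ᵥ S.piMean z c t u (M.x S t ω) + b ⬝ᵥ S.priceMean z c t u k (M.x S t ω) : ℝ) : ℂ)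
          - (((a ⬝ᵥ (S.piCov z c t *ᵥ a) + 2 * (a ⬝ᵥ (S.piPriceCov z c t k *ᵥ b))
              + b ⬝ᵥ (S.priceCov z c t k *ᵥ b)) / 2 : ℝ) : ℂ))

/-! ### Hedging of a discounted claim `Hbar` under `P̃` and the filtration `F_t^x` -/

/-- value `h^0_t + h_t'(P_t + d_t)` of a strategy, and `h^0_0 + h_1' P_0` at time `0` -/
def portfolio (h0 : ℕ → Ω → ℝ) (h : ℕ → Ω → Fin n → ℝ) : ℕ → Ω → ℝ
  | 0 => fun ω => h0 0 ω + h 1 ω ⬝ᵥ M.P S 0 ω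
  | t + 1 => fun ω => h0 (t + 1) ω + h (t + 1) ω ⬝ᵥ M.cumPrice S (t + 1) ω

def discPortfolio (h0 : ℕ → Ω → ℝ) (h : ℕ → Ω → Fin n → ℝ) (t : ℕ) (ω : Ω) : ℝ :=
  M.D S t ω * M.portfolio S h0 h t ω

/-- increment over `(t, t+1]` of the discounted cumulative cost process -/
def costIncr (h0 : ℕ → Ω → ℝ) (h : ℕ → Ω → Fin n → ℝ) (t : ℕ) (ω : Ω) : ℝ :=
  M.discPortfolio S h0 h (t + 1) ω - M.discPortfolio S h0 h t ω
    - h (t + 1) ω ⬝ᵥ M.gain S (t + 1) ω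

/-- square-integrable strategies (`h^0` adapted, `h` predictable) that replicate `Hbar` at `T` -/
structure Admissible (Pr : Measure Ω) (Hbar : Ω → ℝ) (h0 : ℕ → Ω → ℝ)
    (h : ℕ → Ω → Fin n → ℝ) : Prop where
  adapted : ∀ t ≤ T, StronglyMeasurable[M.sigFx S t] (h0 t)
  predictable : ∀ t < T, ∀ i, StronglyMeasurable[M.sigFx S t] fun ω => h (t + 1) ω i
  value_L2 : ∀ t ≤ T, MemLp (M.discPortfolio S h0 h t) 2 (M.riskNeutral S Pr)
  gain_L2 : ∀ t < T, MemLp (fun ω => h (t + 1) ω ⬝ᵥ M.gain S (t + 1) ω) 2 (M.riskNeutral S Pr)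
  terminal : M.discPortfolio S h0 h T =ᵐ[M.riskNeutral S Pr] Hbar

/-- locally risk-minimizing: at every time `t` the conditional expectation of the squared cost
increment is minimal among the admissible strategies with the same value at time `t + 1` -/
structure IsLocallyRiskMinimizing (Pr : Measure Ω) (Hbar : Ω → ℝ) (h0 : ℕ → Ω → ℝ)
    (h : ℕ → Ω → Fin n → ℝ) : Prop where
  admissible : M.Admissible S Pr Hbar h0 h
  minimal : ∀ t < T, ∀ (k0 : ℕ → Ω → ℝ) (k : ℕ → Ω → Fin n → ℝ), M.Admissible S Pr Hbar k0 k →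
    M.discPortfolio S k0 k (t + 1) =ᵐ[M.riskNeutral S Pr] M.discPortfolio S h0 h (t + 1) →
    (M.riskNeutral S Pr)[fun ω => M.costIncr S h0 h t ω ^ 2 | M.sigFx S t]
      ≤ᵐ[M.riskNeutral S Pr]
        (M.riskNeutral S Pr)[fun ω => M.costIncr S k0 k t ω ^ 2 | M.sigFx S t]

/-- `Ω̄_{t+1}`, relative to a σ-field `m` (`H_t` or `F_t^x`), under the measure `μ` (`P̃`) -/
def OmegaBar (μ : Measure Ω) (m : MeasurableSpace Ω) (t : ℕ) (ω : Ω) :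
    Matrix (Fin n) (Fin n) ℝ :=
  Matrix.of fun a b =>
    (μ[fun ω' => M.gain S (t + 1) ω' a * M.gain S (t + 1) ω' b | m]) ω

/-- `Λ̄_{t+1}`, relative to a σ-field `m`, under the measure `μ` (`P̃`), for a scalar discounted claim -/
def LambdaBar (μ : Measure Ω) (m : MeasurableSpace Ω) (Hbar : Ω → ℝ) (t : ℕ) (ω : Ω) :
    Fin n → ℝ :=
  fun a => condCov μ m (fun ω' => M.gain S (t + 1) ω' a) Hbar ω

/-- `V_t` -/
def value (Pr : Measure Ω) (Hbar : Ω → ℝ) (t : ℕ) (ω : Ω) : ℝ :=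
  ((M.riskNeutral S Pr)[Hbar | M.sigFx S t]) ω / M.D S t ω

/-- `h_{t+1} = Ω̄_{t+1}⁻¹ Λ̄_{t+1}` (the value at index `0` is not used) -/
def shares (Pr : Measure Ω) (Hbar : Ω → ℝ) : ℕ → Ω → Fin n → ℝ
  | 0 => fun _ _ => 0
  | t + 1 => fun ω => (M.OmegaBar S (M.riskNeutral S Pr) (M.sigFx S t) t ω)⁻¹ *ᵥ
      M.LambdaBar S (M.riskNeutral S Pr) (M.sigFx S t) Hbar t ω

/-- `h^0_{t+1} = V_{t+1} - h_{t+1}'(P_{t+1} + d_{t+1})` and `h^0_0 = V_0 - h_1' P_0` -/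
def cash (Pr : Measure Ω) (Hbar : Ω → ℝ) : ℕ → Ω → ℝ
  | 0 => fun ω => M.value S Pr Hbar 0 ω - M.shares S Pr Hbar 1 ω ⬝ᵥ M.P S 0 ω
  | t + 1 => fun ω => M.value S Pr Hbar (t + 1) ω
      - M.shares S Pr Hbar (t + 1) ω ⬝ᵥ M.cumPrice S (t + 1) ω

/-- `(h^0, h)` given by `cash` and `shares` is the locally risk-minimizing strategy, unique up to
null sets. -/
def LRMGivenByFormula (Pr : Measure Ω) (Hbar : Ω → ℝ) : Prop :=
  M.IsLocallyRiskMinimizing S Pr Hbar (M.cash S Pr Hbar) (M.shares S Pr Hbar) ∧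
  ∀ (k0 : ℕ → Ω → ℝ) (k : ℕ → Ω → Fin n → ℝ), M.IsLocallyRiskMinimizing S Pr Hbar k0 k →
    (∀ t < T, k (t + 1) =ᵐ[M.riskNeutral S Pr] M.shares S Pr Hbar (t + 1)) ∧
    ∀ t ≤ T, k0 t =ᵐ[M.riskNeutral S Pr] M.cash S Pr Hbar t

/-! ### Explicit quantities -/

/-- `∑_s ∫ X f(s̄_t^c | G_t) f̃(C, Γ, 𝖯, s̄_t | F_t) dC dΓ d𝖯` at the observed data; the
integrand may use the initial information, the coefficients and the current `x_t`. -/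
def mixed (t : ℕ) (X : 𝓩 → CoefPath n lk ly T → (XIdx n → ℝ) → ℝ) (ω : Ω) : ℝ :=
  S.mix t (M.init ω) (fun m => M.x S m ω) fun c => X (M.init ω) c (M.x S t ω)

/-- `(exp Σ_{uu,t+1} - 𝖤_n) ⊙ P̄_t P̄_t'` -/
def omegaH (t : ℕ) (ω : Ω) : Matrix (Fin n) (Fin n) ℝ :=
  Matrix.hadamard ((Spec.Suu (M.coef ω) (t + 1)).map Real.exp - Matrix.of fun _ _ => 1)
    (Matrix.vecMulVec (M.discP S t ω) (M.discP S t ω))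

/-- its mixture over regimes -/
def omegaMixed (t : ℕ) (ω : Ω) : Matrix (Fin n) (Fin n) ℝ :=
  Matrix.of fun a b => M.mixed S t
    (fun _ c _ => (Real.exp (Spec.Suu c (t + 1) a b) - 1) * (M.discP S t ω a * M.discP S t ω b)) ω

/-- The claim `Hbar` is hedged by the explicit covariance `Λ`: the strategy
`h_{t+1} = Ω̄_{t+1}⁻¹ Λ̄_{t+1}` is the locally risk-minimizing one, `Λ̄_{t+1} = Λ_t`, and
`h_{t+1}` is the inverse of the explicit mixture `Ω̄_{t+1}` applied to `Λ_t`. -/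
def HedgedBy (Pr : Measure Ω) (Hbar : Ω → ℝ) (Λ : ℕ → Ω → Fin n → ℝ) : Prop :=
  M.LRMGivenByFormula S Pr Hbar ∧
  ∀ t < T,
    M.LambdaBar S (M.riskNeutral S Pr) (M.sigFx S t) Hbar t =ᵐ[M.riskNeutral S Pr] Λ t ∧
    M.shares S Pr Hbar (t + 1) =ᵐ[M.riskNeutral S Pr]
      fun ω => (M.omegaMixed S t ω)⁻¹ *ᵥ Λ t ω

/-- survival function `s ↦ P(T_x > s)` -/
def survival (Pr : Measure Ω) (s : ℕ) : ℝ := Pr.real {ω | (s : ℝ) < M.life ω}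

/-- `_k p_{x+t}` -/
def surv (Pr : Measure Ω) (k t : ℕ) : ℝ := M.survival Pr (t + k) / M.survival Pr t

/-- `q_{x+k}` -/
def mort (Pr : Measure Ω) (k : ℕ) : ℝ := 1 - M.surv Pr 1 k

/-- indicator of `{T_x > t}` -/
def alive (t : ℕ) (ω : Ω) : ℝ := Set.indicator {ω' | (t : ℝ) < M.life ω'} (fun _ => 1) ω

/-- discounted pure endowment claim `D_T f 1_{T_x > T}`, where `f` is the sum insured -/
def endowment (f : ℕ → Ω → ℝ) (ω : Ω) : ℝ := M.D S T ω * f T ω * M.alive T ω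

/-- discounted term insurance claim: the sum insured is paid at `K_x + 1 ≤ T`, `K_x = ⌊T_x⌋` -/
def term (f : ℕ → Ω → ℝ) (ω : Ω) : ℝ :=
  ∑ k ∈ Finset.range T, M.D S (k + 1) ω * f (k + 1) ω
    * Set.indicator {ω' | ⌊M.life ω'⌋₊ = k} (fun _ => 1) ω

/-- sum insured `F* (G*/F* - P_k)⁺` of the segregated fund contract (component `i`) -/
def segregated (Fs Gs : ℕ → Fin n → ℝ) (i : Fin n) (k : ℕ) (ω : Ω) : ℝ :=
  Fs k i * max (Gs k i / Fs k i - M.P S k ω i) 0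

/-- sum insured `F* (P_k - G*/F*)⁺ + G*` of the unit-linked contract (component `i`) -/
def unitLinked (Fs Gs : ℕ → Fin n → ℝ) (i : Fin n) (k : ℕ) (ω : Ω) : ℝ :=
  Fs k i * max (M.P S k ω i - Gs k i / Fs k i) 0 + Gs k i

/-- `Λ̄_{t+1}` in the form `∑_s ∫ {D_t² L} f f̃ - P̄_t V̄_t`, `V̄_t = D_t ∑_s ∫ V f f̃`, where
`L` and `V` are explicit functions of `(t, z, c, x_t)` -/
def lambdaMixed (L : ℕ → 𝓩 → CoefPath n lk ly T → (XIdx n → ℝ) → Fin n → ℝ)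
    (V : ℕ → 𝓩 → CoefPath n lk ly T → (XIdx n → ℝ) → ℝ) (t : ℕ) (ω : Ω) : Fin n → ℝ :=
  fun a => M.mixed S t (fun z c x => M.D S t ω ^ 2 * L t z c x a) ω
    - M.discP S t ω a * (M.D S t ω * M.mixed S t (V t) ω)

/-- the strike vector `G*_k ⊘ F*_k` -/
def strike (Fs Gs : ℕ → Fin n → ℝ) (k : ℕ) : Fin n → ℝ := fun i => Gs k i / Fs k i

end Elements

end GordonHedge

end

open GordonHedge

/-!
Given the initial information and the coefficients, the density of the risk-neutral measure is a
product of Girsanov factors. It shifts the noise of each date by a function of the past, and the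
shifted system is affine with Gaussian noise (`Spec.lintegral_girsanov`, `Spec.rnPath_eq`). Hence,
given `H_t`, the risk-neutral path is continued after `t` by fresh noise
(`IsModel.setLIntegral_sigH`, `IsModel.condExp_sigH`), and every conditional expectation given `H_t`
is a Gaussian integral. In particular the discounted gains have mean zero and lognormal covariances
(`Spec.integral_pathGain`, `Spec.integral_pathGain_mul`).

The likelihood `ℓ_t` is the density of the observed path given the coefficients
(`Spec.lintegral_likelihood`). By Bayes' formula the conditional expectations given `F_t` are the
posterior means of those given `H_t` (`IsModel.condExp_sigF`), and the posterior mean is the mixture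
`⟨·⟩_t` (`Spec.mix_eq_integral`). The lifetime remains independent of the market under the
risk-neutral measure (`IsModel.riskNeutral_inter`), so passing from `F_t` to `F_t^x` only brings in
survival probabilities (`condExp_mul_sup_of_indep`).

Local risk minimization is conditional least squares, one period at a time: the next value is
regressed on the gains (`condExp_sq_residual`), and the minimizer is unique because the conditional
second moments are positive definite (`eq_projCoef_of_condExp_sq_le`). Positive definiteness of
`exp Σ - E` follows from that of `Σ` by Schur products (`sum_exp_sub_one_pos`). Backward induction
then gives the strategy (`IsModel.lrmGivenByFormula`).

Discounting multiplies by the exponential of a linear functional of the noise, which by Cameron and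
Martin shifts the noise (`Spec.integral_discount`); this yields the bond prices and the moments
under the forward measures (`IsModel.bondPricing`, `IsModel.forwardMoments`). All payoffs are
exchange options between two lognormal variables (`integral_exp_mul_exchange`); `Spec.HasPrice`
records the price and the mixed moment with the cumulative prices that hedging needs, and
`IsModel.hedgedBy_insured` assembles them into insured claims.
-/

set_option linter.unusedSectionVars false

namespace GordonHedge

/-! ### Product measures with densities -/

section ProductMeasures

variable {τ : Type*} [Fintype τ] {X : τ → Type*} [∀ i, MeasurableSpace (X i)]

theorem lintegral_pi_prod (μ : ∀ i, Measure (X i)) [∀ i, SigmaFinite (μ i)]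
    (f : ∀ i, X i → ℝ≥0∞) (hf : ∀ i, Measurable (f i)) :
    ∫⁻ x, ∏ i, f i (x i) ∂(Measure.pi μ) = ∏ i, ∫⁻ y, f i y ∂(μ i) := by
  classical
  have key : ∀ s : Finset τ, ∀ x : ∀ i, X i,
      (∫⋯∫⁻_s, (fun x => ∏ i ∈ s, f i (x i)) ∂μ) x = ∏ i ∈ s, ∫⁻ y, f i y ∂(μ i) := by
    intro s
    induction s using Finset.induction_on with
    | empty => intro x; simp
    | insert a s ha ih =>
      intro x
      have hm : Measurable fun x : ∀ i, X i => ∏ i ∈ insert a s, f i (x i) :=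
        Finset.measurable_prod _ fun i _ => (hf i).comp (measurable_pi_apply i)
      have hm' : Measurable fun x : ∀ i, X i => ∏ i ∈ s, f i (x i) :=
        Finset.measurable_prod _ fun i _ => (hf i).comp (measurable_pi_apply i)
      rw [lmarginal_insert' _ hm ha]
      have : (fun x => ∫⁻ y, ∏ i ∈ insert a s, f i (Function.update x a y i) ∂(μ a))
          = fun x => (∫⁻ y, f a y ∂(μ a)) * ∏ i ∈ s, f i (x i) := by
        funext x
        rw [← lintegral_mul_const _ (hf a)]
        refine lintegral_congr fun y => ?_
        rw [Finset.prod_insert ha, Function.update_self]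
        congr 1
        refine Finset.prod_congr rfl fun i hi => ?_
        rw [Function.update_of_ne (fun h : i = a => ha (h ▸ hi))]
      rw [this]
      unfold lmarginal at ih ⊢
      rw [lintegral_const_mul _ (by fun_prop), Finset.prod_insert ha]
      rw [← ih x]
  by_cases hX : Nonempty (∀ i, X i)
  · obtain ⟨x⟩ := hX
    rw [lintegral_eq_lmarginal_univ x]
    exact key Finset.univ x
  · have : IsEmpty (∀ i, X i) := not_nonempty_iff.1 hX
    obtain ⟨i, hi⟩ : ∃ i, IsEmpty (X i) := by
      by_contra h
      push Not at h
      exact hX ⟨fun i => (h i).some⟩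
    rw [Finset.prod_eq_zero (Finset.mem_univ i) (by simp [Measure.eq_zero_of_isEmpty])]
    simp [Measure.eq_zero_of_isEmpty]

theorem pi_withDensity (μ : ∀ i, Measure (X i)) [∀ i, SigmaFinite (μ i)]
    (f : ∀ i, X i → ℝ≥0∞) (hf : ∀ i, Measurable (f i))
    [∀ i, SigmaFinite ((μ i).withDensity (f i))] :
    Measure.pi (fun i => (μ i).withDensity (f i))
      = (Measure.pi μ).withDensity fun x => ∏ i, f i (x i) := by
  classical
  refine Measure.pi_eq fun s hs => ?_
  rw [withDensity_apply _ (MeasurableSet.univ_pi hs),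
    ← lintegral_indicator (MeasurableSet.univ_pi hs)]
  have : ∀ x : ∀ i, X i, (Set.univ.pi s).indicator (fun x => ∏ i, f i (x i)) x
      = ∏ i, (s i).indicator (f i) (x i) := by
    intro x
    by_cases hx : x ∈ Set.univ.pi s
    · rw [Set.indicator_of_mem hx]
      exact Finset.prod_congr rfl fun i _ => (Set.indicator_of_mem (hx i trivial) _).symm
    · rw [Set.indicator_of_notMem hx]
      simp only [Set.mem_pi, not_forall] at hx
      obtain ⟨i, _, hi⟩ := hx
      exact (Finset.prod_eq_zero (Finset.mem_univ i) (Set.indicator_of_notMem hi _)).symm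
  simp_rw [this]
  rw [lintegral_pi_prod μ _ fun i => (hf i).indicator (hs i)]
  exact Finset.prod_congr rfl fun i _ => by
    rw [withDensity_apply _ (hs i), lintegral_indicator (hs i)]

end ProductMeasures

/-! ### Gaussian vectors -/

section GaussianVector

variable {ι : Type*} [Fintype ι] [DecidableEq ι]

theorem normalDensity_nonneg (S : Matrix ι ι ℝ) (v : ι → ℝ) : 0 ≤ normalDensity S v := by
  unfold normalDensity; positivity

/-- Measurability of a matrix-valued map, entry by entry (`Matrix` carries no σ-field). -/
def EntryMeasurable {κ ι' α : Type*} [MeasurableSpace α] (f : α → Matrix κ ι' ℝ) : Prop :=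
  ∀ i j, Measurable fun a => f a i j

namespace EntryMeasurable

variable {κ κ' α : Type*} [MeasurableSpace α]

theorem det {f : α → Matrix ι ι ℝ} (hf : EntryMeasurable f) : Measurable fun a => (f a).det := by
  simp only [Matrix.det_apply]
  refine Finset.measurable_sum _ fun σ _ => ?_
  exact (Finset.measurable_prod _ fun i _ => hf _ _).const_smul _

theorem inv {f : α → Matrix ι ι ℝ} (hf : EntryMeasurable f) :
    EntryMeasurable fun a => (f a)⁻¹ := by
  intro i j
  simp only [Matrix.inv_def, Ring.inverse_eq_inv', Matrix.smul_apply, smul_eq_mul,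
    Matrix.adjugate_apply]
  refine hf.det.inv.mul (EntryMeasurable.det fun k l => ?_)
  simp only [Matrix.updateRow_apply]
  split_ifs
  · exact measurable_const
  · exact hf k l

omit [DecidableEq ι] in
theorem mul {f : α → Matrix κ ι ℝ} {g : α → Matrix ι κ' ℝ} (hf : EntryMeasurable f)
    (hg : EntryMeasurable g) : EntryMeasurable fun a => f a * g a := by
  intro i j
  simp only [Matrix.mul_apply]
  exact Finset.measurable_sum _ fun k _ => (hf i k).mul (hg k j)

omit [DecidableEq ι] in
theorem mulVec {f : α → Matrix κ ι ℝ} {g : α → ι → ℝ} (hf : EntryMeasurable f)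
    (hg : Measurable g) : Measurable fun a => f a *ᵥ g a := by
  refine measurable_pi_lambda _ fun i => ?_
  simp only [Matrix.mulVec, dotProduct]
  exact Finset.measurable_sum _ fun k _ => (hf i k).mul ((measurable_pi_apply k).comp hg)

omit [Fintype ι] [DecidableEq ι] in
theorem transpose {f : α → Matrix κ ι ℝ} (hf : EntryMeasurable f) :
    EntryMeasurable fun a => (f a)ᵀ := fun i j => hf j i

end EntryMeasurable

omit [DecidableEq ι] in
theorem measurable_dotProduct {α : Type*} [MeasurableSpace α]
    {f g : α → ι → ℝ} (hf : Measurable f) (hg : Measurable g) :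
    Measurable fun a => f a ⬝ᵥ g a := by
  simp only [dotProduct]
  exact Finset.measurable_sum _ fun k _ =>
    ((measurable_pi_apply k).comp hf).mul ((measurable_pi_apply k).comp hg)

theorem EntryMeasurable.normalDensity {α : Type*} [MeasurableSpace α]
    {f : α → Matrix ι ι ℝ} {g : α → ι → ℝ} (hf : EntryMeasurable f) (hg : Measurable g) :
    Measurable fun a => normalDensity (f a) (g a) := by
  unfold GordonHedge.normalDensity
  have h1 := measurable_dotProduct hg (hf.inv.mulVec hg)
  have h2 := hf.det
  fun_prop

/-- Substitution `x = a + B w` in Lebesgue measure. -/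
theorem lintegral_affine (B : Matrix ι ι ℝ) (hB : B.det ≠ 0) (a : ι → ℝ) {h : (ι → ℝ) → ℝ≥0∞}
    (hh : Measurable h) :
    ∫⁻ x, h x = ENNReal.ofReal |B.det| * ∫⁻ w, h (a + B *ᵥ w) := by
  have h1 : ∫⁻ w, h (a + B *ᵥ w) = ∫⁻ v, h (a + v) ∂(Measure.map (Matrix.toLin' B) volume) := by
    rw [lintegral_map (by fun_prop)]
    · simp
    · exact (LinearMap.continuous_of_finiteDimensional _).measurable
  rw [h1, Real.map_matrix_volume_pi_eq_smul_volume_pi hB, lintegral_smul_measure, smul_eq_mul,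
    ← mul_assoc, ← ENNReal.ofReal_mul (abs_nonneg _), ← abs_mul, mul_inv_cancel₀ hB, abs_one,
    ENNReal.ofReal_one, one_mul, lintegral_add_left_eq_self]

theorem normalDensity_mulVec (B S : Matrix ι ι ℝ) (hB : B.det ≠ 0)
    (v : ι → ℝ) :
    normalDensity (B * S * Bᵀ) (B *ᵥ v) = normalDensity S v / |B.det| := by
  have hBu : IsUnit B.det := isUnit_iff_ne_zero.2 hB
  have hBt : IsUnit Bᵀ.det := by rwa [Matrix.det_transpose]
  have h1 : (B *ᵥ v) ⬝ᵥ ((B * S * Bᵀ)⁻¹ *ᵥ (B *ᵥ v)) = v ⬝ᵥ (S⁻¹ *ᵥ v) := by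
    rw [Matrix.mul_inv_rev, Matrix.mul_inv_rev, Matrix.mulVec_mulVec, Matrix.mul_assoc,
      Matrix.mul_assoc, Matrix.nonsing_inv_mul _ hBu, Matrix.mul_one, ← Matrix.mulVec_mulVec,
      Matrix.dotProduct_mulVec, ← Matrix.mulVec_transpose, Matrix.mulVec_mulVec,
      Matrix.transpose_nonsing_inv, Matrix.transpose_transpose, Matrix.nonsing_inv_mul _ hBu,
      Matrix.one_mulVec]
  have h2 : (B * S * Bᵀ).det = B.det ^ 2 * S.det := by
    rw [Matrix.det_mul, Matrix.det_mul, Matrix.det_transpose]; ring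
  unfold normalDensity
  rw [h1, h2, show (2 * Real.pi) ^ Fintype.card ι * (B.det ^ 2 * S.det)
    = B.det ^ 2 * ((2 * Real.pi) ^ Fintype.card ι * S.det) by ring,
    Real.sqrt_mul (sq_nonneg _), Real.sqrt_sq_eq_abs, div_div, mul_comm |B.det|]

theorem lintegral_normalDensity_one :
    ∫⁻ v : ι → ℝ, ENNReal.ofReal (normalDensity (1 : Matrix ι ι ℝ) v) = 1 := by
  have h : ∀ v : ι → ℝ, ENNReal.ofReal (normalDensity (1 : Matrix ι ι ℝ) v)
      = ∏ i, gaussianPDF 0 1 (v i) := by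
    intro v
    simp only [gaussianPDF]
    rw [← ENNReal.ofReal_prod_of_nonneg fun i _ => gaussianPDFReal_nonneg _ _ _]
    congr 1
    simp only [normalDensity, gaussianPDFReal, inv_one, Matrix.one_mulVec, Matrix.det_one, mul_one,
      Finset.prod_mul_distrib, Finset.prod_const, Finset.card_univ, ← Real.exp_sum, sub_zero,
      NNReal.coe_one, dotProduct]
    rw [div_eq_inv_mul, inv_pow, Real.sqrt_eq_rpow, Real.sqrt_eq_rpow, ← Real.rpow_natCast,
      ← Real.rpow_natCast, ← Real.rpow_mul (by positivity), ← Real.rpow_mul (by positivity),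
      mul_comm (1 / 2 : ℝ)]
    congr 2
    rw [← Finset.sum_neg_distrib, Finset.sum_div]
    exact Finset.sum_congr rfl fun i _ => by ring
  simp_rw [h]
  rw [volume_pi, lintegral_pi_prod _ _ fun i => measurable_gaussianPDF _ _]
  simp [lintegral_gaussianPDF_eq_one]

open scoped MatrixOrder Matrix.Norms.L2Operator in
/-- A positive definite matrix is a full square `B Bᵀ` with invertible `B`. -/
theorem _root_.Matrix.PosDef.exists_eq_mul_transpose {S : Matrix ι ι ℝ} (hS : S.PosDef) :
    ∃ B : Matrix ι ι ℝ, B.det ≠ 0 ∧ S = B * Bᵀ := by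
  obtain ⟨B, hB⟩ := (CStarAlgebra.nonneg_iff_eq_star_mul_self (a := S)).1
    (Matrix.nonneg_iff_posSemidef.2 hS.posSemidef)
  refine ⟨Bᵀ, ?_, ?_⟩
  · intro h
    apply hS.det_pos.ne'
    rw [Matrix.det_transpose] at h
    rw [hB, Matrix.det_mul, h, mul_zero]
  · rw [hB, Matrix.transpose_transpose]; rfl

/-- The normal law `N(0, S)` on `ℝ^ι`, through its density. -/
noncomputable def gaussVec (S : Matrix ι ι ℝ) : Measure (ι → ℝ) :=
  volume.withDensity fun v => ENNReal.ofReal (normalDensity S v)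

theorem measurable_normalDensity_right (S : Matrix ι ι ℝ) : Measurable (normalDensity S) :=
  EntryMeasurable.normalDensity (fun _ _ => measurable_const) measurable_id

theorem lintegral_gaussVec (S : Matrix ι ι ℝ) (f : (ι → ℝ) → ℝ≥0∞) (hf : Measurable f) :
    ∫⁻ v, f v ∂(gaussVec S) = ∫⁻ v, ENNReal.ofReal (normalDensity S v) * f v := by
  rw [gaussVec, lintegral_withDensity_eq_lintegral_mul _
    (measurable_normalDensity_right S).ennreal_ofReal hf]
  rfl

theorem isProbabilityMeasure_gaussVec {S : Matrix ι ι ℝ} (hS : S.PosDef) :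
    IsProbabilityMeasure (gaussVec S) := by
  refine ⟨?_⟩
  obtain ⟨B, hB, rfl⟩ := hS.exists_eq_mul_transpose
  have h := lintegral_affine B hB 0
    (measurable_normalDensity_right (B * Bᵀ)).ennreal_ofReal
  have h2 : ∀ w : ι → ℝ, ENNReal.ofReal (normalDensity (B * Bᵀ) (0 + B *ᵥ w))
      = ENNReal.ofReal |B.det|⁻¹ * ENNReal.ofReal (normalDensity (1 : Matrix ι ι ℝ) w) := by
    intro w
    have := normalDensity_mulVec B 1 hB w
    rw [Matrix.mul_one] at this
    rw [zero_add, this, ← ENNReal.ofReal_mul (by positivity), div_eq_inv_mul]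
  rw [gaussVec, withDensity_apply _ MeasurableSet.univ, Measure.restrict_univ, h]
  simp_rw [h2]
  rw [lintegral_const_mul _ (measurable_normalDensity_right _).ennreal_ofReal,
    lintegral_normalDensity_one, mul_one, ← ENNReal.ofReal_mul (abs_nonneg _),
    mul_inv_cancel₀ (abs_ne_zero.2 hB), ENNReal.ofReal_one]

/-- The law of `Q⁻¹ (m + B ζ)`, `ζ ~ N(0, S)`, `det Q = 1`. -/
theorem lintegral_gaussVec_affine {S B Q : Matrix ι ι ℝ} (hB : B.det ≠ 0)
    (hQ : Q.det = 1) (m : ι → ℝ) {f : (ι → ℝ) → ℝ≥0∞} (hf : Measurable f) :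
    ∫⁻ ζ, f (Q⁻¹ *ᵥ (m + B *ᵥ ζ)) ∂(gaussVec S)
      = ∫⁻ x, ENNReal.ofReal (normalDensity (B * S * Bᵀ) (Q *ᵥ x - m)) * f x := by
  have hQu : IsUnit Q.det := by rw [hQ]; exact isUnit_one
  have hd : (Q⁻¹ * B).det = B.det := by
    rw [Matrix.det_mul, Matrix.det_nonsing_inv, hQ, Ring.inverse_one, one_mul]
  have hQm : ∀ x, Q *ᵥ (Q⁻¹ *ᵥ x) = x := fun x => by
    rw [Matrix.mulVec_mulVec, Matrix.mul_nonsing_inv _ hQu, Matrix.one_mulVec]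
  have hml : ∀ A : Matrix ι ι ℝ, Measurable fun x : ι → ℝ => A *ᵥ x := fun A =>
    EntryMeasurable.mulVec (fun _ _ => measurable_const) measurable_id
  have hm : Measurable fun x : ι → ℝ => ENNReal.ofReal
      (normalDensity (B * S * Bᵀ) (Q *ᵥ x - m)) * f x :=
    ((measurable_normalDensity_right _).comp ((hml Q).sub_const m)).ennreal_ofReal.mul hf
  have hF : Measurable fun ζ => f (Q⁻¹ *ᵥ (m + B *ᵥ ζ)) :=
    hf.comp ((hml _).comp ((hml B).const_add m))
  rw [lintegral_affine (Q⁻¹ * B) (by rwa [hd]) (Q⁻¹ *ᵥ m) hm, hd, lintegral_gaussVec _ _ hF,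
    ← lintegral_const_mul' _ _ ENNReal.ofReal_ne_top]
  refine lintegral_congr fun ζ => ?_
  have e : Q⁻¹ *ᵥ m + (Q⁻¹ * B) *ᵥ ζ = Q⁻¹ *ᵥ (m + B *ᵥ ζ) := by
    rw [Matrix.mulVec_add, Matrix.mulVec_mulVec]
  rw [e, hQm, add_sub_cancel_left, normalDensity_mulVec B S hB, ← mul_assoc,
    ← ENNReal.ofReal_mul (abs_nonneg _), mul_div_cancel₀ _ (abs_ne_zero.2 hB)]

/-- Shifting a normal density by `S w` tilts it by `exp (w'v - w'S w / 2)`. -/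
theorem normalDensity_sub_mulVec {S : Matrix ι ι ℝ} (hS : S.PosDef) (w v : ι → ℝ) :
    normalDensity S (v - S *ᵥ w)
      = normalDensity S v * Real.exp (w ⬝ᵥ v - w ⬝ᵥ (S *ᵥ w) / 2) := by
  have hu : IsUnit S.det := isUnit_iff_ne_zero.2 hS.det_pos.ne'
  have hT : Sᵀ = S := by simpa using hS.isHermitian.eq
  have h1 : ∀ x, S⁻¹ *ᵥ (S *ᵥ x) = x := fun x => by
    rw [Matrix.mulVec_mulVec, Matrix.nonsing_inv_mul _ hu, Matrix.one_mulVec]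
  have h2 : (S *ᵥ w) ⬝ᵥ (S⁻¹ *ᵥ v) = w ⬝ᵥ v := by
    rw [Matrix.dotProduct_mulVec, ← Matrix.mulVec_transpose, Matrix.transpose_nonsing_inv, hT, h1]
  unfold normalDensity
  rw [div_mul_eq_mul_div, ← Real.exp_add]
  congr 2
  rw [Matrix.mulVec_sub, h1, sub_dotProduct, dotProduct_sub, dotProduct_sub, h2,
    dotProduct_comm v w, dotProduct_comm (S *ᵥ w) w]
  ring

end GaussianVector

/-! ### Independent Gaussian vectors -/

section GaussianPath

variable {τ ι : Type*} [Fintype τ] [Fintype ι] [DecidableEq ι]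

/-- The law of independent vectors `ζ_i ~ N(0, S_i)`. -/
noncomputable def gaussPath (S : τ → Matrix ι ι ℝ) : Measure (τ → ι → ℝ) :=
  volume.withDensity fun ζ => ∏ i, ENNReal.ofReal (normalDensity (S i) (ζ i))

/-- The linear functional `ζ ↦ ∑ w_i'ζ_i`. -/
def linPath (w ζ : τ → ι → ℝ) : ℝ := ∑ i, w i ⬝ᵥ ζ i

/-- The covariance `∑ w_i'S_i v_i` of the functionals with coefficients `w` and `v`. -/
def covPath (S : τ → Matrix ι ι ℝ) (w v : τ → ι → ℝ) : ℝ := ∑ i, w i ⬝ᵥ (S i *ᵥ v i)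

theorem measurable_prod_normalDensity (S : τ → Matrix ι ι ℝ) :
    Measurable fun ζ : τ → ι → ℝ => ∏ i, ENNReal.ofReal (normalDensity (S i) (ζ i)) :=
  Finset.measurable_prod _ fun i _ =>
    ((measurable_normalDensity_right (S i)).comp (measurable_pi_apply i)).ennreal_ofReal

theorem gaussPath_eq_pi {S : τ → Matrix ι ι ℝ} (hS : ∀ i, (S i).PosDef) :
    gaussPath S = Measure.pi fun i => gaussVec (S i) := by
  have := fun i => isProbabilityMeasure_gaussVec (hS i)
  unfold gaussVec at this ⊢
  rw [pi_withDensity _ _ fun i => (measurable_normalDensity_right (S i)).ennreal_ofReal]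
  rfl

theorem isProbabilityMeasure_gaussPath {S : τ → Matrix ι ι ℝ} (hS : ∀ i, (S i).PosDef) :
    IsProbabilityMeasure (gaussPath S) := by
  have := fun i => isProbabilityMeasure_gaussVec (hS i)
  rw [gaussPath_eq_pi hS]
  infer_instance

omit [DecidableEq ι] in
theorem measurable_linPath (w : τ → ι → ℝ) : Measurable (linPath w) := by
  unfold linPath dotProduct
  fun_prop

omit [DecidableEq ι] in
theorem linPath_add_right (w ζ ζ' : τ → ι → ℝ) :
    linPath w (ζ + ζ') = linPath w ζ + linPath w ζ' := by
  simp [linPath, dotProduct_add, Finset.sum_add_distrib]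

omit [DecidableEq ι] in
theorem linPath_add_left (w w' ζ : τ → ι → ℝ) :
    linPath (w + w') ζ = linPath w ζ + linPath w' ζ := by
  simp [linPath, add_dotProduct, Finset.sum_add_distrib]

omit [DecidableEq ι] in
theorem linPath_smul_left (r : ℝ) (w ζ : τ → ι → ℝ) :
    linPath (r • w) ζ = r * linPath w ζ := by
  simp [linPath, smul_dotProduct, Finset.mul_sum]

omit [DecidableEq ι] in
theorem covPath_add_left (S : τ → Matrix ι ι ℝ) (w w' v : τ → ι → ℝ) :
    covPath S (w + w') v = covPath S w v + covPath S w' v := by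
  simp [covPath, add_dotProduct, Finset.sum_add_distrib]

omit [DecidableEq ι] in
theorem covPath_add_right (S : τ → Matrix ι ι ℝ) (w v v' : τ → ι → ℝ) :
    covPath S w (v + v') = covPath S w v + covPath S w v' := by
  simp [covPath, Matrix.mulVec_add, dotProduct_add, Finset.sum_add_distrib]

omit [DecidableEq ι] in
theorem covPath_smul_left (S : τ → Matrix ι ι ℝ) (r : ℝ) (w v : τ → ι → ℝ) :
    covPath S (r • w) v = r * covPath S w v := by
  simp [covPath, smul_dotProduct, Finset.mul_sum]

omit [DecidableEq ι] in
theorem covPath_smul_right (S : τ → Matrix ι ι ℝ) (r : ℝ) (w v : τ → ι → ℝ) :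
    covPath S w (r • v) = r * covPath S w v := by
  simp [covPath, Matrix.mulVec_smul, dotProduct_smul, Finset.mul_sum]

omit [DecidableEq ι] in
theorem covPath_comm {S : τ → Matrix ι ι ℝ} (hS : ∀ i, (S i).PosDef) (w v : τ → ι → ℝ) :
    covPath S w v = covPath S v w := by
  refine Finset.sum_congr rfl fun i _ => ?_
  have hT : (S i)ᵀ = S i := by simpa using (hS i).isHermitian.eq
  rw [Matrix.dotProduct_mulVec, ← Matrix.mulVec_transpose, hT, dotProduct_comm]

omit [DecidableEq ι] in
theorem covPath_self_nonneg {S : τ → Matrix ι ι ℝ} (hS : ∀ i, (S i).PosDef) (w : τ → ι → ℝ) :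
    0 ≤ covPath S w w := by
  refine Finset.sum_nonneg fun i _ => ?_
  simpa using (hS i).posSemidef.dotProduct_mulVec_nonneg (w i)

omit [DecidableEq ι] in
theorem covPath_self_pos {S : τ → Matrix ι ι ℝ} (hS : ∀ i, (S i).PosDef) {w : τ → ι → ℝ}
    (hw : w ≠ 0) : 0 < covPath S w w := by
  obtain ⟨i, hi⟩ := Function.ne_iff.1 hw
  refine Finset.sum_pos' (fun j _ => ?_) ⟨i, Finset.mem_univ i, ?_⟩
  · simpa using (hS j).posSemidef.dotProduct_mulVec_nonneg (w j)
  · simpa using (hS i).dotProduct_mulVec_pos hi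

/-- Cameron–Martin: the exponential of a linear functional shifts the Gaussian law. -/
theorem gaussPath_withDensity_exp {S : τ → Matrix ι ι ℝ} (hS : ∀ i, (S i).PosDef)
    (w : τ → ι → ℝ) :
    (gaussPath S).withDensity
        (fun ζ => ENNReal.ofReal (Real.exp (linPath w ζ - covPath S w w / 2)))
      = (gaussPath S).map (fun ζ => ζ + fun i => S i *ᵥ w i) := by
  have hm : Measurable fun ζ : τ → ι → ℝ => ENNReal.ofReal
      (Real.exp (linPath w ζ - covPath S w w / 2)) := by
    have := measurable_linPath w
    fun_prop
  have hd := measurable_prod_normalDensity S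
  refine Measure.ext_of_lintegral _ fun f hf => ?_
  have hf' : Measurable fun ζ : τ → ι → ℝ => f (ζ + fun i => S i *ᵥ w i) := by fun_prop
  rw [lintegral_map hf (by fun_prop), lintegral_withDensity_eq_lintegral_mul _ hm hf, gaussPath,
    lintegral_withDensity_eq_lintegral_mul _ hd (hm.mul hf),
    lintegral_withDensity_eq_lintegral_mul _ hd hf']
  conv_rhs => rw [← lintegral_sub_right_eq_self _ (fun i => S i *ᵥ w i)]
  refine lintegral_congr fun ζ => ?_
  simp only [Pi.mul_apply, sub_add_cancel, Pi.sub_apply]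
  simp_rw [normalDensity_sub_mulVec (hS _)]
  rw [← mul_assoc]
  congr 1
  rw [← ENNReal.ofReal_prod_of_nonneg fun i _ => normalDensity_nonneg _ _,
    ← ENNReal.ofReal_prod_of_nonneg fun i _ =>
      mul_nonneg (normalDensity_nonneg _ _) (Real.exp_nonneg _),
    ← ENNReal.ofReal_mul (Finset.prod_nonneg fun i _ => normalDensity_nonneg _ _),
    Finset.prod_mul_distrib, ← Real.exp_sum, Finset.sum_sub_distrib, ← Finset.sum_div]
  rfl

/-- Cameron–Martin formula for nonnegative integrands. -/
theorem lintegral_exp_linPath {S : τ → Matrix ι ι ℝ} (hS : ∀ i, (S i).PosDef) (w : τ → ι → ℝ)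
    {f : (τ → ι → ℝ) → ℝ≥0∞} (hf : Measurable f) :
    ∫⁻ ζ, ENNReal.ofReal (Real.exp (linPath w ζ)) * f ζ ∂(gaussPath S)
      = ENNReal.ofReal (Real.exp (covPath S w w / 2))
        * ∫⁻ ζ, f (ζ + fun i => S i *ᵥ w i) ∂(gaussPath S) := by
  have hl := measurable_linPath w
  have h := congrArg (fun μ => ∫⁻ ζ, f ζ ∂μ) (gaussPath_withDensity_exp hS w)
  rw [lintegral_map hf (by fun_prop), lintegral_withDensity_eq_lintegral_mul _ (by fun_prop) hf]
    at h
  rw [← h, ← lintegral_const_mul _ (by fun_prop)]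
  refine lintegral_congr fun ζ => ?_
  rw [Pi.mul_apply, ← mul_assoc, ← ENNReal.ofReal_mul (Real.exp_nonneg _), ← Real.exp_add]
  congr 4
  ring

/-- Cameron–Martin formula for Bochner integrals. No integrability is assumed: both sides are `0`
together when it fails. -/
theorem integral_exp_linPath {F : Type*} [NormedAddCommGroup F] [NormedSpace ℝ F]
    {S : τ → Matrix ι ι ℝ} (hS : ∀ i, (S i).PosDef) (w : τ → ι → ℝ) (f : (τ → ι → ℝ) → F) :
    ∫ ζ, Real.exp (linPath w ζ) • f ζ ∂(gaussPath S)
      = Real.exp (covPath S w w / 2) • ∫ ζ, f (ζ + fun i => S i *ᵥ w i) ∂(gaussPath S) := by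
  have hl := measurable_linPath w
  have h := congrArg (fun μ => ∫ ζ, f ζ ∂μ) (gaussPath_withDensity_exp hS w)
  rw [(measurableEmbedding_addRight _).integral_map,
    integral_withDensity_eq_integral_toReal_smul (by fun_prop) (by simp)] at h
  rw [← h, ← integral_smul]
  refine integral_congr_ae (.of_forall fun ζ => ?_)
  simp only
  rw [ENNReal.toReal_ofReal (Real.exp_nonneg _), smul_smul, ← Real.exp_add]
  congr 2
  ring

theorem integrable_exp_linPath_smul {F : Type*} [NormedAddCommGroup F] [NormedSpace ℝ F]
    {S : τ → Matrix ι ι ℝ} (hS : ∀ i, (S i).PosDef) (w : τ → ι → ℝ) (f : (τ → ι → ℝ) → F) :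
    Integrable (fun ζ => Real.exp (linPath w ζ) • f ζ) (gaussPath S)
      ↔ Integrable (fun ζ => f (ζ + fun i => S i *ᵥ w i)) (gaussPath S) := by
  have hl := measurable_linPath w
  have h := congrArg (fun μ => Integrable f μ) (gaussPath_withDensity_exp hS w)
  rw [(measurableEmbedding_addRight _).integrable_map_iff,
    integrable_withDensity_iff_integrable_smul' (by fun_prop) (by simp)] at h
  rw [show (f ∘ fun x => x + fun i => S i *ᵥ w i) = fun ζ => f (ζ + fun i => S i *ᵥ w i) from rfl]
    at h
  rw [← h, ← integrable_fun_smul_iff (Real.exp_ne_zero (-(covPath S w w / 2)))]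
  refine iff_of_eq (congrArg (fun g => Integrable g (gaussPath S)) (funext fun ζ => ?_))
  rw [ENNReal.toReal_ofReal (Real.exp_nonneg _), smul_smul, ← Real.exp_add]
  congr 2
  ring

theorem integrable_exp_linPath {S : τ → Matrix ι ι ℝ} (hS : ∀ i, (S i).PosDef)
    (w : τ → ι → ℝ) : Integrable (fun ζ => Real.exp (linPath w ζ)) (gaussPath S) := by
  have := isProbabilityMeasure_gaussPath hS
  have h := (integrable_exp_linPath_smul hS w (fun _ => (1 : ℝ))).2 (integrable_const _)
  simpa using h

/-- A linear functional of the noise is centred normal with variance `covPath S w w`. -/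
theorem gaussPath_map_linPath {S : τ → Matrix ι ι ℝ} (hS : ∀ i, (S i).PosDef)
    (w : τ → ι → ℝ) :
    (gaussPath S).map (linPath w) = gaussianReal 0 (covPath S w w).toNNReal := by
  have := isProbabilityMeasure_gaussPath hS
  have hint : integrableExpSet (linPath w) (gaussPath S) = Set.univ := by
    refine Set.eq_univ_of_forall fun r => ?_
    have h := integrable_exp_linPath hS (r • w)
    simp_rw [linPath_smul_left] at h
    exact h
  have hmgf : mgf (linPath w) (gaussPath S)
      = mgf id (gaussianReal 0 (covPath S w w).toNNReal) := by
    funext r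
    have h := integral_exp_linPath hS (r • w) (fun _ => (1 : ℝ))
    have h2 : mgf id (gaussianReal 0 (covPath S w w).toNNReal) r
        = Real.exp (covPath S w w * r ^ 2 / 2) := by
      rw [mgf_gaussianReal (μ := 0) (v := (covPath S w w).toNNReal) Measure.map_id,
        Real.coe_toNNReal _ (covPath_self_nonneg hS w), zero_mul, zero_add]
    rw [h2]
    simp only [linPath_smul_left, covPath_smul_left, covPath_smul_right, smul_eq_mul, mul_one,
      integral_const, probReal_univ] at h
    rw [mgf, h]
    congr 1
    ring
  have h := eqOn_complexMGF_of_mgf hmgf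
  rw [hint] at h
  have h2 := Measure.ext_of_complexMGF_eq (measurable_linPath w).aemeasurable aemeasurable_id
    (funext fun z => h (by simp))
  simpa using h2

end GaussianPath

end GordonHedge

namespace GordonHedge

/-! ### Lognormal expectations -/

theorem gaussianReal_real_Ioi {q : ℝ} (hq : 0 < q) (c : ℝ) :
    (gaussianReal 0 q.toNNReal).real (Set.Ioi c) = Phi (-c / Real.sqrt q) := by
  have hs : 0 < Real.sqrt q := Real.sqrt_pos.2 hq
  have h : gaussianReal 0 q.toNNReal = (gaussianReal 0 1).map (fun y => -Real.sqrt q * y) := by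
    rw [gaussianReal_map_const_mul]
    congr 1
    · simp
    · ext
      simp [Real.coe_toNNReal _ hq.le, Real.sq_sqrt hq.le]
  have hset : (fun y => -Real.sqrt q * y) ⁻¹' Set.Ioi c = Set.Iio (-c / Real.sqrt q) := by
    ext y
    simp only [Set.mem_preimage, Set.mem_Ioi, Set.mem_Iio]
    rw [lt_div_iff₀ hs]
    constructor <;> intro h <;> nlinarith
  rw [h, map_measureReal_apply (by fun_prop) measurableSet_Ioi, hset, Phi, cdf_eq_real]
  have := nullSingletonClass_gaussianReal (μ := 0) (v := 1) one_ne_zero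
  exact measureReal_congr Iio_ae_eq_Iic

section Lognormal

variable {τ ι : Type*} [Fintype τ] [Fintype ι] [DecidableEq ι]
variable {S : τ → Matrix ι ι ℝ}

/-- Upper tail probability of a Gaussian functional. -/
theorem integral_ite_lt_linPath (hS : ∀ i, (S i).PosDef) {v : τ → ι → ℝ}
    (hv : 0 < covPath S v v) (a μ : ℝ) :
    ∫ ζ, (if a < μ + linPath v ζ then (1 : ℝ) else 0) ∂(gaussPath S)
      = Phi ((μ - a) / Real.sqrt (covPath S v v)) := by
  have h := gaussianReal_real_Ioi hv (a - μ)
  rw [← gaussPath_map_linPath hS, map_measureReal_apply (measurable_linPath v) measurableSet_Ioi,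
    neg_sub] at h
  rw [← h, ← integral_indicator_one (measurable_linPath v measurableSet_Ioi)]
  refine integral_congr_ae (.of_forall fun ζ => ?_)
  by_cases hc : a < μ + linPath v ζ
  · rw [Set.indicator_of_mem (by simpa [sub_lt_iff_lt_add'] using hc)]
    simp [hc]
  · rw [Set.indicator_of_notMem (by simpa [sub_lt_iff_lt_add'] using hc)]
    simp [hc]

/-- By Cameron–Martin, the exponential factor only shifts the argument of `Φ` by a covariance. -/
theorem integral_exp_mul_ite (hS : ∀ i, (S i).PosDef) (w : τ → ι → ℝ) {v : τ → ι → ℝ}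
    (hv : 0 < covPath S v v) (m a μ : ℝ) :
    ∫ ζ, Real.exp (m + linPath w ζ) * (if a < μ + linPath v ζ then (1 : ℝ) else 0) ∂(gaussPath S)
      = Real.exp (m + covPath S w w / 2)
        * Phi ((μ - a + covPath S v w) / Real.sqrt (covPath S v v)) := by
  have h := integral_exp_linPath hS w fun ζ => if a < μ + linPath v ζ then (1 : ℝ) else 0
  have hs : linPath v (fun i => S i *ᵥ w i) = covPath S v w := rfl
  simp_rw [linPath_add_right, hs, add_comm (linPath v _) (covPath S v w), ← add_assoc,
    smul_eq_mul] at h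
  rw [integral_ite_lt_linPath hS hv] at h
  simp_rw [Real.exp_add, mul_assoc]
  rw [integral_const_mul, h]
  congr 4
  ring

theorem integrable_exp_mul_ite (hS : ∀ i, (S i).PosDef) (w v : τ → ι → ℝ) (m a μ : ℝ) :
    Integrable (fun ζ => Real.exp (m + linPath w ζ) *
      (if a < μ + linPath v ζ then (1 : ℝ) else 0)) (gaussPath S) := by
  have h := (integrable_exp_linPath hS w).const_mul (Real.exp m)
  simp_rw [← Real.exp_add] at h
  have hl := measurable_linPath v
  refine h.mul_bdd (c := 1) ?_ (.of_forall fun ζ => ?_)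
  · exact (Measurable.ite (measurableSet_lt measurable_const (by fun_prop)) measurable_const
      measurable_const).aestronglyMeasurable
  · split_ifs <;> simp

/-- `E[e^X (α e^Y - β e^Z)⁺]` for jointly Gaussian `X`, `Y`, `Z`. -/
theorem integral_exp_mul_exchange (hS : ∀ i, (S i).PosDef) (w v₁ v₂ : τ → ι → ℝ)
    (hv : 0 < covPath S (v₁ + (-1 : ℝ) • v₂) (v₁ + (-1 : ℝ) • v₂)) (m μ₁ μ₂ : ℝ) {α β : ℝ}
    (hα : 0 < α) (hβ : 0 < β) :
    Integrable (fun ζ => Real.exp (m + linPath w ζ) * max (α * Real.exp (μ₁ + linPath v₁ ζ)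
        - β * Real.exp (μ₂ + linPath v₂ ζ)) 0) (gaussPath S) ∧
    ∫ ζ, Real.exp (m + linPath w ζ) * max (α * Real.exp (μ₁ + linPath v₁ ζ)
        - β * Real.exp (μ₂ + linPath v₂ ζ)) 0 ∂(gaussPath S)
      = α * (Real.exp (m + μ₁ + covPath S (w + v₁) (w + v₁) / 2)
          * Phi ((μ₁ - μ₂ - Real.log (β / α) + covPath S (v₁ + (-1 : ℝ) • v₂) (w + v₁))
            / Real.sqrt (covPath S (v₁ + (-1 : ℝ) • v₂) (v₁ + (-1 : ℝ) • v₂))))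
        - β * (Real.exp (m + μ₂ + covPath S (w + v₂) (w + v₂) / 2)
          * Phi ((μ₁ - μ₂ - Real.log (β / α) + covPath S (v₁ + (-1 : ℝ) • v₂) (w + v₂))
            / Real.sqrt (covPath S (v₁ + (-1 : ℝ) • v₂) (v₁ + (-1 : ℝ) • v₂)))) := by
  -- the option is exercised iff `log (β / α) < Y - Z` for the two normal exponents `Y` and `Z`
  have e : ∀ ζ, Real.exp (m + linPath w ζ) * max (α * Real.exp (μ₁ + linPath v₁ ζ)
        - β * Real.exp (μ₂ + linPath v₂ ζ)) 0
      = α * (Real.exp (m + μ₁ + linPath (w + v₁) ζ)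
          * (if Real.log (β / α) < μ₁ - μ₂ + linPath (v₁ + (-1 : ℝ) • v₂) ζ then (1 : ℝ) else 0))
        - β * (Real.exp (m + μ₂ + linPath (w + v₂) ζ)
          * (if Real.log (β / α) < μ₁ - μ₂ + linPath (v₁ + (-1 : ℝ) • v₂) ζ then (1 : ℝ)
            else 0)) := by
    intro ζ
    have h1 : Real.exp (m + μ₁ + linPath (w + v₁) ζ)
        = Real.exp (m + linPath w ζ) * Real.exp (μ₁ + linPath v₁ ζ) := by
      rw [linPath_add_left, ← Real.exp_add]; congr 1; ring
    have h2 : Real.exp (m + μ₂ + linPath (w + v₂) ζ)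
        = Real.exp (m + linPath w ζ) * Real.exp (μ₂ + linPath v₂ ζ) := by
      rw [linPath_add_left, ← Real.exp_add]; congr 1; ring
    have h3 : Real.log (β / α) < μ₁ - μ₂ + linPath (v₁ + (-1 : ℝ) • v₂) ζ
        ↔ β * Real.exp (μ₂ + linPath v₂ ζ) < α * Real.exp (μ₁ + linPath v₁ ζ) := by
      rw [Real.log_lt_iff_lt_exp (div_pos hβ hα), div_lt_iff₀ hα, linPath_add_left,
        linPath_smul_left,
        show μ₁ - μ₂ + (linPath v₁ ζ + -1 * linPath v₂ ζ)
          = (μ₁ + linPath v₁ ζ) - (μ₂ + linPath v₂ ζ) by ring, Real.exp_sub, div_mul_eq_mul_div,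
        lt_div_iff₀ (Real.exp_pos _), mul_comm (Real.exp (μ₁ + linPath v₁ ζ))]
    rw [h1, h2]
    by_cases hc : Real.log (β / α) < μ₁ - μ₂ + linPath (v₁ + (-1 : ℝ) • v₂) ζ
    · rw [if_pos hc, max_eq_left (sub_nonneg.2 (h3.1 hc).le)]; ring
    · rw [if_neg hc, max_eq_right (sub_nonpos.2 (not_lt.1 (fun h => hc (h3.2 h))))]; ring
  simp_rw [e]
  have i1 := (integrable_exp_mul_ite hS (w + v₁) (v₁ + (-1 : ℝ) • v₂) (m + μ₁)
    (Real.log (β / α)) (μ₁ - μ₂)).const_mul α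
  have i2 := (integrable_exp_mul_ite hS (w + v₂) (v₁ + (-1 : ℝ) • v₂) (m + μ₂)
    (Real.log (β / α)) (μ₁ - μ₂)).const_mul β
  refine ⟨i1.sub i2, ?_⟩
  rw [integral_sub i1 i2, integral_const_mul, integral_const_mul, integral_exp_mul_ite hS _ hv,
    integral_exp_mul_ite hS _ hv]

omit [DecidableEq ι] in
theorem covPath_zero_left (v : τ → ι → ℝ) : covPath S 0 v = 0 := by simp [covPath]

/-- `E[e^X (e^Y - L)⁺]` is an entry of `Ψ⁺`. -/
theorem integral_exp_mul_call {κ κ' : Type*} (hS : ∀ i, (S i).PosDef) (w v : τ → ι → ℝ)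
    {L : κ' → ℝ} {μ₁ : κ → ℝ} {μ₂ : κ' → ℝ} {S₁₁ : Matrix κ κ ℝ} {S₁₂ : Matrix κ κ' ℝ}
    {S₂₂ : Matrix κ' κ' ℝ} {a : κ} {b : κ'} (hL : 0 < L b) (h11 : S₁₁ a a = covPath S w w)
    (h12 : S₁₂ a b = covPath S w v) (h22 : S₂₂ b b = covPath S v v) (hv : 0 < covPath S v v) :
    Integrable (fun ζ => Real.exp (μ₁ a + linPath w ζ)
        * max (Real.exp (μ₂ b + linPath v ζ) - L b) 0) (gaussPath S) ∧
    ∫ ζ, Real.exp (μ₁ a + linPath w ζ) * max (Real.exp (μ₂ b + linPath v ζ) - L b) 0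
        ∂(gaussPath S) = PsiPlus L μ₁ μ₂ S₁₁ S₁₂ S₂₂ a b := by
  have hz : v + (-1 : ℝ) • (0 : τ → ι → ℝ) = v := by simp
  have h := integral_exp_mul_exchange hS w v 0 (by rwa [hz]) (μ₁ a) (μ₂ b) 0 one_pos hL
  have hl0 : ∀ ζ, linPath (0 : τ → ι → ℝ) ζ = 0 := fun ζ => by simp [linPath]
  simp only [hz, hl0, add_zero, Real.exp_zero, mul_one, one_mul, div_one, sub_zero] at h
  refine ⟨h.1, h.2.trans ?_⟩
  have hs : Real.sqrt (covPath S v v) ≠ 0 := (Real.sqrt_pos.2 hv).ne'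
  have hss : Real.sqrt (covPath S v v) * Real.sqrt (covPath S v v) = covPath S v v :=
    Real.mul_self_sqrt hv.le
  simp only [PsiPlus, Matrix.of_apply, lognMean, dOne, dTwo, h11, h12, h22,
    covPath_add_left, covPath_add_right, covPath_comm hS v w]
  congr 1
  · rw [← Real.exp_add, ← Real.exp_add]
    congr 2
    · ring
    · rw [← add_div]; congr 1; ring
  · rw [mul_comm (L b), mul_assoc, mul_assoc, mul_comm (L b)]
    congr 3
    field_simp
    rw [sq, hss]
    ring

/-- `E[e^X (L - e^Y)⁺]` is an entry of `Ψ⁻`. -/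
theorem integral_exp_mul_put {κ κ' : Type*} (hS : ∀ i, (S i).PosDef) (w v : τ → ι → ℝ)
    {L : κ' → ℝ} {μ₁ : κ → ℝ} {μ₂ : κ' → ℝ} {S₁₁ : Matrix κ κ ℝ} {S₁₂ : Matrix κ κ' ℝ}
    {S₂₂ : Matrix κ' κ' ℝ} {a : κ} {b : κ'} (hL : 0 < L b) (h11 : S₁₁ a a = covPath S w w)
    (h12 : S₁₂ a b = covPath S w v) (h22 : S₂₂ b b = covPath S v v) (hv : 0 < covPath S v v) :
    Integrable (fun ζ => Real.exp (μ₁ a + linPath w ζ)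
        * max (L b - Real.exp (μ₂ b + linPath v ζ)) 0) (gaussPath S) ∧
    ∫ ζ, Real.exp (μ₁ a + linPath w ζ) * max (L b - Real.exp (μ₂ b + linPath v ζ)) 0
        ∂(gaussPath S) = PsiMinus L μ₁ μ₂ S₁₁ S₁₂ S₂₂ a b := by
  have hq : covPath S ((0 : τ → ι → ℝ) + (-1 : ℝ) • v) ((0 : τ → ι → ℝ) + (-1 : ℝ) • v)
      = covPath S v v := by
    rw [zero_add, covPath_smul_left, covPath_smul_right]; ring
  have h := integral_exp_mul_exchange hS w 0 v (by rwa [hq]) (μ₁ a) 0 (μ₂ b) hL one_pos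
  have hl0 : ∀ ζ, linPath (0 : τ → ι → ℝ) ζ = 0 := fun ζ => by simp [linPath]
  rw [hq] at h
  simp only [hl0, add_zero, Real.exp_zero, mul_one, one_mul, zero_sub, zero_add, one_div,
    Real.log_inv, covPath_smul_left, sub_neg_eq_add] at h
  refine ⟨h.1, h.2.trans ?_⟩
  have hs : Real.sqrt (covPath S v v) ≠ 0 := (Real.sqrt_pos.2 hv).ne'
  have hss : Real.sqrt (covPath S v v) * Real.sqrt (covPath S v v) = covPath S v v :=
    Real.mul_self_sqrt hv.le
  simp only [PsiMinus, Matrix.of_apply, lognMean, dOne, dTwo, h11, h12, h22,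
    covPath_add_left, covPath_add_right, covPath_comm hS v w]
  congr 1
  · rw [mul_comm (L b), mul_assoc, mul_assoc, mul_comm (L b)]
    congr 3
    field_simp
    rw [sq, hss]
    ring
  · rw [← Real.exp_add, ← Real.exp_add]
    congr 2
    · ring
    · field_simp; ring

/-- Characteristic function of a Gaussian functional. -/
theorem integral_cexp_linPath (hS : ∀ i, (S i).PosDef) (v : τ → ι → ℝ) (μ : ℝ) :
    ∫ ζ, Complex.exp (Complex.I * ((μ + linPath v ζ : ℝ) : ℂ)) ∂(gaussPath S)
      = Complex.exp (Complex.I * (μ : ℂ) - ((covPath S v v / 2 : ℝ) : ℂ)) := by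
  have h := charFun_gaussianReal (μ := 0) (v := (covPath S v v).toNNReal) 1
  rw [charFun_apply_real, ← gaussPath_map_linPath hS,
    integral_map (measurable_linPath v).aemeasurable (by fun_prop),
    Real.coe_toNNReal _ (covPath_self_nonneg hS v)] at h
  have e : ∀ ζ, Complex.exp (Complex.I * ((μ + linPath v ζ : ℝ) : ℂ))
      = Complex.exp (Complex.I * (μ : ℂ))
        * Complex.exp (((1 : ℝ) : ℂ) * (linPath v ζ : ℂ) * Complex.I) := by
    intro ζ
    rw [← Complex.exp_add]
    congr 1
    push_cast
    ring
  simp_rw [e]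
  rw [integral_const_mul, h, ← Complex.exp_add]
  congr 1
  push_cast
  ring

end Lognormal
end GordonHedge

namespace GordonHedge

/-! ### Product measures on paths -/

section Merge

variable {τ V : Type*} [Fintype τ] [MeasurableSpace V]

/-- The path that follows `ζ` on `p` and `ζ'` off `p`. -/
def mergePath (p : τ → Prop) [DecidablePred p] (ζ ζ' : τ → V) : τ → V :=
  fun i => if p i then ζ i else ζ' i

omit [Fintype τ] in
theorem measurable_mergePath (p : τ → Prop) [DecidablePred p] :
    Measurable fun q : (τ → V) × (τ → V) => mergePath p q.1 q.2 := by
  refine measurable_pi_lambda _ fun i => ?_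
  unfold mergePath
  split_ifs <;> fun_prop

theorem map_mergePath (p : τ → Prop) [DecidablePred p] (μ ν : τ → Measure V)
    [∀ i, IsProbabilityMeasure (μ i)] [∀ i, IsProbabilityMeasure (ν i)] :
    ((Measure.pi μ).prod (Measure.pi ν)).map (fun q => mergePath p q.1 q.2)
      = Measure.pi fun i => if p i then μ i else ν i := by
  have : ∀ i, IsProbabilityMeasure (if p i then μ i else ν i) := fun i => by
    split_ifs <;> infer_instance
  refine (Measure.pi_eq fun s hs => ?_).symm
  rw [Measure.map_apply (measurable_mergePath p) (MeasurableSet.univ_pi hs)]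
  have : (fun q : (τ → V) × (τ → V) => mergePath p q.1 q.2) ⁻¹' Set.univ.pi s
      = (Set.univ.pi fun i => if p i then s i else Set.univ) ×ˢ
        (Set.univ.pi fun i => if p i then Set.univ else s i) := by
    ext q
    simp only [Set.mem_preimage, Set.mem_pi, Set.mem_univ, forall_const, Set.mem_prod, mergePath,
      ← forall_and]
    refine forall_congr' fun i => ?_
    split_ifs <;> simp
  rw [this, Measure.prod_prod, Measure.pi_pi, Measure.pi_pi, ← Finset.prod_mul_distrib]
  refine Finset.prod_congr rfl fun i _ => ?_
  split_ifs <;> simp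

/-- Independent coordinates may be drawn from two independent paths. -/
theorem lintegral_mergePath (p : τ → Prop) [DecidablePred p] (μ ν : τ → Measure V)
    [∀ i, IsProbabilityMeasure (μ i)] [∀ i, IsProbabilityMeasure (ν i)] {f : (τ → V) → ℝ≥0∞}
    (hf : Measurable f) :
    ∫⁻ ζ, ∫⁻ ζ', f (mergePath p ζ ζ') ∂(Measure.pi ν) ∂(Measure.pi μ)
      = ∫⁻ ζ, f ζ ∂(Measure.pi fun i => if p i then μ i else ν i) := by
  have h := hf.comp (measurable_mergePath (V := V) p)
  simp only [Function.comp_def] at h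
  rw [← map_mergePath, lintegral_map hf (measurable_mergePath p), lintegral_prod _ h.aemeasurable]

end Merge

section Triangular

variable {T : ℕ} {V : Type*} [MeasurableSpace V] [Nonempty V]

/-- The family that equals `ρ` before position `m` and `κ` from position `m` on. -/
def hybridMeasure (ρ κ : Fin T → Measure V) (m : ℕ) : Fin T → Measure V :=
  fun i => if i.val < m then ρ i else κ i

omit [Nonempty V] in
theorem sigmaFinite_hybridMeasure {ρ κ : Fin T → Measure V} (hρ : ∀ i, SigmaFinite (ρ i))
    (hκ : ∀ i, SigmaFinite (κ i)) (m : ℕ) (i : Fin T) : SigmaFinite (hybridMeasure ρ κ m i) := by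
  unfold hybridMeasure
  split_ifs
  · exact hρ i
  · exact hκ i

/-- Triangular change of variables.  If `y ζ` is computed recursively, the coordinate `i` from the
earlier coordinates of `y ζ` and from `ζ i` by the map `F i`, and `F i` carries `κ i` to the law
with density `l i` relative to `ρ i`, then `y` carries the product of the `κ i` to the law with
density `∏ l i` relative to the product of the `ρ i`; here for the first `m` coordinates. -/
theorem lintegral_triangular {ρ κ : Fin T → Measure V} [hρ : ∀ i, SigmaFinite (ρ i)]
    [hκ : ∀ i, SigmaFinite (κ i)] (F : Fin T → (Fin T → V) → V → V)
    (l : Fin T → (Fin T → V) → V → ℝ≥0∞)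
    (hFm : ∀ i, Measurable fun q : (Fin T → V) × V => F i q.1 q.2)
    (hlm : ∀ i, Measurable fun q : (Fin T → V) × V => l i q.1 q.2)
    (hF : ∀ i η η', (∀ j < i, η j = η' j) → F i η = F i η')
    (hl : ∀ i η η', (∀ j < i, η j = η' j) → l i η = l i η')
    (hlaw : ∀ i η (f : V → ℝ≥0∞), Measurable f →
      ∫⁻ v, f (F i η v) ∂(κ i) = ∫⁻ v, l i η v * f v ∂(ρ i))
    (y : (Fin T → V) → Fin T → V) (hy : ∀ ζ i, y ζ i = F i (y ζ) (ζ i))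
    (m : ℕ) (hm : m ≤ T) {G : (Fin T → V) → ℝ≥0∞} (hG : Measurable G) :
    ∫⁻ ζ, G (fun i => if i.val < m then y ζ i else ζ i) ∂(Measure.pi κ)
      = ∫⁻ η, (∏ i : Fin T with i.val < m, l i η (η i)) * G η
          ∂(Measure.pi (hybridMeasure ρ κ m)) := by
  induction m generalizing G with
  | zero =>
    have : hybridMeasure ρ κ 0 = κ := by funext i; simp [hybridMeasure]
    simp [this]
  | succ m ih =>
    have hmT : m < T := hm
    set a : Fin T := ⟨m, hmT⟩ with ha
    have hmeas : Measurable fun η : Fin T → V => Function.update η a (F a η (η a)) := by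
      refine measurable_pi_lambda _ fun j => ?_
      by_cases hj : j = a
      · subst hj
        simp only [Function.update_self]
        exact (hFm a).comp (measurable_id.prodMk (measurable_pi_apply a))
      · simp only [Function.update_of_ne hj]
        exact measurable_pi_apply j
    -- passing from `m` to `m + 1` replaces the coordinate `a` by its recursive value
    have step : ∀ ζ, (fun i : Fin T => if i.val < m + 1 then y ζ i else ζ i)
        = Function.update (fun i : Fin T => if i.val < m then y ζ i else ζ i) a
          (F a (fun i : Fin T => if i.val < m then y ζ i else ζ i)
            ((fun i : Fin T => if i.val < m then y ζ i else ζ i) a)) := by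
      intro ζ
      have h1 : F a (fun i : Fin T => if i.val < m then y ζ i else ζ i) = F a (y ζ) := by
        refine hF a _ _ fun j hj => ?_
        have : j.val < m := hj
        simp [this]
      funext i
      by_cases hi : i = a
      · subst hi
        rw [Function.update_self, h1]
        simp [ha, hy ζ]
      · have : i.val < m + 1 ↔ i.val < m := by
          have : i.val ≠ m := fun h => hi (Fin.ext h)
          omega
        simp [Function.update_of_ne hi, this]
    have hGs : Measurable fun η : Fin T → V => G (Function.update η a (F a η (η a))) :=
      hG.comp hmeas
    simp_rw [step]
    rw [ih hmT.le hGs]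
    have hlp : ∀ k, Measurable fun η : Fin T → V => ∏ i : Fin T with i.val < k, l i η (η i) :=
      fun k => Finset.measurable_prod _ fun i _ =>
        (hlm i).comp (measurable_id.prodMk (measurable_pi_apply i))
    have s1 := sigmaFinite_hybridMeasure hρ hκ m
    have s2 := sigmaFinite_hybridMeasure hρ hκ (m + 1)
    have hup : ∀ (x : Fin T → V) (v : V), ∀ i ≤ a, ∀ j < i,
        Function.update x a v j = x j := fun x v i hi j hj =>
      Function.update_of_ne (ne_of_lt (lt_of_lt_of_le hj hi)) _ _
    have hm1 : Measurable fun η : Fin T → V => (∏ i : Fin T with i.val < m, l i η (η i))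
        * G (Function.update η a (F a η (η a))) := (hlp m).mul hGs
    have hm2 : Measurable fun η : Fin T → V => (∏ i : Fin T with i.val < m + 1, l i η (η i))
        * G η := (hlp (m + 1)).mul hG
    obtain ⟨v0⟩ := ‹Nonempty V›
    -- integrate the coordinate `a` first; the earlier coordinates are not affected by it
    rw [lintegral_eq_lmarginal_univ (fun _ => v0), lintegral_eq_lmarginal_univ (fun _ => v0),
      lmarginal_erase' _ hm1 (Finset.mem_univ a), lmarginal_erase' _ hm2 (Finset.mem_univ a)]
    -- on the coordinate `a`, change variables by the one-dimensional law
    have hin : (fun x : Fin T → V => ∫⁻ v, (∏ i : Fin T with i.val < m,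
          l i (Function.update x a v) (Function.update x a v i)) *
          G (Function.update (Function.update x a v) a
            (F a (Function.update x a v) (Function.update x a v a))) ∂(hybridMeasure ρ κ m a))
        = fun x => ∫⁻ v, (∏ i : Fin T with i.val < m + 1,
          l i (Function.update x a v) (Function.update x a v i)) *
          G (Function.update x a v) ∂(hybridMeasure ρ κ (m + 1) a) := by
      funext x
      have hp : ∀ v, (∏ i : Fin T with i.val < m,
          l i (Function.update x a v) (Function.update x a v i))
          = ∏ i : Fin T with i.val < m, l i x (x i) := by
        intro v
        refine Finset.prod_congr rfl fun i hi => ?_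
        have him : i.val < m := by simpa using hi
        rw [hl i _ x (hup x v i (Fin.le_def.2 him.le)), Function.update_of_ne]
        exact fun h => by rw [h] at him; exact lt_irrefl _ him
      have hp' : ∀ v, (∏ i : Fin T with i.val < m + 1,
          l i (Function.update x a v) (Function.update x a v i))
          = (∏ i : Fin T with i.val < m, l i x (x i)) * l a x v := by
        intro v
        have : (Finset.univ.filter fun i : Fin T => i.val < m + 1)
            = insert a (Finset.univ.filter fun i : Fin T => i.val < m) := by
          ext i
          simp only [Finset.mem_filter, Finset.mem_univ, true_and, Finset.mem_insert, ha,
            Fin.ext_iff]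
          omega
        rw [this, Finset.prod_insert (by simp [ha]), hp, Function.update_self,
          hl a _ x (hup x v a le_rfl),
          mul_comm]
      have e1 : hybridMeasure ρ κ m a = κ a := by simp [hybridMeasure, ha]
      have e2 : hybridMeasure ρ κ (m + 1) a = ρ a := by simp [hybridMeasure, ha]
      have hGu : Measurable fun v => G (Function.update x a v) :=
        hG.comp (measurable_update x)
      simp_rw [hp, hp', e1, e2, Function.update_self, Function.update_idem,
        fun v => hF a _ x (hup x v a le_rfl), mul_assoc]
      have hFx : Measurable fun v => G (Function.update x a (F a x v)) :=
        hGu.comp ((hFm a).comp (measurable_const.prodMk measurable_id))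
      have hlx : Measurable fun v => l a x v * G (Function.update x a v) :=
        ((hlm a).comp (measurable_const.prodMk measurable_id)).mul hGu
      rw [lintegral_const_mul _ hFx, lintegral_const_mul _ hlx, hlaw a x _ hGu]
    rw [hin]
    unfold lmarginal
    have hmu : (fun i : {x // x ∈ Finset.univ.erase a} => hybridMeasure ρ κ m i)
        = fun i : {x // x ∈ Finset.univ.erase a} => hybridMeasure ρ κ (m + 1) i := by
      funext i
      have hi : i.val ≠ a := (Finset.mem_erase.1 i.2).1
      have : i.val.val < m + 1 ↔ i.val.val < m := by
        have : i.val.val ≠ m := fun h => hi (Fin.ext h)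
        omega
      simp only [hybridMeasure, this]
    rw [hmu]

end Triangular
end GordonHedge

namespace GordonHedge

/-! ### Conditional expectations -/

section CondExp

variable {Ω : Type*} {m m₀ : MeasurableSpace Ω} {μ : Measure Ω}

/-- A conditional expectation may be identified by the lower integrals of the positive and the
negative part. -/
theorem condExp_ae_eq_of_setLIntegral_eq [IsFiniteMeasure μ] (hm : m ≤ m₀) {X : Ω → ℝ}
    (hX : Integrable X μ) {Kp Kn : Ω → ℝ≥0∞} (hKp : Measurable[m] Kp) (hKn : Measurable[m] Kn)
    (hp : ∀ A, MeasurableSet[m] A → ∫⁻ ω in A, ENNReal.ofReal (X ω) ∂μ = ∫⁻ ω in A, Kp ω ∂μ)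
    (hn : ∀ A, MeasurableSet[m] A → ∫⁻ ω in A, ENNReal.ofReal (-X ω) ∂μ = ∫⁻ ω in A, Kn ω ∂μ) :
    (∀ᵐ ω ∂μ, Kp ω < ∞ ∧ Kn ω < ∞) ∧
      μ[X | m] =ᵐ[μ] fun ω => (Kp ω).toReal - (Kn ω).toReal := by
  have hKp0 : Measurable Kp := hKp.mono hm le_rfl
  have hKn0 : Measurable Kn := hKn.mono hm le_rfl
  have fin : ∀ {X : Ω → ℝ}, Integrable X μ → ∫⁻ ω, ENNReal.ofReal (X ω) ∂μ ≠ ∞ := fun hX =>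
    ((lintegral_mono fun ω => by
      rw [← ofReal_norm]; exact ENNReal.ofReal_le_ofReal (le_abs_self _)).trans_lt hX.2).ne
  have ip : ∫⁻ ω, Kp ω ∂μ ≠ ∞ := by
    have := hp Set.univ MeasurableSet.univ
    rw [Measure.restrict_univ] at this
    rw [← this]; exact fin hX
  have inn : ∫⁻ ω, Kn ω ∂μ ≠ ∞ := by
    have := hn Set.univ MeasurableSet.univ
    rw [Measure.restrict_univ] at this
    rw [← this]; exact fin hX.neg
  have ap := ae_lt_top hKp0 ip
  have an := ae_lt_top hKn0 inn
  have jp := integrable_toReal_of_lintegral_ne_top hKp0.aemeasurable ip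
  have jn := integrable_toReal_of_lintegral_ne_top hKn0.aemeasurable inn
  refine ⟨ap.and an, (ae_eq_condExp_of_forall_setIntegral_eq hm hX
    (fun s _ _ => (jp.sub jn).integrableOn) (fun A hA _ => ?_) ?_).symm⟩
  · simp only [Pi.sub_apply]
    rw [integral_sub jp.integrableOn jn.integrableOn,
      integral_toReal hKp0.aemeasurable (ae_restrict_of_ae ap),
      integral_toReal hKn0.aemeasurable (ae_restrict_of_ae an), ← hp A hA, ← hn A hA,
      ← integral_eq_lintegral_pos_part_sub_lintegral_neg_part hX.integrableOn]
  · exact (hKp.ennreal_toReal.sub hKn.ennreal_toReal).stronglyMeasurable.aestronglyMeasurable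

/-- If `M₁` and `M₂` are independent, `X` is `M₁`-measurable and `L` is `M₂`-measurable, then the
conditional expectation of `X L` given `m₁ ⊔ m₂`, `m_i ≤ M_i`, factors. -/
theorem condExp_mul_sup_of_indep {M₁ M₂ m₁ m₂ : MeasurableSpace Ω} [IsProbabilityMeasure μ]
    (hM₁ : M₁ ≤ m₀) (hM₂ : M₂ ≤ m₀) (h₁ : m₁ ≤ M₁) (h₂ : m₂ ≤ M₂) (hind : Indep M₁ M₂ μ)
    {X L : Ω → ℝ} (hX : StronglyMeasurable[M₁] X) (hL : StronglyMeasurable[M₂] L)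
    (iX : Integrable X μ) (iL : Integrable L μ) :
    Integrable (fun ω => X ω * L ω) μ ∧
      μ[fun ω => X ω * L ω | m₁ ⊔ m₂] =ᵐ[μ] fun ω => (μ[X | m₁]) ω * (μ[L | m₂]) ω := by
  have ind : ∀ {f g : Ω → ℝ}, StronglyMeasurable[M₁] f → StronglyMeasurable[M₂] g →
      IndepFun f g μ := fun {f g} hf hg => by
    rw [IndepFun_iff_Indep]
    exact indep_of_indep_of_le_left (indep_of_indep_of_le_right hind hg.measurable.comap_le)
      hf.measurable.comap_le
  have iXL : Integrable (fun ω => X ω * L ω) μ := (ind hX hL).integrable_mul iX iL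
  have c1 : StronglyMeasurable[M₁] (μ[X | m₁]) := stronglyMeasurable_condExp.mono h₁
  have c2 : StronglyMeasurable[M₂] (μ[L | m₂]) := stronglyMeasurable_condExp.mono h₂
  have iC : Integrable (fun ω => (μ[X | m₁]) ω * (μ[L | m₂]) ω) μ :=
    (ind c1 c2).integrable_mul integrable_condExp integrable_condExp
  have hle : m₁ ⊔ m₂ ≤ m₀ := sup_le (h₁.trans hM₁) (h₂.trans hM₂)
  refine ⟨iXL, (ae_eq_condExp_of_forall_setIntegral_eq hle iXL (fun s _ _ => iC.integrableOn)
    (fun A hA _ => ?_) ?_).symm⟩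
  · -- the sets `A₁ ∩ A₂` form a π-system that generates `m₁ ⊔ m₂`
    have hgen : m₁ ⊔ m₂ = MeasurableSpace.generateFrom
        {A | ∃ A₁ A₂, MeasurableSet[m₁] A₁ ∧ MeasurableSet[m₂] A₂ ∧ A = A₁ ∩ A₂} := by
      apply le_antisymm
      · refine sup_le (fun A hA => ?_) (fun A hA => ?_)
        · exact MeasurableSpace.measurableSet_generateFrom
            ⟨A, Set.univ, hA, MeasurableSet.univ, by simp⟩
        · exact MeasurableSpace.measurableSet_generateFrom
            ⟨Set.univ, A, MeasurableSet.univ, hA, by simp⟩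
      · refine MeasurableSpace.generateFrom_le ?_
        rintro A ⟨A₁, A₂, k₁, k₂, rfl⟩
        exact MeasurableSet.inter ((le_sup_left : m₁ ≤ m₁ ⊔ m₂) _ k₁)
          ((le_sup_right : m₂ ≤ m₁ ⊔ m₂) _ k₂)
    have hpi : IsPiSystem
        {A : Set Ω | ∃ A₁ A₂, MeasurableSet[m₁] A₁ ∧ MeasurableSet[m₂] A₂ ∧ A = A₁ ∩ A₂} := by
      rintro _ ⟨A₁, A₂, k₁, k₂, rfl⟩ _ ⟨B₁, B₂, l₁, l₂, rfl⟩ _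
      exact ⟨A₁ ∩ B₁, A₂ ∩ B₂, k₁.inter l₁, k₂.inter l₂, Set.inter_inter_inter_comm _ _ _ _⟩
    have prodform : ∀ {f g : Ω → ℝ}, StronglyMeasurable[M₁] f → StronglyMeasurable[M₂] g →
        ∀ {A₁ A₂ : Set Ω}, MeasurableSet[m₁] A₁ → MeasurableSet[m₂] A₂ →
        ∫ ω in A₁ ∩ A₂, f ω * g ω ∂μ = (∫ ω in A₁, f ω ∂μ) * ∫ ω in A₂, g ω ∂μ := by
      intro f g hf hg A₁ A₂ k₁ k₂
      have K₁ := hM₁ _ (h₁ _ k₁)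
      have K₂ := hM₂ _ (h₂ _ k₂)
      rw [← integral_indicator (K₁.inter K₂), ← integral_indicator K₁, ← integral_indicator K₂]
      have := (ind (hf.indicator (h₁ _ k₁)) (hg.indicator (h₂ _ k₂))).integral_mul_eq_mul_integral
        ((hf.indicator (h₁ _ k₁)).mono hM₁).aestronglyMeasurable
        ((hg.indicator (h₂ _ k₂)).mono hM₂).aestronglyMeasurable
      rw [← this]
      refine integral_congr_ae (.of_forall fun ω => ?_)
      simp only [Pi.mul_apply]
      by_cases q₁ : ω ∈ A₁ <;> by_cases q₂ : ω ∈ A₂ <;> simp [q₁, q₂]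
    refine MeasurableSpace.induction_on_inter (C := fun A _ =>
      ∫ ω in A, (μ[X | m₁]) ω * (μ[L | m₂]) ω ∂μ = ∫ ω in A, X ω * L ω ∂μ) hgen hpi
      (by simp) ?_ ?_ ?_ A hA
    · rintro _ ⟨A₁, A₂, k₁, k₂, rfl⟩
      rw [prodform hX hL k₁ k₂, prodform c1 c2 k₁ k₂, setIntegral_condExp (h₁.trans hM₁) iX k₁,
        setIntegral_condExp (h₂.trans hM₂) iL k₂]
    · intro B hB ih
      have hB0 := hle _ hB
      have huniv : ∫ ω, (μ[X | m₁]) ω * (μ[L | m₂]) ω ∂μ = ∫ ω, X ω * L ω ∂μ := by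
        have e1 := prodform hX hL (A₁ := Set.univ) (A₂ := Set.univ) MeasurableSet.univ
          MeasurableSet.univ
        have e2 := prodform c1 c2 (A₁ := Set.univ) (A₂ := Set.univ) MeasurableSet.univ
          MeasurableSet.univ
        simp only [Set.inter_univ, Measure.restrict_univ] at e1 e2
        rw [e1, e2, integral_condExp (h₁.trans hM₁), integral_condExp (h₂.trans hM₂)]
      rw [setIntegral_compl hB0 iC, setIntegral_compl hB0 iXL, ih, huniv]
    · intro f hd hf ih
      rw [integral_iUnion (fun i => hle _ (hf i)) hd iC.integrableOn,
        integral_iUnion (fun i => hle _ (hf i)) hd iXL.integrableOn]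
      exact tsum_congr ih
  · exact ((stronglyMeasurable_condExp.mono le_sup_left).mul
      (stronglyMeasurable_condExp.mono le_sup_right)).aestronglyMeasurable

/-- Known factors may be taken out of the conditional expectation of a sum as soon as the sum is
integrable; the single products need not be integrable. -/
theorem condExp_sum_mul_of_stronglyMeasurable {κ : Type*} [Fintype κ] [IsFiniteMeasure μ]
    (hm : m ≤ m₀) {h X : κ → Ω → ℝ} (hh : ∀ a, StronglyMeasurable[m] (h a))
    (hX : ∀ a, Integrable (X a) μ) (hsum : Integrable (fun ω => ∑ a, h a ω * X a ω) μ) :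
    μ[fun ω => ∑ a, h a ω * X a ω | m] =ᵐ[μ] fun ω => ∑ a, h a ω * (μ[X a | m]) ω := by
  -- truncation to the sets on which all factors are bounded by `k`
  let A : ℕ → Set Ω := fun k => {ω | ∀ a, |h a ω| ≤ k}
  have hA : ∀ k, MeasurableSet[m] (A k) := fun k => by
    have : A k = ⋂ a, {ω | |h a ω| ≤ k} := by ext; simp [A]
    rw [this]
    exact MeasurableSet.iInter fun a =>
      measurableSet_Iic.preimage (f := fun ω => |h a ω|)
        (continuous_abs.measurable.comp (hh a).measurable)
  have key : ∀ k, ∀ᵐ ω ∂μ, ω ∈ A k →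
      (μ[fun ω => ∑ a, h a ω * X a ω | m]) ω = ∑ a, h a ω * (μ[X a | m]) ω := by
    intro k
    have hb : ∀ a, StronglyMeasurable[m] ((A k).indicator (h a)) := fun a =>
      (hh a).indicator (hA k)
    have hbd : ∀ a ω, ‖(A k).indicator (h a) ω‖ ≤ k := by
      intro a ω
      by_cases hω : ω ∈ A k
      · rw [Set.indicator_of_mem hω]; exact hω a
      · rw [Set.indicator_of_notMem hω]; simp
    have hi : ∀ a, Integrable ((A k).indicator (h a) * X a) μ := fun a =>
      (hX a).bdd_mul ((hb a).mono hm).aestronglyMeasurable (.of_forall (hbd a))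
    have e1 := condExp_indicator (m := m) hsum (hA k)
    have e2 : (A k).indicator (fun ω => ∑ a, h a ω * X a ω)
        = ∑ a, (A k).indicator (h a) * X a := by
      funext ω
      rw [Finset.sum_apply]
      by_cases hω : ω ∈ A k
      · simp [Set.indicator_of_mem hω]
      · simp [Set.indicator_of_notMem hω]
    have e3 := condExp_finsetSum (m := m) (s := Finset.univ) (fun a _ => hi a)
    have e4 : ∀ᵐ ω ∂μ, ∀ a, (μ[(A k).indicator (h a) * X a | m]) ω
        = (A k).indicator (h a) ω * (μ[X a | m]) ω :=
      ae_all_iff.2 fun a => condExp_mul_of_stronglyMeasurable_left (hb a) (hi a) (hX a)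
    rw [← e2] at e3
    filter_upwards [e1, e3, e4] with ω w1 w3 w4 hω
    rw [w3, Set.indicator_of_mem hω] at w1
    rw [← w1, Finset.sum_apply]
    refine Finset.sum_congr rfl fun a _ => ?_
    rw [w4 a, Set.indicator_of_mem hω]
  filter_upwards [ae_all_iff.2 key] with ω hω
  obtain ⟨k, hk⟩ := exists_nat_ge (∑ a, |h a ω|)
  exact hω k fun a =>
    (Finset.single_le_sum (f := fun a => |h a ω|) (fun _ _ => abs_nonneg _)
      (Finset.mem_univ a)).trans hk

end CondExp
end GordonHedge

namespace GordonHedge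

/-! ### Conditional least squares over one period -/

section Projection

variable {Ω : Type*} {m m₀ : MeasurableSpace Ω} {μ : Measure Ω} [IsProbabilityMeasure μ]
variable {κ : Type*} [Fintype κ] [DecidableEq κ]

/-- Coefficients `E[g g' | m]⁻¹ E[g Y | m]` of the conditional regression of `Y` on `g`. -/
noncomputable def projCoef (μ : Measure Ω) (m : MeasurableSpace Ω) (g : Ω → κ → ℝ) (Y : Ω → ℝ)
    (ω : Ω) : κ → ℝ :=
  (Matrix.of fun a b => (μ[fun ω' => g ω' a * g ω' b | m]) ω)⁻¹ *ᵥ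
    fun a => (μ[fun ω' => g ω' a * Y ω' | m]) ω

theorem measurable_inv_mulVec {α : Type*} [MeasurableSpace α] {f : α → Matrix κ κ ℝ}
    {v : α → κ → ℝ} (hf : EntryMeasurable f) (hv : Measurable v) :
    Measurable fun a => (f a)⁻¹ *ᵥ v a := hf.inv.mulVec hv

omit [IsProbabilityMeasure μ] in
theorem stronglyMeasurable_projCoef (g : Ω → κ → ℝ) (Y : Ω → ℝ) (a : κ) :
    StronglyMeasurable[m] fun ω => projCoef μ m g Y ω a := by
  have h1 : @EntryMeasurable κ κ Ω m
      fun ω => Matrix.of fun a b => (μ[fun ω' => g ω' a * g ω' b | m]) ω :=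
    fun a b => (stronglyMeasurable_condExp (m := m)).measurable
  have h2 : Measurable[m] fun ω => fun a => (μ[fun ω' => g ω' a * Y ω' | m]) ω :=
    @measurable_pi_lambda Ω κ (fun _ => ℝ) m _ _ fun a =>
      (stronglyMeasurable_condExp (m := m)).measurable
  exact ((measurable_pi_apply a).comp
    (@measurable_inv_mulVec κ _ _ Ω m _ _ h1 h2)).stronglyMeasurable

omit [IsProbabilityMeasure μ] [DecidableEq κ] in
theorem aestronglyMeasurable_dotProduct (hm : m ≤ m₀) {g k : Ω → κ → ℝ}
    (hg : ∀ a, MemLp (fun ω => g ω a) 2 μ) (hk : ∀ a, StronglyMeasurable[m] fun ω => k ω a) :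
    AEStronglyMeasurable (fun ω => k ω ⬝ᵥ g ω) μ := by
  simp only [dotProduct]
  exact Finset.aestronglyMeasurable_fun_sum _ fun a _ =>
    ((hk a).mono hm).aestronglyMeasurable.mul (hg a).1

variable (hm : m ≤ m₀) {g : Ω → κ → ℝ} (hg : ∀ a, MemLp (fun ω => g ω a) 2 μ)

include hm hg

omit [DecidableEq κ] in
theorem condExp_dotProduct_mul {k : Ω → κ → ℝ} (hk : ∀ a, StronglyMeasurable[m] fun ω => k ω a)
    (hkg : MemLp (fun ω => k ω ⬝ᵥ g ω) 2 μ) {Y : Ω → ℝ} (hY : MemLp Y 2 μ) :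
    μ[fun ω => (k ω ⬝ᵥ g ω) * Y ω | m]
      =ᵐ[μ] fun ω => k ω ⬝ᵥ fun a => (μ[fun ω' => g ω' a * Y ω' | m]) ω := by
  have e : (fun ω => (k ω ⬝ᵥ g ω) * Y ω) = fun ω => ∑ a, k ω a * (g ω a * Y ω) := by
    funext ω
    simp only [dotProduct, Finset.sum_mul, mul_assoc]
  have i := hkg.integrable_mul hY
  rw [show ((fun ω => k ω ⬝ᵥ g ω) * Y) = fun ω => (k ω ⬝ᵥ g ω) * Y ω from rfl, e] at i
  rw [e]
  exact condExp_sum_mul_of_stronglyMeasurable hm hk (fun a => (hg a).integrable_mul hY) i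

omit [DecidableEq κ] in
theorem condExp_dotProduct_eq_zero (hg0 : ∀ a, μ[fun ω => g ω a | m] =ᵐ[μ] 0)
    {k : Ω → κ → ℝ} (hk : ∀ a, StronglyMeasurable[m] fun ω => k ω a)
    (hkg : MemLp (fun ω => k ω ⬝ᵥ g ω) 2 μ) :
    μ[fun ω => k ω ⬝ᵥ g ω | m] =ᵐ[μ] 0 := by
  have h := condExp_dotProduct_mul hm hg hk hkg (Y := fun _ => 1) (memLp_const 1)
  simp only [mul_one] at h
  filter_upwards [h, ae_all_iff.2 hg0] with ω h1 h2
  rw [h1]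
  simp [dotProduct, h2]

omit [DecidableEq κ] in
theorem condExp_dotProduct_sq {k : Ω → κ → ℝ} (hk : ∀ a, StronglyMeasurable[m] fun ω => k ω a)
    (hkg : MemLp (fun ω => k ω ⬝ᵥ g ω) 2 μ) :
    μ[fun ω => (k ω ⬝ᵥ g ω) ^ 2 | m] =ᵐ[μ] fun ω => k ω ⬝ᵥ
      ((Matrix.of fun a b => (μ[fun ω' => g ω' a * g ω' b | m]) ω) *ᵥ k ω) := by
  have e : (fun ω => (k ω ⬝ᵥ g ω) ^ 2)
      = fun ω => ∑ p : κ × κ, (k ω p.1 * k ω p.2) * (g ω p.1 * g ω p.2) := by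
    funext ω
    rw [sq, dotProduct, Finset.sum_mul_sum, Fintype.sum_prod_type]
    exact Finset.sum_congr rfl fun a _ => Finset.sum_congr rfl fun b _ => by ring
  have i := hkg.integrable_sq
  rw [e] at i
  rw [e]
  have h := condExp_sum_mul_of_stronglyMeasurable (μ := μ) hm
    (h := fun (p : κ × κ) ω => k ω p.1 * k ω p.2)
    (X := fun (p : κ × κ) ω => g ω p.1 * g ω p.2) (fun p => (hk p.1).mul (hk p.2))
    (fun p => (hg p.1).integrable_mul (hg p.2)) i
  filter_upwards [h] with ω hω
  rw [hω]
  simp only [dotProduct, Matrix.mulVec, Matrix.of_apply, Fintype.sum_prod_type, Finset.mul_sum]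
  exact Finset.sum_congr rfl fun a _ => Finset.sum_congr rfl fun b _ => by ring

variable (hPD : ∀ᵐ ω ∂μ, (Matrix.of fun a b => (μ[fun ω' => g ω' a * g ω' b | m]) ω).PosDef)

include hPD

omit [IsProbabilityMeasure μ] hm hg in
/-- The normal equations of the conditional regression. -/
theorem mulVec_projCoef (Y : Ω → ℝ) : ∀ᵐ ω ∂μ,
    (Matrix.of fun a b => (μ[fun ω' => g ω' a * g ω' b | m]) ω) *ᵥ projCoef μ m g Y ω
      = fun a => (μ[fun ω' => g ω' a * Y ω' | m]) ω := by
  filter_upwards [hPD] with ω hω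
  rw [projCoef, Matrix.mulVec_mulVec, Matrix.mul_nonsing_inv _
    (isUnit_iff_ne_zero.2 hω.det_pos.ne'), Matrix.one_mulVec]

/-- The fitted value of the conditional regression is square integrable (Bessel's inequality on
the sets where the coefficients are bounded). -/
theorem memLp_projCoef_dotProduct {Y : Ω → ℝ} (hY : MemLp Y 2 μ) :
    MemLp (fun ω => projCoef μ m g Y ω ⬝ᵥ g ω) 2 μ := by
  set h := projCoef μ m g Y with hh
  have hs : ∀ a, StronglyMeasurable[m] fun ω => h ω a := stronglyMeasurable_projCoef g Y
  -- truncate the coefficients, so that all products below are integrable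
  let A : ℕ → Set Ω := fun k => {ω | ∀ a, |h ω a| ≤ k}
  have hA : ∀ k, MeasurableSet[m] (A k) := fun k => by
    have : A k = ⋂ a, {ω | |h ω a| ≤ k} := by ext; simp [A]
    rw [this]
    exact MeasurableSet.iInter fun a => measurableSet_Iic.preimage (f := fun ω => |h ω a|)
      (continuous_abs.measurable.comp (hs a).measurable)
  have hAmono : ∀ k ω, ω ∈ A k → ω ∈ A (k + 1) := fun k ω hω a =>
    (hω a).trans (by push_cast; linarith)
  have hmeas := aestronglyMeasurable_dotProduct hm hg hs
  have bound : ∀ k, ∫⁻ ω, (A k).indicator (fun ω => ENNReal.ofReal ((h ω ⬝ᵥ g ω) ^ 2)) ω ∂μ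
      ≤ ENNReal.ofReal (∫ ω, Y ω ^ 2 ∂μ) := by
    intro k
    let hk : Ω → κ → ℝ := fun ω => (A k).indicator h ω
    have hka : ∀ ω a, hk ω a = (A k).indicator (fun ω => h ω a) ω := fun ω a => by
      by_cases hω : ω ∈ A k <;> simp [hk, hω]
    have hks : ∀ a, StronglyMeasurable[m] fun ω => hk ω a := fun a => by
      simp_rw [hka]; exact (hs a).indicator (hA k)
    have hkL : MemLp (fun ω => hk ω ⬝ᵥ g ω) 2 μ := by
      simp only [dotProduct]
      refine memLp_finsetSum _ fun a _ => ?_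
      refine MemLp.mul' (p := ∞) (q := 2) (hg a) (memLp_top_of_bound
        ((hks a).mono hm).aestronglyMeasurable k (.of_forall fun ω => ?_))
      rw [hka]
      by_cases hω : ω ∈ A k
      · rw [Set.indicator_of_mem hω]; exact hω a
      · rw [Set.indicator_of_notMem hω]; simp
    have e1 := condExp_dotProduct_sq hm hg hks hkL
    have e2 := condExp_dotProduct_mul hm hg hks hkL hY
    -- by the normal equations the fitted value has the same product with itself and with `Y`
    have e3 : μ[fun ω => (hk ω ⬝ᵥ g ω) ^ 2 | m] =ᵐ[μ] μ[fun ω => (hk ω ⬝ᵥ g ω) * Y ω | m] := by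
      filter_upwards [e1, e2, mulVec_projCoef hPD Y] with ω w1 w2 w3
      rw [w1, w2]
      by_cases hω : ω ∈ A k
      · simp only [hk, Set.indicator_of_mem hω]
        rw [← w3]
      · simp [hk, Set.indicator_of_notMem hω]
    have e4 : ∫ ω, (hk ω ⬝ᵥ g ω) ^ 2 ∂μ = ∫ ω, (hk ω ⬝ᵥ g ω) * Y ω ∂μ := by
      rw [← integral_condExp hm, ← integral_condExp hm (f := fun ω => (hk ω ⬝ᵥ g ω) * Y ω)]
      exact integral_congr_ae e3
    have i1 := hkL.integrable_sq
    have i2 : Integrable (fun ω => (hk ω ⬝ᵥ g ω) * Y ω) μ := hkL.integrable_mul hY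
    have i3 := hY.integrable_sq
    -- by `2xy ≤ x² + y²`, the fitted value is bounded by `Y` in mean square
    have e5 : ∫ ω, (hk ω ⬝ᵥ g ω) * Y ω ∂μ
        ≤ ∫ ω, ((hk ω ⬝ᵥ g ω) ^ 2 / 2 + Y ω ^ 2 / 2) ∂μ :=
      integral_mono i2 ((i1.div_const 2).add (i3.div_const 2)) fun ω => by
        simp only
        nlinarith [sq_nonneg ((hk ω ⬝ᵥ g ω) - Y ω)]
    rw [integral_add (i1.div_const 2) (i3.div_const 2), integral_div, integral_div] at e5
    have e6 : ∫ ω, (hk ω ⬝ᵥ g ω) ^ 2 ∂μ ≤ ∫ ω, Y ω ^ 2 ∂μ := by linarith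
    calc _ = ∫⁻ ω, ENNReal.ofReal ((hk ω ⬝ᵥ g ω) ^ 2) ∂μ := by
          refine lintegral_congr fun ω => ?_
          by_cases hω : ω ∈ A k
          · simp only [hk, Set.indicator_of_mem hω]
          · simp only [hk, Set.indicator_of_notMem hω, zero_dotProduct]
            rw [zero_pow two_ne_zero, ENNReal.ofReal_zero]
      _ = ENNReal.ofReal (∫ ω, (hk ω ⬝ᵥ g ω) ^ 2 ∂μ) :=
          (ofReal_integral_eq_lintegral_ofReal i1 (.of_forall fun ω => sq_nonneg _)).symm
      _ ≤ _ := ENNReal.ofReal_le_ofReal e6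
  -- let the truncation level tend to infinity
  have hsup : ∫⁻ ω, ENNReal.ofReal ((h ω ⬝ᵥ g ω) ^ 2) ∂μ ≤ ENNReal.ofReal (∫ ω, Y ω ^ 2 ∂μ) := by
    have : ∀ ω, ENNReal.ofReal ((h ω ⬝ᵥ g ω) ^ 2)
        = ⨆ k, (A k).indicator (fun ω => ENNReal.ofReal ((h ω ⬝ᵥ g ω) ^ 2)) ω := by
      intro ω
      refine le_antisymm ?_ (iSup_le fun k => Set.indicator_le_self _ _ _)
      obtain ⟨k, hk⟩ := exists_nat_ge (∑ a, |h ω a|)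
      have hω : ω ∈ A k := fun a =>
        (Finset.single_le_sum (f := fun a => |h ω a|) (fun _ _ => abs_nonneg _)
          (Finset.mem_univ a)).trans hk
      refine le_iSup_of_le k ?_
      rw [Set.indicator_of_mem hω]
    rw [lintegral_congr this, lintegral_iSup']
    · exact iSup_le bound
    · exact fun k => ((hmeas.aemeasurable.pow_const 2).ennreal_ofReal).indicator (hm _ (hA k))
    · refine .of_forall fun ω => monotone_nat_of_le_succ fun k => ?_
      by_cases hω : ω ∈ A k
      · rw [Set.indicator_of_mem hω, Set.indicator_of_mem (hAmono k ω hω)]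
      · rw [Set.indicator_of_notMem hω]; exact zero_le
  refine (memLp_two_iff_integrable_sq hmeas).2 ⟨(hmeas.aemeasurable.pow_const 2).aestronglyMeasurable,
    ?_⟩
  rw [hasFiniteIntegral_iff_ofReal (.of_forall fun ω => sq_nonneg _)]
  exact hsup.trans_lt ENNReal.ofReal_lt_top

variable (hg0 : ∀ a, μ[fun ω => g ω a | m] =ᵐ[μ] 0)

include hg0

/-- Pythagoras for the conditional regression of `Y` on the constants and `g`. -/
theorem condExp_sq_residual {Y : Ω → ℝ} (hY : MemLp Y 2 μ) {W : Ω → ℝ}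
    (hW : StronglyMeasurable[m] W) (hW2 : MemLp W 2 μ) {k : Ω → κ → ℝ}
    (hk : ∀ a, StronglyMeasurable[m] fun ω => k ω a) (hkg : MemLp (fun ω => k ω ⬝ᵥ g ω) 2 μ) :
    μ[fun ω => (Y ω - W ω - k ω ⬝ᵥ g ω) ^ 2 | m] =ᵐ[μ]
      μ[fun ω => (Y ω - (μ[Y | m]) ω - projCoef μ m g Y ω ⬝ᵥ g ω) ^ 2 | m]
      + μ[fun ω => ((μ[Y | m]) ω - W ω + (projCoef μ m g Y ω - k ω) ⬝ᵥ g ω) ^ 2 | m] := by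
  set h := projCoef μ m g Y with hh
  have hs : ∀ a, StronglyMeasurable[m] fun ω => h ω a := stronglyMeasurable_projCoef g Y
  have hL : MemLp (fun ω => h ω ⬝ᵥ g ω) 2 μ := memLp_projCoef_dotProduct hm hg hPD hY
  have hE : MemLp (μ[Y | m]) 2 μ := hY.condExp one_le_two
  set C : Ω → ℝ := fun ω => Y ω - (μ[Y | m]) ω - h ω ⬝ᵥ g ω with hC
  have hCL : MemLp C 2 μ := (hY.sub hE).sub hL
  set U : Ω → ℝ := fun ω => (μ[Y | m]) ω - W ω + (h ω - k ω) ⬝ᵥ g ω with hU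
  have hdL : MemLp (fun ω => (h ω - k ω) ⬝ᵥ g ω) 2 μ := by
    simp_rw [sub_dotProduct]; exact hL.sub hkg
  have hds : ∀ a, StronglyMeasurable[m] fun ω => (h ω - k ω) a := fun a => (hs a).sub (hk a)
  have hUL : MemLp U 2 μ := (hE.sub hW2).add hdL
  -- the residual `C` is conditionally orthogonal to the constants and to the gains
  have c1 : μ[C | m] =ᵐ[μ] 0 := by
    have e1 := condExp_sub (hY.integrable one_le_two |>.sub (hE.integrable one_le_two))
      (hL.integrable one_le_two) m
    have e2 := condExp_sub (hY.integrable one_le_two) (hE.integrable one_le_two) m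
    have e3 := condExp_dotProduct_eq_zero hm hg hg0 hs hL
    have e4 : μ[μ[Y | m] | m] = μ[Y | m] :=
      condExp_of_stronglyMeasurable hm stronglyMeasurable_condExp (hE.integrable one_le_two)
    filter_upwards [e1, e2, e3] with ω w1 w2 w3
    rw [show C = (Y - μ[Y | m]) - fun ω => h ω ⬝ᵥ g ω from rfl, w1, Pi.sub_apply, w2, w3,
      Pi.sub_apply, e4]
    simp
  have c2 : ∀ a, μ[fun ω => g ω a * C ω | m] =ᵐ[μ] 0 := by
    intro a
    have i1 : Integrable (fun ω => g ω a * Y ω) μ := (hg a).integrable_mul hY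
    have i2 : Integrable (fun ω => g ω a * (μ[Y | m]) ω) μ := (hg a).integrable_mul hE
    have i3 : Integrable (fun ω => (h ω ⬝ᵥ g ω) * g ω a) μ := hL.integrable_mul (hg a)
    have e1 := condExp_sub (i1.sub i2) i3 m
    have e2 := condExp_sub i1 i2 m
    have e3 := condExp_dotProduct_mul hm hg hs hL (hg a)
    have e4 : μ[fun ω => g ω a * (μ[Y | m]) ω | m] =ᵐ[μ] fun ω => (μ[fun ω => g ω a | m]) ω
        * (μ[Y | m]) ω :=
      condExp_mul_of_stronglyMeasurable_right stronglyMeasurable_condExp i2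
        ((hg a).integrable one_le_two)
    have e5 : (fun ω => g ω a * C ω) = ((fun ω => g ω a * Y ω) - fun ω => g ω a * (μ[Y | m]) ω)
        - fun ω => (h ω ⬝ᵥ g ω) * g ω a := by
      funext ω
      simp only [hC, Pi.sub_apply]
      ring
    filter_upwards [e1, e2, e3, e4, hg0 a, mulVec_projCoef hPD Y] with ω w1 w2 w3 w4 w5 w6
    rw [e5, w1, Pi.sub_apply, w2, Pi.sub_apply, w3, w4, w5]
    have := congrFun w6 a
    simp only [Matrix.mulVec, dotProduct, Matrix.of_apply] at this
    rw [← this]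
    simp only [dotProduct, hh, Pi.zero_apply, zero_mul, sub_zero]
    rw [sub_eq_zero]
    refine Finset.sum_congr rfl fun b _ => ?_
    rw [mul_comm]
    simp_rw [mul_comm (g _ a)]
  -- hence also to the difference `U` of the fitted value and any other predictor
  have cross : μ[fun ω => C ω * U ω | m] =ᵐ[μ] 0 := by
    have i1 : Integrable (fun ω => C ω * ((μ[Y | m]) ω - W ω)) μ := hCL.integrable_mul (hE.sub hW2)
    have i2 : Integrable (fun ω => ((h ω - k ω) ⬝ᵥ g ω) * C ω) μ := hdL.integrable_mul hCL
    have e1 := condExp_add i1 i2 m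
    have e2 : μ[fun ω => C ω * ((μ[Y | m]) ω - W ω) | m] =ᵐ[μ]
        fun ω => (μ[C | m]) ω * ((μ[Y | m]) ω - W ω) :=
      condExp_mul_of_stronglyMeasurable_right (stronglyMeasurable_condExp.sub hW) i1
        (hCL.integrable one_le_two)
    have e3 := condExp_dotProduct_mul hm hg hds hdL hCL
    have e5 : (fun ω => C ω * U ω) = (fun ω => C ω * ((μ[Y | m]) ω - W ω))
        + fun ω => ((h ω - k ω) ⬝ᵥ g ω) * C ω := by
      funext ω
      simp only [hU, Pi.add_apply]
      ring
    filter_upwards [e1, e2, e3, c1, ae_all_iff.2 c2] with ω w1 w2 w3 w4 w5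
    rw [e5, w1, Pi.add_apply, w2, w3, w4]
    simp [dotProduct, w5]
  have hD : (fun ω => (Y ω - W ω - k ω ⬝ᵥ g ω) ^ 2)
      = (fun ω => C ω ^ 2) + (fun ω => U ω ^ 2) + (2 : ℝ) • fun ω => C ω * U ω := by
    funext ω
    simp only [hC, hU, Pi.add_apply, Pi.smul_apply, smul_eq_mul, sub_dotProduct]
    ring
  have iCU : Integrable (fun ω => C ω * U ω) μ := hCL.integrable_mul hUL
  rw [hD]
  have e1 := condExp_add (hCL.integrable_sq.add hUL.integrable_sq) (iCU.smul (2 : ℝ)) m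
  have e2 := condExp_add hCL.integrable_sq hUL.integrable_sq m
  have e3 := condExp_smul (μ := μ) (2 : ℝ) (fun ω => C ω * U ω) m
  filter_upwards [e1, e2, e3, cross] with ω w1 w2 w3 w4
  rw [w1, Pi.add_apply, w2, w3, Pi.smul_apply, w4]
  simp only [Pi.add_apply, Pi.zero_apply, smul_zero, add_zero]
  rfl

theorem condExp_sq_residual_le {Y : Ω → ℝ} (hY : MemLp Y 2 μ) {W : Ω → ℝ}
    (hW : StronglyMeasurable[m] W) (hW2 : MemLp W 2 μ) {k : Ω → κ → ℝ}
    (hk : ∀ a, StronglyMeasurable[m] fun ω => k ω a) (hkg : MemLp (fun ω => k ω ⬝ᵥ g ω) 2 μ) :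
    μ[fun ω => (Y ω - (μ[Y | m]) ω - projCoef μ m g Y ω ⬝ᵥ g ω) ^ 2 | m] ≤ᵐ[μ]
      μ[fun ω => (Y ω - W ω - k ω ⬝ᵥ g ω) ^ 2 | m] := by
  have h2 : 0 ≤ᵐ[μ] μ[fun ω => ((μ[Y | m]) ω - W ω
      + (projCoef μ m g Y ω - k ω) ⬝ᵥ g ω) ^ 2 | m] :=
    condExp_nonneg (.of_forall fun ω => sq_nonneg _)
  filter_upwards [condExp_sq_residual hm hg hPD hg0 hY hW hW2 hk hkg, h2] with ω w1 w2
  rw [w1, Pi.add_apply]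
  exact le_add_of_nonneg_right w2

/-- The conditional regression is the only minimizer of the conditional mean squared error. -/
theorem eq_projCoef_of_condExp_sq_le {Y : Ω → ℝ} (hY : MemLp Y 2 μ) {W : Ω → ℝ}
    (hW : StronglyMeasurable[m] W) (hW2 : MemLp W 2 μ) {k : Ω → κ → ℝ}
    (hk : ∀ a, StronglyMeasurable[m] fun ω => k ω a) (hkg : MemLp (fun ω => k ω ⬝ᵥ g ω) 2 μ)
    (hle : μ[fun ω => (Y ω - W ω - k ω ⬝ᵥ g ω) ^ 2 | m] ≤ᵐ[μ]
      μ[fun ω => (Y ω - (μ[Y | m]) ω - projCoef μ m g Y ω ⬝ᵥ g ω) ^ 2 | m]) :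
    W =ᵐ[μ] μ[Y | m] ∧ k =ᵐ[μ] projCoef μ m g Y := by
  have hE : MemLp (μ[Y | m]) 2 μ := hY.condExp one_le_two
  have hL : MemLp (fun ω => projCoef μ m g Y ω ⬝ᵥ g ω) 2 μ :=
    memLp_projCoef_dotProduct hm hg hPD hY
  have hdL : MemLp (fun ω => (projCoef μ m g Y ω - k ω) ⬝ᵥ g ω) 2 μ := by
    simp_rw [sub_dotProduct]; exact hL.sub hkg
  have hds : ∀ a, StronglyMeasurable[m] fun ω => (projCoef μ m g Y ω - k ω) a := fun a =>
    (stronglyMeasurable_projCoef g Y a).sub (hk a)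
  have hdW : MemLp (fun ω => (μ[Y | m]) ω - W ω) 2 μ := hE.sub hW2
  have hUL : MemLp (fun ω => (μ[Y | m]) ω - W ω + (projCoef μ m g Y ω - k ω) ⬝ᵥ g ω) 2 μ :=
    hdW.add hdL
  -- equality in the Pythagorean identity: the difference of the two predictors vanishes
  have hU0 : (fun ω => ((μ[Y | m]) ω - W ω + (projCoef μ m g Y ω - k ω) ⬝ᵥ g ω) ^ 2)
      =ᵐ[μ] 0 := by
    rw [← integral_eq_zero_iff_of_nonneg (fun ω => sq_nonneg _) hUL.integrable_sq]
    refine le_antisymm ?_ (integral_nonneg fun ω => sq_nonneg _)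
    rw [← integral_condExp hm]
    refine integral_nonpos_of_ae ?_
    filter_upwards [condExp_sq_residual hm hg hPD hg0 hY hW hW2 hk hkg, hle] with ω w1 w2
    rw [w1, Pi.add_apply] at w2
    simpa using w2
  have hU : (fun ω => (μ[Y | m]) ω - W ω + (projCoef μ m g Y ω - k ω) ⬝ᵥ g ω) =ᵐ[μ] 0 := by
    filter_upwards [hU0] with ω w
    exact pow_eq_zero_iff two_ne_zero |>.1 w
  have hW' : W =ᵐ[μ] μ[Y | m] := by
    have e1 := condExp_congr_ae (m := m) hU
    have e2 := condExp_add (hdW.integrable one_le_two) (hdL.integrable one_le_two) m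
    have e3 := condExp_dotProduct_eq_zero hm hg hg0 hds hdL
    have e4 : μ[fun ω => (μ[Y | m]) ω - W ω | m] = fun ω => (μ[Y | m]) ω - W ω :=
      condExp_of_stronglyMeasurable hm (stronglyMeasurable_condExp.sub hW)
        (hdW.integrable one_le_two)
    rw [condExp_zero] at e1
    filter_upwards [e1, e2, e3] with ω w1 w2 w3
    have w2' := w2
    rw [show ((fun ω => (μ[Y | m]) ω - W ω) + fun ω => (projCoef μ m g Y ω - k ω) ⬝ᵥ g ω)
      = fun ω => (μ[Y | m]) ω - W ω + (projCoef μ m g Y ω - k ω) ⬝ᵥ g ω from rfl, w1,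
      Pi.add_apply, w3, e4] at w2'
    simp only [Pi.zero_apply, add_zero] at w2'
    linarith
  refine ⟨hW', ?_⟩
  have hd0 : (fun ω => ((projCoef μ m g Y ω - k ω) ⬝ᵥ g ω) ^ 2) =ᵐ[μ] 0 := by
    filter_upwards [hU, hW'] with ω w1 w2
    simp only [w2, sub_self, zero_add, Pi.zero_apply] at w1
    simp [w1]
  have e1 := condExp_congr_ae (m := m) hd0
  have e2 := condExp_dotProduct_sq hm hg hds hdL
  rw [condExp_zero] at e1
  filter_upwards [e1, e2, hPD] with ω w1 w2 w3
  rw [w1] at w2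
  -- positive definiteness of the conditional second moments separates the coefficients
  by_contra hne
  have := w3.dotProduct_mulVec_pos (x := projCoef μ m g Y ω - k ω)
    (sub_ne_zero.2 fun h => hne h.symm)
  simp only [star_trivial] at this
  rw [← w2] at this
  exact lt_irrefl _ this

end Projection
end GordonHedge

namespace GordonHedge

/-! ### The system under the risk-neutral measure -/

namespace Spec

variable {n lk ly N T : ℕ} [NeZero T] {𝓩 : Type*} [MeasurableSpace 𝓩] (S : Spec n lk ly N T 𝓩)

theorem dateIdx_succ (i : Fin T) : dateIdx T (i.val + 1) = i := by
  simp [dateIdx]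

theorem dateIdx_val {t : ℕ} (h0 : 1 ≤ t) (hT : t ≤ T) : (dateIdx T t).val = t - 1 := by
  simp only [dateIdx, Fin.val_ofNat]
  exact Nat.mod_eq_of_lt (by omega)

/-- The shift of the noise that turns the real-world system into the risk-neutral one; it is
`𝖦_t⁻¹ θ_t`. -/
noncomputable def noiseShift (z : 𝓩) (c : CoefPath n lk ly T) (t : ℕ) (x : XIdx n → ℝ) :
    XIdx n → ℝ :=
  Sum.elim (fun i => x (rIdx n) - (Ck c t *ᵥ S.psiK t z) i - Suu c t i i / 2)
    ((Setau c t * (Suu c t)⁻¹) *ᵥ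
      fun i => x (rIdx n) - (Ck c t *ᵥ S.psiK t z) i - Suu c t i i / 2)

/-- One step of the risk-neutral system: the solution `x'` of
`Q_{0,t} x' = ν̃_t + Q_{1,t} x + 𝖦_t ζ`. -/
noncomputable def rnStep (z : 𝓩) (c : CoefPath n lk ly T) (t : ℕ) (x ζ : XIdx n → ℝ) :
    XIdx n → ℝ :=
  (S.Q0 z t)⁻¹ *ᵥ (S.nuTilde z c t + S.Q1 z c t *ᵥ x + S.GG z t *ᵥ ζ)

/-- The path that follows `x` up to time `t` and the risk-neutral system with noise `ζ` after
`t`. -/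
noncomputable def rnPath (z : 𝓩) (c : CoefPath n lk ly T) (t : ℕ) (x : ℕ → XIdx n → ℝ)
    (ζ : Fin T → XIdx n → ℝ) : ℕ → XIdx n → ℝ
  | 0 => x 0
  | k + 1 => if k + 1 ≤ t then x (k + 1)
      else S.rnStep z c (k + 1) (rnPath z c t x ζ k) (ζ (dateIdx T (k + 1)))

theorem g_pos (z : 𝓩) (t : ℕ) (i : Fin n) : 0 < S.g z t i := by
  unfold g; positivity

theorem det_Q0 (z : 𝓩) (t : ℕ) : (S.Q0 z t).det = 1 := by
  simp [Q0]

theorem det_G_ne_zero (z : 𝓩) (t : ℕ) : (S.G z t).det ≠ 0 := by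
  rw [G, Matrix.det_diagonal]
  exact Finset.prod_ne_zero_iff.2 fun i _ => (S.g_pos z t i).ne'

theorem det_GG_ne_zero (z : 𝓩) (t : ℕ) : (S.GG z t).det ≠ 0 := by
  simp [GG, S.det_G_ne_zero]

theorem GG_mulVec_noiseShift (z : 𝓩) (c : CoefPath n lk ly T) (t : ℕ) (x : XIdx n → ℝ) :
    S.GG z t *ᵥ S.noiseShift z c t x = S.girsanovKernel z c t (x (rIdx n)) := by
  rw [GG, Matrix.fromBlocks_mulVec, girsanovKernel, Matrix.fromRows_mulVec, noiseShift]
  simp only [Sum.elim_comp_inl, Sum.elim_comp_inr, Matrix.zero_mulVec, add_zero, zero_add,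
    Matrix.one_mulVec]

theorem Q0_mulVec_rnStep (z : 𝓩) (c : CoefPath n lk ly T) (t : ℕ) (x ζ : XIdx n → ℝ) :
    S.Q0 z t *ᵥ S.rnStep z c t x ζ = S.nuTilde z c t + S.Q1 z c t *ᵥ x + S.GG z t *ᵥ ζ := by
  rw [rnStep, Matrix.mulVec_mulVec, Matrix.mul_nonsing_inv _ (by rw [det_Q0]; exact isUnit_one),
    Matrix.one_mulVec]

theorem eq_rnStep_iff (z : 𝓩) (c : CoefPath n lk ly T) (t : ℕ) (x ζ x' : XIdx n → ℝ) :
    x' = S.rnStep z c t x ζ ↔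
      S.Q0 z t *ᵥ x' = S.nuTilde z c t + S.Q1 z c t *ᵥ x + S.GG z t *ᵥ ζ := by
  constructor
  · rintro rfl; exact S.Q0_mulVec_rnStep z c t x ζ
  · intro h
    rw [rnStep, ← h, Matrix.mulVec_mulVec,
      Matrix.nonsing_inv_mul _ (by rw [det_Q0]; exact isUnit_one), Matrix.one_mulVec]

theorem jr_dotProduct (y : YIdx n → ℝ) : jr n ⬝ᵥ y = y (Sum.inr ()) := by
  simp [jr, dotProduct, Fintype.sum_sum_type]

/-- The matrix `i_n j_r'`. -/
noncomputable def onesJr (n : ℕ) : Matrix (Fin n) (YIdx n) ℝ := Matrix.vecMulVec (fun _ => 1) (jr n)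

theorem onesJr_mulVec (y : YIdx n → ℝ) : onesJr n *ᵥ y = fun _ => y (Sum.inr ()) := by
  funext i
  simp only [onesJr, Matrix.mulVec, Matrix.vecMulVec_apply, one_mul, dotProduct]
  exact jr_dotProduct y

theorem H_mulVec (z : 𝓩) (t : ℕ) (y : YIdx n → ℝ) :
    S.H z t *ᵥ y = (S.G z t - 1) *ᵥ (y ∘ Sum.inl) := by
  rw [H, Matrix.fromCols_mulVec]
  simp

theorem E_mulVec (c : CoefPath n lk ly T) (t : ℕ) (y : YIdx n → ℝ) :
    E c t *ᵥ y = y + (Setau c t * (Suu c t)⁻¹) *ᵥ fun _ => y (Sum.inr ()) := by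
  have h : E c t = 1 + Setau c t * (Suu c t)⁻¹ * onesJr n := rfl
  rw [h, Matrix.add_mulVec, Matrix.one_mulVec, ← Matrix.mulVec_mulVec (v := y), onesJr_mulVec]

theorem Q1_mulVec (z : 𝓩) (c : CoefPath n lk ly T) (t : ℕ) (x : XIdx n → ℝ) :
    S.Q1 z c t *ᵥ x = Sum.elim
      (S.G z t *ᵥ (x ∘ Sum.inl) + S.G z t *ᵥ fun _ => x (rIdx n)) (E c t *ᵥ (x ∘ Sum.inr)) := by
  have h : S.Q1 z c t = Matrix.fromBlocks (S.G z t) (S.G z t * onesJr n) 0 (E c t) := rfl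
  rw [h, Matrix.fromBlocks_mulVec, ← Matrix.mulVec_mulVec (v := x ∘ Sum.inr), onesJr_mulVec]
  simp only [Matrix.zero_mulVec, zero_add]
  rfl

/-- The shifted noise drives the real-world system along the risk-neutral one. -/
theorem step_add_noiseShift (z : 𝓩) (c : CoefPath n lk ly T) (t : ℕ) (x ζ : XIdx n → ℝ) :
    S.step z c t x (ζ + S.noiseShift z c t x) = S.rnStep z c t x ζ := by
  rw [eq_rnStep_iff]
  rw [Q0, GG, Matrix.fromBlocks_mulVec, Matrix.fromBlocks_mulVec, Q1_mulVec]
  simp only [step, Sum.elim_comp_inl, Sum.elim_comp_inr, Matrix.one_mulVec, Matrix.zero_mulVec,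
    zero_add, add_zero, H_mulVec, E_mulVec, ← Matrix.mulVec_mulVec]
  funext a
  rcases a with i | j
  · simp only [Sum.elim_inl, Pi.add_apply, Pi.sub_apply, nuTilde, noiseShift, G,
      Matrix.mulVec_diagonal, Function.comp_apply, rIdx]
    ring
  · have e : (fun i => x (rIdx n) - (Ck c t *ᵥ S.psiK t z) i - Suu c t i i / 2)
        = (fun _ => (x ∘ Sum.inr) (Sum.inr ()))
          - (Ck c t *ᵥ S.psiK t z + fun i => Suu c t i i / 2) := by
      funext i
      simp only [Pi.sub_apply, Pi.add_apply, Function.comp_apply, rIdx]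
      ring
    simp only [Sum.elim_inr, Pi.add_apply, nuTilde, noiseShift, Function.comp_apply, e]
    simp only [Matrix.mulVec_sub, ← Matrix.mulVec_mulVec, Pi.sub_apply]
    ring

/-! ### Measurability of the coefficients of the system -/

section Measurability

variable {α : Type*} [MeasurableSpace α] {z : α → 𝓩} {c : α → CoefPath n lk ly T}

theorem measurable_coef_apply (hc : Measurable c) (t : ℕ) :
    (EntryMeasurable fun a => Ck (c a) t) ∧ (EntryMeasurable fun a => Cy (c a) t) ∧
      EntryMeasurable fun a => Sig (c a) t := by
  have h := (measurable_pi_apply (dateIdx T t)).comp hc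
  refine ⟨fun i j => ?_, fun i j => ?_, fun i j => ?_⟩
  · exact (measurable_pi_apply j).comp ((measurable_pi_apply i).comp h.fst)
  · exact (measurable_pi_apply j).comp ((measurable_pi_apply i).comp h.snd.fst)
  · exact (measurable_pi_apply j).comp ((measurable_pi_apply i).comp h.snd.snd)

theorem entryMeasurable_Suu (hc : Measurable c) (t : ℕ) :
    EntryMeasurable fun a => Suu (c a) t := fun i j =>
  (measurable_coef_apply hc t).2.2 (Sum.inl i) (Sum.inl j)

theorem entryMeasurable_Setau_mul (hc : Measurable c) (t : ℕ) :
    EntryMeasurable fun a => Setau (c a) t * (Suu (c a) t)⁻¹ :=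
  EntryMeasurable.mul (fun i j => (measurable_coef_apply hc t).2.2 (Sum.inr i) (Sum.inl j))
    (entryMeasurable_Suu hc t).inv

variable (hz : Measurable z)
include hz

theorem measurable_g (t : ℕ) (i : Fin n) : Measurable fun a => S.g (z a) t i := by
  have := (measurable_pi_apply i).comp ((S.meas_mu t).comp hz)
  exact measurable_const.add (Real.measurable_exp.comp this)

theorem entryMeasurable_G (t : ℕ) : EntryMeasurable fun a => S.G (z a) t := by
  intro i j
  simp only [G, Matrix.diagonal_apply]
  split_ifs
  · exact S.measurable_g hz t i
  · exact measurable_const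

theorem measurable_hlin (t : ℕ) : Measurable fun a => S.hlin (z a) t := by
  refine measurable_pi_lambda _ fun i => ?_
  have := (measurable_pi_apply i).comp ((S.meas_mu t).comp hz)
  have h2 := S.measurable_g hz t i
  exact (h2.mul ((Real.measurable_log.comp h2).sub this)).add this

theorem entryMeasurable_GG (t : ℕ) : EntryMeasurable fun a => S.GG (z a) t := by
  rintro (i | i) (j | j)
  · exact S.entryMeasurable_G hz t i j
  all_goals exact measurable_const

theorem entryMeasurable_Q0 (t : ℕ) : EntryMeasurable fun a => S.Q0 (z a) t := by
  rintro (i | i) (j | j)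
  · exact measurable_const
  · rcases j with j | j
    · exact (S.entryMeasurable_G hz t i j).sub measurable_const
    · exact measurable_const
  all_goals exact measurable_const

theorem measurable_Ck_psi (hc : Measurable c) (t : ℕ) :
    Measurable fun a => Ck (c a) t *ᵥ S.psiK t (z a) :=
  (measurable_coef_apply hc t).1.mulVec ((S.meas_psiK t).comp hz)

theorem entryMeasurable_Q1 (hc : Measurable c) (t : ℕ) :
    EntryMeasurable fun a => S.Q1 (z a) (c a) t := by
  rintro (i | i) (j | j)
  · exact S.entryMeasurable_G hz t i j
  · exact EntryMeasurable.mul (g := fun _ => onesJr n) (S.entryMeasurable_G hz t)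
      (fun _ _ => measurable_const) i j
  · exact measurable_const
  · exact measurable_const.add
      (EntryMeasurable.mul (g := fun _ => onesJr n) (entryMeasurable_Setau_mul hc t)
        (fun _ _ => measurable_const) i j)

theorem measurable_nuTilde (hc : Measurable c) (t : ℕ) :
    Measurable fun a => S.nuTilde (z a) (c a) t := by
  have hs : ∀ i, Measurable fun a => Suu (c a) t i i := fun i => entryMeasurable_Suu hc t i i
  have hC := S.measurable_Ck_psi hz hc t
  have h1 : Measurable fun a => Cy (c a) t *ᵥ S.psiY t (z a) :=
    (measurable_coef_apply hc t).2.1.mulVec ((S.meas_psiY t).comp hz)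
  have h2 : Measurable fun a => (Setau (c a) t * (Suu (c a) t)⁻¹) *ᵥ
      (Ck (c a) t *ᵥ S.psiK t (z a) + fun i => Suu (c a) t i i / 2) :=
    (entryMeasurable_Setau_mul hc t).mulVec
      (hC.add (measurable_pi_lambda _ fun i => (hs i).div_const 2))
  refine measurable_pi_lambda _ ?_
  rintro (i | i)
  · have := (measurable_pi_apply i).comp (S.measurable_hlin hz t)
    exact (((S.measurable_g hz t i).mul (hs i)).neg.div_const 2).sub this
  · exact (measurable_pi_apply i).comp (h1.sub h2)

theorem measurable_rnStep (hc : Measurable c) (t : ℕ) {x ζ : α → XIdx n → ℝ} (hx : Measurable x)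
    (hζ : Measurable ζ) : Measurable fun a => S.rnStep (z a) (c a) t (x a) (ζ a) :=
  (S.entryMeasurable_Q0 hz t).inv.mulVec (((S.measurable_nuTilde hz hc t).add
    ((S.entryMeasurable_Q1 hz hc t).mulVec hx)).add ((S.entryMeasurable_GG hz t).mulVec hζ))

theorem measurable_noiseShift (hc : Measurable c) (t : ℕ) {x : α → XIdx n → ℝ}
    (hx : Measurable x) : Measurable fun a => S.noiseShift (z a) (c a) t (x a) := by
  have hs : ∀ i, Measurable fun a => Suu (c a) t i i := fun i => entryMeasurable_Suu hc t i i
  have h : Measurable fun a => fun i : Fin n =>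
      x a (rIdx n) - (Ck (c a) t *ᵥ S.psiK t (z a)) i - Suu (c a) t i i / 2 :=
    measurable_pi_lambda _ fun i => (((measurable_pi_apply _).comp hx).sub
      ((measurable_pi_apply i).comp (S.measurable_Ck_psi hz hc t))).sub ((hs i).div_const 2)
  refine measurable_pi_lambda _ ?_
  rintro (i | i)
  · exact (measurable_pi_apply i).comp h
  · exact (measurable_pi_apply i).comp ((entryMeasurable_Setau_mul hc t).mulVec h)

theorem measurable_step (hc : Measurable c) (t : ℕ) {x ξ : α → XIdx n → ℝ} (hx : Measurable x)
    (hξ : Measurable ξ) : Measurable fun a => S.step (z a) (c a) t (x a) (ξ a) := by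
  have h : (fun a => S.step (z a) (c a) t (x a) (ξ a))
      = fun a => S.rnStep (z a) (c a) t (x a) (ξ a - S.noiseShift (z a) (c a) t (x a)) := by
    funext a
    rw [← step_add_noiseShift, sub_add_cancel]
  rw [h]
  exact S.measurable_rnStep hz hc t hx (hξ.sub (S.measurable_noiseShift hz hc t hx))

theorem measurable_state (hc : Measurable c) {ξ : α → Fin T → XIdx n → ℝ} (hξ : Measurable ξ)
    (k : ℕ) : Measurable fun a => S.state (z a) (c a) (ξ a) k := by
  induction k with
  | zero => exact S.meas_x0.comp hz
  | succ k ih => exact S.measurable_step hz hc (k + 1) ih ((measurable_pi_apply _).comp hξ)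

theorem measurable_rnPath (hc : Measurable c) (t : ℕ) {x : α → ℕ → XIdx n → ℝ}
    (hx : Measurable x) {ζ : α → Fin T → XIdx n → ℝ} (hζ : Measurable ζ) (k : ℕ) :
    Measurable fun a => S.rnPath (z a) (c a) t (x a) (ζ a) k := by
  induction k with
  | zero => exact (measurable_pi_apply 0).comp hx
  | succ k ih =>
    simp only [rnPath]
    split_ifs
    · exact (measurable_pi_apply _).comp hx
    · exact S.measurable_rnStep hz hc (k + 1) ih ((measurable_pi_apply _).comp hζ)

end Measurability

end Spec
end GordonHedge

namespace GordonHedge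

/-! ### Girsanov theorem for given coefficients -/

namespace Spec

variable {n lk ly N T : ℕ} [NeZero T] {𝓩 : Type*} [MeasurableSpace 𝓩] (S : Spec n lk ly N T 𝓩)

/-- The covariance matrices of the coefficient path, indexed by position. -/
def sigFam (c : CoefPath n lk ly T) : Fin T → Matrix (XIdx n) (XIdx n) ℝ :=
  fun i => Matrix.of (c i).2.2

/-- The law of the risk-neutral noise path given the coefficients. -/
noncomputable def noiseLaw (c : CoefPath n lk ly T) : Measure (Fin T → XIdx n → ℝ) :=
  gaussPath (sigFam c)

/-- The sequence with initial value `x₀` and later values `η`. -/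
def pathOf (x₀ : XIdx n → ℝ) (η : Fin T → XIdx n → ℝ) : ℕ → XIdx n → ℝ
  | 0 => x₀
  | k + 1 => η (dateIdx T (k + 1))

/-- The path `x_1, …, x_T` that follows `η` up to time `t` and the risk-neutral system with noise
`ζ` after `t`. -/
noncomputable def contPath (z : 𝓩) (c : CoefPath n lk ly T) (t : ℕ)
    (η ζ : Fin T → XIdx n → ℝ) : Fin T → XIdx n → ℝ :=
  fun i => S.rnPath z c t (pathOf (S.x0 z) η) ζ (i.val + 1)

theorem prod_Icc_eq_prod_fin {R : Type*} [CommMonoid R] (f : ℕ → R) :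
    ∏ m ∈ Finset.Icc 1 T, f m = ∏ i : Fin T, f (i.val + 1) := by
  rw [Fin.prod_univ_eq_prod_range (fun i => f (i + 1)) T, Finset.range_eq_Ico,
    Finset.prod_Ico_add' f 0 T 1]
  rfl

theorem state_congr (z : 𝓩) (c : CoefPath n lk ly T) {k : ℕ} (hk : k ≤ T)
    {ξ ξ' : Fin T → XIdx n → ℝ} (h : ∀ j : Fin T, j.val < k → ξ j = ξ' j) :
    S.state z c ξ k = S.state z c ξ' k := by
  induction k with
  | zero => rfl
  | succ k ih =>
    simp only [state]
    rw [ih (by omega) fun j hj => h j (by omega), h (dateIdx T (k + 1))]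
    rw [dateIdx_val (by omega) hk]; omega

theorem pathOf_congr (x₀ : XIdx n → ℝ) {k : ℕ} (hk : k ≤ T) {η η' : Fin T → XIdx n → ℝ}
    (h : ∀ j : Fin T, j.val < k → η j = η' j) : pathOf x₀ η k = pathOf x₀ η' k := by
  cases k with
  | zero => rfl
  | succ k =>
    simp only [pathOf]
    refine h _ ?_
    rw [dateIdx_val (by omega) hk]; omega

theorem rnPath_congr (z : 𝓩) (c : CoefPath n lk ly T) (t : ℕ) {x x' : ℕ → XIdx n → ℝ}
    (h : ∀ k ≤ t, x k = x' k) (ζ : Fin T → XIdx n → ℝ) (k : ℕ) :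
    S.rnPath z c t x ζ k = S.rnPath z c t x' ζ k := by
  induction k with
  | zero => exact h 0 (Nat.zero_le _)
  | succ k ih =>
    simp only [rnPath, ih]
    split_ifs with hk
    · exact h _ hk
    · rfl

theorem rnPath_of_le (z : 𝓩) (c : CoefPath n lk ly T) {t : ℕ} (x : ℕ → XIdx n → ℝ)
    (ζ : Fin T → XIdx n → ℝ) {k : ℕ} (hk : k ≤ t) : S.rnPath z c t x ζ k = x k := by
  cases k with
  | zero => rfl
  | succ k => simp [rnPath, hk]

theorem contPath_congr (z : 𝓩) (c : CoefPath n lk ly T) {t : ℕ} (ht : t ≤ T)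
    {η η' : Fin T → XIdx n → ℝ} (h : ∀ j : Fin T, j.val < t → η j = η' j)
    (ζ : Fin T → XIdx n → ℝ) : S.contPath z c t η ζ = S.contPath z c t η' ζ := by
  funext i
  exact S.rnPath_congr z c t (fun k hk => pathOf_congr _ (hk.trans ht)
    fun j hj => h j (by omega)) ζ _

theorem pathOf_contPath (z : 𝓩) (c : CoefPath n lk ly T) (t : ℕ) (η ζ : Fin T → XIdx n → ℝ)
    {k : ℕ} (hk : k ≤ T) :
    pathOf (S.x0 z) (S.contPath z c t η ζ) k = S.rnPath z c t (pathOf (S.x0 z) η) ζ k := by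
  cases k with
  | zero => rfl
  | succ k =>
    simp only [pathOf, contPath]
    rw [dateIdx_val (by omega) hk, Nat.add_sub_cancel]

theorem contPath_apply_of_lt (z : 𝓩) (c : CoefPath n lk ly T) {t : ℕ}
    (η ζ : Fin T → XIdx n → ℝ) {j : Fin T} (hj : j.val < t) : S.contPath z c t η ζ j = η j := by
  rw [contPath, S.rnPath_of_le z c _ _ (by omega : j.val + 1 ≤ t)]
  simp [pathOf, dateIdx_succ]

theorem contPath_mergePath (z : 𝓩) (c : CoefPath n lk ly T) {t : ℕ} (ht : t ≤ T)
    (η ζ ζ' : Fin T → XIdx n → ℝ) :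
    S.contPath z c 0 η (mergePath (fun i => i.val < t) ζ ζ')
      = S.contPath z c t (S.contPath z c 0 η ζ) ζ' := by
  have key : ∀ k ≤ T, S.rnPath z c 0 (pathOf (S.x0 z) η) (mergePath (fun i => i.val < t) ζ ζ') k
      = S.rnPath z c t (pathOf (S.x0 z) (S.contPath z c 0 η ζ)) ζ' k := by
    have hle : ∀ k ≤ t, S.rnPath z c 0 (pathOf (S.x0 z) η)
        (mergePath (fun i => i.val < t) ζ ζ') k = S.rnPath z c 0 (pathOf (S.x0 z) η) ζ k := by
      intro k hk
      induction k with
      | zero => rfl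
      | succ k ih =>
        have : (dateIdx T (k + 1)).val < t := by
          rw [dateIdx_val (by omega) (hk.trans ht)]; omega
        simp [rnPath, ih (by omega), mergePath, this]
    intro k hk
    induction k with
    | zero => rfl
    | succ k ih =>
      by_cases hkt : k + 1 ≤ t
      · rw [hle _ hkt, S.rnPath_of_le z c _ _ hkt, pathOf_contPath _ _ _ _ _ _ hk]
      · have : ¬ (dateIdx T (k + 1)).val < t := by
          rw [dateIdx_val (by omega) hk]; omega
        simp only [rnPath, if_false, hkt, ih (by omega), mergePath, this]
        simp
  funext i
  exact key _ i.2

theorem measurable_pathOf {α : Type*} [MeasurableSpace α] {x₀ : α → XIdx n → ℝ}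
    {η : α → Fin T → XIdx n → ℝ} (hx : Measurable x₀) (hη : Measurable η) :
    Measurable fun a => pathOf (x₀ a) (η a) := by
  refine measurable_pi_lambda _ fun k => ?_
  cases k with
  | zero => exact hx
  | succ k => exact (measurable_pi_apply _).comp hη

theorem measurable_contPath {α : Type*} [MeasurableSpace α] {z : α → 𝓩}
    {c : α → CoefPath n lk ly T} (hz : Measurable z) (hc : Measurable c) (t : ℕ)
    {η ζ : α → Fin T → XIdx n → ℝ} (hη : Measurable η) (hζ : Measurable ζ) :
    Measurable fun a => S.contPath (z a) (c a) t (η a) (ζ a) :=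
  measurable_pi_lambda _ fun _ =>
    S.measurable_rnPath hz hc t (measurable_pathOf (S.meas_x0.comp hz) hη) hζ _

theorem measurable_prod_sigFam {α : Type*} [MeasurableSpace α]
    {c : α → CoefPath n lk ly T} (hc : Measurable c) {ζ : α → Fin T → XIdx n → ℝ}
    (hζ : Measurable ζ) :
    Measurable fun a => ∏ i, ENNReal.ofReal (normalDensity (sigFam (c a) i) (ζ a i)) := by
  refine Finset.measurable_prod _ fun i _ => Measurable.ennreal_ofReal ?_
  refine EntryMeasurable.normalDensity (fun k l => ?_) ((measurable_pi_apply i).comp hζ)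
  exact (measurable_pi_apply l).comp ((measurable_pi_apply k).comp
    ((measurable_pi_apply i).comp hc).snd.snd)

theorem lintegral_noiseLaw (c : CoefPath n lk ly T) {f : (Fin T → XIdx n → ℝ) → ℝ≥0∞}
    (hf : Measurable f) : ∫⁻ ζ, f ζ ∂(noiseLaw c)
      = ∫⁻ ζ, (∏ i, ENNReal.ofReal (normalDensity (sigFam c i) (ζ i))) * f ζ := by
  rw [noiseLaw, gaussPath, lintegral_withDensity_eq_lintegral_mul _
    (measurable_prod_normalDensity _) hf]
  rfl

theorem measurable_lintegral_noiseLaw {α : Type*} [MeasurableSpace α]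
    {c : α → CoefPath n lk ly T} (hc : Measurable c)
    {f : α × (Fin T → XIdx n → ℝ) → ℝ≥0∞} (hf : Measurable f) :
    Measurable fun a => ∫⁻ ζ, f (a, ζ) ∂(noiseLaw (c a)) := by
  have h : (fun a => ∫⁻ ζ, f (a, ζ) ∂(noiseLaw (c a))) = fun a =>
      ∫⁻ ζ, (∏ i, ENNReal.ofReal (normalDensity (sigFam (c a) i) (ζ i))) * f (a, ζ) :=
    funext fun a => lintegral_noiseLaw (c a) (hf.comp measurable_prodMk_left)
  rw [h]
  exact Measurable.lintegral_prod_right'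
    (((measurable_prod_sigFam (hc.comp measurable_fst) measurable_snd)).mul hf)

theorem measurableSet_posDef :
    MeasurableSet {c : CoefPath n lk ly T | ∀ i, (sigFam c i).PosDef} := by
  have hme : ∀ i k l, Measurable fun c : CoefPath n lk ly T => sigFam c i k l := by
    intro i k l
    exact (measurable_pi_apply l).comp ((measurable_pi_apply k).comp
      (measurable_pi_apply i).snd.snd)
  have e : {c : CoefPath n lk ly T | ∀ i, (sigFam c i).PosDef}
      = ⋂ i, ({c | (sigFam c i).PosSemidef} ∩ {c | (sigFam c i).det ≠ 0}) := by
    ext c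
    simp only [Set.mem_ofPred_eq, Set.mem_iInter, Set.mem_inter_iff]
    exact forall_congr' fun i => ⟨fun h => ⟨h.posSemidef, h.det_pos.ne'⟩,
      fun h => h.1.posDef_iff_det_ne_zero.2 h.2⟩
  rw [e]
  refine MeasurableSet.iInter fun i => MeasurableSet.inter ?_ ?_
  · have hcl : IsClosed {A : XIdx n → XIdx n → ℝ | (Matrix.of A).PosSemidef} := by
      have e2 : {A : XIdx n → XIdx n → ℝ | (Matrix.of A).PosSemidef}
          = (⋂ k, ⋂ l, {A | A k l = A l k})
            ∩ ⋂ x : XIdx n → ℝ, {A | 0 ≤ x ⬝ᵥ (Matrix.of A *ᵥ x)} := by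
        ext A
        simp only [Set.mem_ofPred_eq, Set.mem_inter_iff, Set.mem_iInter]
        rw [Matrix.posSemidef_iff_dotProduct_mulVec]
        refine and_congr ⟨fun h k l => ?_, fun h => ?_⟩ (by simp)
        · simpa using h.apply l k
        · exact Matrix.IsHermitian.ext fun k l => by simpa using h l k
      rw [e2]
      refine IsClosed.inter ?_ ?_
      · exact isClosed_iInter fun k => isClosed_iInter fun l =>
          isClosed_eq (by fun_prop) (by fun_prop)
      · refine isClosed_iInter fun x => isClosed_le continuous_const ?_
        simp only [Matrix.mulVec, dotProduct, Matrix.of_apply]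
        fun_prop
    exact ((measurable_pi_apply i).snd.snd :
      Measurable fun c : CoefPath n lk ly T => (c i).2.2) hcl.measurableSet
  · have hm : Measurable fun c : CoefPath n lk ly T => (sigFam c i).det :=
      EntryMeasurable.det fun k l => hme i k l
    exact hm (measurableSet_singleton 0).compl

/-- The density of the risk-neutral measure as a function of the noise path. -/
noncomputable def girsanovDensity (z : 𝓩) (c : CoefPath n lk ly T) (ξ : Fin T → XIdx n → ℝ) : ℝ :=
  ∏ t ∈ Finset.Icc 1 T,
    let θ := S.girsanovKernel z c t (S.state z c ξ (t - 1) (rIdx n))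
    let A := (S.GG z t * Sig c t * (S.GG z t)ᵀ)⁻¹
    Real.exp (θ ⬝ᵥ (A *ᵥ (S.GG z t *ᵥ ξ (dateIdx T t))) - θ ⬝ᵥ (A *ᵥ θ) / 2)

theorem measurable_girsanovDensity {α : Type*} [MeasurableSpace α] {z : α → 𝓩}
    {c : α → CoefPath n lk ly T} (hz : Measurable z) (hc : Measurable c)
    {ξ : α → Fin T → XIdx n → ℝ} (hξ : Measurable ξ) :
    Measurable fun a => S.girsanovDensity (z a) (c a) (ξ a) := by
  refine Finset.measurable_prod _ fun t _ => Real.measurable_exp.comp ?_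
  have hθ : Measurable fun a => S.girsanovKernel (z a) (c a) t
      (S.state (z a) (c a) (ξ a) (t - 1) (rIdx n)) := by
    simp_rw [← GG_mulVec_noiseShift]
    exact (S.entryMeasurable_GG hz t).mulVec
      (S.measurable_noiseShift hz hc t (S.measurable_state hz hc hξ _))
  have hA : EntryMeasurable fun a => (S.GG (z a) t * Sig (c a) t * (S.GG (z a) t)ᵀ)⁻¹ :=
    (((S.entryMeasurable_GG hz t).mul (measurable_coef_apply hc t).2.2).mul
      (S.entryMeasurable_GG hz t).transpose).inv
  exact (measurable_dotProduct hθ (hA.mulVec ((S.entryMeasurable_GG hz t).mulVec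
    ((measurable_pi_apply _).comp hξ)))).sub
    ((measurable_dotProduct hθ (hA.mulVec hθ)).div_const 2)

/-- One factor of the risk-neutral density shifts the Gaussian density of the noise. -/
theorem normalDensity_mul_girsanov {z : 𝓩} {c : CoefPath n lk ly T} {t : ℕ}
    (hS : (Sig c t).PosDef) (x v : XIdx n → ℝ) :
    normalDensity (Sig c t) v * (let θ := S.girsanovKernel z c t (x (rIdx n))
      let A := (S.GG z t * Sig c t * (S.GG z t)ᵀ)⁻¹
      Real.exp (θ ⬝ᵥ (A *ᵥ (S.GG z t *ᵥ v)) - θ ⬝ᵥ (A *ᵥ θ) / 2))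
      = normalDensity (Sig c t) (v - S.noiseShift z c t x) := by
  set s := S.noiseShift z c t x with hs
  have hu : IsUnit (Sig c t).det := isUnit_iff_ne_zero.2 hS.det_pos.ne'
  have hGu : IsUnit (S.GG z t).det := isUnit_iff_ne_zero.2 (S.det_GG_ne_zero z t)
  have hT : ((Sig c t)⁻¹)ᵀ = (Sig c t)⁻¹ := by
    rw [Matrix.transpose_nonsing_inv]
    congr 1
    simpa using hS.isHermitian.eq
  have hw : Sig c t *ᵥ ((Sig c t)⁻¹ *ᵥ s) = s := by
    rw [Matrix.mulVec_mulVec, Matrix.mul_nonsing_inv _ hu, Matrix.one_mulVec]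
  have hk : ∀ y, (S.GG z t *ᵥ s) ⬝ᵥ ((S.GG z t * Sig c t * (S.GG z t)ᵀ)⁻¹ *ᵥ (S.GG z t *ᵥ y))
      = ((Sig c t)⁻¹ *ᵥ s) ⬝ᵥ y := by
    intro y
    rw [Matrix.mul_inv_rev, Matrix.mul_inv_rev, Matrix.mulVec_mulVec, Matrix.mul_assoc,
      Matrix.mul_assoc, Matrix.nonsing_inv_mul _ hGu, Matrix.mul_one, ← Matrix.mulVec_mulVec,
      Matrix.dotProduct_mulVec, ← Matrix.mulVec_transpose, Matrix.mulVec_mulVec,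
      Matrix.transpose_nonsing_inv, Matrix.transpose_transpose, Matrix.nonsing_inv_mul _ hGu,
      Matrix.one_mulVec, Matrix.dotProduct_mulVec, ← Matrix.mulVec_transpose, hT]
  rw [← S.GG_mulVec_noiseShift, ← hs]
  simp only [hk]
  have h := normalDensity_sub_mulVec hS ((Sig c t)⁻¹ *ᵥ s) v
  rw [hw] at h
  rw [h]

/-- Girsanov's theorem for given initial information and coefficients. -/
theorem lintegral_girsanov {z : 𝓩} {c : CoefPath n lk ly T} (hc : ∀ i, (sigFam c i).PosDef)
    {F : (Fin T → XIdx n → ℝ) → ℝ≥0∞} (hF : Measurable F) (η₀ : Fin T → XIdx n → ℝ) :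
    ∫⁻ ξ : Fin T → XIdx n → ℝ,
        ENNReal.ofReal (∏ m ∈ Finset.Icc 1 T, normalDensity (Sig c m) (ξ (dateIdx T m)))
          * (ENNReal.ofReal (S.girsanovDensity z c ξ) * F fun i => S.state z c ξ (i.val + 1))
      = ∫⁻ ζ, F (S.contPath z c 0 η₀ ζ) ∂(noiseLaw c) := by
  have hprob := fun i => isProbabilityMeasure_gaussVec (hc i)
  have hSig : ∀ i : Fin T, Sig c (i.val + 1) = sigFam c i := fun i => by
    rw [Sig, sigFam, dateIdx_succ]
  let R : (Fin T → XIdx n → ℝ) → ℕ → XIdx n → ℝ := fun ζ =>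
    S.rnPath z c 0 (pathOf (S.x0 z) η₀) ζ
  -- the real-world noise that produces the risk-neutral path driven by `ζ`
  let y : (Fin T → XIdx n → ℝ) → Fin T → XIdx n → ℝ := fun ζ i =>
    ζ i + S.noiseShift z c (i.val + 1) (R ζ i.val)
  have hstate : ∀ ζ, ∀ k ≤ T, S.state z c (y ζ) k = R ζ k := by
    intro ζ k hk
    induction k with
    | zero => rfl
    | succ k ih =>
      have hd : (dateIdx T (k + 1)).val = k := by rw [dateIdx_val (by omega) hk]; omega
      simp only [state, ih (by omega), y, R, rnPath, hd]
      exact S.step_add_noiseShift z c (k + 1) _ _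
  have hmst : ∀ k, Measurable fun q : (Fin T → XIdx n → ℝ) × (XIdx n → ℝ) =>
      S.state z c q.1 k := fun k =>
    S.measurable_state (z := fun _ => z) (c := fun _ => c) measurable_const measurable_const
      measurable_fst k
  have hmsh : ∀ i : Fin T, Measurable fun q : (Fin T → XIdx n → ℝ) × (XIdx n → ℝ) =>
      S.noiseShift z c (i.val + 1) (S.state z c q.1 i.val) := fun i =>
    S.measurable_noiseShift (z := fun _ => z) (c := fun _ => c) measurable_const measurable_const
      _ (hmst i.val)
  have hG : Measurable fun ξ : Fin T → XIdx n → ℝ => F fun i => S.state z c ξ (i.val + 1) :=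
    hF.comp (measurable_pi_lambda _ fun i => S.measurable_state (z := fun _ => z)
      (c := fun _ => c) measurable_const measurable_const measurable_id _)
  -- `ζ ↦ y ζ` is triangular, since the shift of each date depends on the earlier noise only
  have tri := lintegral_triangular (ρ := fun _ : Fin T => (volume : Measure (XIdx n → ℝ)))
    (κ := fun i => gaussVec (sigFam c i))
    (F := fun i η v => v + S.noiseShift z c (i.val + 1) (S.state z c η i.val))
    (l := fun i η v => ENNReal.ofReal (normalDensity (sigFam c i)
      (v - S.noiseShift z c (i.val + 1) (S.state z c η i.val))))
    (fun i => measurable_snd.add (hmsh i))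
    (fun i => ((measurable_normalDensity_right _).comp
      (measurable_snd.sub (hmsh i))).ennreal_ofReal)
    (fun i η η' h => by
      rw [S.state_congr z c i.2.le fun j hj => h j hj])
    (fun i η η' h => by
      rw [S.state_congr z c i.2.le fun j hj => h j hj])
    (fun i η f hf => by
      rw [lintegral_gaussVec _ (fun v => f (v + S.noiseShift z c (i.val + 1)
        (S.state z c η i.val))) (hf.comp (measurable_id.add_const _))]
      conv_rhs => rw [← lintegral_add_right_eq_self _
        (S.noiseShift z c (i.val + 1) (S.state z c η i.val))]
      simp)
    y (fun ζ i => by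
      rw [hstate ζ i.val i.2.le])
    T le_rfl hG
  have hhyb : hybridMeasure (fun _ : Fin T => (volume : Measure (XIdx n → ℝ)))
      (fun i => gaussVec (sigFam c i)) T = fun _ => volume := by
    funext i; simp [hybridMeasure]
  rw [hhyb, ← volume_pi] at tri
  rw [noiseLaw, gaussPath_eq_pi hc]
  have e1 : ∀ ζ, F (S.contPath z c 0 η₀ ζ)
      = F fun i => S.state z c (fun i => if i.val < T then y ζ i else ζ i) (i.val + 1) := by
    intro ζ
    congr 1
    funext i
    have : (fun i : Fin T => if i.val < T then y ζ i else ζ i) = y ζ := by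
      funext i; simp
    rw [this, hstate ζ _ i.2]
    rfl
  simp_rw [e1]
  rw [tri]
  refine lintegral_congr fun ξ => ?_
  rw [← mul_assoc]
  congr 1
  rw [girsanovDensity, prod_Icc_eq_prod_fin, prod_Icc_eq_prod_fin,
    ← ENNReal.ofReal_mul (Finset.prod_nonneg fun i _ => normalDensity_nonneg _ _),
    ← Finset.prod_mul_distrib, ENNReal.ofReal_prod_of_nonneg]
  · have hf : (Finset.univ.filter fun i : Fin T => i.val < T) = Finset.univ := by ext; simp
    rw [hf]
    refine Finset.prod_congr rfl fun i _ => ?_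
    rw [dateIdx_succ, Nat.add_sub_cancel]
    have h := S.normalDensity_mul_girsanov (z := z) (c := c) (t := i.val + 1)
      (by rw [hSig]; exact hc i) (S.state z c ξ i.val) (ξ i)
    rw [h, hSig]
  · exact fun i _ => mul_nonneg (normalDensity_nonneg _ _) (Real.exp_nonneg _)

end Spec
end GordonHedge

namespace GordonHedge

/-! ### The law of the model under the risk-neutral measure -/

/-- Values of the initial information, the transition matrix, the regimes and the coefficients. -/
abbrev Base (n lk ly N T : ℕ) (𝓩 : Type*) : Type _ :=
  𝓩 × TransMat N × (Fin T → Fin N) × CoefPath n lk ly T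

namespace Spec

variable {n lk ly N T : ℕ} [NeZero T] {𝓩 : Type*} [MeasurableSpace 𝓩] (S : Spec n lk ly N T 𝓩)

instance : SigmaFinite S.refCoef := S.sigmaFinite_refCoef

instance : SigmaFinite S.refTrans := S.sigmaFinite_refTrans

/-- Markov property for given coefficients: the noise after `t` may be replaced by fresh noise. -/
theorem lintegral_noiseLaw_contPath {c : CoefPath n lk ly T} (hc : ∀ i, (sigFam c i).PosDef)
    (z : 𝓩) {t : ℕ} (ht : t ≤ T) (η : Fin T → XIdx n → ℝ)
    {f : (Fin T → XIdx n → ℝ) → ℝ≥0∞} (hf : Measurable f) :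
    ∫⁻ ζ, ∫⁻ ζ', f (S.contPath z c t (S.contPath z c 0 η ζ) ζ') ∂(noiseLaw c) ∂(noiseLaw c)
      = ∫⁻ ζ, f (S.contPath z c 0 η ζ) ∂(noiseLaw c) := by
  have hprob := fun i => isProbabilityMeasure_gaussVec (hc i)
  have hg : Measurable fun ζ => f (S.contPath z c 0 η ζ) :=
    hf.comp (S.measurable_contPath (z := fun _ => z) (c := fun _ => c) measurable_const
      measurable_const 0 measurable_const measurable_id)
  have h := lintegral_mergePath (fun i : Fin T => i.val < t) (fun i => gaussVec (sigFam c i))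
    (fun i => gaussVec (sigFam c i)) hg
  simp only [ite_self] at h
  rw [noiseLaw, gaussPath_eq_pi hc, ← h]
  simp_rw [S.contPath_mergePath z c ht]

/-- The measure with respect to which `likelihood` is the density of the first `t` values of the
path; the later coordinates are integrated with an arbitrary probability measure. -/
noncomputable def pathRef (n T t : ℕ) : Measure (Fin T → XIdx n → ℝ) :=
  Measure.pi fun i => if i.val < t then volume else gaussVec 1

instance (t : ℕ) : SigmaFinite (pathRef n T t) := by
  have : IsProbabilityMeasure (gaussVec (1 : Matrix (XIdx n) (XIdx n) ℝ)) :=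
    isProbabilityMeasure_gaussVec Matrix.PosDef.one
  have : ∀ i : Fin T, SigmaFinite (if i.val < t then (volume : Measure (XIdx n → ℝ))
      else gaussVec 1) := fun i => by split_ifs <;> infer_instance
  unfold pathRef
  infer_instance

/-- The likelihood is the density of the first `t` values of the risk-neutral path with respect to
`pathRef`. -/
theorem lintegral_likelihood {c : CoefPath n lk ly T} (hc : ∀ i, (sigFam c i).PosDef) (z : 𝓩)
    {t : ℕ} (ht : t ≤ T) (η₀ : Fin T → XIdx n → ℝ) {G : (Fin T → XIdx n → ℝ) → ℝ≥0∞}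
    (hG : Measurable G) (hGt : ∀ η η', (∀ j : Fin T, j.val < t → η j = η' j) → G η = G η') :
    ∫⁻ ζ, G (S.contPath z c 0 η₀ ζ) ∂(noiseLaw c)
      = ∫⁻ η, ENNReal.ofReal (S.likelihood t z (pathOf (S.x0 z) η) c) * G η
          ∂(pathRef n T t) := by
  have hprob := fun i => isProbabilityMeasure_gaussVec (hc i)
  have hone : IsProbabilityMeasure (gaussVec (1 : Matrix (XIdx n) (XIdx n) ℝ)) :=
    isProbabilityMeasure_gaussVec Matrix.PosDef.one
  have hSig : ∀ i : Fin T, Sig c (i.val + 1) = sigFam c i := fun i => by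
    rw [Sig, sigFam, dateIdx_succ]
  set κ : Fin T → Measure (XIdx n → ℝ) := fun i =>
    if i.val < t then gaussVec (sigFam c i) else gaussVec 1 with hκ
  set ρ : Fin T → Measure (XIdx n → ℝ) := fun i =>
    if i.val < t then volume else gaussVec 1 with hρ
  have hκp : ∀ i, IsProbabilityMeasure (κ i) := fun i => by
    simp only [hκ]; split_ifs <;> infer_instance
  have hρs : ∀ i, SigmaFinite (ρ i) := fun i => by
    simp only [hρ]; split_ifs <;> infer_instance
  let y : (Fin T → XIdx n → ℝ) → Fin T → XIdx n → ℝ := fun ζ i =>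
    if i.val < t then S.contPath z c 0 η₀ ζ i else ζ i
  have hg : Measurable fun ζ => G (S.contPath z c 0 η₀ ζ) :=
    hG.comp (S.measurable_contPath (z := fun _ => z) (c := fun _ => c) measurable_const
      measurable_const 0 measurable_const measurable_id)
  -- the integrand ignores the noise from position `t` on, so its law there may be replaced
  have e1 : ∫⁻ ζ, G (S.contPath z c 0 η₀ ζ) ∂(noiseLaw c)
      = ∫⁻ ζ, G (S.contPath z c 0 η₀ ζ) ∂(Measure.pi κ) := by
    have h := lintegral_mergePath (fun i : Fin T => i.val < t) (fun i => gaussVec (sigFam c i))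
      (fun _ => gaussVec 1) hg
    rw [← h, noiseLaw, gaussPath_eq_pi hc]
    refine lintegral_congr fun ζ => ?_
    have e : ∀ ζ', G (S.contPath z c 0 η₀ (mergePath (fun i : Fin T => i.val < t) ζ ζ'))
        = G (S.contPath z c 0 η₀ ζ) := fun ζ' => by
      rw [S.contPath_mergePath z c ht]
      exact hGt _ _ fun j hj => S.contPath_apply_of_lt z c _ _ hj
    simp only [e, lintegral_const, measure_univ, mul_one]
  have hyeq : ∀ ζ, ∀ k ≤ t, pathOf (S.x0 z) (y ζ) k = S.rnPath z c 0 (pathOf (S.x0 z) η₀) ζ k := by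
    intro ζ k hk
    rw [← S.pathOf_contPath z c 0 η₀ ζ (hk.trans ht)]
    refine pathOf_congr _ (hk.trans ht) fun j hj => ?_
    have : j.val < t := by omega
    simp [y, this]
  have mp : ∀ k, Measurable fun q : (Fin T → XIdx n → ℝ) × (XIdx n → ℝ) =>
      pathOf (S.x0 z) q.1 k := fun k =>
    (measurable_pi_apply k).comp (measurable_pathOf measurable_const measurable_fst)
  -- `ζ ↦ y ζ` is triangular, since each step of the system depends on the earlier path only
  have tri := lintegral_triangular (ρ := ρ) (κ := κ)
    (fun i η v => if i.val < t then S.rnStep z c (i.val + 1) (pathOf (S.x0 z) η i.val) v else v)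
    (fun i η x => if i.val < t then ENNReal.ofReal (normalDensity
      (S.GG z (i.val + 1) * sigFam c i * (S.GG z (i.val + 1))ᵀ)
      (S.Q0 z (i.val + 1) *ᵥ x - (S.nuTilde z c (i.val + 1)
        + S.Q1 z c (i.val + 1) *ᵥ pathOf (S.x0 z) η i.val))) else 1)
    (fun i => by
      split_ifs
      · exact S.measurable_rnStep (z := fun _ => z) (c := fun _ => c) measurable_const
          measurable_const _ (mp _) measurable_snd
      · exact measurable_snd)
    (fun i => by
      split_ifs
      · refine ((measurable_normalDensity_right _).comp (Measurable.sub ?_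
          (measurable_const.add ?_))).ennreal_ofReal
        · exact EntryMeasurable.mulVec (f := fun _ => S.Q0 z (i.val + 1))
            (fun _ _ => measurable_const) measurable_snd
        · exact EntryMeasurable.mulVec (f := fun _ => S.Q1 z c (i.val + 1))
            (fun _ _ => measurable_const) (mp _)
      · exact measurable_const)
    (fun i η η' h => by
      funext v
      rw [pathOf_congr _ i.2.le fun j hj => h j hj])
    (fun i η η' h => by
      funext v
      rw [pathOf_congr _ i.2.le fun j hj => h j hj])
    (fun i η f hf => by
      by_cases hi : i.val < t
      · simp only [hi, if_true, hκ, hρ]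
        exact lintegral_gaussVec_affine (S.det_GG_ne_zero z _) (S.det_Q0 z _) _ hf
      · simp only [hi, if_false, hκ, hρ, one_mul])
    y (fun ζ i => by
      by_cases hi : i.val < t
      · simp only [hi, if_true]
        rw [hyeq ζ i.val hi.le]
        simp only [y, hi, if_true, contPath, rnPath, dateIdx_succ]
        simp
      · simp [hi, y])
    t ht hG
  have hhyb : Measure.pi (hybridMeasure ρ κ t) = pathRef n T t := by
    rw [pathRef]
    congr 1
    funext i
    simp only [hybridMeasure, hρ, hκ]
    split_ifs <;> rfl
  rw [hhyb] at tri
  rw [e1]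
  have e2 : ∀ ζ, G (S.contPath z c 0 η₀ ζ) = G fun i => if i.val < t then y ζ i else ζ i :=
    fun ζ => hGt _ _ fun j hj => by simp [y, hj]
  simp_rw [e2]
  rw [tri]
  refine lintegral_congr fun η => ?_
  congr 1
  rw [likelihood, ENNReal.ofReal_prod_of_nonneg fun _ _ => normalDensity_nonneg _ _]
  -- complete the product over the dates up to `t` to all dates by factors `1`
  have e3 : ∏ m ∈ Finset.Icc 1 t, ENNReal.ofReal (normalDensity (S.GG z m * Sig c m * (S.GG z m)ᵀ)
      (S.Q0 z m *ᵥ pathOf (S.x0 z) η m - S.nuTilde z c m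
        - S.Q1 z c m *ᵥ pathOf (S.x0 z) η (m - 1)))
      = ∏ m ∈ Finset.Icc 1 T, if m ≤ t then ENNReal.ofReal (normalDensity
        (S.GG z m * Sig c m * (S.GG z m)ᵀ)
      (S.Q0 z m *ᵥ pathOf (S.x0 z) η m - S.nuTilde z c m
        - S.Q1 z c m *ᵥ pathOf (S.x0 z) η (m - 1))) else 1 := by
    rw [← Finset.prod_filter]
    refine Finset.prod_congr ?_ fun _ _ => rfl
    ext m
    simp only [Finset.mem_Icc, Finset.mem_filter]
    omega
  rw [e3, prod_Icc_eq_prod_fin, Finset.prod_filter]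
  refine Finset.prod_congr rfl fun i _ => ?_
  by_cases hi : i.val < t
  · have hi' : i.val + 1 ≤ t := hi
    simp only [hi, hi', if_true, hSig, Nat.add_sub_cancel]
    have : pathOf (S.x0 z) η (i.val + 1) = η i := by simp [pathOf, dateIdx_succ]
    rw [this, sub_sub]
  · have hi' : ¬ i.val + 1 ≤ t := hi
    simp only [hi, hi', if_false]

/-- `f(C, Γ | s, F₀) f(s | 𝖯) f(𝖯 | F₀)` -/
noncomputable def prior (z : 𝓩) (s : Fin T → Fin N) (q : CoefPath n lk ly T × TransMat N) : ℝ :=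
  S.fCoef s z q.1 * (∏ m ∈ Finset.Icc 1 T, S.stepProb z q.2 s m) * S.fTrans z q.2

theorem measurable_stepProb {α : Type*} [MeasurableSpace α] {z : α → 𝓩} {p : α → TransMat N}
    (hz : Measurable z) (hp : Measurable p) (s : Fin T → Fin N) (m : ℕ) :
    Measurable fun a => S.stepProb (z a) (p a) s m := by
  unfold stepProb
  split_ifs
  · exact (S.meas_pInit _).comp (hz.prodMk hp)
  · exact (measurable_pi_apply _).comp ((measurable_pi_apply _).comp hp)

theorem measurable_prior {α : Type*} [MeasurableSpace α] {z : α → 𝓩}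
    {q : α → CoefPath n lk ly T × TransMat N} (hz : Measurable z) (hq : Measurable q)
    (s : Fin T → Fin N) : Measurable fun a => S.prior (z a) s (q a) :=
  (((S.meas_fCoef s).comp (hz.prodMk hq.fst)).mul
    (Finset.measurable_prod _ fun m _ => S.measurable_stepProb hz hq.snd s m)).mul
    (S.meas_fTrans.comp (hz.prodMk hq.snd))

/-- Almost everywhere in the support of the prior the transition matrix has nonnegative entries and
the covariance matrices are positive definite. -/
theorem ae_prior_support (z : 𝓩) (s : Fin T → Fin N) :
    ∀ᵐ q ∂(S.refCoef.prod S.refTrans),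
      (S.fTrans z q.2 ≠ 0 → ∀ i j, 0 ≤ q.2 i j) ∧
      (S.fCoef s z q.1 ≠ 0 → ∀ i, (sigFam q.1 i).PosDef) := by
  have h1 := Measure.quasiMeasurePreserving_snd (μ := S.refCoef) (ν := S.refTrans) |>.ae
    (S.fTrans_stochastic z)
  have h2 := Measure.quasiMeasurePreserving_fst (μ := S.refCoef) (ν := S.refTrans) |>.ae
    (S.fCoef_posDef s z)
  filter_upwards [h1, h2] with q hq1 hq2
  exact ⟨fun h => (hq1 h).1, hq2⟩

theorem stepProb_nonneg (z : 𝓩) {p : TransMat N} (hp : ∀ i j, 0 ≤ p i j) (s : Fin T → Fin N)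
    (m : ℕ) : 0 ≤ S.stepProb z p s m := by
  unfold stepProb
  split_ifs
  · exact S.pInit_nonneg _ _ _
  · exact hp _ _

theorem ae_prior_nonneg (z : 𝓩) (s : Fin T → Fin N) :
    ∀ᵐ q ∂(S.refCoef.prod S.refTrans), 0 ≤ S.prior z s q := by
  filter_upwards [S.ae_prior_support z s] with q hq
  unfold prior
  by_cases h : S.fTrans z q.2 = 0
  · simp [h]
  · exact mul_nonneg (mul_nonneg (S.fCoef_nonneg _ _ _)
      (Finset.prod_nonneg fun m _ => S.stepProb_nonneg z (hq.1 h) s m)) (S.fTrans_nonneg _ _)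

theorem ae_posDef_of_prior_ne_zero (z : 𝓩) (s : Fin T → Fin N) :
    ∀ᵐ q ∂(S.refCoef.prod S.refTrans), S.prior z s q ≠ 0 → ∀ i, (sigFam q.1 i).PosDef := by
  filter_upwards [S.ae_prior_support z s] with q hq h
  refine hq.2 fun h0 => h ?_
  simp [prior, h0]

end Spec

namespace Elements

variable {n lk ly N T : ℕ} [NeZero T] {𝓩 : Type*} [MeasurableSpace 𝓩]
  {Ω : Type*} [MeasurableSpace Ω] (M : Elements n lk ly N T 𝓩 Ω) (S : Spec n lk ly N T 𝓩)
  {Pr : Measure Ω}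

/-- The initial information, the transition matrix, the regimes and the coefficients, jointly. -/
def base (ω : Ω) : Base n lk ly N T 𝓩 := (M.init ω, M.trans ω, M.regime ω, M.coef ω)

/-- The path `x_1, …, x_T`. -/
noncomputable def xPath (ω : Ω) : Fin T → XIdx n → ℝ := fun i => M.x S (i.val + 1) ω

theorem pathOf_xPath {k : ℕ} (hk : k ≤ T) (ω : Ω) :
    Spec.pathOf (S.x0 (M.init ω)) (M.xPath S ω) k = M.x S k ω := by
  cases k with
  | zero => rfl
  | succ k =>
    simp only [Spec.pathOf, xPath]
    rw [Spec.dateIdx_val (by omega) hk, Nat.add_sub_cancel]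

variable {M S} (hM : M.IsModel S Pr)
include hM

theorem IsModel.measurable_base : Measurable M.base :=
  hM.meas_init.prodMk (hM.meas_trans.prodMk (hM.meas_regime.prodMk hM.meas_coef))

theorem IsModel.measurable_x (t : ℕ) : Measurable (M.x S t) :=
  S.measurable_state hM.meas_init hM.meas_coef hM.meas_noise t

theorem IsModel.measurable_xPath : Measurable (M.xPath S) :=
  measurable_pi_lambda _ fun _ => hM.measurable_x _

theorem IsModel.measurable_density : Measurable (M.density S) :=
  S.measurable_girsanovDensity hM.meas_init hM.meas_coef hM.meas_noise

/-- The law of the base variables and of the path under the risk-neutral measure: the base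
variables keep their law, and given them the path follows the risk-neutral system. -/
theorem IsModel.lintegral_riskNeutral
    {F : Base n lk ly N T 𝓩 × (Fin T → XIdx n → ℝ) → ℝ≥0∞} (hF : Measurable F) :
    ∫⁻ ω, F (M.base ω, M.xPath S ω) ∂(M.riskNeutral S Pr)
      = ∫⁻ z, ∑ s, ∫⁻ q, ENNReal.ofReal (S.prior z s q)
          * ∫⁻ ζ, F ((z, q.2, s, q.1), S.contPath z q.1 0 0 ζ) ∂(Spec.noiseLaw q.1)
          ∂(S.refCoef.prod S.refTrans) ∂(Pr.map M.init) := by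
  have h := lintegral_withDensity_eq_lintegral_mul Pr hM.measurable_density.ennreal_ofReal
    (hF.comp (hM.measurable_base.prodMk hM.measurable_xPath))
  refine h.trans ?_
  let F' : 𝓩 × TransMat N × (Fin T → Fin N) × CoefPath n lk ly T × (Fin T → XIdx n → ℝ) → ℝ≥0∞ :=
    fun a => ENNReal.ofReal (S.girsanovDensity a.1 a.2.2.2.1 a.2.2.2.2)
      * F ((a.1, a.2.1, a.2.2.1, a.2.2.2.1), fun i => S.state a.1 a.2.2.2.1 a.2.2.2.2 (i.val + 1))
  have hF' : Measurable F' := by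
    refine Measurable.mul (S.measurable_girsanovDensity measurable_fst
      measurable_snd.snd.snd.fst measurable_snd.snd.snd.snd).ennreal_ofReal (hF.comp ?_)
    refine Measurable.prodMk (by fun_prop) (measurable_pi_lambda _ fun i => ?_)
    exact S.measurable_state measurable_fst measurable_snd.snd.snd.fst
      measurable_snd.snd.snd.snd _
  refine (hM.joint_law F' hF').trans ?_
  refine lintegral_congr fun z => ?_
  have hmq : ∀ s, Measurable fun q : CoefPath n lk ly T × TransMat N =>
      ENNReal.ofReal (S.prior z s q)
          * ∫⁻ ζ, F ((z, q.2, s, q.1), S.contPath z q.1 0 0 ζ) ∂(Spec.noiseLaw q.1) := by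
    intro s
    refine (S.measurable_prior measurable_const measurable_id s).ennreal_ofReal.mul ?_
    refine Spec.measurable_lintegral_noiseLaw (c := fun q : CoefPath n lk ly T × TransMat N => q.1)
      (f := fun a => F ((z, a.1.2, s, a.1.1), S.contPath z a.1.1 0 0 a.2)) measurable_fst
      (hF.comp (Measurable.prodMk (by fun_prop) ?_))
    exact S.measurable_contPath measurable_const measurable_fst.fst 0 measurable_const
      measurable_snd
  have e : ∀ s p, ∫⁻ c, ENNReal.ofReal (S.fTrans z p * (∏ m ∈ Finset.Icc 1 T, S.stepProb z p s m)
              * S.fCoef s z c)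
            * ∫⁻ ξ, ENNReal.ofReal
                  (∏ m ∈ Finset.Icc 1 T, normalDensity (Spec.Sig c m) (ξ (dateIdx T m)))
                * F' (z, p, s, c, ξ) ∂volume ∂S.refCoef
      = ∫⁻ c, ENNReal.ofReal (S.prior z s (c, p))
          * ∫⁻ ζ, F ((z, p, s, c), S.contPath z c 0 0 ζ) ∂(Spec.noiseLaw c) ∂S.refCoef := by
    intro s p
    refine lintegral_congr_ae ?_
    filter_upwards [S.fCoef_posDef s z] with c hc
    by_cases h0 : S.fCoef s z c = 0
    · simp [h0, Spec.prior]
    · congr 1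
      · rw [Spec.prior]; congr 1; ring
      · refine S.lintegral_girsanov (hc h0) (F := fun η => F ((z, p, s, c), η))
          (hF.comp measurable_prodMk_left) 0
  simp_rw [e]
  rw [lintegral_finsetSum]
  · refine Finset.sum_congr rfl fun s _ => ?_
    rw [lintegral_prod_symm _ (hmq s).aemeasurable]
  · intro s _
    exact (hmq s).lintegral_prod_left'

end Elements
end GordonHedge

namespace GordonHedge

/-! ### Conditional expectations given `H_t` and given `F_t` -/

/-- The first `t` coordinates of a path; the other coordinates are set to `0`. -/
def cutPath {n T : ℕ} (t : ℕ) (η : Fin T → XIdx n → ℝ) : Fin T → XIdx n → ℝ :=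
  fun i => if i.val < t then η i else 0

theorem measurable_cutPath {n T : ℕ} (t : ℕ) :
    Measurable (cutPath t : (Fin T → XIdx n → ℝ) → _) := by
  refine measurable_pi_lambda _ fun i => ?_
  unfold cutPath
  split_ifs
  · exact measurable_pi_apply i
  · exact measurable_const

theorem cutPath_congr {n T t : ℕ} {η η' : Fin T → XIdx n → ℝ}
    (h : ∀ j : Fin T, j.val < t → η j = η' j) : cutPath t η = cutPath t η' := by
  funext i
  unfold cutPath
  split_ifs with hi
  · exact h i hi
  · rfl

theorem cutPath_apply_of_lt {n T t : ℕ} (η : Fin T → XIdx n → ℝ) {j : Fin T} (hj : j.val < t) :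
    cutPath t η j = η j := by
  simp [cutPath, hj]

namespace Elements

variable {n lk ly N T : ℕ} [NeZero T] {𝓩 : Type*} [MeasurableSpace 𝓩]
  {Ω : Type*} [MeasurableSpace Ω] {M : Elements n lk ly N T 𝓩 Ω} {S : Spec n lk ly N T 𝓩}
  {Pr : Measure Ω} (hM : M.IsModel S Pr)
include hM

/-- The base variables have the same law under both measures. -/
theorem IsModel.lintegral_riskNeutral_base {F : Base n lk ly N T 𝓩 → ℝ≥0∞} (hF : Measurable F) :
    ∫⁻ ω, F (M.base ω) ∂(M.riskNeutral S Pr) = ∫⁻ ω, F (M.base ω) ∂Pr := by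
  have h := lintegral_withDensity_eq_lintegral_mul Pr hM.measurable_density.ennreal_ofReal
    (hF.comp hM.measurable_base)
  refine h.trans ?_
  have hF1 : Measurable fun a : 𝓩 × TransMat N × (Fin T → Fin N) × CoefPath n lk ly T
      × (Fin T → XIdx n → ℝ) => F (a.1, a.2.1, a.2.2.1, a.2.2.2.1) := hF.comp (by fun_prop)
  refine (hM.joint_law (fun a => ENNReal.ofReal (S.girsanovDensity a.1 a.2.2.2.1 a.2.2.2.2)
      * F (a.1, a.2.1, a.2.2.1, a.2.2.2.1)) (Measurable.mul (S.measurable_girsanovDensity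
        measurable_fst measurable_snd.snd.snd.fst measurable_snd.snd.snd.snd).ennreal_ofReal
      hF1)).trans ?_
  refine Eq.trans ?_ (hM.joint_law _ hF1).symm
  refine lintegral_congr fun z => lintegral_congr fun p => Finset.sum_congr rfl fun s _ => ?_
  refine lintegral_congr_ae ?_
  filter_upwards [S.fCoef_posDef s z] with c hc
  by_cases h0 : S.fCoef s z c = 0
  · simp [h0]
  · congr 1
    have h1 := S.lintegral_girsanov (z := z) (hc h0) (F := fun _ => F (z, p, s, c))
      measurable_const 0
    refine h1.trans ?_
    rw [Spec.lintegral_noiseLaw c measurable_const]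
    refine lintegral_congr fun ξ => ?_
    rw [Spec.prod_Icc_eq_prod_fin,
      ENNReal.ofReal_prod_of_nonneg fun _ _ => normalDensity_nonneg _ _]
    simp only [Spec.Sig, Spec.sigFam, Spec.dateIdx_succ]

theorem IsModel.isProbabilityMeasure_riskNeutral :
    IsProbabilityMeasure (M.riskNeutral S Pr) := by
  have := hM.prob
  refine ⟨?_⟩
  have h := hM.lintegral_riskNeutral_base (F := fun _ => 1) measurable_const
  simpa using h

theorem IsModel.ae_posDef :
    ∀ᵐ ω ∂(M.riskNeutral S Pr), ∀ i, (Spec.sigFam (M.coef ω) i).PosDef := by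
  set B : Set (CoefPath n lk ly T) := {c | ∀ i, (Spec.sigFam c i).PosDef}
  have hB : MeasurableSet B := Spec.measurableSet_posDef
  have hm : Measurable fun a : Base n lk ly N T 𝓩 × (Fin T → XIdx n → ℝ) =>
      Bᶜ.indicator (fun _ => (1 : ℝ≥0∞)) a.1.2.2.2 :=
    (measurable_const.indicator hB.compl).comp (by fun_prop)
  have h := hM.lintegral_riskNeutral hm
  rw [ae_iff]
  have e : {ω | ¬ ∀ i, (Spec.sigFam (M.coef ω) i).PosDef} = M.coef ⁻¹' Bᶜ := rfl
  rw [e, ← lintegral_indicator_one (hM.meas_coef hB.compl)]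
  refine Eq.trans (b := ∫⁻ ω, Bᶜ.indicator (fun _ => (1 : ℝ≥0∞)) (M.coef ω)
    ∂(M.riskNeutral S Pr)) rfl ?_
  refine h.trans ?_
  refine lintegral_eq_zero_of_ae_eq_zero (.of_forall fun z => ?_)
  refine Finset.sum_eq_zero fun s _ => lintegral_eq_zero_of_ae_eq_zero ?_
  filter_upwards [S.ae_posDef_of_prior_ne_zero z s] with q hq
  by_cases h0 : S.prior z s q = 0
  · simp [h0]
  · have : q.1 ∉ Bᶜ := fun hc => hc (hq h0)
    simp [Set.indicator_of_notMem this]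

/-- Markov property under the risk-neutral measure: after `t` the path may be continued by fresh
noise. -/
theorem IsModel.lintegral_markov {t : ℕ} (ht : t ≤ T)
    {F : Base n lk ly N T 𝓩 × (Fin T → XIdx n → ℝ) → ℝ≥0∞} (hF : Measurable F) :
    ∫⁻ ω, F (M.base ω, M.xPath S ω) ∂(M.riskNeutral S Pr)
      = ∫⁻ ω, ∫⁻ ζ, F (M.base ω, S.contPath (M.init ω) (M.coef ω) t (M.xPath S ω) ζ)
          ∂(Spec.noiseLaw (M.coef ω)) ∂(M.riskNeutral S Pr) := by
  have hm : Measurable fun a : Base n lk ly N T 𝓩 × (Fin T → XIdx n → ℝ) =>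
      ∫⁻ ζ, F (a.1, S.contPath a.1.1 a.1.2.2.2 t a.2 ζ) ∂(Spec.noiseLaw a.1.2.2.2) := by
    refine Spec.measurable_lintegral_noiseLaw (f := fun b : (Base n lk ly N T 𝓩
      × (Fin T → XIdx n → ℝ)) × (Fin T → XIdx n → ℝ) =>
        F (b.1.1, S.contPath b.1.1.1 b.1.1.2.2.2 t b.1.2 b.2)) (by fun_prop)
      (hF.comp (measurable_fst.fst.prodMk ?_))
    exact S.measurable_contPath (by fun_prop) (by fun_prop) t (by fun_prop) measurable_snd
  have h2 := hM.lintegral_riskNeutral hm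
  refine Eq.trans ?_ h2.symm
  rw [hM.lintegral_riskNeutral hF]
  refine lintegral_congr fun z => Finset.sum_congr rfl fun s _ => lintegral_congr_ae ?_
  filter_upwards [S.ae_posDef_of_prior_ne_zero z s] with q hq
  by_cases h0 : S.prior z s q = 0
  · simp [h0]
  · congr 1
    exact (S.lintegral_noiseLaw_contPath (hq h0) z ht 0
      (f := fun η => F ((z, q.2, s, q.1), η)) (hF.comp measurable_prodMk_left)).symm

theorem IsModel.sigF_le (t : ℕ) : M.sigF S t ≤ ‹MeasurableSpace Ω› :=
  sup_le hM.meas_init.comap_le (iSup₂_le fun m _ => (hM.measurable_x m).comap_le)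

theorem IsModel.sigH_le (t : ℕ) : M.sigH S t ≤ ‹MeasurableSpace Ω› :=
  sup_le (sup_le (sup_le (hM.sigF_le t) hM.meas_coef.comap_le) hM.meas_trans.comap_le)
    hM.meas_regime.comap_le

omit hM in
theorem measurable_x_sigF {t m : ℕ} (h : m ≤ t) : Measurable[M.sigF S t] (M.x S m) := by
  rcases Nat.eq_zero_or_pos m with rfl | h0
  · have h1 : Measurable[M.sigF S t] M.init :=
      Measurable.mono (comap_measurable M.init) le_sup_left le_rfl
    exact S.meas_x0.comp h1
  · refine Measurable.mono (comap_measurable (M.x S m)) (le_sup_of_le_right ?_) le_rfl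
    exact le_iSup₂_of_le m (Finset.mem_Icc.2 ⟨h0, h⟩) le_rfl

omit hM in
theorem measurable_init_sigF (t : ℕ) : Measurable[M.sigF S t] M.init :=
  Measurable.mono (comap_measurable M.init) le_sup_left le_rfl

omit hM in
theorem measurable_cutPath_sigF (t : ℕ) :
    Measurable[M.sigF S t] fun ω => cutPath t (M.xPath S ω) := by
  refine @measurable_pi_lambda _ _ _ (M.sigF S t) _ _ fun i => ?_
  by_cases hi : i.val < t
  · simp only [cutPath, hi, if_true]
    exact measurable_x_sigF hi
  · simp only [cutPath, hi, if_false]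
    exact @measurable_const _ _ _ (M.sigF S t) _

omit hM in
theorem measurable_base_sigH (t : ℕ) : Measurable[M.sigH S t] M.base := by
  have h1 : Measurable[M.sigH S t] M.init := (measurable_init_sigF t).mono
    (le_sup_of_le_left (le_sup_of_le_left le_sup_left)) le_rfl
  have h2 : Measurable[M.sigH S t] M.coef := Measurable.mono (comap_measurable M.coef)
    (le_sup_of_le_left (le_sup_of_le_left le_sup_right)) le_rfl
  have h3 : Measurable[M.sigH S t] M.trans := Measurable.mono (comap_measurable M.trans)
    (le_sup_of_le_left le_sup_right) le_rfl
  have h4 : Measurable[M.sigH S t] M.regime := Measurable.mono (comap_measurable M.regime)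
    le_sup_right le_rfl
  exact h1.prodMk (h3.prodMk (h4.prodMk h2))

omit hM in
theorem sigF_le_sigH (t : ℕ) : M.sigF S t ≤ M.sigH S t :=
  le_sup_of_le_left (le_sup_of_le_left le_sup_left)

omit hM in
/-- `F_t` is generated by one random variable, the initial information with the path cut off after
`t`. -/
theorem sigF_eq_comap {t : ℕ} (ht : t ≤ T) :
    M.sigF S t = MeasurableSpace.comap (fun ω => (M.init ω, cutPath t (M.xPath S ω)))
      inferInstance := by
  refine le_antisymm ?_ ((measurable_init_sigF t).prodMk (measurable_cutPath_sigF t)).comap_le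
  set m := MeasurableSpace.comap (fun ω => (M.init ω, cutPath t (M.xPath S ω))) inferInstance
  have hJ : Measurable[m] fun ω => (M.init ω, cutPath t (M.xPath S ω)) := comap_measurable _
  refine sup_le (Measurable.comap_le hJ.fst) (iSup₂_le fun k hk => ?_)
  obtain ⟨h1, h2⟩ := Finset.mem_Icc.1 hk
  have hd : (dateIdx T k).val = k - 1 := Spec.dateIdx_val h1 (h2.trans ht)
  have e : M.x S k = fun ω => cutPath t (M.xPath S ω) (dateIdx T k) := by
    funext ω
    rw [cutPath_apply_of_lt _ (by omega), xPath, hd, Nat.sub_add_cancel h1]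
  rw [e]
  exact Measurable.comap_le (Measurable.comp (g := fun η : Fin T → XIdx n → ℝ => η (dateIdx T k))
    (measurable_pi_apply _) hJ.snd)

omit hM in
/-- `H_t` is generated by one random variable, the base variables with the path cut off after `t`.
-/
theorem sigH_eq_comap {t : ℕ} (ht : t ≤ T) :
    M.sigH S t = MeasurableSpace.comap (fun ω => (M.base ω, cutPath t (M.xPath S ω)))
      inferInstance := by
  refine le_antisymm ?_ ((measurable_base_sigH t).prodMk
    ((measurable_cutPath_sigF t).mono (sigF_le_sigH t) le_rfl)).comap_le
  set m := MeasurableSpace.comap (fun ω => (M.base ω, cutPath t (M.xPath S ω))) inferInstance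
  have hJ : Measurable[m] fun ω => (M.base ω, cutPath t (M.xPath S ω)) := comap_measurable _
  refine sup_le (sup_le (sup_le ?_ ?_) ?_) ?_
  · rw [sigF_eq_comap ht]
    exact Measurable.comap_le (hJ.fst.fst.prodMk hJ.snd)
  · exact Measurable.comap_le hJ.fst.snd.snd.snd
  · exact Measurable.comap_le hJ.fst.snd.fst
  · exact Measurable.comap_le hJ.fst.snd.snd.fst

/-- The conditional law of the path given `H_t`: the path up to `t` is kept and continued by the
risk-neutral system with fresh noise. -/
theorem IsModel.setLIntegral_sigH {t : ℕ} (ht : t ≤ T)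
    {F : Base n lk ly N T 𝓩 × (Fin T → XIdx n → ℝ) → ℝ≥0∞} (hF : Measurable F) {A : Set Ω}
    (hA : MeasurableSet[M.sigH S t] A) :
    ∫⁻ ω in A, F (M.base ω, M.xPath S ω) ∂(M.riskNeutral S Pr)
      = ∫⁻ ω in A, ∫⁻ ζ, F (M.base ω, S.contPath (M.init ω) (M.coef ω) t (M.xPath S ω) ζ)
          ∂(Spec.noiseLaw (M.coef ω)) ∂(M.riskNeutral S Pr) := by
  have hA0 := hM.sigH_le t A hA
  rw [sigH_eq_comap ht] at hA
  obtain ⟨B, hB, rfl⟩ := hA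
  rw [← lintegral_indicator hA0, ← lintegral_indicator hA0]
  have hm : Measurable fun a : Base n lk ly N T 𝓩 × (Fin T → XIdx n → ℝ) =>
      B.indicator (fun _ => (1 : ℝ≥0∞)) (a.1, cutPath t a.2) * F a :=
    ((measurable_const.indicator hB).comp
      (measurable_fst.prodMk ((measurable_cutPath t).comp measurable_snd))).mul hF
  have h := hM.lintegral_markov ht hm
  refine Eq.trans ?_ (h.trans ?_)
  · refine lintegral_congr fun ω => ?_
    by_cases hω : (M.base ω, cutPath t (M.xPath S ω)) ∈ B <;>
      simp [Set.indicator, hω]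
  · refine lintegral_congr fun ω => ?_
    have e : ∀ ζ, cutPath t (S.contPath (M.init ω) (M.coef ω) t (M.xPath S ω) ζ)
        = cutPath t (M.xPath S ω) := fun ζ =>
      cutPath_congr fun j hj => S.contPath_apply_of_lt _ _ _ _ hj
    simp only [e]
    by_cases hω : (M.base ω, cutPath t (M.xPath S ω)) ∈ B <;>
      simp [Set.indicator, hω]

/-- A conditional expectation given `H_t` is an integral over the fresh noise that continues the
path after `t`. -/
theorem IsModel.condExp_sigH {t : ℕ} (ht : t ≤ T)
    {Y : Base n lk ly N T 𝓩 × (Fin T → XIdx n → ℝ) → ℝ} (hY : Measurable Y)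
    (hint : Integrable (fun ω => Y (M.base ω, M.xPath S ω)) (M.riskNeutral S Pr)) :
    (∀ᵐ ω ∂(M.riskNeutral S Pr), Integrable
      (fun ζ => Y (M.base ω, S.contPath (M.init ω) (M.coef ω) t (M.xPath S ω) ζ))
      (Spec.noiseLaw (M.coef ω))) ∧
    (M.riskNeutral S Pr)[fun ω => Y (M.base ω, M.xPath S ω) | M.sigH S t]
      =ᵐ[M.riskNeutral S Pr] fun ω =>
        ∫ ζ, Y (M.base ω, S.contPath (M.init ω) (M.coef ω) t (M.xPath S ω) ζ)
          ∂(Spec.noiseLaw (M.coef ω)) := by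
  have := hM.isProbabilityMeasure_riskNeutral
  -- integrating out the fresh noise leaves an `H_t`-measurable function
  have meas : ∀ {F : Base n lk ly N T 𝓩 × (Fin T → XIdx n → ℝ) → ℝ≥0∞}, Measurable F →
      Measurable[M.sigH S t] fun ω =>
        ∫⁻ ζ, F (M.base ω, S.contPath (M.init ω) (M.coef ω) t (M.xPath S ω) ζ)
          ∂(Spec.noiseLaw (M.coef ω)) := by
    intro F hF
    have hm : Measurable fun a : Base n lk ly N T 𝓩 × (Fin T → XIdx n → ℝ) =>
        ∫⁻ ζ, F (a.1, S.contPath a.1.1 a.1.2.2.2 t a.2 ζ) ∂(Spec.noiseLaw a.1.2.2.2) := by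
      refine Spec.measurable_lintegral_noiseLaw (f := fun b : (Base n lk ly N T 𝓩
        × (Fin T → XIdx n → ℝ)) × (Fin T → XIdx n → ℝ) =>
          F (b.1.1, S.contPath b.1.1.1 b.1.1.2.2.2 t b.1.2 b.2)) (by fun_prop)
        (hF.comp (measurable_fst.fst.prodMk ?_))
      exact S.measurable_contPath (by fun_prop) (by fun_prop) t (by fun_prop) measurable_snd
    have h2 := hm.comp ((measurable_base_sigH t).prodMk
      ((measurable_cutPath_sigF t).mono (sigF_le_sigH t) le_rfl) :
        Measurable[M.sigH S t] fun ω => (M.base ω, cutPath t (M.xPath S ω)))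
    refine (congrArg (Measurable[M.sigH S t] ·) (funext fun ω => ?_)).mp h2
    refine lintegral_congr fun ζ => ?_
    congr 2
    exact S.contPath_congr _ _ ht (fun j hj => cutPath_apply_of_lt _ hj) ζ
  obtain ⟨hfin, hce⟩ := condExp_ae_eq_of_setLIntegral_eq (hM.sigH_le t) hint
    (meas hY.ennreal_ofReal) (meas hY.neg.ennreal_ofReal)
    (fun A hA => hM.setLIntegral_sigH ht hY.ennreal_ofReal hA)
    (fun A hA => hM.setLIntegral_sigH ht hY.neg.ennreal_ofReal hA)
  have hi : ∀ᵐ ω ∂(M.riskNeutral S Pr), Integrable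
      (fun ζ => Y (M.base ω, S.contPath (M.init ω) (M.coef ω) t (M.xPath S ω) ζ))
      (Spec.noiseLaw (M.coef ω)) := by
    filter_upwards [hfin] with ω hω
    have hms : Measurable fun ζ =>
        Y (M.base ω, S.contPath (M.init ω) (M.coef ω) t (M.xPath S ω) ζ) :=
      hY.comp (measurable_const.prodMk (S.measurable_contPath (z := fun _ => M.init ω)
        (c := fun _ => M.coef ω) measurable_const measurable_const t measurable_const
        measurable_id))
    refine ⟨hms.aestronglyMeasurable, ?_⟩
    rw [hasFiniteIntegral_iff_norm]
    have e : ∀ r : ℝ, ENNReal.ofReal ‖r‖ = ENNReal.ofReal r + ENNReal.ofReal (-r) := fun r => by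
      rcases le_total 0 r with h | h
      · rw [Real.norm_of_nonneg h, ENNReal.ofReal_of_nonpos (neg_nonpos.2 h), add_zero]
      · rw [Real.norm_of_nonpos h, ENNReal.ofReal_of_nonpos h, zero_add]
    simp_rw [e]
    rw [lintegral_add_left hms.ennreal_ofReal]
    exact ENNReal.add_lt_top.2 hω
  refine ⟨hi, hce.trans ?_⟩
  filter_upwards [hi] with ω hω
  rw [integral_eq_lintegral_pos_part_sub_lintegral_neg_part hω]
  rfl

end Elements
end GordonHedge

namespace GordonHedge

/-! ### Bayes' formula for the coefficients given the observed path -/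

namespace Spec

variable {n lk ly N T : ℕ} [NeZero T] {𝓩 : Type*} [MeasurableSpace 𝓩] (S : Spec n lk ly N T 𝓩)

theorem likelihood_nonneg (t : ℕ) (z : 𝓩) (xs : ℕ → XIdx n → ℝ) (c : CoefPath n lk ly T) :
    0 ≤ S.likelihood t z xs c :=
  Finset.prod_nonneg fun _ _ => normalDensity_nonneg _ _

theorem likelihood_congr {t : ℕ} (z : 𝓩) {xs xs' : ℕ → XIdx n → ℝ} (h : ∀ k ≤ t, xs k = xs' k)
    (c : CoefPath n lk ly T) : S.likelihood t z xs c = S.likelihood t z xs' c := by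
  refine Finset.prod_congr rfl fun m hm => ?_
  obtain ⟨h1, h2⟩ := Finset.mem_Icc.1 hm
  rw [h m h2, h (m - 1) (by omega)]

theorem measurable_likelihood {α : Type*} [MeasurableSpace α] {z : α → 𝓩}
    {c : α → CoefPath n lk ly T} {xs : α → ℕ → XIdx n → ℝ} (hz : Measurable z) (hc : Measurable c)
    (hx : Measurable xs) (t : ℕ) : Measurable fun a => S.likelihood t (z a) (xs a) (c a) := by
  refine Finset.measurable_prod _ fun m _ => ?_
  refine EntryMeasurable.normalDensity (((S.entryMeasurable_GG hz m).mul
    (measurable_coef_apply hc m).2.2).mul (S.entryMeasurable_GG hz m).transpose) ?_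
  exact (((S.entryMeasurable_Q0 hz m).mulVec ((measurable_pi_apply m).comp hx)).sub
    (S.measurable_nuTilde hz hc m)).sub
    ((S.entryMeasurable_Q1 hz hc m).mulVec ((measurable_pi_apply (m - 1)).comp hx))

/-- Joint density of the observations up to `t`, the coefficients, the transition matrix and the
regimes. -/
noncomputable def jointWeight (t : ℕ) (z : 𝓩) (xs : ℕ → XIdx n → ℝ) (s : Fin T → Fin N)
    (q : CoefPath n lk ly T × TransMat N) : ℝ≥0∞ :=
  ENNReal.ofReal (S.likelihood t z xs q.1 * S.prior z s q)

theorem measurable_jointWeight {α : Type*} [MeasurableSpace α] {z : α → 𝓩}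
    {q : α → CoefPath n lk ly T × TransMat N} {xs : α → ℕ → XIdx n → ℝ} (hz : Measurable z)
    (hq : Measurable q) (hx : Measurable xs) (t : ℕ) (s : Fin T → Fin N) :
    Measurable fun a => S.jointWeight t (z a) (xs a) s (q a) :=
  ((S.measurable_likelihood hz hq.fst hx t).mul (S.measurable_prior hz hq s)).ennreal_ofReal

theorem measurable_jointWeight_right (t : ℕ) (z : 𝓩) (xs : ℕ → XIdx n → ℝ) (s : Fin T → Fin N) :
    Measurable (S.jointWeight t z xs s) :=
  S.measurable_jointWeight measurable_const measurable_id measurable_const t s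

/-- Density of the observations up to `t`. -/
noncomputable def evidence (t : ℕ) (z : 𝓩) (xs : ℕ → XIdx n → ℝ) : ℝ≥0∞ :=
  ∑ s, ∫⁻ q, S.jointWeight t z xs s q ∂(S.refCoef.prod S.refTrans)

/-- The posterior law of the coefficients given the observations up to `t`. -/
noncomputable def postLaw (t : ℕ) (z : 𝓩) (xs : ℕ → XIdx n → ℝ) :
    Measure (CoefPath n lk ly T) :=
  ∑ s, ((S.refCoef.prod S.refTrans).withDensity
    fun q => S.jointWeight t z xs s q / S.evidence t z xs).map Prod.fst

theorem measurable_jointWeight_pathOf (t : ℕ) (s : Fin T → Fin N) :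
    Measurable fun b : (𝓩 × (Fin T → XIdx n → ℝ)) × (CoefPath n lk ly T × TransMat N) =>
      S.jointWeight t b.1.1 (pathOf (S.x0 b.1.1) b.1.2) s b.2 :=
  S.measurable_jointWeight measurable_fst.fst measurable_snd
    (measurable_pathOf (S.meas_x0.comp measurable_fst.fst) measurable_fst.snd) t s

theorem measurable_evidence (t : ℕ) : Measurable fun a : 𝓩 × (Fin T → XIdx n → ℝ) =>
    S.evidence t a.1 (pathOf (S.x0 a.1) a.2) :=
  Finset.measurable_sum _ fun s _ => (S.measurable_jointWeight_pathOf t s).lintegral_prod_right'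

theorem measurable_evidence_right (t : ℕ) (z : 𝓩) :
    Measurable fun η : Fin T → XIdx n → ℝ => S.evidence t z (pathOf (S.x0 z) η) := by
  refine Finset.measurable_sum _ fun s _ => Measurable.lintegral_prod_right' (f := fun b :
    (Fin T → XIdx n → ℝ) × (CoefPath n lk ly T × TransMat N) =>
      S.jointWeight t z (pathOf (S.x0 z) b.1) s b.2) ?_
  exact S.measurable_jointWeight measurable_const measurable_snd
    (measurable_pathOf measurable_const measurable_fst) t s

theorem lintegral_postLaw (t : ℕ) (z : 𝓩) (xs : ℕ → XIdx n → ℝ)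
    {f : CoefPath n lk ly T → ℝ≥0∞} (hf : Measurable f) :
    ∫⁻ c, f c ∂(S.postLaw t z xs)
      = (∑ s, ∫⁻ q, S.jointWeight t z xs s q * f q.1 ∂(S.refCoef.prod S.refTrans))
        / S.evidence t z xs := by
  rw [postLaw, lintegral_finsetSum_measure, ENNReal.div_eq_inv_mul, Finset.mul_sum]
  refine Finset.sum_congr rfl fun s _ => ?_
  rw [lintegral_map hf measurable_fst]
  refine (lintegral_withDensity_eq_lintegral_mul _
    ((S.measurable_jointWeight_right t z xs s).div_const _) (hf.comp measurable_fst)).trans ?_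
  refine Eq.trans ?_ (lintegral_const_mul _ ((S.measurable_jointWeight_right t z xs s).mul
      (hf.comp measurable_fst)))
  refine lintegral_congr fun q => ?_
  simp only [Pi.mul_apply, Function.comp_apply, ENNReal.div_eq_inv_mul, mul_assoc]

/-- The defining property of the posterior law. It also holds where the evidence vanishes, since the
joint weight then vanishes almost everywhere. -/
theorem evidence_mul_lintegral_postLaw {t : ℕ} {z : 𝓩} {xs : ℕ → XIdx n → ℝ}
    (hZ : S.evidence t z xs ≠ ∞) {f : CoefPath n lk ly T → ℝ≥0∞} (hf : Measurable f) :
    S.evidence t z xs * ∫⁻ c, f c ∂(S.postLaw t z xs)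
      = ∑ s, ∫⁻ q, S.jointWeight t z xs s q * f q.1 ∂(S.refCoef.prod S.refTrans) := by
  rw [S.lintegral_postLaw t z xs hf]
  by_cases h0 : S.evidence t z xs = 0
  · rw [h0, zero_mul]
    refine (Finset.sum_eq_zero fun s hs => ?_).symm
    have h1 := (Finset.sum_eq_zero_iff.1 h0) s hs
    rw [lintegral_eq_zero_iff (S.measurable_jointWeight_right t z xs s)] at h1
    refine lintegral_eq_zero_of_ae_eq_zero ?_
    filter_upwards [h1] with q hq
    simp only [Pi.zero_apply] at hq ⊢
    rw [hq, zero_mul]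
  · exact ENNReal.mul_div_cancel h0 hZ

theorem isProbabilityMeasure_postLaw {t : ℕ} {z : 𝓩} {xs : ℕ → XIdx n → ℝ}
    (h0 : S.evidence t z xs ≠ 0) (hZ : S.evidence t z xs ≠ ∞) :
    IsProbabilityMeasure (S.postLaw t z xs) := by
  refine ⟨?_⟩
  have h := S.lintegral_postLaw t z xs (f := fun _ => 1) measurable_const
  simp only [lintegral_const, one_mul, mul_one] at h
  rw [h]
  exact ENNReal.div_self h0 hZ

theorem ae_postLaw_posDef (t : ℕ) (z : 𝓩) (xs : ℕ → XIdx n → ℝ) :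
    ∀ᵐ c ∂(S.postLaw t z xs), ∀ i, (sigFam c i).PosDef := by
  set B : Set (CoefPath n lk ly T) := {c | ∀ i, (sigFam c i).PosDef}
  have hB : MeasurableSet B := measurableSet_posDef
  rw [ae_iff]
  change S.postLaw t z xs Bᶜ = 0
  rw [← lintegral_indicator_one hB.compl, S.lintegral_postLaw t z xs
    (measurable_one.indicator hB.compl)]
  rw [Finset.sum_eq_zero, ENNReal.zero_div]
  refine fun s _ => lintegral_eq_zero_of_ae_eq_zero ?_
  filter_upwards [S.ae_posDef_of_prior_ne_zero z s] with q hq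
  by_cases h0 : S.prior z s q = 0
  · simp [jointWeight, h0]
  · have : q.1 ∉ Bᶜ := fun hc => hc (hq h0)
    simp [Set.indicator_of_notMem this]

/-- The weights of the mixture are the normalized joint density. -/
theorem ae_regimeDensity_mul_posterior {t : ℕ} (ht : t ≤ T) (z : 𝓩) {xs : ℕ → XIdx n → ℝ}
    (hZ : S.evidence t z xs ≠ ∞) (s : Fin T → Fin N) :
    ∀ᵐ q ∂(S.refCoef.prod S.refTrans),
      S.regimeDensity t z q s * S.posterior t z xs q s
        = (S.jointWeight t z xs s q / S.evidence t z xs).toReal := by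
  have hden : ∑ s' : Fin T → Fin N, ∫ q' : CoefPath n lk ly T × TransMat N,
        S.likelihood t z xs q'.1 * S.fCoef s' z q'.1
          * (∏ m ∈ Finset.Icc 1 T, S.stepProb z q'.2 s' m) * S.fTrans z q'.2
        ∂(S.refCoef.prod S.refTrans) = (S.evidence t z xs).toReal := by
    have hfin := fun s => ((ENNReal.sum_ne_top.1 hZ) s (Finset.mem_univ s))
    rw [evidence, ENNReal.toReal_sum fun s _ => hfin s]
    refine Finset.sum_congr rfl fun s' _ => ?_
    simp only [jointWeight]
    rw [← integral_eq_lintegral_of_nonneg_ae]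
    · refine integral_congr_ae (.of_forall fun q => ?_)
      simp only [prior]; ring
    · filter_upwards [S.ae_prior_nonneg z s'] with q hq
      exact mul_nonneg (S.likelihood_nonneg _ _ _ _) hq
    · exact ((S.measurable_likelihood measurable_const measurable_fst measurable_const t).mul
        (S.measurable_prior measurable_const measurable_id s')).aestronglyMeasurable
  filter_upwards [S.ae_prior_support z s, S.ae_prior_nonneg z s] with q hq hq0
  rw [posterior, hden, ENNReal.toReal_div, jointWeight,
    ENNReal.toReal_ofReal (mul_nonneg (S.likelihood_nonneg _ _ _ _) hq0), ← mul_div_assoc]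
  congr 1
  by_cases hf : S.fTrans z q.2 = 0
  · simp [prior, hf]
  have hstep := S.stepProb_nonneg z (hq.1 hf)
  have hw : ∀ s', 0 ≤ S.tailWeight t z q s' := fun s' =>
    mul_nonneg (S.fCoef_nonneg _ _ _) (Finset.prod_nonneg fun m _ => hstep s' m)
  have hmem : s ∈ (Finset.univ.filter fun s' : Fin T → Fin N =>
      ∀ i : Fin T, i.val < t → s' i = s i) := by simp
  have hle : S.tailWeight t z q s ≤ S.tailTotal t z q s :=
    Finset.single_le_sum (f := S.tailWeight t z q) (fun s' _ => hw s') hmem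
  have hprod : (∏ m ∈ Finset.Icc 1 T, S.stepProb z q.2 s m)
      = (∏ m ∈ Finset.Icc 1 t, S.stepProb z q.2 s m)
        * ∏ m ∈ Finset.Icc (t + 1) T, S.stepProb z q.2 s m := by
    have h1 : Finset.Icc 1 T = Finset.Ico 1 (T + 1) := rfl
    have h2 : Finset.Icc 1 t = Finset.Ico 1 (t + 1) := rfl
    have h3 : Finset.Icc (t + 1) T = Finset.Ico (t + 1) (T + 1) := rfl
    rw [h1, h2, h3, Finset.prod_Ico_consecutive _ (by omega) (by omega)]
  -- if the total weight vanishes, so does the weight, and `0 / 0 = 0` does no harm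
  have key : S.regimeDensity t z q s * S.tailTotal t z q s = S.tailWeight t z q s := by
    rw [regimeDensity]
    by_cases h0 : S.tailTotal t z q s = 0
    · have : S.tailWeight t z q s = 0 := le_antisymm (h0 ▸ hle) (hw s)
      rw [h0, this, mul_zero]
    · exact div_mul_cancel₀ _ h0
  calc S.regimeDensity t z q s * (S.likelihood t z xs q.1 * S.tailTotal t z q s
          * (∏ m ∈ Finset.Icc 1 t, S.stepProb z q.2 s m) * S.fTrans z q.2)
      = (S.regimeDensity t z q s * S.tailTotal t z q s) * (S.likelihood t z xs q.1
          * (∏ m ∈ Finset.Icc 1 t, S.stepProb z q.2 s m) * S.fTrans z q.2) := by ring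
    _ = S.likelihood t z xs q.1 * S.prior z s q := by
        rw [key, tailWeight, prior, hprod]; ring

/-- The mixture `⟨X⟩_t` is the posterior mean of `X`. -/
theorem mix_eq_integral {t : ℕ} (ht : t ≤ T) (z : 𝓩) {xs : ℕ → XIdx n → ℝ}
    (hZ0 : S.evidence t z xs ≠ 0) (hZ : S.evidence t z xs ≠ ∞) {X : CoefPath n lk ly T → ℝ}
    (hint : Integrable X (S.postLaw t z xs)) : S.mix t z xs X = ∫ c, X c ∂(S.postLaw t z xs) := by
  rw [postLaw, integrable_finsetSum_measure] at hint
  rw [postLaw, integral_finsetSum_measure hint]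
  refine Finset.sum_congr rfl fun s _ => ?_
  have hfin := ENNReal.sum_ne_top.1 hZ s (Finset.mem_univ s)
  rw [integral_map measurable_fst.aemeasurable (hint s (Finset.mem_univ s)).1,
    integral_withDensity_eq_integral_toReal_smul
      ((S.measurable_jointWeight_right t z xs s).div_const _)
      (.of_forall fun q => ENNReal.div_lt_top ENNReal.ofReal_ne_top hZ0)]
  refine integral_congr_ae ?_
  filter_upwards [S.ae_regimeDensity_mul_posterior ht z hZ s] with q hq
  rw [mul_assoc, hq, smul_eq_mul, mul_comm]

end Spec

namespace Elements

variable {n lk ly N T : ℕ} [NeZero T] {𝓩 : Type*} [MeasurableSpace 𝓩]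
  {Ω : Type*} [MeasurableSpace Ω] {M : Elements n lk ly N T 𝓩 Ω} {S : Spec n lk ly N T 𝓩}
  {Pr : Measure Ω} (hM : M.IsModel S Pr)
include hM

/-- Joint density of the observations up to `t` and the coefficients. -/
theorem IsModel.lintegral_jointWeight {t : ℕ} (ht : t ≤ T)
    {G : 𝓩 × CoefPath n lk ly T × (Fin T → XIdx n → ℝ) → ℝ≥0∞} (hG : Measurable G)
    (hGt : ∀ z c η η', (∀ j : Fin T, j.val < t → η j = η' j) → G (z, c, η) = G (z, c, η')) :
    ∫⁻ ω, G (M.init ω, M.coef ω, M.xPath S ω) ∂(M.riskNeutral S Pr)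
      = ∫⁻ z, ∫⁻ η, ∑ s, ∫⁻ q, S.jointWeight t z (Spec.pathOf (S.x0 z) η) s q * G (z, q.1, η)
          ∂(S.refCoef.prod S.refTrans) ∂(Spec.pathRef n T t) ∂(Pr.map M.init) := by
  have hm : Measurable fun a : Base n lk ly N T 𝓩 × (Fin T → XIdx n → ℝ) =>
      G (a.1.1, a.1.2.2.2, a.2) := hG.comp (by fun_prop)
  refine (hM.lintegral_riskNeutral hm).trans (lintegral_congr fun z => ?_)
  have hmw : ∀ s, Measurable fun b : (CoefPath n lk ly T × TransMat N) × (Fin T → XIdx n → ℝ) =>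
      S.jointWeight t z (Spec.pathOf (S.x0 z) b.2) s b.1 * G (z, b.1.1, b.2) := fun s =>
    (S.measurable_jointWeight measurable_const measurable_fst
      (Spec.measurable_pathOf measurable_const measurable_snd) t s).mul (hG.comp (by fun_prop))
  rw [lintegral_finsetSum]
  · refine Finset.sum_congr rfl fun s _ => ?_
    refine Eq.trans ?_ (lintegral_lintegral_swap (f := fun q η =>
      S.jointWeight t z (Spec.pathOf (S.x0 z) η) s q * G (z, q.1, η)) (hmw s).aemeasurable)
    refine lintegral_congr_ae ?_
    filter_upwards [S.ae_posDef_of_prior_ne_zero z s] with q hq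
    by_cases h0 : S.prior z s q = 0
    · simp [Spec.jointWeight, h0]
    · have hg : Measurable fun η => G (z, q.1, η) := hG.comp (by fun_prop)
      have h := S.lintegral_likelihood (hq h0) z ht 0 hg (hGt z q.1)
      refine (congrArg _ h).trans ?_
      have hml : Measurable fun η => ENNReal.ofReal
          (S.likelihood t z (Spec.pathOf (S.x0 z) η) q.1) * G (z, q.1, η) :=
        (S.measurable_likelihood (z := fun _ => z) (c := fun _ => q.1) measurable_const
          measurable_const (Spec.measurable_pathOf measurable_const measurable_id)
          t).ennreal_ofReal.mul hg
      rw [← lintegral_const_mul _ hml]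
      refine lintegral_congr fun η => ?_
      rw [Spec.jointWeight, ENNReal.ofReal_mul (S.likelihood_nonneg _ _ _ _)]
      ring
  · exact fun s _ => (hmw s).lintegral_prod_left'

theorem IsModel.ae_evidence_lt_top {t : ℕ} (ht : t ≤ T) :
    ∀ᵐ z ∂(Pr.map M.init), ∀ᵐ η ∂(Spec.pathRef n T t),
      S.evidence t z (Spec.pathOf (S.x0 z) η) < ∞ := by
  have := hM.isProbabilityMeasure_riskNeutral
  have h := hM.lintegral_jointWeight ht (G := fun _ => 1) measurable_const fun _ _ _ _ _ => rfl
  simp only [mul_one] at h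
  have hme := S.measurable_evidence t
  have h1 : ∫⁻ z, ∫⁻ η, S.evidence t z (Spec.pathOf (S.x0 z) η) ∂(Spec.pathRef n T t)
      ∂(Pr.map M.init) = 1 := by
    refine Eq.trans h.symm ?_
    rw [lintegral_const, measure_univ, one_mul]
  have hm : Measurable fun z => ∫⁻ η, S.evidence t z (Spec.pathOf (S.x0 z) η)
      ∂(Spec.pathRef n T t) := hme.lintegral_prod_right'
  have h2 := ae_lt_top hm (by rw [h1]; exact ENNReal.one_ne_top)
  filter_upwards [h2] with z hz
  exact ae_lt_top (S.measurable_evidence_right t z) hz.ne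

/-- The density of the observations, evaluated at the observations, is almost surely positive and
finite, so the posterior law is a genuine probability measure. -/
theorem IsModel.ae_evidence {t : ℕ} (ht : t ≤ T) : ∀ᵐ ω ∂(M.riskNeutral S Pr),
    S.evidence t (M.init ω) (fun m => M.x S m ω) ≠ 0 ∧
      S.evidence t (M.init ω) (fun m => M.x S m ω) ≠ ∞ := by
  have hme := S.measurable_evidence t
  -- the observations at which the evidence is zero or infinite
  set B : Set (𝓩 × (Fin T → XIdx n → ℝ)) :=
    {a | S.evidence t a.1 (Spec.pathOf (S.x0 a.1) a.2) = 0 ∨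
      S.evidence t a.1 (Spec.pathOf (S.x0 a.1) a.2) = ∞} with hBdef
  have hB : MeasurableSet B :=
    (hme (measurableSet_singleton 0)).union (hme (measurableSet_singleton ∞))
  have hcong : ∀ z (xs xs' : ℕ → XIdx n → ℝ), (∀ k ≤ t, xs k = xs' k) →
      S.evidence t z xs = S.evidence t z xs' := fun z xs xs' h => by
    simp only [Spec.evidence, Spec.jointWeight, S.likelihood_congr z h]
  have h := hM.lintegral_jointWeight ht (G := fun a => B.indicator 1 (a.1, a.2.2))
    ((measurable_one.indicator hB).comp (by fun_prop)) (fun z c η η' hη => by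
      have : S.evidence t z (Spec.pathOf (S.x0 z) η) = S.evidence t z (Spec.pathOf (S.x0 z) η') :=
        hcong _ _ _ fun k hk => Spec.pathOf_congr _ (hk.trans ht) fun j hj => hη j (by omega)
      simp [Set.indicator, hBdef, this])
  have hz : ∫⁻ z, ∫⁻ η, ∑ s, ∫⁻ q, S.jointWeight t z (Spec.pathOf (S.x0 z) η) s q
      * B.indicator 1 (z, η) ∂(S.refCoef.prod S.refTrans) ∂(Spec.pathRef n T t)
      ∂(Pr.map M.init) = 0 := by
    refine lintegral_eq_zero_of_ae_eq_zero ?_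
    filter_upwards [hM.ae_evidence_lt_top ht] with z hz
    refine lintegral_eq_zero_of_ae_eq_zero ?_
    filter_upwards [hz] with η hη
    have e : ∑ s, ∫⁻ q, S.jointWeight t z (Spec.pathOf (S.x0 z) η) s q
      * B.indicator 1 (z, η) ∂(S.refCoef.prod S.refTrans)
        = S.evidence t z (Spec.pathOf (S.x0 z) η) * B.indicator 1 (z, η) := by
      rw [Spec.evidence, Finset.sum_mul]
      refine Finset.sum_congr rfl fun s _ => ?_
      rw [lintegral_mul_const _ (S.measurable_jointWeight_right _ _ _ _)]
    simp only [e, Pi.zero_apply]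
    by_cases hb : (z, η) ∈ B
    · rcases hb with hb | hb
      · simp only at hb
        rw [hb, zero_mul]
      · exact absurd hb hη.ne
    · simp [hb]
  have h0 := h.trans hz
  have hmeas : Measurable fun ω => (M.init ω, M.xPath S ω) :=
    hM.meas_init.prodMk hM.measurable_xPath
  rw [ae_iff]
  have e : {ω | ¬ (S.evidence t (M.init ω) (fun m => M.x S m ω) ≠ 0 ∧
      S.evidence t (M.init ω) (fun m => M.x S m ω) ≠ ∞)}
      = (fun ω => (M.init ω, M.xPath S ω)) ⁻¹' B := by
    ext ω
    have : S.evidence t (M.init ω) (Spec.pathOf (S.x0 (M.init ω)) (M.xPath S ω))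
        = S.evidence t (M.init ω) (fun m => M.x S m ω) :=
      hcong _ _ _ fun k hk => M.pathOf_xPath S (hk.trans ht) ω
    simp only [Set.mem_ofPred_eq, Set.mem_preimage, hBdef, this]
    tauto
  rw [e, ← lintegral_indicator_one (hmeas hB)]
  exact h0

/-- Bayes' formula on the events of `F_t`: the coefficients may be redrawn from the posterior law.
-/
theorem IsModel.setLIntegral_sigF {t : ℕ} (ht : t ≤ T)
    {F : 𝓩 × CoefPath n lk ly T × (Fin T → XIdx n → ℝ) → ℝ≥0∞} (hF : Measurable F)
    (hFt : ∀ z c η η', (∀ j : Fin T, j.val < t → η j = η' j) → F (z, c, η) = F (z, c, η'))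
    {A : Set Ω} (hA : MeasurableSet[M.sigF S t] A) :
    Measurable[M.sigF S t] (fun ω => ∫⁻ c, F (M.init ω, c, M.xPath S ω)
      ∂(S.postLaw t (M.init ω) fun m => M.x S m ω)) ∧
    ∫⁻ ω in A, F (M.init ω, M.coef ω, M.xPath S ω) ∂(M.riskNeutral S Pr)
      = ∫⁻ ω in A, ∫⁻ c, F (M.init ω, c, M.xPath S ω)
          ∂(S.postLaw t (M.init ω) fun m => M.x S m ω) ∂(M.riskNeutral S Pr) := by
  have hA0 := hM.sigF_le t A hA
  rw [sigF_eq_comap ht] at hA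
  obtain ⟨B, hB, rfl⟩ := hA
  -- the posterior expectation as a function of the initial information and the path
  let K : 𝓩 × (Fin T → XIdx n → ℝ) → ℝ≥0∞ := fun a =>
    ∫⁻ c, F (a.1, c, a.2) ∂(S.postLaw t a.1 (Spec.pathOf (S.x0 a.1) a.2))
  have hFc : ∀ z η, Measurable fun c => F (z, c, η) := fun z η => hF.comp (by fun_prop)
  have hK : Measurable K := by
    have e : K = fun a => (∑ s, ∫⁻ q, S.jointWeight t a.1 (Spec.pathOf (S.x0 a.1) a.2) s q
        * F (a.1, q.1, a.2) ∂(S.refCoef.prod S.refTrans))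
          / S.evidence t a.1 (Spec.pathOf (S.x0 a.1) a.2) :=
      funext fun a => S.lintegral_postLaw t _ _ (hFc _ _)
    rw [e]
    refine Measurable.div ?_ (S.measurable_evidence t)
    refine Finset.measurable_sum _ fun s _ => ?_
    have h1 : Measurable fun b : (𝓩 × (Fin T → XIdx n → ℝ)) × (CoefPath n lk ly T
        × TransMat N) => F (b.1.1, b.2.1, b.1.2) := hF.comp (by fun_prop)
    exact ((S.measurable_jointWeight_pathOf t s).mul h1).lintegral_prod_right'
  have hpost : ∀ z (xs xs' : ℕ → XIdx n → ℝ), (∀ k ≤ t, xs k = xs' k) →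
      S.postLaw t z xs = S.postLaw t z xs' := fun z xs xs' h => by
    simp only [Spec.postLaw, Spec.evidence, Spec.jointWeight, S.likelihood_congr z h]
  have hKt : ∀ z η η', (∀ j : Fin T, j.val < t → η j = η' j) → K (z, η) = K (z, η') := by
    intro z η η' h
    simp only [K]
    rw [hpost z (Spec.pathOf (S.x0 z) η) (Spec.pathOf (S.x0 z) η') fun k hk =>
      Spec.pathOf_congr _ (hk.trans ht) fun j hj => h j (by omega)]
    exact lintegral_congr fun c => hFt _ _ _ _ h
  have hKω : ∀ ω, K (M.init ω, M.xPath S ω) = ∫⁻ c, F (M.init ω, c, M.xPath S ω)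
      ∂(S.postLaw t (M.init ω) fun m => M.x S m ω) := fun ω => by
    simp only [K]
    rw [hpost _ _ (fun m => M.x S m ω) fun k hk => M.pathOf_xPath S (hk.trans ht) ω]
  constructor
  · have h2 := hK.comp ((measurable_init_sigF t).prodMk (measurable_cutPath_sigF t) :
        Measurable[M.sigF S t] fun ω => (M.init ω, cutPath t (M.xPath S ω)))
    refine (congrArg (Measurable[M.sigF S t] ·) (funext fun ω => ?_)).mp h2
    rw [← hKω]
    exact hKt _ _ _ fun j hj => cutPath_apply_of_lt _ hj
  simp_rw [← hKω]
  rw [← lintegral_indicator hA0, ← lintegral_indicator hA0]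
  have hind : Measurable fun a : 𝓩 × CoefPath n lk ly T × (Fin T → XIdx n → ℝ) =>
      B.indicator (fun _ => (1 : ℝ≥0∞)) (a.1, cutPath t a.2.2) :=
    (measurable_const.indicator hB).comp (measurable_fst.prodMk
      ((measurable_cutPath t).comp measurable_snd.snd))
  have h1 := hM.lintegral_jointWeight ht (hind.mul hF) (fun z c η η' h => by
    simp only [Pi.mul_apply]
    rw [cutPath_congr h, hFt z c η η' h])
  have h2 := hM.lintegral_jointWeight ht
    (hind.mul (hK.comp (measurable_fst.prodMk measurable_snd.snd))) (fun z c η η' h => by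
    simp only [Pi.mul_apply, Function.comp_apply]
    rw [cutPath_congr h, hKt z η η' h])
  -- with respect to the joint density both sides are integrals over the observations, and they
  -- agree pointwise by the definition of the posterior law
  have h3 : ∫⁻ ω, B.indicator (fun _ => (1 : ℝ≥0∞)) (M.init ω, cutPath t (M.xPath S ω))
        * F (M.init ω, M.coef ω, M.xPath S ω) ∂(M.riskNeutral S Pr)
      = ∫⁻ ω, B.indicator (fun _ => (1 : ℝ≥0∞)) (M.init ω, cutPath t (M.xPath S ω))
        * K (M.init ω, M.xPath S ω) ∂(M.riskNeutral S Pr) := by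
    refine h1.trans (Eq.trans ?_ h2.symm)
    refine lintegral_congr_ae ?_
    filter_upwards [hM.ae_evidence_lt_top ht] with z hz
    refine lintegral_congr_ae ?_
    filter_upwards [hz] with η hη
    have hw := fun s => S.measurable_jointWeight_right t z (Spec.pathOf (S.x0 z) η) s
    simp only [Pi.mul_apply, Function.comp_apply]
    have e1 := S.evidence_mul_lintegral_postLaw hη.ne (hFc z η)
    have e2 : ∑ s, ∫⁻ q, S.jointWeight t z (Spec.pathOf (S.x0 z) η) s q
        * (B.indicator (fun _ => (1 : ℝ≥0∞)) (z, cutPath t η) * F (z, q.1, η))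
          ∂(S.refCoef.prod S.refTrans)
        = B.indicator (fun _ => (1 : ℝ≥0∞)) (z, cutPath t η)
          * ∑ s, ∫⁻ q, S.jointWeight t z (Spec.pathOf (S.x0 z) η) s q * F (z, q.1, η)
          ∂(S.refCoef.prod S.refTrans) := by
      rw [Finset.mul_sum]
      refine Finset.sum_congr rfl fun s _ => ?_
      refine Eq.trans ?_ (lintegral_const_mul _ ((hw s).mul ((hFc z η).comp measurable_fst)))
      exact lintegral_congr fun q => mul_left_comm _ _ _
    have e3 : ∑ s, ∫⁻ q, S.jointWeight t z (Spec.pathOf (S.x0 z) η) s q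
        * (B.indicator (fun _ => (1 : ℝ≥0∞)) (z, cutPath t η) * K (z, η))
          ∂(S.refCoef.prod S.refTrans)
        = S.evidence t z (Spec.pathOf (S.x0 z) η)
          * (B.indicator (fun _ => (1 : ℝ≥0∞)) (z, cutPath t η) * K (z, η)) := by
      rw [Spec.evidence, Finset.sum_mul]
      refine Finset.sum_congr rfl fun s _ => ?_
      rw [lintegral_mul_const _ (hw s)]
    rw [e2, e3, ← e1]
    simp only [K]
    ring
  refine Eq.trans ?_ (h3.trans ?_)
  all_goals
    refine lintegral_congr fun ω => ?_
    by_cases hω : (M.init ω, cutPath t (M.xPath S ω)) ∈ B <;> simp [Set.indicator, hω]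

/-- Bayes' formula: the conditional expectation given `F_t` of a function of the coefficients and
of the path up to `t` is its mixture. -/
theorem IsModel.condExp_sigF {t : ℕ} (ht : t ≤ T)
    {Y : 𝓩 × CoefPath n lk ly T × (Fin T → XIdx n → ℝ) → ℝ} (hY : Measurable Y)
    (hYt : ∀ z c η η', (∀ j : Fin T, j.val < t → η j = η' j) → Y (z, c, η) = Y (z, c, η'))
    (hint : Integrable (fun ω => Y (M.init ω, M.coef ω, M.xPath S ω)) (M.riskNeutral S Pr)) :
    (∀ᵐ ω ∂(M.riskNeutral S Pr), Integrable (fun c => Y (M.init ω, c, M.xPath S ω))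
      (S.postLaw t (M.init ω) fun m => M.x S m ω)) ∧
    (M.riskNeutral S Pr)[fun ω => Y (M.init ω, M.coef ω, M.xPath S ω) | M.sigF S t]
      =ᵐ[M.riskNeutral S Pr] fun ω => ∫ c, Y (M.init ω, c, M.xPath S ω)
          ∂(S.postLaw t (M.init ω) fun m => M.x S m ω) := by
  have := hM.isProbabilityMeasure_riskNeutral
  have hp := fun (A : Set Ω) (hA : MeasurableSet[M.sigF S t] A) =>
    hM.setLIntegral_sigF ht hY.ennreal_ofReal (fun z c η η' h => by rw [hYt z c η η' h]) hA
  have hn := fun (A : Set Ω) (hA : MeasurableSet[M.sigF S t] A) =>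
    hM.setLIntegral_sigF ht hY.neg.ennreal_ofReal (fun z c η η' h => by
      rw [Pi.neg_apply, Pi.neg_apply, hYt z c η η' h]) hA
  obtain ⟨hfin, hce⟩ := condExp_ae_eq_of_setLIntegral_eq (hM.sigF_le t) hint
    (hp _ MeasurableSet.univ).1 (hn _ MeasurableSet.univ).1 (fun A hA => (hp A hA).2)
    (fun A hA => (hn A hA).2)
  have hi : ∀ᵐ ω ∂(M.riskNeutral S Pr), Integrable (fun c => Y (M.init ω, c, M.xPath S ω))
      (S.postLaw t (M.init ω) fun m => M.x S m ω) := by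
    filter_upwards [hfin] with ω hω
    have hms : Measurable fun c => Y (M.init ω, c, M.xPath S ω) := hY.comp (by fun_prop)
    refine ⟨hms.aestronglyMeasurable, ?_⟩
    rw [hasFiniteIntegral_iff_norm]
    have e : ∀ r : ℝ, ENNReal.ofReal ‖r‖ = ENNReal.ofReal r + ENNReal.ofReal (-r) := fun r => by
      rcases le_total 0 r with h | h
      · rw [Real.norm_of_nonneg h, ENNReal.ofReal_of_nonpos (neg_nonpos.2 h), add_zero]
      · rw [Real.norm_of_nonpos h, ENNReal.ofReal_of_nonpos h, zero_add]
    simp_rw [e]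
    rw [lintegral_add_left hms.ennreal_ofReal]
    exact ENNReal.add_lt_top.2 hω
  refine ⟨hi, hce.trans ?_⟩
  filter_upwards [hi] with ω hω
  rw [integral_eq_lintegral_pos_part_sub_lintegral_neg_part hω]
  rfl

end Elements
end GordonHedge

namespace GordonHedge

/-! ### The affine form of the risk-neutral system and Gaussian pricing -/

section PathFunctionals

variable {τ ι κ : Type*} [Fintype τ] [Fintype ι]

theorem linPath_neg_sum (s : Finset κ) (w : κ → τ → ι → ℝ) (ζ : τ → ι → ℝ) :
    linPath (-∑ k ∈ s, w k) ζ = -∑ k ∈ s, linPath (w k) ζ := by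
  simp only [linPath, Pi.neg_apply, Finset.sum_apply, neg_dotProduct, sum_dotProduct,
    Finset.sum_neg_distrib]
  rw [Finset.sum_comm]

theorem covPath_neg_sum_right (S : τ → Matrix ι ι ℝ) (w : τ → ι → ℝ) (s : Finset κ)
    (v : κ → τ → ι → ℝ) : covPath S w (-∑ k ∈ s, v k) = -∑ k ∈ s, covPath S w (v k) := by
  simp only [covPath, Pi.neg_apply, Finset.sum_apply, Matrix.mulVec_neg, Matrix.mulVec_sum,
    dotProduct_neg, dotProduct_sum, Finset.sum_neg_distrib]
  rw [Finset.sum_comm]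

theorem covPath_neg_sum_left (S : τ → Matrix ι ι ℝ) (w : τ → ι → ℝ) (s : Finset κ)
    (v : κ → τ → ι → ℝ) : covPath S (-∑ k ∈ s, v k) w = -∑ k ∈ s, covPath S (v k) w := by
  simp only [covPath, Pi.neg_apply, Finset.sum_apply, neg_dotProduct, sum_dotProduct,
    Finset.sum_neg_distrib]
  rw [Finset.sum_comm]

end PathFunctionals

namespace Spec

variable {n lk ly N T : ℕ} [NeZero T] {𝓩 : Type*} [MeasurableSpace 𝓩] (S : Spec n lk ly N T 𝓩)

theorem sum_Icc_eq_sum_fin {R : Type*} [AddCommMonoid R] (f : ℕ → R) :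
    ∑ m ∈ Finset.Icc 1 T, f m = ∑ i : Fin T, f (i.val + 1) := by
  rw [Fin.sum_univ_eq_sum_range (fun i => f (i + 1)) T, Finset.range_eq_Ico,
    Finset.sum_Ico_add' f 0 T 1]
  rfl

/-- The matrix `R_{β,k} 𝖦_β` with which the noise of date `β` enters the state at date `k`. -/
noncomputable def loading (z : 𝓩) (c : CoefPath n lk ly T) (β k : ℕ) :
    Matrix (XIdx n) (XIdx n) ℝ :=
  S.Pi z c β k * (S.Q0 z β)⁻¹ * S.GG z β

/-- The coefficients of the noise path in `v'x_k`, given the state at `t`. -/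
noncomputable def loads (z : 𝓩) (c : CoefPath n lk ly T) (t k : ℕ) (v : XIdx n → ℝ) :
    Fin T → XIdx n → ℝ :=
  fun i => if t < i.val + 1 ∧ i.val + 1 ≤ k then v ᵥ* S.loading z c (i.val + 1) k else 0

theorem Pi_self (z : 𝓩) (c : CoefPath n lk ly T) (k : ℕ) : S.Pi z c k k = 1 := by
  simp [Pi, transProd]

theorem Pi_succ (z : 𝓩) (c : CoefPath n lk ly T) {β k : ℕ} (h : β ≤ k) :
    S.Pi z c β (k + 1) = (S.Q0 z (k + 1))⁻¹ * S.Q1 z c (k + 1) * S.Pi z c β k := by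
  have e : k + 1 - β = (k - β) + 1 := by omega
  have e2 : β + (k - β) + 1 = k + 1 := by omega
  simp only [Pi]
  rw [e, transProd, e2]

/-- The risk-neutral path is its conditional mean plus a linear function of the noise after `t`. -/
theorem rnPath_eq (z : 𝓩) (c : CoefPath n lk ly T) {t k : ℕ} (xs : ℕ → XIdx n → ℝ)
    (ζ : Fin T → XIdx n → ℝ) (h : t ≤ k) :
    S.rnPath z c t xs ζ k = S.rnMean z c t k (xs t)
      + ∑ β ∈ Finset.Ioc t k, S.loading z c β k *ᵥ ζ (dateIdx T β) := by
  induction k, h using Nat.le_induction with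
  | base => simp [S.rnPath_of_le z c xs ζ le_rfl, rnMean, Pi_self]
  | succ k hk ih =>
    have h1 : ¬ k + 1 ≤ t := by omega
    have hmem : Finset.Ioc t (k + 1) = insert (k + 1) (Finset.Ioc t k) := by
      ext m; simp only [Finset.mem_Ioc, Finset.mem_insert]; omega
    have hnot : k + 1 ∉ Finset.Ioc t k := by simp
    have hP : ∀ β ∈ Finset.Ioc t k,
        S.Pi z c β (k + 1) = (S.Q0 z (k + 1))⁻¹ * S.Q1 z c (k + 1) * S.Pi z c β k := fun β hβ =>
      S.Pi_succ z c (Finset.mem_Ioc.1 hβ).2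
    simp only [rnPath, h1, if_false, ih, rnStep, rnMean, hmem, Finset.sum_insert hnot]
    have s1 : ∑ β ∈ Finset.Ioc t k, (S.Pi z c β (k + 1) * (S.Q0 z β)⁻¹) *ᵥ S.nuTilde z c β
        = ((S.Q0 z (k + 1))⁻¹ * S.Q1 z c (k + 1)) *ᵥ
          ∑ β ∈ Finset.Ioc t k, (S.Pi z c β k * (S.Q0 z β)⁻¹) *ᵥ S.nuTilde z c β := by
      rw [Matrix.mulVec_sum]
      refine Finset.sum_congr rfl fun β hβ => ?_
      rw [hP β hβ, Matrix.mulVec_mulVec, Matrix.mul_assoc]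
    have s2 : ∑ β ∈ Finset.Ioc t k, S.loading z c β (k + 1) *ᵥ ζ (dateIdx T β)
        = ((S.Q0 z (k + 1))⁻¹ * S.Q1 z c (k + 1)) *ᵥ
          ∑ β ∈ Finset.Ioc t k, S.loading z c β k *ᵥ ζ (dateIdx T β) := by
      rw [Matrix.mulVec_sum]
      refine Finset.sum_congr rfl fun β hβ => ?_
      rw [loading, loading, hP β hβ, Matrix.mulVec_mulVec]
      simp only [Matrix.mul_assoc]
    rw [s1, s2, S.Pi_succ z c hk, loading, Pi_self, Matrix.one_mul]
    simp only [Matrix.mulVec_add, Matrix.mulVec_mulVec, Matrix.mul_assoc]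
    abel

theorem dotProduct_rnPath (z : 𝓩) (c : CoefPath n lk ly T) {t k : ℕ} (xs : ℕ → XIdx n → ℝ)
    (ζ : Fin T → XIdx n → ℝ) (h : t ≤ k) (hk : k ≤ T) (v : XIdx n → ℝ) :
    v ⬝ᵥ S.rnPath z c t xs ζ k
      = v ⬝ᵥ S.rnMean z c t k (xs t) + linPath (S.loads z c t k v) ζ := by
  rw [S.rnPath_eq z c xs ζ h, dotProduct_add, dotProduct_sum]
  congr 1
  have e : ∀ i : Fin T, S.loads z c t k v i ⬝ᵥ ζ i
      = (fun m => if t < m ∧ m ≤ k then v ⬝ᵥ (S.loading z c m k *ᵥ ζ (dateIdx T m)) else 0)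
        (i.val + 1) := by
    intro i
    simp only [loads, dateIdx_succ]
    split_ifs
    · rw [Matrix.dotProduct_mulVec]
    · rw [zero_dotProduct]
  rw [linPath, Finset.sum_congr rfl fun i _ => e i]
  refine Eq.trans ?_ (sum_Icc_eq_sum_fin fun m => if t < m ∧ m ≤ k then
    v ⬝ᵥ (S.loading z c m k *ᵥ ζ (dateIdx T m)) else 0)
  rw [← Finset.sum_filter]
  refine Finset.sum_congr ?_ fun _ _ => rfl
  ext m
  simp only [Finset.mem_Ioc, Finset.mem_filter, Finset.mem_Icc]
  omega

/-- The covariance of two linear functionals of the path is given by `Σ_{k,l|t}`. -/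
theorem covPath_loads (z : 𝓩) (c : CoefPath n lk ly T) {t k l : ℕ} (hk : k ≤ T)
    (v w : XIdx n → ℝ) : covPath (sigFam c) (S.loads z c t k v) (S.loads z c t l w)
      = v ⬝ᵥ (S.rnCov z c t k l *ᵥ w) := by
  have e : ∀ i : Fin T, S.loads z c t k v i ⬝ᵥ (sigFam c i *ᵥ S.loads z c t l w i)
      = (fun m => if t < m ∧ m ≤ min k l then
          v ⬝ᵥ ((S.loading z c m k * Sig c m * (S.loading z c m l)ᵀ) *ᵥ w) else 0)
        (i.val + 1) := by
    intro i
    have hs : Sig c (i.val + 1) = sigFam c i := by rw [Sig, sigFam, dateIdx_succ]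
    simp only [loads, hs]
    by_cases h1 : t < i.val + 1 ∧ i.val + 1 ≤ k
    · by_cases h2 : t < i.val + 1 ∧ i.val + 1 ≤ l
      · rw [if_pos h1, if_pos h2, if_pos ⟨h1.1, le_min h1.2 h2.2⟩, ← Matrix.mulVec_mulVec,
          ← Matrix.mulVec_mulVec, Matrix.dotProduct_mulVec v, Matrix.mulVec_transpose]
      · rw [if_neg h2, if_neg (show ¬ (t < i.val + 1 ∧ i.val + 1 ≤ min k l) from
          fun h => h2 ⟨h.1, (le_min_iff.1 h.2).2⟩),
          Matrix.mulVec_zero, dotProduct_zero]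
    · rw [if_neg h1, if_neg (show ¬ (t < i.val + 1 ∧ i.val + 1 ≤ min k l) from
        fun h => h1 ⟨h.1, (le_min_iff.1 h.2).1⟩), zero_dotProduct]
  rw [covPath, Finset.sum_congr rfl fun i _ => e i]
  refine (sum_Icc_eq_sum_fin fun m => if t < m ∧ m ≤ min k l then
    v ⬝ᵥ ((S.loading z c m k * Sig c m * (S.loading z c m l)ᵀ) *ᵥ w) else 0).symm.trans ?_
  rw [← Finset.sum_filter, rnCov, Matrix.sum_mulVec, dotProduct_sum]
  refine Finset.sum_congr ?_ fun _ _ => rfl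
  ext m
  simp only [Finset.mem_Ioc, Finset.mem_filter, Finset.mem_Icc]
  have := min_le_left k l
  omega

/-- A nonzero functional of the state after `t` depends on the noise, so its variance is positive.
-/
theorem loads_ne_zero (z : 𝓩) (c : CoefPath n lk ly T) {t k : ℕ} (h : t < k) (hk : k ≤ T)
    {v : XIdx n → ℝ} (hv : v ≠ 0) : S.loads z c t k v ≠ 0 := by
  intro h0
  have hd : (dateIdx T k).val = k - 1 := dateIdx_val (by omega) hk
  have h1 := congrFun h0 (dateIdx T k)
  have e : (dateIdx T k).val + 1 = k := by omega
  rw [loads, e, if_pos ⟨h, le_rfl⟩, loading, Pi_self, Matrix.one_mul] at h1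
  apply hv
  have hdet : ((S.Q0 z k)⁻¹ * S.GG z k).det ≠ 0 := by
    rw [Matrix.det_mul, Matrix.det_nonsing_inv, det_Q0, Ring.inverse_one, one_mul]
    exact S.det_GG_ne_zero z k
  exact Matrix.eq_zero_of_vecMul_eq_zero hdet h1

/-- The coefficients of the noise path in the logarithm of `D_u / D_t`. -/
noncomputable def rateLoads (z : 𝓩) (c : CoefPath n lk ly T) (t u : ℕ) : Fin T → XIdx n → ℝ :=
  -∑ β ∈ Finset.Ico (t + 1) u, S.loads z c t β (Pi.single (rIdx n) 1)

/-- The change of the noise path under the forward measure. -/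
noncomputable def fwdShift (z : 𝓩) (c : CoefPath n lk ly T) (t u : ℕ) : Fin T → XIdx n → ℝ :=
  fun i => sigFam c i *ᵥ S.rateLoads z c t u i

theorem exp_neg_sum_rnPath (z : 𝓩) (c : CoefPath n lk ly T) {t u : ℕ} (xs : ℕ → XIdx n → ℝ)
    (ζ : Fin T → XIdx n → ℝ) (h : t < u) (hu : u ≤ T) :
    Real.exp (-∑ β ∈ Finset.Ico t u, S.rnPath z c t xs ζ β (rIdx n))
      = Real.exp (-xs t (rIdx n) - ∑ β ∈ Finset.Ico (t + 1) u, S.rnMean z c t β (xs t) (rIdx n))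
        * Real.exp (linPath (S.rateLoads z c t u) ζ) := by
  rw [← Real.exp_add, rateLoads, linPath_neg_sum, Finset.sum_eq_sum_Ico_succ_bot h,
    S.rnPath_of_le z c xs ζ le_rfl]
  have e : ∀ β ∈ Finset.Ico (t + 1) u, S.rnPath z c t xs ζ β (rIdx n)
      = S.rnMean z c t β (xs t) (rIdx n)
        + linPath (S.loads z c t β (Pi.single (rIdx n) 1)) ζ := by
    intro β hβ
    obtain ⟨h1, h2⟩ := Finset.mem_Ico.1 hβ
    have := S.dotProduct_rnPath z c xs ζ (by omega : t ≤ β) (by omega) (Pi.single (rIdx n) 1)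
    simpa using this
  rw [Finset.sum_congr rfl e, Finset.sum_add_distrib]
  congr 1
  ring

/-- The bond price `B_{t,u}` is the mean of the lognormal variable whose exponent has the
coefficients `rateLoads`. -/
theorem bond_eq (z : 𝓩) (c : CoefPath n lk ly T) {t u : ℕ} (x : XIdx n → ℝ) (hu : u ≤ T) :
    S.bond z c t u x
      = Real.exp (-x (rIdx n) - ∑ β ∈ Finset.Ico (t + 1) u, S.rnMean z c t β x (rIdx n))
        * Real.exp (covPath (sigFam c) (S.rateLoads z c t u) (S.rateLoads z c t u) / 2) := by
  rw [bond, ← Real.exp_add, rateLoads, covPath_neg_sum_left]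
  congr 3
  rw [← Finset.sum_neg_distrib]
  refine Finset.sum_congr rfl fun α hα => ?_
  rw [covPath_neg_sum_right, neg_neg]
  refine Finset.sum_congr rfl fun β _ => ?_
  rw [S.covPath_loads z c (by have := (Finset.mem_Ico.1 hα).2; omega)]
  simp

/-- Discounting to the maturity `u` is a change of measure that shifts the noise. -/
theorem integral_discount {F : Type*} [NormedAddCommGroup F] [NormedSpace ℝ F] {z : 𝓩}
    {c : CoefPath n lk ly T} (hc : ∀ i, (sigFam c i).PosDef) {t u : ℕ} (xs : ℕ → XIdx n → ℝ)
    (h : t < u) (hu : u ≤ T) (f : (Fin T → XIdx n → ℝ) → F) :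
    (Integrable (fun ζ =>
        Real.exp (-∑ β ∈ Finset.Ico t u, S.rnPath z c t xs ζ β (rIdx n)) • f ζ) (noiseLaw c)
      ↔ Integrable (fun ζ => f (ζ + S.fwdShift z c t u)) (noiseLaw c)) ∧
    ∫ ζ, Real.exp (-∑ β ∈ Finset.Ico t u, S.rnPath z c t xs ζ β (rIdx n)) • f ζ ∂(noiseLaw c)
      = S.bond z c t u (xs t) • ∫ ζ, f (ζ + S.fwdShift z c t u) ∂(noiseLaw c) := by
  simp_rw [S.exp_neg_sum_rnPath z c xs _ h hu, mul_smul]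
  constructor
  · exact (integrable_smul_iff (Real.exp_pos _).ne' _).trans (integrable_exp_linPath_smul hc _ f)
  · rw [integral_smul, S.bond_eq z c (xs t) hu, mul_smul]
    congr 1
    exact integral_exp_linPath hc _ f

theorem lintegral_discount {z : 𝓩} {c : CoefPath n lk ly T} (hc : ∀ i, (sigFam c i).PosDef)
    {t u : ℕ} (xs : ℕ → XIdx n → ℝ) (h : t < u) (hu : u ≤ T) :
    ∫⁻ ζ, ENNReal.ofReal (Real.exp (-∑ β ∈ Finset.Ico t u, S.rnPath z c t xs ζ β (rIdx n)))
      ∂(noiseLaw c) = ENNReal.ofReal (S.bond z c t u (xs t)) := by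
  have := isProbabilityMeasure_gaussPath hc
  have hl := lintegral_exp_linPath hc (S.rateLoads z c t u) (f := fun _ => 1) measurable_const
  simp only [mul_one, lintegral_const, measure_univ] at hl
  simp_rw [S.exp_neg_sum_rnPath z c xs _ h hu, ENNReal.ofReal_mul (Real.exp_nonneg _)]
  have hm : Measurable fun ζ => ENNReal.ofReal (Real.exp (linPath (S.rateLoads z c t u) ζ)) :=
    (Real.measurable_exp.comp (measurable_linPath _)).ennreal_ofReal
  rw [lintegral_const_mul _ hm, noiseLaw, hl,
    S.bond_eq z c (xs t) hu, ENNReal.ofReal_mul (Real.exp_nonneg _)]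

/-- Under the forward measure the path has mean `fwdMean` and the loadings of the risk-neutral path.
-/
theorem dotProduct_rnPath_fwdShift (z : 𝓩) (c : CoefPath n lk ly T) {t u k : ℕ}
    (xs : ℕ → XIdx n → ℝ) (ζ : Fin T → XIdx n → ℝ) (h : t ≤ k) (hk : k ≤ T)
    (v : XIdx n → ℝ) : v ⬝ᵥ S.rnPath z c t xs (ζ + S.fwdShift z c t u) k
      = v ⬝ᵥ S.fwdMean z c t u k (xs t) + linPath (S.loads z c t k v) ζ := by
  have e1 : linPath (S.loads z c t k v) (S.fwdShift z c t u)
      = covPath (sigFam c) (S.loads z c t k v) (S.rateLoads z c t u) := rfl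
  have e2 : S.fwdMean z c t u k (xs t) = S.rnMean z c t k (xs t)
      - ∑ β ∈ Finset.Ico (t + 1) u, S.rnCov z c t k β *ᵥ Pi.single (rIdx n) 1 := by
    funext a
    simp [fwdMean, Finset.sum_apply]
  rw [S.dotProduct_rnPath z c xs _ h hk, linPath_add_right, e1, rateLoads, covPath_neg_sum_right,
    e2, dotProduct_sub, dotProduct_sum]
  simp_rw [S.covPath_loads z c hk]
  ring

/-! ### Prices and gains as functions of the noise -/

/-- The coefficients of the noise path in the log price of asset `i` at date `k`, given the state at
`t`. -/
noncomputable def priceLoads (z : 𝓩) (c : CoefPath n lk ly T) (t k : ℕ) (i : Fin n) :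
    Fin T → XIdx n → ℝ :=
  S.loads z c t k (Pi.single (Sum.inl i) 1)

/-- The coefficients of the noise path in the component `a` of the exponent `π`, given the state at
`t`. -/
noncomputable def piLoads (z : 𝓩) (c : CoefPath n lk ly T) (t : ℕ) (a : Fin n) :
    Fin T → XIdx n → ℝ :=
  S.loads z c t (t + 1) (S.W z (t + 1) a)

theorem price_rnPath_fwdShift (z : 𝓩) (c : CoefPath n lk ly T) {t u k : ℕ}
    (xs : ℕ → XIdx n → ℝ) (ζ : Fin T → XIdx n → ℝ) (h : t ≤ k) (hk : k ≤ T) (i : Fin n) :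
    S.rnPath z c t xs (ζ + S.fwdShift z c t u) k (Sum.inl i)
      = S.priceMean z c t u k (xs t) i + linPath (S.priceLoads z c t k i) ζ := by
  have := S.dotProduct_rnPath_fwdShift z c (u := u) xs ζ h hk (Pi.single (Sum.inl i) 1)
  simpa [priceMean, priceLoads] using this

theorem piVec_rnPath_fwdShift (z : 𝓩) (c : CoefPath n lk ly T) {t u : ℕ}
    (xs : ℕ → XIdx n → ℝ) (ζ : Fin T → XIdx n → ℝ) (ht : t < T) (a : Fin n) :
    S.piVec z t (xs t) (S.rnPath z c t xs (ζ + S.fwdShift z c t u) (t + 1)) a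
      = S.piMean z c t u (xs t) a + linPath (S.piLoads z c t a) ζ := by
  have := S.dotProduct_rnPath_fwdShift z c (u := u) xs ζ (by omega : t ≤ t + 1) ht
    (S.W z (t + 1) a)
  simp only [piVec, piMean, Pi.add_apply, Pi.sub_apply, piLoads, Matrix.mulVec] at this ⊢
  rw [this]
  ring

theorem covPath_priceLoads (z : 𝓩) (c : CoefPath n lk ly T) {t k : ℕ} (hk : k ≤ T)
    (i j : Fin n) : covPath (sigFam c) (S.priceLoads z c t k i) (S.priceLoads z c t k j)
      = S.priceCov z c t k i j := by
  rw [priceLoads, priceLoads, S.covPath_loads z c hk]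
  simp [priceCov, Matrix.toBlocks₁₁]

theorem covPath_piLoads (z : 𝓩) (c : CoefPath n lk ly T) {t : ℕ} (ht : t < T) (a b : Fin n) :
    covPath (sigFam c) (S.piLoads z c t a) (S.piLoads z c t b) = S.piCov z c t a b := by
  rw [piLoads, piLoads, S.covPath_loads z c ht, piCov, Matrix.dotProduct_mulVec]
  rfl

theorem covPath_piLoads_priceLoads (z : 𝓩) (c : CoefPath n lk ly T) {t k : ℕ} (ht : t < T)
    (a i : Fin n) : covPath (sigFam c) (S.piLoads z c t a) (S.priceLoads z c t k i)
      = S.piPriceCov z c t k a i := by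
  have h : S.piPriceCov z c t k = S.W z (t + 1) * S.rnCov z c t (t + 1) k
      * (Matrix.fromCols 1 0 : Matrix (Fin n) (XIdx n) ℝ)ᵀ := rfl
  have e : (Matrix.fromCols 1 0 : Matrix (Fin n) (XIdx n) ℝ) i = Pi.single (Sum.inl i) 1 := by
    funext b
    rcases b with b | b
    · simp [Matrix.fromCols, Matrix.one_apply, Pi.single_apply, eq_comm]
    · simp [Matrix.fromCols]
  rw [piLoads, priceLoads, S.covPath_loads z c ht, h, Matrix.dotProduct_mulVec, ← e]
  rfl

theorem covPath_priceLoads_pos {z : 𝓩} {c : CoefPath n lk ly T}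
    (hc : ∀ i, (sigFam c i).PosDef) {t k : ℕ} (h : t < k) (hk : k ≤ T) (i : Fin n) :
    0 < covPath (sigFam c) (S.priceLoads z c t k i) (S.priceLoads z c t k i) :=
  covPath_self_pos hc (S.loads_ne_zero z c h hk (by simp))

end Spec
end GordonHedge

namespace GordonHedge

/-! ### Discounted gains -/

namespace Spec

variable {n lk ly N T : ℕ} [NeZero T] {𝓩 : Type*} [MeasurableSpace 𝓩] (S : Spec n lk ly N T 𝓩)

/-- The discount factor `D_k` as a function of the path. -/
noncomputable def pathD (z : 𝓩) (k : ℕ) (η : Fin T → XIdx n → ℝ) : ℝ :=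
  Real.exp (-∑ m ∈ Finset.Icc 1 k, pathOf (S.x0 z) η (m - 1) (rIdx n))

/-- The price vector at date `k` as a function of the path. -/
noncomputable def pathP (z : 𝓩) (k : ℕ) (η : Fin T → XIdx n → ℝ) : Fin n → ℝ :=
  fun i => Real.exp (pathOf (S.x0 z) η k (Sum.inl i))

/-- The discounted value at `t + 1` of a share bought at `t`, dividend included, as a function of
the path. -/
noncomputable def pathCum (z : 𝓩) (t : ℕ) (η : Fin T → XIdx n → ℝ) : Fin n → ℝ :=
  fun a => S.pathD z t η
    * Real.exp (S.piVec z t (pathOf (S.x0 z) η t) (pathOf (S.x0 z) η (t + 1)) a)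

/-- The discounted gain of period `t + 1` as a function of the path. -/
noncomputable def pathGain (z : 𝓩) (t : ℕ) (η : Fin T → XIdx n → ℝ) : Fin n → ℝ :=
  fun a => S.pathCum z t η a - S.pathD z t η * S.pathP z t η a

section Measurability

variable {α : Type*} [MeasurableSpace α] {z : α → 𝓩} {η : α → Fin T → XIdx n → ℝ}
  (hz : Measurable z) (hη : Measurable η)
include hz hη

theorem measurable_pathOf_apply (k : ℕ) (b : XIdx n) :
    Measurable fun a => pathOf (S.x0 (z a)) (η a) k b :=
  (measurable_pi_apply b).comp ((measurable_pi_apply k).comp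
    (measurable_pathOf (S.meas_x0.comp hz) hη))

theorem measurable_pathD (k : ℕ) : Measurable fun a => S.pathD (z a) k (η a) :=
  Real.measurable_exp.comp (Finset.measurable_sum _ fun m _ =>
    S.measurable_pathOf_apply hz hη (m - 1) _).neg

theorem measurable_pathP (k : ℕ) : Measurable fun a => S.pathP (z a) k (η a) :=
  measurable_pi_lambda _ fun _ => Real.measurable_exp.comp (S.measurable_pathOf_apply hz hη k _)

theorem entryMeasurable_W (t : ℕ) : EntryMeasurable fun a => S.W (z a) t := by
  have h := (S.entryMeasurable_G hz t).inv
  rintro i (j | j | j)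
  · exact h i j
  · exact measurable_const.sub (h i j)
  · exact measurable_const

theorem measurable_piVec (t : ℕ) : Measurable fun a =>
    S.piVec (z a) t (pathOf (S.x0 (z a)) (η a) t) (pathOf (S.x0 (z a)) (η a) (t + 1)) := by
  have hp := fun k => (measurable_pi_apply k).comp (measurable_pathOf (S.meas_x0.comp hz) hη)
  have h1 := (S.entryMeasurable_W hz hη (t + 1)).mulVec (hp (t + 1))
  have h2 := (S.entryMeasurable_G hz (t + 1)).inv.mulVec (S.measurable_hlin hz (t + 1))
  exact (h1.sub (measurable_pi_lambda _ fun _ => S.measurable_pathOf_apply hz hη t _)).add h2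

theorem measurable_pathCum (t : ℕ) (b : Fin n) :
    Measurable fun a => S.pathCum (z a) t (η a) b :=
  (S.measurable_pathD hz hη t).mul (Real.measurable_exp.comp
    ((measurable_pi_apply b).comp (S.measurable_piVec hz hη t)))

theorem measurable_pathGain (t : ℕ) (b : Fin n) :
    Measurable fun a => S.pathGain (z a) t (η a) b :=
  (S.measurable_pathCum hz hη t b).sub ((S.measurable_pathD hz hη t).mul
    ((measurable_pi_apply b).comp (S.measurable_pathP hz hη t)))

end Measurability

theorem inv_G (z : 𝓩) (t : ℕ) :
    (S.G z t)⁻¹ = Matrix.diagonal fun i => (S.g z t i)⁻¹ := by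
  refine Matrix.inv_eq_right_inv ?_
  rw [G, Matrix.diagonal_mul_diagonal, ← Matrix.diagonal_one]
  congr 1
  funext i
  exact mul_inv_cancel₀ (S.g_pos z t i).ne'

theorem piVec_apply (z : 𝓩) (t : ℕ) (x x' : XIdx n → ℝ) (a : Fin n) :
    S.piVec z t x x' a = (S.g z (t + 1) a)⁻¹ * x' (Sum.inl a)
      + (1 - (S.g z (t + 1) a)⁻¹) * x' (Sum.inr (Sum.inl a)) - x (rIdx n)
      + (S.g z (t + 1) a)⁻¹ * S.hlin z (t + 1) a := by
  have h1 : (1 : Matrix (Fin n) (Fin n) ℝ) - (S.G z (t + 1))⁻¹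
      = Matrix.diagonal fun i => 1 - (S.g z (t + 1) i)⁻¹ := by
    rw [inv_G, ← Matrix.diagonal_one, Matrix.diagonal_sub]
  simp only [piVec, W, h1, Pi.add_apply, Pi.sub_apply]
  rw [inv_G, Matrix.fromCols_mulVec, Matrix.fromCols_mulVec]
  simp [Matrix.mulVec_diagonal]

/-- Along the risk-neutral system the discounted cumulative return is a Gaussian exponential. -/
theorem piVec_rnStep (z : 𝓩) (c : CoefPath n lk ly T) (t : ℕ) (x ζ : XIdx n → ℝ) (a : Fin n) :
    S.piVec z t x (S.rnStep z c (t + 1) x ζ) a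
      = x (Sum.inl a) - Suu c (t + 1) a a / 2 + ζ (Sum.inl a) := by
  have h := congrFun (S.Q0_mulVec_rnStep z c (t + 1) x ζ) (Sum.inl a)
  set x' := S.rnStep z c (t + 1) x ζ
  rw [Q0, GG, Matrix.fromBlocks_mulVec, Matrix.fromBlocks_mulVec, Q1_mulVec] at h
  simp only [H_mulVec, Matrix.one_mulVec, Matrix.zero_mulVec, add_zero, Pi.add_apply,
    Sum.elim_inl, nuTilde, G, Matrix.sub_mulVec, Pi.sub_apply, Matrix.mulVec_diagonal,
    Function.comp_apply] at h
  rw [piVec_apply]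
  have hg := inv_mul_cancel₀ (S.g_pos z (t + 1) a).ne'
  linear_combination (S.g z (t + 1) a)⁻¹ * h - (x' (Sum.inr (Sum.inl a))
    + Suu c (t + 1) a a / 2 - x (rIdx n) - x (Sum.inl a) - ζ (Sum.inl a)) * hg

/-- The functional that picks the component `a` of the noise of the period `t + 1`. -/
noncomputable def unitLoads (n : ℕ) (T : ℕ) [NeZero T] (t : ℕ) (a : Fin n) : Fin T → XIdx n → ℝ :=
  Pi.single (dateIdx T (t + 1)) (Pi.single (Sum.inl a) 1)

theorem linPath_unitLoads (t : ℕ) (a : Fin n) (ζ : Fin T → XIdx n → ℝ) :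
    linPath (unitLoads n T t a) ζ = ζ (dateIdx T (t + 1)) (Sum.inl a) := by
  rw [linPath, Finset.sum_eq_single (dateIdx T (t + 1))]
  · simp [unitLoads]
  · intro j _ hj
    simp [unitLoads, Pi.single_eq_of_ne hj]
  · simp

theorem covPath_unitLoads (c : CoefPath n lk ly T) (t : ℕ) (a b : Fin n) :
    covPath (sigFam c) (unitLoads n T t a) (unitLoads n T t b) = Suu c (t + 1) a b := by
  rw [covPath, Finset.sum_eq_single (dateIdx T (t + 1))]
  · simp [unitLoads, Suu, Sig, sigFam, Matrix.toBlocks₁₁]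
  · intro j _ hj
    simp [unitLoads, Pi.single_eq_of_ne hj]
  · simp

theorem isProbabilityMeasure_noiseLaw {c : CoefPath n lk ly T}
    (hc : ∀ i, (sigFam c i).PosDef) : IsProbabilityMeasure (noiseLaw c) :=
  isProbabilityMeasure_gaussPath hc

theorem integrable_exp_noiseLaw {c : CoefPath n lk ly T} (hc : ∀ i, (sigFam c i).PosDef)
    (w : Fin T → XIdx n → ℝ) : Integrable (fun ζ => Real.exp (linPath w ζ)) (noiseLaw c) :=
  integrable_exp_linPath hc w

theorem integral_exp_linPath_one {c : CoefPath n lk ly T} (hc : ∀ i, (sigFam c i).PosDef)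
    (w : Fin T → XIdx n → ℝ) : ∫ ζ, Real.exp (linPath w ζ) ∂(noiseLaw c)
      = Real.exp (covPath (sigFam c) w w / 2) := by
  have := isProbabilityMeasure_gaussPath hc
  have h := integral_exp_linPath hc w fun _ => (1 : ℝ)
  simp only [smul_eq_mul, mul_one, integral_const, probReal_univ] at h
  exact h

theorem pathOf_contPath_le (z : 𝓩) (c : CoefPath n lk ly T) {t : ℕ} (ht : t ≤ T)
    (η ζ : Fin T → XIdx n → ℝ) {k : ℕ} (hk : k ≤ t) :
    pathOf (S.x0 z) (S.contPath z c t η ζ) k = pathOf (S.x0 z) η k := by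
  rw [S.pathOf_contPath z c t η ζ (hk.trans ht), S.rnPath_of_le z c _ _ hk]

theorem pathD_contPath_of_le (z : 𝓩) (c : CoefPath n lk ly T) {t : ℕ} (ht : t ≤ T)
    (η ζ : Fin T → XIdx n → ℝ) {k : ℕ} (hk : k ≤ t + 1) :
    S.pathD z k (S.contPath z c t η ζ) = S.pathD z k η := by
  unfold pathD
  congr 2
  refine Finset.sum_congr rfl fun m hm => ?_
  obtain ⟨h1, h2⟩ := Finset.mem_Icc.1 hm
  rw [S.pathOf_contPath_le z c ht η ζ (by omega)]

theorem pathD_contPath (z : 𝓩) (c : CoefPath n lk ly T) {t k : ℕ} (h : t ≤ k) (hk : k ≤ T)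
    (η ζ : Fin T → XIdx n → ℝ) : S.pathD z k (S.contPath z c t η ζ) = S.pathD z t η
      * Real.exp (-∑ β ∈ Finset.Ico t k, S.rnPath z c t (pathOf (S.x0 z) η) ζ β (rIdx n)) := by
  rw [← S.pathD_contPath_of_le z c (h.trans hk) η ζ (Nat.le_succ t)]
  unfold pathD
  rw [← Real.exp_add, ← neg_add]
  congr 2
  have e : ∀ m ∈ Finset.Ico t k, S.rnPath z c t (pathOf (S.x0 z) η) ζ m (rIdx n)
      = pathOf (S.x0 z) (S.contPath z c t η ζ) m (rIdx n) := fun m hm => by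
    rw [S.pathOf_contPath z c t η ζ (by have := (Finset.mem_Ico.1 hm).2; omega)]
  have hI : ∀ j, ∑ m ∈ Finset.Icc 1 j, pathOf (S.x0 z) (S.contPath z c t η ζ) (m - 1) (rIdx n)
      = ∑ m ∈ Finset.Ico 0 j, pathOf (S.x0 z) (S.contPath z c t η ζ) m (rIdx n) := fun j => by
    have : Finset.Icc 1 j = Finset.Ico (0 + 1) (j + 1) := rfl
    rw [this, ← Finset.sum_Ico_add' (fun m => pathOf (S.x0 z) (S.contPath z c t η ζ) (m - 1)
      (rIdx n)) 0 j 1]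
    simp
  rw [Finset.sum_congr rfl e, hI, hI, Finset.sum_Ico_consecutive _ (Nat.zero_le _) h]

theorem pathP_contPath_of_le (z : 𝓩) (c : CoefPath n lk ly T) {t : ℕ} (ht : t ≤ T)
    (η ζ : Fin T → XIdx n → ℝ) {k : ℕ} (hk : k ≤ t) :
    S.pathP z k (S.contPath z c t η ζ) = S.pathP z k η := by
  unfold pathP
  rw [S.pathOf_contPath_le z c ht η ζ hk]

theorem pathCum_contPath (z : 𝓩) (c : CoefPath n lk ly T) {t : ℕ} (ht : t < T)
    (η ζ : Fin T → XIdx n → ℝ) (a : Fin n) :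
    S.pathCum z t (S.contPath z c t η ζ) a = S.pathD z t η * S.pathP z t η a
      * Real.exp (linPath (unitLoads n T t a) ζ - Suu c (t + 1) a a / 2) := by
  have h1 : ¬ t + 1 ≤ t := by omega
  rw [pathCum, S.pathD_contPath_of_le z c ht.le η ζ (Nat.le_succ t),
    S.pathOf_contPath_le z c ht.le η ζ le_rfl, S.pathOf_contPath z c t η ζ ht, rnPath, if_neg h1,
    S.rnPath_of_le z c _ _ le_rfl, S.piVec_rnStep, linPath_unitLoads, pathP, mul_assoc,
    ← Real.exp_add]
  congr 2
  ring

/-- The gain of the next period is the discounted price times `Y - 1`, with `Y` lognormal of mean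
one. -/
theorem pathGain_contPath (z : 𝓩) (c : CoefPath n lk ly T) {t : ℕ} (ht : t < T)
    (η ζ : Fin T → XIdx n → ℝ) (a : Fin n) :
    S.pathGain z t (S.contPath z c t η ζ) a = S.pathD z t η * S.pathP z t η a
      * (Real.exp (linPath (unitLoads n T t a) ζ - Suu c (t + 1) a a / 2) - 1) := by
  rw [pathGain, S.pathCum_contPath z c ht, S.pathD_contPath_of_le z c ht.le η ζ (Nat.le_succ t),
    S.pathP_contPath_of_le z c ht.le η ζ le_rfl]
  ring

/-- Discounted gains have mean zero given the coefficients and the past. -/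
theorem integral_pathGain {z : 𝓩} {c : CoefPath n lk ly T} (hc : ∀ i, (sigFam c i).PosDef)
    {t : ℕ} (ht : t < T) (η : Fin T → XIdx n → ℝ) (a : Fin n) :
    ∫ ζ, S.pathGain z t (S.contPath z c t η ζ) a ∂(noiseLaw c) = 0 := by
  have := isProbabilityMeasure_noiseLaw hc
  have hI := integrable_exp_noiseLaw hc (unitLoads n T t a)
  have h1 := integral_exp_linPath_one hc (unitLoads n T t a)
  rw [covPath_unitLoads] at h1
  have i1 : Integrable (fun ζ => Real.exp (linPath (unitLoads n T t a) ζ)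
      / Real.exp (Suu c (t + 1) a a / 2)) (noiseLaw c) := hI.div_const _
  simp only [S.pathGain_contPath z c ht, Real.exp_sub]
  rw [integral_const_mul, integral_sub i1 (integrable_const _), integral_div, h1,
    div_self (Real.exp_pos _).ne', integral_const, probReal_univ, one_smul, sub_self, mul_zero]

/-- The covariance of the gains given the coefficients and the past. -/
theorem integral_pathGain_mul {z : 𝓩} {c : CoefPath n lk ly T}
    (hc : ∀ i, (sigFam c i).PosDef) {t : ℕ} (ht : t < T) (η : Fin T → XIdx n → ℝ) (a b : Fin n) :
    ∫ ζ, S.pathGain z t (S.contPath z c t η ζ) a * S.pathGain z t (S.contPath z c t η ζ) b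
        ∂(noiseLaw c)
      = (Real.exp (Suu c (t + 1) a b) - 1) * ((S.pathD z t η * S.pathP z t η a)
          * (S.pathD z t η * S.pathP z t η b)) := by
  have := isProbabilityMeasure_noiseLaw hc
  set wa := unitLoads n T t a
  set wb := unitLoads n T t b
  have hIa := integrable_exp_noiseLaw hc wa
  have hIb := integrable_exp_noiseLaw hc wb
  have hIab := integrable_exp_noiseLaw hc (wa + wb)
  have ha := integral_exp_linPath_one hc wa
  have hb := integral_exp_linPath_one hc wb
  have hab := integral_exp_linPath_one hc (wa + wb)
  have hcov : covPath (sigFam c) (wa + wb) (wa + wb) = Suu c (t + 1) a a + Suu c (t + 1) b b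
      + 2 * Suu c (t + 1) a b := by
    rw [covPath_add_left, covPath_add_right, covPath_add_right, covPath_comm hc wb wa,
      covPath_unitLoads, covPath_unitLoads, covPath_unitLoads]
    ring
  rw [covPath_unitLoads] at ha hb
  rw [hcov] at hab
  set sa := Suu c (t + 1) a a
  set sb := Suu c (t + 1) b b
  set r := Suu c (t + 1) a b
  set A := S.pathD z t η * S.pathP z t η a
  set B := S.pathD z t η * S.pathP z t η b
  -- expand the product into four exponentials of linear functionals
  have e : ∀ ζ, S.pathGain z t (S.contPath z c t η ζ) a * S.pathGain z t (S.contPath z c t η ζ) b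
      = (A * B) * (Real.exp (-sa / 2 - sb / 2) * Real.exp (linPath (wa + wb) ζ)
        - Real.exp (-sa / 2) * Real.exp (linPath wa ζ)
        - Real.exp (-sb / 2) * Real.exp (linPath wb ζ) + 1) := by
    intro ζ
    rw [S.pathGain_contPath z c ht, S.pathGain_contPath z c ht]
    rw [← Real.exp_add, ← Real.exp_add, ← Real.exp_add, linPath_add_left]
    have e1 : -sa / 2 - sb / 2 + (linPath wa ζ + linPath wb ζ)
        = (linPath wa ζ - sa / 2) + (linPath wb ζ - sb / 2) := by ring
    have e2 : -sa / 2 + linPath wa ζ = linPath wa ζ - sa / 2 := by ring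
    have e3 : -sb / 2 + linPath wb ζ = linPath wb ζ - sb / 2 := by ring
    rw [e1, e2, e3, Real.exp_add]
    ring
  simp_rw [e]
  have i1 := hIab.const_mul (Real.exp (-sa / 2 - sb / 2))
  have i2 := hIa.const_mul (Real.exp (-sa / 2))
  have i3 := hIb.const_mul (Real.exp (-sb / 2))
  have i12 : Integrable (fun ζ => Real.exp (-sa / 2 - sb / 2) * Real.exp (linPath (wa + wb) ζ)
      - Real.exp (-sa / 2) * Real.exp (linPath wa ζ)) (noiseLaw c) := i1.sub i2
  have i123 : Integrable (fun ζ => Real.exp (-sa / 2 - sb / 2) * Real.exp (linPath (wa + wb) ζ)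
      - Real.exp (-sa / 2) * Real.exp (linPath wa ζ)
      - Real.exp (-sb / 2) * Real.exp (linPath wb ζ)) (noiseLaw c) := i12.sub i3
  rw [integral_const_mul, integral_add i123 (integrable_const _), integral_sub i12 i3,
    integral_sub i1 i2, integral_const_mul, integral_const_mul, integral_const_mul, ha, hb, hab,
    integral_const, probReal_univ, ← Real.exp_add, ← Real.exp_add, ← Real.exp_add, one_smul]
  have e5 : -sa / 2 - sb / 2 + (sa + sb + 2 * r) / 2 = r := by ring
  have e6 : -sa / 2 + sa / 2 = 0 := by ring
  have e7 : -sb / 2 + sb / 2 = 0 := by ring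
  rw [e5, e6, e7, Real.exp_zero]
  ring

end Spec

namespace Elements

variable {n lk ly N T : ℕ} [NeZero T] {𝓩 : Type*} [MeasurableSpace 𝓩]
  {Ω : Type*} [MeasurableSpace Ω] (M : Elements n lk ly N T 𝓩 Ω) (S : Spec n lk ly N T 𝓩)

theorem pathD_xPath {k : ℕ} (hk : k ≤ T + 1) (ω : Ω) :
    S.pathD (M.init ω) k (M.xPath S ω) = M.D S k ω := by
  unfold Spec.pathD D rate
  congr 2
  refine Finset.sum_congr rfl fun m hm => ?_
  obtain ⟨h1, h2⟩ := Finset.mem_Icc.1 hm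
  rw [M.pathOf_xPath S (by omega)]

theorem pathP_xPath {k : ℕ} (hk : k ≤ T) (ω : Ω) :
    S.pathP (M.init ω) k (M.xPath S ω) = M.P S k ω := by
  funext i
  rw [Spec.pathP, M.pathOf_xPath S hk, P]

/-- The identity `D_{t+1}(P_{t+1} + d_{t+1}) = D_t e^π`. -/
theorem D_mul_cumPrice {t : ℕ} (ω : Ω) (a : Fin n) :
    M.D S (t + 1) ω * M.cumPrice S (t + 1) ω a
      = M.D S t ω * Real.exp (S.piVec (M.init ω) t (M.x S t ω) (M.x S (t + 1) ω) a) := by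
  have hg := (S.g_pos (M.init ω) (t + 1) a).ne'
  rw [Spec.piVec_apply, D, D, Finset.sum_Icc_succ_top (by omega), cumPrice, P, logReturn,
    Nat.add_sub_cancel, ← Real.exp_add, ← Real.exp_add, ← Real.exp_add, rate, Spec.hlin,
    Nat.add_sub_cancel]
  congr 1
  field_simp
  ring

theorem gain_eq_pathGain {t : ℕ} (ht : t < T) (ω : Ω) (a : Fin n) :
    M.gain S (t + 1) ω a = S.pathGain (M.init ω) t (M.xPath S ω) a := by
  rw [gain, D_mul_cumPrice, Spec.pathGain, Spec.pathCum, M.pathD_xPath S (by omega),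
    M.pathP_xPath S ht.le, M.pathOf_xPath S ht.le, M.pathOf_xPath S ht, Nat.add_sub_cancel, discP]

end Elements
end GordonHedge

namespace GordonHedge

/-! ### The conditional covariance matrix of the gains -/

/-- The entrywise exponential of a positive definite matrix, minus the all-ones matrix, is positive
definite: every Hadamard power contributes a positive semidefinite term, and the first power a
positive definite one. -/
theorem sum_exp_sub_one_pos {ι : Type*} [Fintype ι] [DecidableEq ι] {A : Matrix ι ι ℝ}
    (hA : A.PosDef) {w : ι → ℝ} (hw : w ≠ 0) :
    0 < ∑ a, ∑ b, w a * w b * (Real.exp (A a b) - 1) := by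
  have hpow : ∀ k : ℕ, (Matrix.of fun a b => A a b ^ k : Matrix ι ι ℝ).PosSemidef := by
    intro k
    induction k with
    | zero =>
      have h := Matrix.posSemidef_vecMulVec_self_star (fun _ : ι => (1 : ℝ))
      convert h using 1
      ext a b
      simp [Matrix.vecMulVec_apply]
    | succ k ih =>
      have h := ih.hadamard hA.posSemidef
      have e : (Matrix.of fun a b => A a b ^ (k + 1) : Matrix ι ι ℝ)
          = Matrix.hadamard (Matrix.of fun a b => A a b ^ k) A := by
        ext a b
        simp [Matrix.hadamard_apply, pow_succ]
      rw [e]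
      exact h
  have hq : ∀ k : ℕ, 0 ≤ ∑ a, ∑ b, w a * w b * A a b ^ k := by
    intro k
    have h := (hpow k).dotProduct_mulVec_nonneg w
    refine h.trans_eq ?_
    simp only [dotProduct, Matrix.mulVec, Matrix.of_apply, Finset.mul_sum, Pi.star_apply,
      star_trivial]
    exact Finset.sum_congr rfl fun a _ => Finset.sum_congr rfl fun b _ => by ring
  have h1 : 0 < ∑ a, ∑ b, w a * w b * A a b := by
    have h := hA.dotProduct_mulVec_pos hw
    refine h.trans_eq ?_
    simp only [dotProduct, Matrix.mulVec, Finset.mul_sum, Pi.star_apply, star_trivial]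
    exact Finset.sum_congr rfl fun a _ => Finset.sum_congr rfl fun b _ => by ring
  have hs : HasSum (fun k : ℕ => ∑ a, ∑ b, w a * w b * (A a b ^ k / (k.factorial : ℝ)))
      (∑ a, ∑ b, w a * w b * Real.exp (A a b)) := by
    refine hasSum_sum fun a _ => hasSum_sum fun b _ => HasSum.mul_left _ ?_
    rw [Real.exp_eq_exp_ℝ]
    exact NormedSpace.expSeries_div_hasSum_exp (A a b)
  have hle := sum_le_hasSum (Finset.range 2) (fun k _ => by
    have e : ∑ a, ∑ b, w a * w b * (A a b ^ k / (k.factorial : ℝ))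
        = (∑ a, ∑ b, w a * w b * A a b ^ k) / (k.factorial : ℝ) := by
      simp only [Finset.sum_div]
      exact Finset.sum_congr rfl fun a _ => Finset.sum_congr rfl fun b _ => by ring
    rw [e]
    exact div_nonneg (hq k) (Nat.cast_nonneg _)) hs
  rw [Finset.sum_range_succ, Finset.sum_range_one] at hle
  simp only [pow_zero, pow_one, Nat.factorial_zero, Nat.factorial_one, Nat.cast_one, div_one,
    mul_one] at hle
  simp only [mul_sub, mul_one, Finset.sum_sub_distrib]
  linarith

namespace Spec

variable {n lk ly N T : ℕ} [NeZero T] {𝓩 : Type*} [MeasurableSpace 𝓩] (S : Spec n lk ly N T 𝓩)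

theorem measurable_integral_noiseLaw {α : Type*} [MeasurableSpace α]
    {c : α → CoefPath n lk ly T} (hc : Measurable c)
    {f : α × (Fin T → XIdx n → ℝ) → ℝ} (hf : Measurable f) :
    Measurable fun a => ∫ ζ, f (a, ζ) ∂(noiseLaw (c a)) := by
  have h : (fun a => ∫ ζ, f (a, ζ) ∂(noiseLaw (c a))) = fun a =>
      ∫ ζ, (∏ i, ENNReal.ofReal (normalDensity (sigFam (c a) i) (ζ i))).toReal • f (a, ζ) := by
    funext a
    rw [noiseLaw, gaussPath, integral_withDensity_eq_integral_toReal_smul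
      (measurable_prod_normalDensity _)
      (.of_forall fun ζ => ENNReal.prod_lt_top fun _ _ => ENNReal.ofReal_lt_top)]
  rw [h]
  have hm : Measurable fun p : α × (Fin T → XIdx n → ℝ) =>
      (∏ i, ENNReal.ofReal (normalDensity (sigFam (c p.1) i) (p.2 i))).toReal • f p :=
    (measurable_prod_sigFam (hc.comp measurable_fst) measurable_snd).ennreal_toReal.smul hf
  exact hm.stronglyMeasurable.integral_prod_right'.measurable

theorem posDef_Suu {c : CoefPath n lk ly T} (hc : ∀ i, (sigFam c i).PosDef) (t : ℕ) :
    (Suu c t).PosDef :=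
  (hc (dateIdx T t)).submatrix Sum.inl_injective

end Spec

namespace Elements

variable {n lk ly N T : ℕ} [NeZero T] {𝓩 : Type*} [MeasurableSpace 𝓩]
  {Ω : Type*} [MeasurableSpace Ω] {M : Elements n lk ly N T 𝓩 Ω} {S : Spec n lk ly N T 𝓩}
  {Pr : Measure Ω} (hM : M.IsModel S Pr)
include hM

/-- Conditional expectations given `H_t` and `F_t` of a functional of the initial information and
the path whose Gaussian integral is known. -/
theorem IsModel.condExp_of_integral {t : ℕ} (ht : t ≤ T)
    {Y : 𝓩 × (Fin T → XIdx n → ℝ) → ℝ} (hY : Measurable Y)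
    (hint : Integrable (fun ω => Y (M.init ω, M.xPath S ω)) (M.riskNeutral S Pr))
    {C : Ω → CoefPath n lk ly T → ℝ}
    (hC : ∀ ω c, (∀ i, (Spec.sigFam c i).PosDef) →
      ∫ ζ, Y (M.init ω, S.contPath (M.init ω) c t (M.xPath S ω) ζ) ∂(Spec.noiseLaw c) = C ω c) :
    ((M.riskNeutral S Pr)[fun ω => Y (M.init ω, M.xPath S ω) | M.sigH S t]
      =ᵐ[M.riskNeutral S Pr] fun ω => C ω (M.coef ω)) ∧
    (∀ᵐ ω ∂(M.riskNeutral S Pr),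
      Integrable (C ω) (S.postLaw t (M.init ω) fun m => M.x S m ω)) ∧
    (∀ᵐ ω ∂(M.riskNeutral S Pr), S.mix t (M.init ω) (fun m => M.x S m ω) (C ω)
      = ∫ c, C ω c ∂(S.postLaw t (M.init ω) fun m => M.x S m ω)) ∧
    (M.riskNeutral S Pr)[fun ω => Y (M.init ω, M.xPath S ω) | M.sigF S t]
      =ᵐ[M.riskNeutral S Pr] fun ω => S.mix t (M.init ω) (fun m => M.x S m ω) (C ω) := by
  have := hM.isProbabilityMeasure_riskNeutral
  obtain ⟨-, hH⟩ := hM.condExp_sigH ht (Y := fun a => Y (a.1.1, a.2)) (hY.comp (by fun_prop)) hint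
  -- the Gaussian integral as a measurable function of initial information, coefficients and path
  let K : 𝓩 × CoefPath n lk ly T × (Fin T → XIdx n → ℝ) → ℝ := fun a =>
    ∫ ζ, Y (a.1, S.contPath a.1 a.2.1 t a.2.2 ζ) ∂(Spec.noiseLaw a.2.1)
  have hK : Measurable K := by
    refine Spec.measurable_integral_noiseLaw (f := fun b : (𝓩 × CoefPath n lk ly T
      × (Fin T → XIdx n → ℝ)) × (Fin T → XIdx n → ℝ) =>
        Y (b.1.1, S.contPath b.1.1 b.1.2.1 t b.1.2.2 b.2)) (by fun_prop) (hY.comp ?_)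
    exact measurable_fst.fst.prodMk (S.measurable_contPath measurable_fst.fst
      measurable_fst.snd.fst t measurable_fst.snd.snd measurable_snd)
  have hKt : ∀ z c η η', (∀ j : Fin T, j.val < t → η j = η' j) → K (z, c, η) = K (z, c, η') := by
    intro z c η η' h
    simp only [K]
    refine integral_congr_ae (.of_forall fun ζ => ?_)
    simp only [S.contPath_congr z c ht h]
  have hH' : (M.riskNeutral S Pr)[fun ω => Y (M.init ω, M.xPath S ω) | M.sigH S t]
      =ᵐ[M.riskNeutral S Pr] fun ω => K (M.init ω, M.coef ω, M.xPath S ω) := hH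
  obtain ⟨hi, hF⟩ := hM.condExp_sigF ht hK hKt (integrable_condExp.congr hH')
  have htower : (M.riskNeutral S Pr)[fun ω => Y (M.init ω, M.xPath S ω) | M.sigF S t]
      =ᵐ[M.riskNeutral S Pr]
        (M.riskNeutral S Pr)[fun ω => K (M.init ω, M.coef ω, M.xPath S ω) | M.sigF S t] :=
    (condExp_condExp_of_le (sigF_le_sigH t) (hM.sigH_le t)).symm.trans (condExp_congr_ae hH')
  have hCK : ∀ ω, C ω =ᵐ[S.postLaw t (M.init ω) fun m => M.x S m ω]
      fun c => K (M.init ω, c, M.xPath S ω) := fun ω => by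
    filter_upwards [S.ae_postLaw_posDef t (M.init ω) fun m => M.x S m ω] with c hc
    exact (hC ω c hc).symm
  have hCi : ∀ᵐ ω ∂(M.riskNeutral S Pr),
      Integrable (C ω) (S.postLaw t (M.init ω) fun m => M.x S m ω) := by
    filter_upwards [hi] with ω hω
    exact hω.congr (hCK ω).symm
  have hmixeq : ∀ᵐ ω ∂(M.riskNeutral S Pr), S.mix t (M.init ω) (fun m => M.x S m ω) (C ω)
      = ∫ c, C ω c ∂(S.postLaw t (M.init ω) fun m => M.x S m ω) := by
    filter_upwards [hM.ae_evidence ht, hCi] with ω hω hiω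
    exact S.mix_eq_integral ht _ hω.1 hω.2 hiω
  refine ⟨?_, ?_, ?_, ?_⟩
  · filter_upwards [hH', hM.ae_posDef] with ω hω hpd
    rw [hω]
    exact hC ω _ hpd
  · exact hCi
  · exact hmixeq
  · filter_upwards [htower, hF, hmixeq] with ω h1 h2 h3
    rw [h1, h2, h3]
    exact integral_congr_ae (hCK ω).symm

section Gains

variable (hgain : ∀ t < T, ∀ i, MemLp (fun ω => M.gain S (t + 1) ω i) 2 (M.riskNeutral S Pr))
include hgain

/-- Discounted gains are martingale differences, both for `H_t` and for `F_t`. -/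
theorem IsModel.condExp_gain {t : ℕ} (ht : t < T) (a : Fin n) :
    (M.riskNeutral S Pr)[fun ω => M.gain S (t + 1) ω a | M.sigH S t]
      =ᵐ[M.riskNeutral S Pr] 0 ∧
    (M.riskNeutral S Pr)[fun ω => M.gain S (t + 1) ω a | M.sigF S t]
      =ᵐ[M.riskNeutral S Pr] 0 := by
  have := hM.isProbabilityMeasure_riskNeutral
  have hint := (hgain t ht a).integrable one_le_two
  have e : (fun ω => M.gain S (t + 1) ω a)
      = fun ω => S.pathGain (M.init ω) t (M.xPath S ω) a :=
    funext fun ω => M.gain_eq_pathGain S ht ω a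
  rw [e] at hint ⊢
  obtain ⟨h1, -, -, h4⟩ := hM.condExp_of_integral ht.le
    (Y := fun b => S.pathGain b.1 t b.2 a)
    (S.measurable_pathGain measurable_fst measurable_snd t a) hint (C := fun _ _ => 0)
    fun ω c hc => S.integral_pathGain hc ht _ a
  refine ⟨h1, h4.trans (.of_forall fun ω => ?_)⟩
  simp [Spec.mix]

/-- The conditional second moments of the gains given `H_t`, and their mixture given `F_t`. -/
theorem IsModel.condExp_gain_mul_gain {t : ℕ} (ht : t < T) (a b : Fin n) :
    ((M.riskNeutral S Pr)[fun ω => M.gain S (t + 1) ω a * M.gain S (t + 1) ω b | M.sigH S t]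
      =ᵐ[M.riskNeutral S Pr] fun ω => M.omegaH S t ω a b) ∧
    (∀ᵐ ω ∂(M.riskNeutral S Pr), Integrable (fun c => (Real.exp (Spec.Suu c (t + 1) a b) - 1)
        * (M.discP S t ω a * M.discP S t ω b))
      (S.postLaw t (M.init ω) fun m => M.x S m ω)) ∧
    (∀ᵐ ω ∂(M.riskNeutral S Pr), M.omegaMixed S t ω a b
      = ∫ c, (Real.exp (Spec.Suu c (t + 1) a b) - 1) * (M.discP S t ω a * M.discP S t ω b)
          ∂(S.postLaw t (M.init ω) fun m => M.x S m ω)) ∧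
    (M.riskNeutral S Pr)[fun ω => M.gain S (t + 1) ω a * M.gain S (t + 1) ω b | M.sigF S t]
      =ᵐ[M.riskNeutral S Pr] fun ω => M.omegaMixed S t ω a b := by
  have hint : Integrable (fun ω => M.gain S (t + 1) ω a * M.gain S (t + 1) ω b)
      (M.riskNeutral S Pr) := (hgain t ht a).integrable_mul (hgain t ht b)
  have e : (fun ω => M.gain S (t + 1) ω a * M.gain S (t + 1) ω b)
      = fun ω => S.pathGain (M.init ω) t (M.xPath S ω) a
        * S.pathGain (M.init ω) t (M.xPath S ω) b := by
    funext ω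
    rw [M.gain_eq_pathGain S ht, M.gain_eq_pathGain S ht]
  rw [e] at hint ⊢
  have h := hM.condExp_of_integral ht.le
    (Y := fun q => S.pathGain q.1 t q.2 a * S.pathGain q.1 t q.2 b)
    ((S.measurable_pathGain measurable_fst measurable_snd t a).mul
      (S.measurable_pathGain measurable_fst measurable_snd t b)) hint
    (C := fun ω c => (Real.exp (Spec.Suu c (t + 1) a b) - 1)
        * (M.discP S t ω a * M.discP S t ω b))
    fun ω c hc => by
      rw [S.integral_pathGain_mul hc ht, M.pathD_xPath S (by omega), M.pathP_xPath S ht.le]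
      rfl
  exact h

/-- The mixture is an average of positive definite matrices under the posterior law. -/
theorem IsModel.ae_posDef_omegaMixed {t : ℕ} (ht : t < T) :
    ∀ᵐ ω ∂(M.riskNeutral S Pr), (M.omegaMixed S t ω).PosDef := by
  have h1 : ∀ᵐ ω ∂(M.riskNeutral S Pr), ∀ a b,
      Integrable (fun c => (Real.exp (Spec.Suu c (t + 1) a b) - 1)
        * (M.discP S t ω a * M.discP S t ω b))
        (S.postLaw t (M.init ω) fun m => M.x S m ω) :=
    ae_all_iff.2 fun a => ae_all_iff.2 fun b =>
      (hM.condExp_gain_mul_gain hgain ht a b).2.1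
  have h2 : ∀ᵐ ω ∂(M.riskNeutral S Pr), ∀ a b, M.omegaMixed S t ω a b
      = ∫ c, (Real.exp (Spec.Suu c (t + 1) a b) - 1) * (M.discP S t ω a * M.discP S t ω b)
          ∂(S.postLaw t (M.init ω) fun m => M.x S m ω) :=
    ae_all_iff.2 fun a => ae_all_iff.2 fun b =>
      (hM.condExp_gain_mul_gain hgain ht a b).2.2.1
  filter_upwards [h1, h2, hM.ae_evidence ht.le] with ω hi he hev
  have hprob := S.isProbabilityMeasure_postLaw hev.1 hev.2
  have hpd := S.ae_postLaw_posDef t (M.init ω) fun m => M.x S m ω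
  set ν := S.postLaw t (M.init ω) fun m => M.x S m ω
  have hp : ∀ a, 0 < M.discP S t ω a := fun a =>
    mul_pos (Real.exp_pos _) (Real.exp_pos _)
  refine Matrix.PosDef.of_dotProduct_mulVec_pos ?_ fun v hv => ?_
  · refine Matrix.IsHermitian.ext fun a b => ?_
    rw [star_trivial, he, he]
    refine integral_congr_ae ?_
    filter_upwards [hpd] with c hc
    have hs : Spec.Suu c (t + 1) b a = Spec.Suu c (t + 1) a b := by
      simpa using (Spec.posDef_Suu hc (t + 1)).isHermitian.apply a b
    simp only [hs, mul_comm (M.discP S t ω b)]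
  · have e : star v ⬝ᵥ (M.omegaMixed S t ω *ᵥ v)
        = ∫ c, ∑ a, ∑ b, v a * v b * ((Real.exp (Spec.Suu c (t + 1) a b) - 1)
            * (M.discP S t ω a * M.discP S t ω b)) ∂ν := by
      rw [integral_finsetSum _ fun a _ => integrable_finsetSum _ fun b _ =>
        (hi a b).const_mul _]
      simp only [dotProduct, Matrix.mulVec, Finset.mul_sum, Pi.star_apply, star_trivial]
      refine Finset.sum_congr rfl fun a _ => ?_
      rw [integral_finsetSum _ fun b _ => (hi a b).const_mul _]
      refine Finset.sum_congr rfl fun b _ => ?_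
      rw [he, integral_const_mul]
      ring
    rw [e]
    -- strict positivity survives averaging, because it holds for almost every coefficient path
    have hpos : ∀ᵐ c ∂ν, 0 < ∑ a, ∑ b, v a * v b * ((Real.exp (Spec.Suu c (t + 1) a b) - 1)
            * (M.discP S t ω a * M.discP S t ω b)) := by
      filter_upwards [hpd] with c hc
      have hw : (fun a => v a * M.discP S t ω a) ≠ 0 := by
        obtain ⟨a, ha⟩ := Function.ne_iff.1 hv
        exact Function.ne_iff.2 ⟨a, mul_ne_zero ha (hp a).ne'⟩
      refine (sum_exp_sub_one_pos (Spec.posDef_Suu hc (t + 1)) hw).trans_eq ?_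
      exact Finset.sum_congr rfl fun a _ => Finset.sum_congr rfl fun b _ => by ring
    rw [integral_pos_iff_support_of_nonneg_ae (hpos.mono fun c hc => hc.le)
      (integrable_finsetSum _ fun a _ => integrable_finsetSum _ fun b _ => (hi a b).const_mul _)]
    have : ν (Function.support fun c => ∑ a, ∑ b, v a * v b
        * ((Real.exp (Spec.Suu c (t + 1) a b) - 1) * (M.discP S t ω a * M.discP S t ω b))) = 1 := by
      rw [← measure_univ (μ := ν)]
      refine measure_congr ?_
      filter_upwards [hpos] with c hc
      exact propext ⟨fun _ => trivial, fun _ => hc.ne'⟩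
    rw [this]
    exact one_pos

end Gains

end Elements
end GordonHedge

namespace GordonHedge

/-! ### The lifetime -/

namespace Elements

variable {n lk ly N T : ℕ} [NeZero T] {𝓩 : Type*} [MeasurableSpace 𝓩]
  {Ω : Type*} [MeasurableSpace Ω] {M : Elements n lk ly N T 𝓩 Ω} {S : Spec n lk ly N T 𝓩}
  {Pr : Measure Ω}

theorem sigF_mono {s t : ℕ} (h : s ≤ t) : M.sigF S s ≤ M.sigF S t :=
  sup_le_sup le_rfl (iSup₂_le fun m hm => le_iSup₂_of_le (f := fun m (_ : m ∈ Finset.Icc 1 t) =>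
    MeasurableSpace.comap (M.x S m) inferInstance) m
      (Finset.Icc_subset_Icc le_rfl h hm) le_rfl)

theorem sigH_mono {s t : ℕ} (h : s ≤ t) : M.sigH S s ≤ M.sigH S t :=
  sup_le_sup (sup_le_sup (sup_le_sup (sigF_mono h) le_rfl) le_rfl) le_rfl

theorem sigLife_mono {s t : ℕ} (h : s ≤ t) : M.sigLife s ≤ M.sigLife t :=
  MeasurableSpace.generateFrom_mono fun _ ⟨u, h0, h1, e⟩ =>
    ⟨u, h0, h1.trans (Nat.cast_le.2 h), e⟩

theorem sigFx_mono {s t : ℕ} (h : s ≤ t) : M.sigFx S s ≤ M.sigFx S t :=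
  sup_le_sup (sigF_mono h) (sigLife_mono h)

/-- The noise of period `k` as a function of the initial information, the coefficients, and the
states before and after. -/
noncomputable def _root_.GordonHedge.Spec.noiseOf (S : Spec n lk ly N T 𝓩) (k : ℕ)
    (q : 𝓩 × CoefPath n lk ly T × (XIdx n → ℝ) × (XIdx n → ℝ)) : XIdx n → ℝ :=
  (S.GG q.1 k)⁻¹ *ᵥ (S.Q0 q.1 k *ᵥ q.2.2.1 - S.nuTilde q.1 q.2.1 k - S.Q1 q.1 q.2.1 k *ᵥ q.2.2.2)
    + S.noiseShift q.1 q.2.1 k q.2.2.2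

theorem _root_.GordonHedge.Spec.measurable_noiseOf (S : Spec n lk ly N T 𝓩) (k : ℕ) :
    Measurable (S.noiseOf k) := by
  have h1 : EntryMeasurable fun q : 𝓩 × CoefPath n lk ly T × (XIdx n → ℝ) × (XIdx n → ℝ) =>
      (S.GG q.1 k)⁻¹ := (S.entryMeasurable_GG measurable_fst k).inv
  have h2 : Measurable fun q : 𝓩 × CoefPath n lk ly T × (XIdx n → ℝ) × (XIdx n → ℝ) =>
      S.Q0 q.1 k *ᵥ q.2.2.1 := (S.entryMeasurable_Q0 measurable_fst k).mulVec measurable_snd.snd.fst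
  have h3 : Measurable fun q : 𝓩 × CoefPath n lk ly T × (XIdx n → ℝ) × (XIdx n → ℝ) =>
      S.nuTilde q.1 q.2.1 k := S.measurable_nuTilde measurable_fst measurable_snd.fst k
  have h4 : Measurable fun q : 𝓩 × CoefPath n lk ly T × (XIdx n → ℝ) × (XIdx n → ℝ) =>
      S.Q1 q.1 q.2.1 k *ᵥ q.2.2.2 :=
    (S.entryMeasurable_Q1 measurable_fst measurable_snd.fst k).mulVec measurable_snd.snd.snd
  have h5 : Measurable fun q : 𝓩 × CoefPath n lk ly T × (XIdx n → ℝ) × (XIdx n → ℝ) =>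
      S.noiseShift q.1 q.2.1 k q.2.2.2 :=
    S.measurable_noiseShift measurable_fst measurable_snd.fst k measurable_snd.snd.snd
  have h6 : Measurable fun q : 𝓩 × CoefPath n lk ly T × (XIdx n → ℝ) × (XIdx n → ℝ) =>
      (S.GG q.1 k)⁻¹ *ᵥ (S.Q0 q.1 k *ᵥ q.2.2.1 - S.nuTilde q.1 q.2.1 k
        - S.Q1 q.1 q.2.1 k *ᵥ q.2.2.2) := h1.mulVec ((h2.sub h3).sub h4)
  exact h6.add h5

/-- The noise is recovered from the path and the coefficients. -/
theorem noise_eq (k : ℕ) (ω : Ω) :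
    M.noise ω (dateIdx T (k + 1))
      = S.noiseOf (k + 1) (M.init ω, M.coef ω, M.x S (k + 1) ω, M.x S k ω) := by
  rw [Spec.noiseOf]
  set z := M.init ω
  set c := M.coef ω
  set ζ := M.noise ω (dateIdx T (k + 1)) - S.noiseShift z c (k + 1) (M.x S k ω) with hζ
  have h : M.x S (k + 1) ω = S.rnStep z c (k + 1) (M.x S k ω) ζ := by
    rw [← S.step_add_noiseShift, hζ, sub_add_cancel]
    rfl
  have e : S.Q0 z (k + 1) *ᵥ M.x S (k + 1) ω - S.nuTilde z c (k + 1)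
      - S.Q1 z c (k + 1) *ᵥ M.x S k ω = S.GG z (k + 1) *ᵥ ζ := by
    rw [h, S.Q0_mulVec_rnStep]
    abel
  rw [e, Matrix.mulVec_mulVec, Matrix.nonsing_inv_mul _
    (isUnit_iff_ne_zero.2 (S.det_GG_ne_zero z (k + 1))), Matrix.one_mulVec, hζ, sub_add_cancel]

theorem measurable_noise_sigH : Measurable[M.sigH S T] M.noise := by
  have hb := measurable_base_sigH (M := M) (S := S) T
  have hz : Measurable[M.sigH S T] M.init := hb.fst
  have hc : Measurable[M.sigH S T] M.coef := hb.snd.snd.snd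
  have hx : ∀ k ≤ T, Measurable[M.sigH S T] (M.x S k) := fun k hk =>
    (measurable_x_sigF hk).mono (sigF_le_sigH T) le_rfl
  refine @measurable_pi_lambda _ _ _ (M.sigH S T) _ _ fun i => ?_
  have e : (fun ω => M.noise ω i) = fun ω => S.noiseOf (i.val + 1)
      (M.init ω, M.coef ω, M.x S (i.val + 1) ω, M.x S i.val ω) := by
    funext ω
    rw [← noise_eq, Spec.dateIdx_succ]
  rw [e]
  have h1 : Measurable[M.sigH S T] fun ω =>
      (M.init ω, M.coef ω, M.x S (i.val + 1) ω, M.x S i.val ω) :=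
    hz.prodMk (hc.prodMk ((hx (i.val + 1) i.isLt).prodMk (hx i.val i.isLt.le)))
  exact (S.measurable_noiseOf (i.val + 1)).comp h1

theorem measurable_density_sigH : Measurable[M.sigH S T] (M.density S) := by
  have hb := measurable_base_sigH (M := M) (S := S) T
  have h1 : Measurable[M.sigH S T] fun ω => (M.init ω, M.coef ω, M.noise ω) :=
    hb.fst.prodMk (hb.snd.snd.snd.prodMk measurable_noise_sigH)
  have hg : Measurable fun q : 𝓩 × CoefPath n lk ly T × (Fin T → XIdx n → ℝ) =>
      S.girsanovDensity q.1 q.2.1 q.2.2 :=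
    S.measurable_girsanovDensity measurable_fst measurable_snd.fst measurable_snd.snd
  have h2 : M.density S = fun ω => S.girsanovDensity (M.init ω) (M.coef ω) (M.noise ω) := rfl
  rw [h2]
  exact fun _ hA => h1 (hg hA)

theorem measurableSet_lt_life {u : ℝ} {t : ℕ} (h0 : 0 ≤ u) (h1 : u ≤ t) :
    MeasurableSet[M.sigLife t] {ω | u < M.life ω} :=
  MeasurableSpace.measurableSet_generateFrom ⟨u, h0, h1, rfl⟩

/-- No event of `T_t^x` splits `{T_x > t}`. -/
theorem subset_or_disjoint_of_sigLife {t : ℕ} {A : Set Ω} (hA : MeasurableSet[M.sigLife t] A) :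
    {ω | (t : ℝ) < M.life ω} ⊆ A ∨ Disjoint {ω | (t : ℝ) < M.life ω} A := by
  refine MeasurableSpace.generateFrom_induction
    {A | ∃ u : ℝ, 0 ≤ u ∧ u ≤ t ∧ A = {ω | u < M.life ω}}
    (fun A _ => {ω | (t : ℝ) < M.life ω} ⊆ A ∨ Disjoint {ω | (t : ℝ) < M.life ω} A)
    ?_ ?_ ?_ ?_ A hA
  · rintro _ ⟨u, -, h1, rfl⟩ _
    exact Or.inl fun ω hω => lt_of_le_of_lt h1 hω
  · exact Or.inr (Set.disjoint_empty _)
  · rintro B - (h | h)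
    · exact Or.inr (Set.disjoint_compl_right_iff_subset.2 h)
    · exact Or.inl (Set.subset_compl_iff_disjoint_right.2 h)
  · intro f _ h
    by_cases hf : ∃ i, {ω | (t : ℝ) < M.life ω} ⊆ f i
    · obtain ⟨i, hi⟩ := hf
      exact Or.inl (hi.trans (Set.subset_iUnion f i))
    · push Not at hf
      exact Or.inr (Set.disjoint_iUnion_right.2 fun i => (h i).resolve_left (hf i))

/-- For a date `k ≥ 1` the event is the intersection of the generators `{T_x > k - 1 / (j + 1)}`;
for `k = 0` it is everything. -/
theorem measurableSet_le_life (hl : ∀ ω, 0 ≤ M.life ω) {k t : ℕ} (hk : k ≤ t) :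
    MeasurableSet[M.sigLife t] {ω | (k : ℝ) ≤ M.life ω} := by
  rcases Nat.eq_zero_or_pos k with rfl | h0
  · have : {ω | ((0 : ℕ) : ℝ) ≤ M.life ω} = Set.univ := by
      ext ω; simpa using hl ω
    rw [this]
    exact MeasurableSet.univ
  · have h1 : (1 : ℝ) ≤ k := by exact_mod_cast h0
    have : {ω | (k : ℝ) ≤ M.life ω} = ⋂ j : ℕ, {ω | (k : ℝ) - 1 / ((j : ℝ) + 1) < M.life ω} := by
      ext ω
      simp only [Set.mem_ofPred_eq, Set.mem_iInter]
      constructor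
      · intro h j
        have : (0 : ℝ) < 1 / ((j : ℝ) + 1) := by positivity
        linarith
      · intro h
        by_contra hlt
        obtain ⟨j, hj⟩ := exists_nat_one_div_lt (sub_pos.2 (not_le.1 hlt))
        linarith [h j]
    rw [this]
    refine MeasurableSet.iInter fun j => measurableSet_lt_life ?_ ?_
    · have : 1 / ((j : ℝ) + 1) ≤ 1 := by
        rw [div_le_one (by positivity)]; linarith [Nat.cast_nonneg (α := ℝ) j]
      linarith
    · have : (0 : ℝ) < 1 / ((j : ℝ) + 1) := by positivity
      have h2 : (k : ℝ) ≤ t := by exact_mod_cast hk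
      linarith

theorem floor_life_eq (hl : ∀ ω, 0 ≤ M.life ω) (k : ℕ) :
    {ω | ⌊M.life ω⌋₊ = k} = {ω | (k : ℝ) ≤ M.life ω} \ {ω | ((k + 1 : ℕ) : ℝ) ≤ M.life ω} := by
  ext ω
  simp only [Set.mem_ofPred_eq, Set.mem_sdiff, not_le, Nat.floor_eq_iff (hl ω), Nat.cast_add,
    Nat.cast_one]

theorem measurableSet_floor_life (hl : ∀ ω, 0 ≤ M.life ω) {k t : ℕ} (hk : k < t) :
    MeasurableSet[M.sigLife t] {ω | ⌊M.life ω⌋₊ = k} := by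
  rw [floor_life_eq hl]
  exact (measurableSet_le_life hl hk.le).diff (measurableSet_le_life hl hk)

variable (hM : M.IsModel S Pr)
include hM

theorem IsModel.sigLife_le (t : ℕ) : M.sigLife t ≤ ‹MeasurableSpace Ω› := by
  refine MeasurableSpace.generateFrom_le ?_
  rintro _ ⟨u, -, -, rfl⟩
  exact measurableSet_lt measurable_const hM.meas_life

theorem IsModel.sigFx_le (t : ℕ) : M.sigFx S t ≤ ‹MeasurableSpace Ω› :=
  sup_le (hM.sigF_le t) (hM.sigLife_le t)

/-- The density is `H_T`-measurable, so that the change of measure does not affect the law of the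
lifetime, and keeps it independent of the market. -/
theorem IsModel.riskNeutral_inter {A B : Set Ω} (hA : MeasurableSet[M.sigH S T] A)
    (hB : MeasurableSet[M.sigLife T] B) :
    M.riskNeutral S Pr (A ∩ B) = M.riskNeutral S Pr A * Pr B := by
  have hA0 := hM.sigH_le T _ hA
  have hB0 := hM.sigLife_le T _ hB
  rw [riskNeutral, withDensity_apply _ (hA0.inter hB0), withDensity_apply _ hA0,
    ← lintegral_indicator (hA0.inter hB0), ← lintegral_indicator hA0]
  have hf : Measurable[M.sigH S T] (A.indicator fun ω => ENNReal.ofReal (M.density S ω)) :=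
    (ENNReal.measurable_ofReal.comp measurable_density_sigH).indicator hA
  have hg : Measurable[M.sigLife T] (B.indicator fun _ => (1 : ℝ≥0∞)) :=
    (@measurable_const _ _ _ (M.sigLife T) _).indicator hB
  have h := lintegral_mul_eq_lintegral_mul_lintegral_of_independent_measurableSpace
    (hM.sigH_le T) (hM.sigLife_le T) hM.life_indep hf hg
  rw [show ∫⁻ ω, B.indicator (fun _ => (1 : ℝ≥0∞)) ω ∂Pr = Pr B from
    lintegral_indicator_one hB0] at h
  rw [← h]
  refine lintegral_congr fun ω => ?_
  by_cases h1 : ω ∈ A <;> by_cases h2 : ω ∈ B <;> simp [h1, h2]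

theorem IsModel.riskNeutral_sigLife {B : Set Ω} (hB : MeasurableSet[M.sigLife T] B) :
    M.riskNeutral S Pr B = Pr B := by
  have := hM.isProbabilityMeasure_riskNeutral
  have h := hM.riskNeutral_inter (A := Set.univ) MeasurableSet.univ hB
  rwa [Set.univ_inter, measure_univ, one_mul] at h

/-- The lifetime stays independent of the market: the density of the risk-neutral measure is
`H_T`-measurable. -/
theorem IsModel.indep_riskNeutral : Indep (M.sigH S T) (M.sigLife T) (M.riskNeutral S Pr) := by
  rw [Indep_iff]
  intro A B hA hB
  rw [hM.riskNeutral_inter hA hB, hM.riskNeutral_sigLife hB]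

/-- Conditional expectations of products of market and lifetime variables factor. -/
theorem IsModel.condExp_mul_sigFx {t : ℕ} (ht : t ≤ T) {X L : Ω → ℝ}
    (hX : StronglyMeasurable[M.sigH S T] X) (hL : StronglyMeasurable[M.sigLife T] L)
    (iX : Integrable X (M.riskNeutral S Pr)) (iL : Integrable L (M.riskNeutral S Pr)) :
    Integrable (fun ω => X ω * L ω) (M.riskNeutral S Pr) ∧
      (M.riskNeutral S Pr)[fun ω => X ω * L ω | M.sigFx S t] =ᵐ[M.riskNeutral S Pr] fun ω =>
        ((M.riskNeutral S Pr)[X | M.sigF S t]) ω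
          * ((M.riskNeutral S Pr)[L | M.sigLife t]) ω := by
  have := hM.isProbabilityMeasure_riskNeutral
  exact condExp_mul_sup_of_indep (hM.sigH_le T) (hM.sigLife_le T)
    ((sigF_mono ht).trans (sigF_le_sigH T)) (sigLife_mono ht) hM.indep_riskNeutral hX hL iX iL

/-- The lifetime does not help to predict a market variable. -/
theorem IsModel.condExp_sigFx {t : ℕ} (ht : t ≤ T) {X : Ω → ℝ}
    (hX : StronglyMeasurable[M.sigH S T] X) (iX : Integrable X (M.riskNeutral S Pr)) :
    (M.riskNeutral S Pr)[X | M.sigFx S t] =ᵐ[M.riskNeutral S Pr]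
      (M.riskNeutral S Pr)[X | M.sigF S t] := by
  have := hM.isProbabilityMeasure_riskNeutral
  have h := (hM.condExp_mul_sigFx ht hX (L := fun _ => 1) stronglyMeasurable_const iX
    (integrable_const 1)).2
  simpa only [mul_one, condExp_const ((hM.sigLife_le t))] using h

theorem IsModel.condExp_sigHx {t : ℕ} (ht : t ≤ T) {X : Ω → ℝ}
    (hX : StronglyMeasurable[M.sigH S T] X) (iX : Integrable X (M.riskNeutral S Pr)) :
    (M.riskNeutral S Pr)[X | M.sigHx S t] =ᵐ[M.riskNeutral S Pr]
      (M.riskNeutral S Pr)[X | M.sigH S t] := by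
  have := hM.isProbabilityMeasure_riskNeutral
  have h := (condExp_mul_sup_of_indep (hM.sigH_le T) (hM.sigLife_le T) (sigH_mono ht)
    (sigLife_mono ht) hM.indep_riskNeutral hX (L := fun _ => 1) stronglyMeasurable_const iX
    (integrable_const 1)).2
  simpa only [mul_one, condExp_const ((hM.sigLife_le t))] using h

/-- Given the lifetime information at `t`, an event after `t` has its elementary conditional
probability on `{T_x > t}`. -/
theorem IsModel.condExp_indicator_sigLife {t : ℕ} (ht : t ≤ T) {B : Set Ω}
    (hB : MeasurableSet[M.sigLife T] B)
    (hsub : B ≤ᵐ[M.riskNeutral S Pr] {ω | (t : ℝ) < M.life ω}) :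
    (M.riskNeutral S Pr)[B.indicator fun _ => (1 : ℝ) | M.sigLife t] =ᵐ[M.riskNeutral S Pr]
      fun ω => M.alive t ω * (Pr.real B / M.survival Pr t) := by
  have := hM.isProbabilityMeasure_riskNeutral
  have hB0 := hM.sigLife_le T _ hB
  set U : Set Ω := {ω | (t : ℝ) < M.life ω} with hU
  have hUt : MeasurableSet[M.sigLife t] U := measurableSet_lt_life (Nat.cast_nonneg t) le_rfl
  have hU0 : MeasurableSet U := hM.sigLife_le t _ hUt
  have hPU : (M.riskNeutral S Pr).real U = M.survival Pr t := by
    rw [survival, measureReal_def, measureReal_def,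
      hM.riskNeutral_sigLife (sigLife_mono ht _ hUt)]
  have hPB : (M.riskNeutral S Pr).real B = Pr.real B := by
    rw [measureReal_def, measureReal_def, hM.riskNeutral_sigLife hB]
  have hBU : Pr.real B ≤ M.survival Pr t := by
    rw [← hPU, ← hPB]
    exact ENNReal.toReal_mono (measure_ne_top _ _) (measure_mono_ae hsub)
  have hal : M.alive t = U.indicator fun _ => (1 : ℝ) := rfl
  have hint : Integrable (fun ω => M.alive t ω * (Pr.real B / M.survival Pr t))
      (M.riskNeutral S Pr) := by
    rw [hal]
    exact ((integrable_const (1 : ℝ)).indicator hU0).mul_const _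
  refine (ae_eq_condExp_of_forall_setIntegral_eq (hM.sigLife_le t)
    ((integrable_const (1 : ℝ)).indicator hB0) (fun _ _ _ => hint.integrableOn)
    (fun A hA _ => ?_) ?_).symm
  · have hA0 := hM.sigLife_le t _ hA
    rw [integral_mul_const, hal, setIntegral_indicator hU0, setIntegral_indicator hB0,
      setIntegral_const, setIntegral_const, smul_eq_mul, mul_one, smul_eq_mul, mul_one]
    -- an event of the lifetime σ-field at `t` contains `{T_x > t}` or is disjoint from it
    rcases subset_or_disjoint_of_sigLife hA with h | h
    · have e1 : A ∩ U = U := Set.inter_eq_right.2 h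
      have e2 : (M.riskNeutral S Pr).real (A ∩ B) = (M.riskNeutral S Pr).real B := by
        refine measureReal_congr ?_
        filter_upwards [hsub] with ω hω
        exact propext ⟨fun hx => hx.2, fun hx => ⟨h (hω hx), hx⟩⟩
      rw [e1, e2, hPU, hPB]
      -- division by a zero survival probability: both sides are `0`
      by_cases h0 : M.survival Pr t = 0
      · rw [h0, zero_mul]
        exact (le_antisymm (h0 ▸ hBU) measureReal_nonneg).symm
      · field_simp
    · have e1 : A ∩ U = ∅ := by rw [Set.inter_comm]; exact h.inter_eq
      have e2 : (M.riskNeutral S Pr).real (A ∩ B) = 0 := by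
        rw [← measureReal_empty (μ := M.riskNeutral S Pr)]
        refine measureReal_congr ?_
        filter_upwards [hsub] with ω hω
        exact propext ⟨fun hx => (Set.disjoint_left.1 h (hω hx.2) hx.1).elim, False.elim⟩
      rw [e1, e2, measureReal_empty, zero_mul]
  · rw [hal]
    exact ((stronglyMeasurable_const.indicator hUt).mul_const _).aestronglyMeasurable

theorem IsModel.survival_anti {s t : ℕ} (h : s ≤ t) : M.survival Pr t ≤ M.survival Pr s := by
  have := hM.prob
  exact measureReal_mono fun ω (hω : (t : ℝ) < M.life ω) =>
    (lt_of_le_of_lt (Nat.cast_le.2 h) hω : (s : ℝ) < M.life ω)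

theorem IsModel.condExp_alive {t : ℕ} (ht : t ≤ T) :
    (M.riskNeutral S Pr)[M.alive T | M.sigLife t] =ᵐ[M.riskNeutral S Pr]
      fun ω => M.alive t ω * M.surv Pr (T - t) t := by
  have h := hM.condExp_indicator_sigLife ht (B := {ω | (T : ℝ) < M.life ω})
    (measurableSet_lt_life (Nat.cast_nonneg T) le_rfl)
    (.of_forall fun ω hω => lt_of_le_of_lt (Nat.cast_le.2 ht) hω)
  refine h.trans (.of_forall fun ω => ?_)
  simp only [surv, survival, Nat.add_sub_cancel' ht]

theorem IsModel.real_floor_life (k : ℕ) :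
    Pr.real {ω | ⌊M.life ω⌋₊ = k} = M.survival Pr k - M.survival Pr (k + 1) := by
  have := hM.prob
  have e : ∀ j : ℕ, Pr.real {ω | (j : ℝ) ≤ M.life ω} = M.survival Pr j := by
    intro j
    refine measureReal_congr ?_
    have h0 : ∀ᵐ ω ∂Pr, M.life ω ≠ j := by
      rw [ae_iff]
      simpa using hM.life_no_atom j
    filter_upwards [h0] with ω hω
    exact propext ⟨fun h => lt_of_le_of_ne h hω.symm, fun h => le_of_lt h⟩
  rw [floor_life_eq hM.life_nonneg, measureReal_sdiff, e, e]
  · exact fun ω (hω : ((k + 1 : ℕ) : ℝ) ≤ M.life ω) =>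
      (le_trans (Nat.cast_le.2 (Nat.le_succ k)) hω : (k : ℝ) ≤ M.life ω)
  · exact measurableSet_le measurable_const hM.meas_life

theorem IsModel.real_floor_life_div {t k : ℕ} (htk : t ≤ k) :
    Pr.real {ω | ⌊M.life ω⌋₊ = k} / M.survival Pr t = M.surv Pr (k - t) t * M.mort Pr k := by
  rw [hM.real_floor_life, mort, surv, surv, Nat.add_sub_cancel' htk]
  by_cases h0 : M.survival Pr k = 0
  · have h1 : M.survival Pr (k + 1) = 0 :=
      le_antisymm (h0 ▸ hM.survival_anti (Nat.le_succ k)) measureReal_nonneg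
    simp [h0, h1]
  · field_simp

theorem IsModel.condExp_floor_life {t k : ℕ} (htk : t ≤ k) (hk : k < T) :
    (M.riskNeutral S Pr)[{ω | ⌊M.life ω⌋₊ = k}.indicator fun _ => (1 : ℝ) | M.sigLife t]
      =ᵐ[M.riskNeutral S Pr] fun ω => M.alive t ω * (M.surv Pr (k - t) t * M.mort Pr k) := by
  have h0 : ∀ᵐ ω ∂(M.riskNeutral S Pr), M.life ω ≠ t := by
    have h1 : ∀ᵐ ω ∂Pr, M.life ω ≠ t := by
      rw [ae_iff]
      simpa using hM.life_no_atom t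
    exact (withDensity_absolutelyContinuous _ _).ae_le h1
  have h := hM.condExp_indicator_sigLife (htk.trans hk.le)
    (measurableSet_floor_life hM.life_nonneg hk) (by
      filter_upwards [h0] with ω hω hx
      have h1 : (k : ℝ) ≤ M.life ω := ((Nat.floor_eq_iff (hM.life_nonneg ω)).1 hx).1
      exact lt_of_le_of_ne ((Nat.cast_le.2 htk).trans h1) hω.symm)
  refine h.trans (.of_forall fun ω => ?_)
  simp only [hM.real_floor_life_div htk]

end Elements
end GordonHedge

namespace GordonHedge

/-! ### Locally risk-minimizing strategies -/

/-- With a centred factor the conditional covariance is the conditional mean of the product. -/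
theorem condCov_eq_of_condExp_eq_zero {Ω : Type*} {m m₀ : MeasurableSpace Ω} {μ : Measure Ω}
    [IsProbabilityMeasure μ] {X Y : Ω → ℝ} (hX : MemLp X 2 μ) (hY : MemLp Y 2 μ)
    (hX0 : μ[X | m] =ᵐ[μ] 0) : condCov μ m X Y =ᵐ[μ] μ[fun ω => X ω * Y ω | m] := by
  have hXY : Integrable (fun ω => X ω * Y ω) μ := hX.integrable_mul hY
  have hXE : Integrable (fun ω => X ω * (μ[Y | m]) ω) μ :=
    hX.integrable_mul (hY.condExp one_le_two)
  have e : (fun ω => (X ω - (μ[X | m]) ω) * (Y ω - (μ[Y | m]) ω))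
      =ᵐ[μ] (fun ω => X ω * Y ω) - fun ω => X ω * (μ[Y | m]) ω := by
    filter_upwards [hX0] with ω hω
    rw [hω, Pi.zero_apply, sub_zero, mul_sub]
    rfl
  have h0 : μ[fun ω => X ω * (μ[Y | m]) ω | m] =ᵐ[μ] 0 := by
    have h := condExp_mul_of_stronglyMeasurable_right (m := m) (f := X) (g := μ[Y | m])
      stronglyMeasurable_condExp hXE (hX.integrable one_le_two)
    refine h.trans ?_
    filter_upwards [hX0] with ω hω
    simp [hω]
  refine (condExp_congr_ae e).trans ((condExp_sub hXY hXE m).trans ?_)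
  filter_upwards [h0] with ω hω
  simp [hω]

namespace Elements

variable {n lk ly N T : ℕ} [NeZero T] {𝓩 : Type*} [MeasurableSpace 𝓩]
  {Ω : Type*} [MeasurableSpace Ω] {M : Elements n lk ly N T 𝓩 Ω} {S : Spec n lk ly N T 𝓩}
  {Pr : Measure Ω}

theorem sigF_le_sigFx (t : ℕ) : M.sigF S t ≤ M.sigFx S t := le_sup_left

theorem D_pos (t : ℕ) (ω : Ω) : 0 < M.D S t ω := Real.exp_pos _

theorem measurable_D_sigF (t : ℕ) : Measurable[M.sigF S t] (M.D S t) := by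
  have h : Measurable[M.sigF S t] fun ω => ∑ m ∈ Finset.Icc 1 t, M.rate S m ω := by
    refine Finset.measurable_fun_sum _ fun m hm => ?_
    have h1 := measurable_x_sigF (M := M) (S := S) (t := t) (m := m - 1)
      (by have := (Finset.mem_Icc.1 hm).2; omega)
    exact (measurable_pi_apply (Spec.rIdx n)).comp h1
  exact Real.measurable_exp.comp h.neg

theorem measurable_P_sigF (t : ℕ) (i : Fin n) : Measurable[M.sigF S t] fun ω => M.P S t ω i :=
  Real.measurable_exp.comp ((measurable_pi_apply (Sum.inl i)).comp
    (measurable_x_sigF (M := M) (S := S) (le_refl t)))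

theorem measurable_cumPrice_sigF (t : ℕ) (i : Fin n) :
    Measurable[M.sigF S t] fun ω => M.cumPrice S t ω i := by
  have hf : Measurable fun q : 𝓩 × (XIdx n → ℝ) × (XIdx n → ℝ) =>
      Real.exp (q.2.2 (Sum.inl i)) * Real.exp (q.2.1 (Sum.inl i) - q.2.2 (Sum.inl i)
        + Real.log (S.g q.1 t i) + (S.g q.1 t i)⁻¹ * (S.g q.1 t i - 1)
          * (q.2.1 (Sum.inr (Sum.inl i)) - q.2.1 (Sum.inl i) - S.mu t q.1 i)) := by
    have hg : Measurable fun q : 𝓩 × (XIdx n → ℝ) × (XIdx n → ℝ) => S.g q.1 t i :=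
      S.measurable_g measurable_fst t i
    have hmu : Measurable fun q : 𝓩 × (XIdx n → ℝ) × (XIdx n → ℝ) => S.mu t q.1 i :=
      (measurable_pi_apply i).comp ((S.meas_mu t).comp measurable_fst)
    fun_prop
  have h1 : Measurable[M.sigF S t] fun ω => (M.init ω, M.x S t ω, M.x S (t - 1) ω) :=
    (measurable_init_sigF t).prodMk ((measurable_x_sigF le_rfl).prodMk
      (measurable_x_sigF (Nat.sub_le t 1)))
  exact fun _ hA => h1 (hf hA)

theorem measurable_gain_sigF (t : ℕ) (i : Fin n) :
    Measurable[M.sigF S t] fun ω => M.gain S t ω i :=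
  ((measurable_D_sigF t).mul (measurable_cumPrice_sigF t i)).sub
    (((measurable_D_sigF (t - 1)).mul (measurable_P_sigF (t - 1) i)).mono
      (sigF_mono (Nat.sub_le t 1)) le_rfl)

theorem stronglyMeasurable_gain_sigH {t : ℕ} (ht : t < T) (i : Fin n) :
    StronglyMeasurable[M.sigH S T] fun ω => M.gain S (t + 1) ω i :=
  ((measurable_gain_sigF (t + 1) i).mono ((sigF_mono ht).trans (sigF_le_sigH T))
    le_rfl).stronglyMeasurable

theorem stronglyMeasurable_shares (Hbar : Ω → ℝ) (t : ℕ) (i : Fin n) :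
    StronglyMeasurable[M.sigFx S t] fun ω => M.shares S Pr Hbar (t + 1) ω i := by
  have h1 : @EntryMeasurable (Fin n) (Fin n) Ω (M.sigFx S t)
      fun ω => M.OmegaBar S (M.riskNeutral S Pr) (M.sigFx S t) t ω :=
    fun a b => (stronglyMeasurable_condExp (m := M.sigFx S t)).measurable
  have h2 : Measurable[M.sigFx S t] fun ω =>
      M.LambdaBar S (M.riskNeutral S Pr) (M.sigFx S t) Hbar t ω :=
    @measurable_pi_lambda Ω (Fin n) (fun _ => ℝ) (M.sigFx S t) _ _ fun a =>
      (stronglyMeasurable_condExp (m := M.sigFx S t)).measurable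
  exact ((measurable_pi_apply i).comp
    (@measurable_inv_mulVec (Fin n) _ _ Ω (M.sigFx S t) _ _ h1 h2)).stronglyMeasurable

theorem stronglyMeasurable_dotProduct_cumPrice {t : ℕ} {h : Ω → Fin n → ℝ}
    (hh : ∀ i, StronglyMeasurable[M.sigFx S t] fun ω => h ω i) :
    StronglyMeasurable[M.sigFx S (t + 1)] fun ω => h ω ⬝ᵥ M.cumPrice S (t + 1) ω := by
  simp only [dotProduct]
  exact Finset.stronglyMeasurable_fun_sum _ fun i _ =>
    ((hh i).mono (sigFx_mono (Nat.le_succ t))).mul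
      ((measurable_cumPrice_sigF (t + 1) i).mono (sigF_le_sigFx _) le_rfl).stronglyMeasurable

theorem stronglyMeasurable_dotProduct_P {t : ℕ} {h : Ω → Fin n → ℝ}
    (hh : ∀ i, StronglyMeasurable[M.sigFx S t] fun ω => h ω i) :
    StronglyMeasurable[M.sigFx S t] fun ω => h ω ⬝ᵥ M.P S t ω := by
  simp only [dotProduct]
  exact Finset.stronglyMeasurable_fun_sum _ fun i _ => (hh i).mul
    ((measurable_P_sigF t i).mono (sigF_le_sigFx _) le_rfl).stronglyMeasurable

theorem stronglyMeasurable_D_sigFx (t : ℕ) : StronglyMeasurable[M.sigFx S t] (M.D S t) :=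
  ((measurable_D_sigF t).mono (sigF_le_sigFx _) le_rfl).stronglyMeasurable

theorem stronglyMeasurable_cash (Hbar : Ω → ℝ) (t : ℕ) :
    StronglyMeasurable[M.sigFx S t] (M.cash S Pr Hbar t) := by
  have hv : ∀ t, StronglyMeasurable[M.sigFx S t] (M.value S Pr Hbar t) := fun t =>
    stronglyMeasurable_condExp.div (stronglyMeasurable_D_sigFx t)
  cases t with
  | zero =>
    exact (hv 0).sub (stronglyMeasurable_dotProduct_P (stronglyMeasurable_shares Hbar 0))
  | succ t =>
    exact (hv (t + 1)).sub
      (stronglyMeasurable_dotProduct_cumPrice (stronglyMeasurable_shares Hbar t))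

/-- The discounted value of the claimed strategy is the martingale `Ẽ[H | F_t^x]`. -/
theorem discPortfolio_cash_shares (Hbar : Ω → ℝ) (t : ℕ) :
    M.discPortfolio S (M.cash S Pr Hbar) (M.shares S Pr Hbar) t
      = (M.riskNeutral S Pr)[Hbar | M.sigFx S t] := by
  funext ω
  have hD := (D_pos (M := M) (S := S) t ω).ne'
  cases t with
  | zero =>
    simp only [discPortfolio, portfolio, cash, value, sub_add_cancel]
    field_simp
  | succ t =>
    simp only [discPortfolio, portfolio, cash, value, sub_add_cancel]
    field_simp

theorem Admissible.stronglyMeasurable_discPortfolio {Hbar : Ω → ℝ} {k0 : ℕ → Ω → ℝ}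
    {k : ℕ → Ω → Fin n → ℝ} (hk : M.Admissible S Pr Hbar k0 k) {t : ℕ} (ht : t ≤ T) :
    StronglyMeasurable[M.sigFx S t] (M.discPortfolio S k0 k t) := by
  refine (stronglyMeasurable_D_sigFx t).mul ?_
  cases t with
  | zero =>
    exact (hk.adapted 0 ht).add
      (stronglyMeasurable_dotProduct_P (hk.predictable 0 (Nat.pos_of_neZero T)))
  | succ t =>
    exact (hk.adapted (t + 1) ht).add
      (stronglyMeasurable_dotProduct_cumPrice (hk.predictable t ht))

variable (hM : M.IsModel S Pr)
  (hgain : ∀ t < T, ∀ i, MemLp (fun ω => M.gain S (t + 1) ω i) 2 (M.riskNeutral S Pr))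
include hM hgain

theorem IsModel.omegaBar_sigH {t : ℕ} (ht : t < T) :
    M.OmegaBar S (M.riskNeutral S Pr) (M.sigH S t) t =ᵐ[M.riskNeutral S Pr] M.omegaH S t := by
  filter_upwards [ae_all_iff.2 fun a => ae_all_iff.2 fun b =>
    (hM.condExp_gain_mul_gain hgain ht a b).1] with ω hω
  ext a b
  exact hω a b

theorem IsModel.omegaBar_sigFx {t : ℕ} (ht : t < T) :
    M.OmegaBar S (M.riskNeutral S Pr) (M.sigFx S t) t
      =ᵐ[M.riskNeutral S Pr] M.omegaMixed S t := by
  filter_upwards [ae_all_iff.2 fun a => ae_all_iff.2 fun b =>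
    (hM.condExp_sigFx ht.le ((stronglyMeasurable_gain_sigH ht a).mul
      (stronglyMeasurable_gain_sigH ht b)) ((hgain t ht a).integrable_mul (hgain t ht b))).trans
      (hM.condExp_gain_mul_gain hgain ht a b).2.2.2] with ω hω
  ext a b
  exact hω a b

theorem IsModel.ae_posDef_omegaBar {t : ℕ} (ht : t < T) :
    ∀ᵐ ω ∂(M.riskNeutral S Pr),
      (M.OmegaBar S (M.riskNeutral S Pr) (M.sigFx S t) t ω).PosDef := by
  filter_upwards [hM.omegaBar_sigFx hgain ht, hM.ae_posDef_omegaMixed hgain ht] with ω h1 h2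
  rwa [h1]

theorem IsModel.condExp_gain_sigFx {t : ℕ} (ht : t < T) (a : Fin n) :
    (M.riskNeutral S Pr)[fun ω => M.gain S (t + 1) ω a | M.sigFx S t]
      =ᵐ[M.riskNeutral S Pr] 0 := by
  have := hM.isProbabilityMeasure_riskNeutral
  exact (hM.condExp_sigFx ht.le (stronglyMeasurable_gain_sigH ht a)
    ((hgain t ht a).integrable one_le_two)).trans (hM.condExp_gain hgain ht a).2

/-- The number of shares is the coefficient in the regression of the next value of the claim on
the gains. -/
theorem IsModel.shares_eq_projCoef {Hbar : Ω → ℝ} (hH : MemLp Hbar 2 (M.riskNeutral S Pr)) {t : ℕ}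
    (ht : t < T) :
    M.shares S Pr Hbar (t + 1) =ᵐ[M.riskNeutral S Pr]
      projCoef (M.riskNeutral S Pr) (M.sigFx S t) (M.gain S (t + 1))
        ((M.riskNeutral S Pr)[Hbar | M.sigFx S (t + 1)]) := by
  have := hM.isProbabilityMeasure_riskNeutral
  have h : ∀ a, (fun ω => M.LambdaBar S (M.riskNeutral S Pr) (M.sigFx S t) Hbar t ω a)
      =ᵐ[M.riskNeutral S Pr] (M.riskNeutral S Pr)[fun ω => M.gain S (t + 1) ω a
        * ((M.riskNeutral S Pr)[Hbar | M.sigFx S (t + 1)]) ω | M.sigFx S t] := by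
    intro a
    refine (condCov_eq_of_condExp_eq_zero (hgain t ht a) hH
      (hM.condExp_gain_sigFx hgain ht a)).trans ?_
    have hg : StronglyMeasurable[M.sigFx S (t + 1)] fun ω => M.gain S (t + 1) ω a :=
      ((measurable_gain_sigF (t + 1) a).mono (sigF_le_sigFx _) le_rfl).stronglyMeasurable
    have h1 := condExp_mul_of_stronglyMeasurable_left (m := M.sigFx S (t + 1)) hg
      ((hgain t ht a).integrable_mul hH) (hH.integrable one_le_two)
    exact (condExp_condExp_of_le (sigFx_mono (Nat.le_succ t)) (hM.sigFx_le (t + 1))).symm.trans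
      (condExp_congr_ae h1)
  filter_upwards [ae_all_iff.2 h] with ω hω
  have e : M.LambdaBar S (M.riskNeutral S Pr) (M.sigFx S t) Hbar t ω
      = fun a => ((M.riskNeutral S Pr)[fun ω => M.gain S (t + 1) ω a
        * ((M.riskNeutral S Pr)[Hbar | M.sigFx S (t + 1)]) ω | M.sigFx S t]) ω := funext hω
  simp only [shares, e]
  rfl

/-- The claimed strategy is admissible. -/
theorem IsModel.admissible_cash_shares {Hbar : Ω → ℝ}
    (hHm : StronglyMeasurable[M.sigFx S T] Hbar) (hH : MemLp Hbar 2 (M.riskNeutral S Pr)) :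
    M.Admissible S Pr Hbar (M.cash S Pr Hbar) (M.shares S Pr Hbar) where
  adapted t _ := stronglyMeasurable_cash Hbar t
  predictable t _ i := stronglyMeasurable_shares Hbar t i
  value_L2 t _ := by
    have := hM.isProbabilityMeasure_riskNeutral
    rw [discPortfolio_cash_shares]
    exact hH.condExp one_le_two
  gain_L2 t ht := by
    have := hM.isProbabilityMeasure_riskNeutral
    have h := memLp_projCoef_dotProduct (hM.sigFx_le t) (g := M.gain S (t + 1)) (hgain t ht)
      (hM.ae_posDef_omegaBar hgain ht)
      (hH.condExp one_le_two : MemLp ((M.riskNeutral S Pr)[Hbar | M.sigFx S (t + 1)]) 2 _)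
    refine h.ae_eq ?_
    filter_upwards [hM.shares_eq_projCoef hgain hH ht] with ω hω
    rw [hω]
  terminal := by
    have := hM.isProbabilityMeasure_riskNeutral
    rw [discPortfolio_cash_shares,
      condExp_of_stronglyMeasurable (hM.sigFx_le T) hHm (hH.integrable one_le_two)]

/-- The squared cost increment of the claimed strategy is the squared residual of the conditional
regression of the next value on the gains. -/
theorem IsModel.costIncr_cash_shares {Hbar : Ω → ℝ} (hH : MemLp Hbar 2 (M.riskNeutral S Pr))
    {t : ℕ} (ht : t < T) :
    (fun ω => M.costIncr S (M.cash S Pr Hbar) (M.shares S Pr Hbar) t ω ^ 2)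
      =ᵐ[M.riskNeutral S Pr] fun ω => (((M.riskNeutral S Pr)[Hbar | M.sigFx S (t + 1)]) ω
        - ((M.riskNeutral S Pr)[(M.riskNeutral S Pr)[Hbar | M.sigFx S (t + 1)] | M.sigFx S t]) ω
        - projCoef (M.riskNeutral S Pr) (M.sigFx S t) (M.gain S (t + 1))
          ((M.riskNeutral S Pr)[Hbar | M.sigFx S (t + 1)]) ω ⬝ᵥ M.gain S (t + 1) ω) ^ 2 := by
  have := hM.isProbabilityMeasure_riskNeutral
  filter_upwards [hM.shares_eq_projCoef hgain hH ht,
    condExp_condExp_of_le (μ := M.riskNeutral S Pr) (f := Hbar)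
      (sigFx_mono (M := M) (S := S) (Nat.le_succ t)) (hM.sigFx_le (t + 1))] with ω h1 h2
  rw [costIncr, discPortfolio_cash_shares, discPortfolio_cash_shares, h1, h2]

/-- The strategy of the theorem is the locally risk-minimizing one, because every one-period
problem is a conditional least squares problem. -/
theorem IsModel.lrmGivenByFormula {Hbar : Ω → ℝ}
    (hHm : StronglyMeasurable[M.sigFx S T] Hbar) (hH : MemLp Hbar 2 (M.riskNeutral S Pr)) :
    M.LRMGivenByFormula S Pr Hbar := by
  have := hM.isProbabilityMeasure_riskNeutral
  have hadm := hM.admissible_cash_shares hgain hHm hH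
  have hY : ∀ t, MemLp ((M.riskNeutral S Pr)[Hbar | M.sigFx S t]) 2 (M.riskNeutral S Pr) :=
    fun t => hH.condExp one_le_two
  -- the squared cost increment of a strategy with the right next value
  have hcost : ∀ {t : ℕ} {k0 : ℕ → Ω → ℝ} {k : ℕ → Ω → Fin n → ℝ},
      M.discPortfolio S k0 k (t + 1) =ᵐ[M.riskNeutral S Pr]
        (M.riskNeutral S Pr)[Hbar | M.sigFx S (t + 1)] →
      (fun ω => M.costIncr S k0 k t ω ^ 2) =ᵐ[M.riskNeutral S Pr] fun ω =>
        (((M.riskNeutral S Pr)[Hbar | M.sigFx S (t + 1)]) ω - M.discPortfolio S k0 k t ω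
          - k (t + 1) ω ⬝ᵥ M.gain S (t + 1) ω) ^ 2 := by
    intro t k0 k h
    filter_upwards [h] with ω hω
    rw [costIncr, hω]
  refine ⟨⟨hadm, fun t ht k0 k hk hval => ?_⟩, fun k0 k hk => ?_⟩
  · rw [discPortfolio_cash_shares] at hval
    have hle := condExp_sq_residual_le (hM.sigFx_le t) (g := M.gain S (t + 1)) (hgain t ht)
      (hM.ae_posDef_omegaBar hgain ht) (hM.condExp_gain_sigFx hgain ht) (hY (t + 1))
      (hk.stronglyMeasurable_discPortfolio ht.le) (hk.value_L2 t ht.le)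
      (hk.predictable t ht) (hk.gain_L2 t ht)
    filter_upwards [hle, condExp_congr_ae (m := M.sigFx S t)
      (hM.costIncr_cash_shares hgain hH ht), condExp_congr_ae (m := M.sigFx S t) (hcost hval)]
      with ω h1 h2 h3
    rw [h2, h3]
    exact h1
  -- one period: the conditional regression has a unique minimizer
  · have hstep : ∀ t < T, M.discPortfolio S k0 k (t + 1) =ᵐ[M.riskNeutral S Pr]
        (M.riskNeutral S Pr)[Hbar | M.sigFx S (t + 1)] →
        M.discPortfolio S k0 k t =ᵐ[M.riskNeutral S Pr]
          (M.riskNeutral S Pr)[Hbar | M.sigFx S t] ∧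
        k (t + 1) =ᵐ[M.riskNeutral S Pr] M.shares S Pr Hbar (t + 1) := by
      intro t ht hval
      have hmin := hk.minimal t ht _ _ hadm (by
        rw [discPortfolio_cash_shares]; exact hval.symm)
      have hle : (M.riskNeutral S Pr)[fun ω =>
          (((M.riskNeutral S Pr)[Hbar | M.sigFx S (t + 1)]) ω - M.discPortfolio S k0 k t ω
          - k (t + 1) ω ⬝ᵥ M.gain S (t + 1) ω) ^ 2 | M.sigFx S t] ≤ᵐ[M.riskNeutral S Pr] _ :=
        (condExp_congr_ae (hcost hval)).symm.le.trans
          (hmin.trans (condExp_congr_ae (hM.costIncr_cash_shares hgain hH ht)).le)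
      obtain ⟨h1, h2⟩ := eq_projCoef_of_condExp_sq_le (hM.sigFx_le t) (g := M.gain S (t + 1))
        (hgain t ht) (hM.ae_posDef_omegaBar hgain ht) (hM.condExp_gain_sigFx hgain ht)
        (hY (t + 1)) (hk.admissible.stronglyMeasurable_discPortfolio ht.le)
        (hk.admissible.value_L2 t ht.le) (hk.admissible.predictable t ht)
        (hk.admissible.gain_L2 t ht) hle
      exact ⟨h1.trans (condExp_condExp_of_le (sigFx_mono (Nat.le_succ t)) (hM.sigFx_le (t + 1))),
        h2.trans (hM.shares_eq_projCoef hgain hH ht).symm⟩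
    -- backward induction from the terminal value
    have hval : ∀ t ≤ T, M.discPortfolio S k0 k t =ᵐ[M.riskNeutral S Pr]
        (M.riskNeutral S Pr)[Hbar | M.sigFx S t] := by
      intro t ht
      induction ht using Nat.decreasingInduction with
      | self =>
        rw [condExp_of_stronglyMeasurable (hM.sigFx_le T) hHm (hH.integrable one_le_two)]
        exact hk.admissible.terminal
      | of_succ t ht ih => exact (hstep t ht ih).1
    have hsh : ∀ t < T, k (t + 1) =ᵐ[M.riskNeutral S Pr] M.shares S Pr Hbar (t + 1) :=
      fun t ht => (hstep t ht (hval (t + 1) ht)).2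
    refine ⟨hsh, fun t ht => ?_⟩
    have hv := hval t ht
    rw [← discPortfolio_cash_shares] at hv
    cases t with
    | zero =>
      filter_upwards [hv, hsh 0 (Nat.pos_of_neZero T)] with ω h1 h2
      have h3 := mul_left_cancel₀ (D_pos (M := M) (S := S) 0 ω).ne' h1
      simp only [portfolio, h2] at h3
      exact add_right_cancel h3
    | succ t =>
      filter_upwards [hv, hsh t ht] with ω h1 h2
      have h3 := mul_left_cancel₀ (D_pos (M := M) (S := S) (t + 1) ω).ne' h1
      simp only [portfolio, h2] at h3
      exact add_right_cancel h3

end Elements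
end GordonHedge

namespace GordonHedge

/-! ### Bond prices and forward measures -/

/-- Bayes' rule for conditional expectations: if the density has conditional mean one, it enters as
a factor only. -/
theorem condExp_withDensity {Ω : Type*} {m m₀ : MeasurableSpace Ω} {μ : Measure Ω}
    [IsProbabilityMeasure μ] (hm : m ≤ m₀) {r : Ω → ℝ} (hr0 : ∀ ω, 0 ≤ r ω) (hrm : Measurable r)
    (hr : Integrable r μ) (hr1 : μ[r | m] =ᵐ[μ] 1) {f : Ω → ℂ} (hf : StronglyMeasurable f)
    (hb : ∀ ω, ‖f ω‖ ≤ 1) :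
    (μ.withDensity fun ω => ENNReal.ofReal (r ω))[f | m]
      =ᵐ[μ.withDensity fun ω => ENNReal.ofReal (r ω)] μ[fun ω => r ω • f ω | m] := by
  set ν := μ.withDensity fun ω => ENNReal.ofReal (r ω) with hν
  have hprob : IsProbabilityMeasure ν := by
    refine ⟨?_⟩
    rw [hν, withDensity_apply _ MeasurableSet.univ, Measure.restrict_univ,
      ← ofReal_integral_eq_lintegral_ofReal hr (.of_forall hr0), ← integral_condExp hm,
      integral_congr_ae hr1]
    simp
  have hac : ν ≪ μ := withDensity_absolutelyContinuous _ _
  have hset : ∀ (h : Ω → ℂ) {A : Set Ω}, MeasurableSet A →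
      ∫ ω in A, h ω ∂ν = ∫ ω in A, r ω • h ω ∂μ := by
    intro h A hA
    rw [hν, setIntegral_withDensity_eq_setIntegral_toReal_smul hrm.ennreal_ofReal
      (.of_forall fun ω => ENNReal.ofReal_lt_top) _ hA]
    simp only [ENNReal.toReal_ofReal (hr0 _)]
  have hrf : Integrable (fun ω => r ω • f ω) μ := by
    refine hr.mono' (hrm.stronglyMeasurable.smul hf).aestronglyMeasurable (.of_forall fun ω => ?_)
    rw [norm_smul, Real.norm_of_nonneg (hr0 ω)]
    exact mul_le_of_le_one_right (hr0 ω) (hb ω)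
  set g := μ[fun ω => r ω • f ω | m] with hg
  have hgb : ∀ᵐ ω ∂μ, ‖g ω‖ ≤ 1 := by
    have h1 : μ[fun ω => ‖r ω • f ω‖ | m] ≤ᵐ[μ] μ[r | m] := by
      refine condExp_mono hrf.norm hr (.of_forall fun ω => ?_)
      simp only [norm_smul, Real.norm_of_nonneg (hr0 ω)]
      exact mul_le_of_le_one_right (hr0 ω) (hb ω)
    filter_upwards [norm_condExp_le (μ := μ) (m := m) fun ω => r ω • f ω, h1, hr1]
      with ω w1 w2 w3
    exact w1.trans (w2.trans w3.le)
  have hgs : StronglyMeasurable[m] g := stronglyMeasurable_condExp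
  have hgi : Integrable g ν := (integrable_const (1 : ℝ)).mono'
    (hgs.mono hm).aestronglyMeasurable (hac.ae_le hgb)
  have hrg : Integrable (r • g) μ := by
    refine hr.mono' (hrm.stronglyMeasurable.smul (hgs.mono hm)).aestronglyMeasurable ?_
    filter_upwards [hgb] with ω hω
    rw [Pi.smul_apply', norm_smul, Real.norm_of_nonneg (hr0 ω)]
    exact mul_le_of_le_one_right (hr0 ω) hω
  have hrg1 : μ[r • g | m] =ᵐ[μ] g := by
    have h := condExp_smul_of_aestronglyMeasurable_right hr hrg hgs.aestronglyMeasurable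
    filter_upwards [h, hr1] with ω w1 w2
    rw [w1, Pi.smul_apply', w2, Pi.one_apply, one_smul]
  refine (ae_eq_condExp_of_forall_setIntegral_eq hm ((integrable_const (1 : ℝ)).mono'
    hf.aestronglyMeasurable (.of_forall hb)) (fun A _ _ => hgi.integrableOn) (fun A hA _ => ?_)
    hgs.aestronglyMeasurable).symm
  rw [hset g (hm A hA), hset f (hm A hA), ← setIntegral_condExp hm hrf hA]
  have h2 := setIntegral_condExp hm hrg hA
  rw [setIntegral_congr_ae (hm A hA) (hrg1.mono fun ω w _ => w)] at h2
  exact h2.symm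

namespace Spec

variable {n lk ly N T : ℕ} [NeZero T] {𝓩 : Type*} [MeasurableSpace 𝓩] (S : Spec n lk ly N T 𝓩)

section Measurability

variable {α : Type*} [MeasurableSpace α] {z : α → 𝓩} {c : α → CoefPath n lk ly T}
  (hz : Measurable z) (hc : Measurable c)
include hz hc

theorem entryMeasurable_Pi (β i : ℕ) : EntryMeasurable fun a => S.Pi (z a) (c a) β i := by
  have h : ∀ k, EntryMeasurable fun a => S.transProd (z a) (c a) β k := by
    intro k
    induction k with
    | zero => exact fun _ _ => measurable_const
    | succ k ih =>
      exact ((S.entryMeasurable_Q0 hz _).inv.mul (S.entryMeasurable_Q1 hz hc _)).mul ih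
  exact h _

theorem measurable_rnMean (t i : ℕ) {x : α → XIdx n → ℝ} (hx : Measurable x) :
    Measurable fun a => S.rnMean (z a) (c a) t i (x a) := by
  refine ((S.entryMeasurable_Pi hz hc t i).mulVec hx).add
    (Finset.measurable_fun_sum _ fun β _ => ?_)
  exact ((S.entryMeasurable_Pi hz hc β i).mul (S.entryMeasurable_Q0 hz β).inv).mulVec
    (S.measurable_nuTilde hz hc β)

theorem entryMeasurable_rnCov (t k l : ℕ) :
    EntryMeasurable fun a => S.rnCov (z a) (c a) t k l := by
  intro i j
  simp only [rnCov, Matrix.sum_apply]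
  refine Finset.measurable_fun_sum _ fun β _ => ?_
  have h : ∀ k, EntryMeasurable fun a =>
      S.Pi (z a) (c a) β k * (S.Q0 (z a) β)⁻¹ * S.GG (z a) β := fun k =>
    ((S.entryMeasurable_Pi hz hc β k).mul (S.entryMeasurable_Q0 hz β).inv).mul
      (S.entryMeasurable_GG hz β)
  exact (((h k).mul (measurable_coef_apply hc β).2.2).mul (h l).transpose) i j

theorem measurable_bond (t u : ℕ) {x : α → XIdx n → ℝ} (hx : Measurable x) :
    Measurable fun a => S.bond (z a) (c a) t u (x a) := by
  refine Real.measurable_exp.comp ((((measurable_pi_apply _).comp hx).neg.sub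
    (Finset.measurable_fun_sum _ fun β _ =>
      (measurable_pi_apply _).comp (S.measurable_rnMean hz hc t β hx))).add
    (Measurable.div_const (Finset.measurable_fun_sum _ fun k _ =>
      Finset.measurable_fun_sum _ fun l _ => ?_) 2))
  exact S.entryMeasurable_rnCov hz hc t k l _ _

end Measurability

/-- The exponent in the characteristic function of `(π, log P_k)`, as a function of the path. -/
noncomputable def pathLinear (z : 𝓩) (t k : ℕ) (a b : Fin n → ℝ) (η : Fin T → XIdx n → ℝ) : ℝ :=
  a ⬝ᵥ S.piVec z t (pathOf (S.x0 z) η t) (pathOf (S.x0 z) η (t + 1))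
    + b ⬝ᵥ (pathOf (S.x0 z) η k ∘ Sum.inl)

theorem measurable_pathLinear (t k : ℕ) (a b : Fin n → ℝ) :
    Measurable fun q : 𝓩 × (Fin T → XIdx n → ℝ) => S.pathLinear q.1 t k a b q.2 :=
  (measurable_dotProduct measurable_const
    (S.measurable_piVec measurable_fst measurable_snd t)).add
    (measurable_dotProduct measurable_const (measurable_pi_lambda _ fun i =>
      S.measurable_pathOf_apply measurable_fst measurable_snd k (Sum.inl i)))

/-- The characteristic function of `(π, log P_k)` under the forward measure, for given
coefficients. -/
theorem integral_cexp_fwdShift {z : 𝓩} {c : CoefPath n lk ly T}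
    (hc : ∀ i, (sigFam c i).PosDef) {t u k : ℕ} (ht : t < T) (htk : t < k) (hk : k ≤ T)
    (η : Fin T → XIdx n → ℝ) (a b : Fin n → ℝ) :
    ∫ ζ, Complex.exp (Complex.I * ((S.pathLinear z t k a b
        (S.contPath z c t η (ζ + S.fwdShift z c t u)) : ℝ) : ℂ)) ∂(noiseLaw c)
      = Complex.exp (Complex.I * ((a ⬝ᵥ S.piMean z c t u (pathOf (S.x0 z) η t)
            + b ⬝ᵥ S.priceMean z c t u k (pathOf (S.x0 z) η t) : ℝ) : ℂ)
          - (((a ⬝ᵥ (S.piCov z c t *ᵥ a) + 2 * (a ⬝ᵥ (S.piPriceCov z c t k *ᵥ b))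
              + b ⬝ᵥ (S.priceCov z c t k *ᵥ b)) / 2 : ℝ) : ℂ)) := by
  set xs := pathOf (S.x0 z) η with hxs
  let va : XIdx n → ℝ := a ᵥ* S.W z (t + 1)
  let vb : XIdx n → ℝ := Sum.elim b 0
  let v := S.loads z c t (t + 1) va + S.loads z c t k vb
  have hvb : ∀ y : XIdx n → ℝ, vb ⬝ᵥ y = b ⬝ᵥ (y ∘ Sum.inl) := fun y => by
    simp [vb, dotProduct, Fintype.sum_sum_type]
  -- the forward shift only moves the mean
  have hlin : ∀ ζ, S.pathLinear z t k a b (S.contPath z c t η (ζ + S.fwdShift z c t u))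
      = (a ⬝ᵥ S.piMean z c t u (xs t) + b ⬝ᵥ S.priceMean z c t u k (xs t))
        + linPath v ζ := by
    intro ζ
    have h1 := S.dotProduct_rnPath_fwdShift z c (u := u) xs ζ (Nat.le_succ t) ht va
    have h2 := S.dotProduct_rnPath_fwdShift z c (u := u) xs ζ htk.le hk vb
    rw [hvb, hvb] at h2
    have h3 : ∀ y, va ⬝ᵥ y = a ⬝ᵥ (S.W z (t + 1) *ᵥ y) := fun y =>
      (Matrix.dotProduct_mulVec _ _ _).symm
    rw [h3, h3] at h1
    rw [pathLinear, S.pathOf_contPath z c t η _ ht.le, S.pathOf_contPath z c t η _ ht,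
      S.pathOf_contPath z c t η _ hk, ← hxs, S.rnPath_of_le z c xs _ le_rfl, h2, linPath_add_left,
      piVec, piMean, dotProduct_add, dotProduct_add, dotProduct_sub, dotProduct_sub, h1]
    simp only [priceMean]
    ring
  -- the variance of the linear functional
  have hcov : covPath (sigFam c) v v = a ⬝ᵥ (S.piCov z c t *ᵥ a)
      + 2 * (a ⬝ᵥ (S.piPriceCov z c t k *ᵥ b)) + b ⬝ᵥ (S.priceCov z c t k *ᵥ b) := by
    have e1 : va ⬝ᵥ (S.rnCov z c t (t + 1) (t + 1) *ᵥ va) = a ⬝ᵥ (S.piCov z c t *ᵥ a) := by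
      simp only [va, piCov]
      rw [← Matrix.dotProduct_mulVec, ← Matrix.mulVec_mulVec, ← Matrix.mulVec_mulVec,
        Matrix.mulVec_transpose]
    have e2 : va ⬝ᵥ (S.rnCov z c t (t + 1) k *ᵥ vb) = a ⬝ᵥ (S.piPriceCov z c t k *ᵥ b) := by
      have h : S.piPriceCov z c t k = S.W z (t + 1) * S.rnCov z c t (t + 1) k
        * (Matrix.fromCols 1 0 : Matrix (Fin n) (XIdx n) ℝ)ᵀ := rfl
      have h' : (Matrix.fromCols 1 0 : Matrix (Fin n) (XIdx n) ℝ)ᵀ *ᵥ b = vb := by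
        rw [Matrix.mulVec_transpose, Matrix.vecMul_fromCols, Matrix.vecMul_one,
          Matrix.vecMul_zero]
      rw [h, ← Matrix.mulVec_mulVec, ← Matrix.mulVec_mulVec, h', Matrix.dotProduct_mulVec a]
    have e3 : vb ⬝ᵥ (S.rnCov z c t k k *ᵥ vb) = b ⬝ᵥ (S.priceCov z c t k *ᵥ b) := by
      rw [hvb]
      congr 1
      funext i
      simp [vb, Matrix.mulVec, dotProduct, Fintype.sum_sum_type, priceCov, Matrix.toBlocks₁₁]
    have hk' : t + 1 ≤ T := ht
    simp only [v]
    rw [covPath_add_left, covPath_add_right, covPath_add_right,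
      covPath_comm hc (S.loads z c t k vb) (S.loads z c t (t + 1) va),
      S.covPath_loads z c hk', S.covPath_loads z c hk', S.covPath_loads z c hk, e1, e2, e3]
    ring
  simp_rw [hlin]
  rw [← hcov]
  exact integral_cexp_linPath hc v _

end Spec

namespace Elements

variable {n lk ly N T : ℕ} [NeZero T] {𝓩 : Type*} [MeasurableSpace 𝓩]
  {Ω : Type*} [MeasurableSpace Ω] {M : Elements n lk ly N T 𝓩 Ω} {S : Spec n lk ly N T 𝓩}
  {Pr : Measure Ω} (hM : M.IsModel S Pr)
include hM

/-- The conditional expectation of the discount factor given `H_t`. -/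
theorem IsModel.bondPricing {t u : ℕ} (h : t < u) (hu : u ≤ T) : M.BondPricing S Pr t u := by
  intro A hA
  have ht : t ≤ T := h.le.trans hu
  have hm : Measurable fun q : Base n lk ly N T 𝓩 × (Fin T → XIdx n → ℝ) =>
      ENNReal.ofReal (S.pathD q.1.1 u q.2) :=
    (S.measurable_pathD measurable_fst.fst measurable_snd u).ennreal_ofReal
  have h1 := hM.setLIntegral_sigH ht hm hA
  have e1 : ∀ ω, ENNReal.ofReal (S.pathD (M.base ω).1 u (M.xPath S ω))
      = ENNReal.ofReal (M.D S u ω) := fun ω => by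
    rw [show (M.base ω).1 = M.init ω from rfl, M.pathD_xPath S (by omega)]
  simp only [e1] at h1
  refine h1.trans (setLIntegral_congr_fun_ae (hM.sigH_le t _ hA) ?_)
  filter_upwards [hM.ae_posDef] with ω hpd _
  have e2 : ∀ ζ, ENNReal.ofReal (S.pathD (M.base ω).1 u
      (S.contPath (M.init ω) (M.coef ω) t (M.xPath S ω) ζ)) = ENNReal.ofReal (M.D S t ω)
      * ENNReal.ofReal (Real.exp (-∑ β ∈ Finset.Ico t u, S.rnPath (M.init ω) (M.coef ω) t
        (Spec.pathOf (S.x0 (M.init ω)) (M.xPath S ω)) ζ β (Spec.rIdx n))) := fun ζ => by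
    rw [show (M.base ω).1 = M.init ω from rfl, S.pathD_contPath _ _ h.le hu,
      M.pathD_xPath S (by omega), ENNReal.ofReal_mul (D_pos t ω).le]
  simp only [e2]
  rw [lintegral_const_mul' _ _ ENNReal.ofReal_ne_top, S.lintegral_discount hpd _ h hu,
    M.pathOf_xPath S ht, ENNReal.ofReal_mul (D_pos t ω).le, B]

/-- The conditional law under the forward measure, identified by its characteristic function through
the change of measure formula for conditional expectations. -/
theorem IsModel.forwardMoments {t u k : ℕ} (h : t < u) (hu : u ≤ T) (htk : t < k) (hk : k ≤ T) :
    M.ForwardMoments S Pr t u k := by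
  intro a b
  have := hM.isProbabilityMeasure_riskNeutral
  have ht : t < T := h.trans_le hu
  -- the density of the forward measure as a function of the base variables and the path
  let R : Base n lk ly N T 𝓩 × (Fin T → XIdx n → ℝ) → ℝ := fun q =>
    S.pathD q.1.1 u q.2 / (S.pathD q.1.1 t q.2
      * S.bond q.1.1 q.1.2.2.2 t u (Spec.pathOf (S.x0 q.1.1) q.2 t))
  let f : Base n lk ly N T 𝓩 × (Fin T → XIdx n → ℝ) → ℂ := fun q =>
    Complex.exp (Complex.I * ((S.pathLinear q.1.1 t k a b q.2 : ℝ) : ℂ))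
  let g : Ω → ℂ := fun ω =>
    Complex.exp (Complex.I * ((a ⬝ᵥ S.piMean (M.init ω) (M.coef ω) t u (M.x S t ω)
      + b ⬝ᵥ S.priceMean (M.init ω) (M.coef ω) t u k (M.x S t ω) : ℝ) : ℂ)
      - (((a ⬝ᵥ (S.piCov (M.init ω) (M.coef ω) t *ᵥ a)
        + 2 * (a ⬝ᵥ (S.piPriceCov (M.init ω) (M.coef ω) t k *ᵥ b))
        + b ⬝ᵥ (S.priceCov (M.init ω) (M.coef ω) t k *ᵥ b)) / 2 : ℝ) : ℂ))
  have hR : Measurable R := by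
    refine (S.measurable_pathD measurable_fst.fst measurable_snd u).div
      ((S.measurable_pathD measurable_fst.fst measurable_snd t).mul ?_)
    exact S.measurable_bond measurable_fst.fst measurable_fst.snd.snd.snd t u
      ((measurable_pi_apply t).comp (Spec.measurable_pathOf (S.meas_x0.comp measurable_fst.fst)
        measurable_snd))
  have hL : Measurable fun q : Base n lk ly N T 𝓩 × (Fin T → XIdx n → ℝ) =>
      S.pathLinear q.1.1 t k a b q.2 :=
    fun _ hA => (measurable_fst.fst.prodMk measurable_snd) (S.measurable_pathLinear t k a b hA)
  have hf : Measurable f := Complex.measurable_exp.comp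
    ((Complex.measurable_ofReal.comp hL).const_mul Complex.I)
  have hf1 : ∀ q, ‖f q‖ = 1 := fun q => by
    simp only [f]
    rw [mul_comm, Complex.norm_exp_ofReal_mul_I]
  let J : Ω → Base n lk ly N T 𝓩 × (Fin T → XIdx n → ℝ) := fun ω => (M.base ω, M.xPath S ω)
  have hJ : Measurable J := hM.measurable_base.prodMk hM.measurable_xPath
  have hRm : Measurable fun ω => R (J ω) := fun _ hA => hJ (hR hA)
  have hfm : Measurable fun ω => f (J ω) := fun _ hA => hJ (hf hA)
  have hRJ : ∀ ω, R (J ω) = M.D S u ω / (M.D S t ω * M.B S t u ω) := fun ω => by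
    simp only [R, J, show (M.base ω).1 = M.init ω from rfl,
      show (M.base ω).2.2.2 = M.coef ω from rfl]
    rw [M.pathD_xPath S (by omega), M.pathD_xPath S (by omega), M.pathOf_xPath S ht.le, B]
  have hBpos : ∀ z c x, 0 < S.bond z c t u x := fun z c x => Real.exp_pos _
  have hR0 : ∀ q, 0 < R q := fun q =>
    div_pos (Real.exp_pos _) (mul_pos (Real.exp_pos _) (hBpos _ _ _))
  -- discounting along the continued path
  have hRc : ∀ ω ζ, R (M.base ω, S.contPath (M.init ω) (M.coef ω) t (M.xPath S ω) ζ)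
      = Real.exp (-∑ β ∈ Finset.Ico t u, S.rnPath (M.init ω) (M.coef ω) t
          (Spec.pathOf (S.x0 (M.init ω)) (M.xPath S ω)) ζ β (Spec.rIdx n))
        * (S.bond (M.init ω) (M.coef ω) t u
          (Spec.pathOf (S.x0 (M.init ω)) (M.xPath S ω) t))⁻¹ := by
    intro ω ζ
    have hD : S.pathD (M.init ω) t (M.xPath S ω) ≠ 0 := (Real.exp_pos _).ne'
    simp only [R, show (M.base ω).1 = M.init ω from rfl,
      show (M.base ω).2.2.2 = M.coef ω from rfl]
    rw [S.pathD_contPath _ _ h.le hu, S.pathD_contPath_of_le _ _ ht.le _ _ (Nat.le_succ t),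
      S.pathOf_contPath_le _ _ ht.le _ _ le_rfl]
    field_simp
  have hcalc : ∀ᵐ ω ∂(M.riskNeutral S Pr), ∀ F : (Fin T → XIdx n → ℝ) → ℂ,
      ∫ ζ, R (M.base ω, S.contPath (M.init ω) (M.coef ω) t (M.xPath S ω) ζ) • F ζ
        ∂(Spec.noiseLaw (M.coef ω))
      = ∫ ζ, F (ζ + S.fwdShift (M.init ω) (M.coef ω) t u) ∂(Spec.noiseLaw (M.coef ω)) := by
    filter_upwards [hM.ae_posDef] with ω hpd F
    have hd := (S.integral_discount hpd (z := M.init ω)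
      (Spec.pathOf (S.x0 (M.init ω)) (M.xPath S ω)) h hu F).2
    simp_rw [hRc, mul_comm _ (Spec.bond _ _ _ _ _ _)⁻¹, mul_smul]
    rw [integral_smul, hd, smul_smul, inv_mul_cancel₀ (hBpos _ _ _).ne', one_smul]
  have hRint : Integrable (fun ω => R (J ω)) (M.riskNeutral S Pr) := by
    refine ⟨hRm.aestronglyMeasurable, ?_⟩
    rw [hasFiniteIntegral_iff_norm]
    have h1 := hM.setLIntegral_sigH ht.le hR.ennreal_ofReal (A := Set.univ) MeasurableSet.univ
    simp only [Measure.restrict_univ] at h1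
    have e : ∀ ω, ENNReal.ofReal ‖R (J ω)‖ = ENNReal.ofReal (R (M.base ω, M.xPath S ω)) :=
      fun ω => by rw [Real.norm_of_nonneg (hR0 _).le]
    simp only [e]
    rw [h1]
    have e2 : ∀ᵐ ω ∂(M.riskNeutral S Pr), ∫⁻ ζ, ENNReal.ofReal
        (R (M.base ω, S.contPath (M.init ω) (M.coef ω) t (M.xPath S ω) ζ))
          ∂(Spec.noiseLaw (M.coef ω)) = 1 := by
      filter_upwards [hM.ae_posDef] with ω hpd
      simp_rw [hRc, ENNReal.ofReal_mul (Real.exp_nonneg _)]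
      rw [lintegral_mul_const' _ _ ENNReal.ofReal_ne_top, S.lintegral_discount hpd _ h hu,
        ← ENNReal.ofReal_mul (hBpos _ _ _).le, mul_inv_cancel₀ (hBpos _ _ _).ne',
        ENNReal.ofReal_one]
    rw [lintegral_congr_ae e2]
    simp
  have hRfint : Integrable (fun ω => R (J ω) • f (J ω)) (M.riskNeutral S Pr) := by
    refine hRint.mono' (hRm.smul hfm).aestronglyMeasurable
      (.of_forall fun ω => ?_)
    rw [norm_smul, hf1, mul_one, Real.norm_of_nonneg (hR0 _).le]
  have hR1 : (M.riskNeutral S Pr)[fun ω => R (J ω) | M.sigH S t]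
      =ᵐ[M.riskNeutral S Pr] 1 := by
    refine (hM.condExp_sigH ht.le hR hRint).2.trans ?_
    filter_upwards [hcalc, hM.ae_posDef] with ω hω hpd
    have hp := Spec.isProbabilityMeasure_noiseLaw hpd
    have h1 := hω fun _ => 1
    have e : ∀ r : ℝ, r • (1 : ℂ) = (r : ℂ) := fun r => by simp
    simp only [e, integral_const, probReal_univ, integral_complex_ofReal] at h1
    exact_mod_cast h1
  -- real and imaginary parts
  have hpart : ∀ p : ℂ →L[ℝ] ℝ, (fun ω =>
      p (((M.riskNeutral S Pr)[fun ω => R (J ω) • f (J ω) | M.sigH S t]) ω))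
        =ᵐ[M.riskNeutral S Pr] fun ω => p (g ω) := by
    intro p
    refine (p.comp_condExp_comm hRfint).trans ?_
    have hmeas : Measurable fun q => p (R q • f q) := p.measurable.comp (hR.smul hf)
    refine (hM.condExp_sigH ht.le hmeas (p.integrable_comp hRfint)).2.trans ?_
    filter_upwards [hcalc, hM.ae_posDef] with ω hω hpd
    have hp := Spec.isProbabilityMeasure_noiseLaw hpd
    have h1 := hω fun ζ => f (M.base ω, S.contPath (M.init ω) (M.coef ω) t (M.xPath S ω) ζ)
    have h2 := S.integral_cexp_fwdShift hpd (z := M.init ω) (u := u) ht htk hk (M.xPath S ω) a b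
    rw [M.pathOf_xPath S ht.le] at h2
    have hcm : Measurable fun ζ => (M.base ω,
        S.contPath (M.init ω) (M.coef ω) t (M.xPath S ω) ζ) :=
      measurable_const.prodMk (S.measurable_contPath (z := fun _ => M.init ω)
        (c := fun _ => M.coef ω) measurable_const measurable_const t measurable_const
        measurable_id)
    have hi : Integrable (fun ζ => f (M.base ω,
        S.contPath (M.init ω) (M.coef ω) t (M.xPath S ω) (ζ + S.fwdShift (M.init ω)
          (M.coef ω) t u))) (Spec.noiseLaw (M.coef ω)) :=
      (integrable_const (1 : ℝ)).mono' ((hf.comp hcm).comp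
        (measurable_id.add_const _)).aestronglyMeasurable (.of_forall fun ζ => (hf1 _).le)
    have hi' : Integrable (fun ζ => R (M.base ω,
        S.contPath (M.init ω) (M.coef ω) t (M.xPath S ω) ζ) • f (M.base ω,
        S.contPath (M.init ω) (M.coef ω) t (M.xPath S ω) ζ)) (Spec.noiseLaw (M.coef ω)) := by
      have hd := (S.integral_discount hpd (z := M.init ω)
        (Spec.pathOf (S.x0 (M.init ω)) (M.xPath S ω)) h hu
        (fun ζ => f (M.base ω, S.contPath (M.init ω) (M.coef ω) t (M.xPath S ω) ζ))).1.2 hi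
      simp_rw [hRc, mul_comm _ (Spec.bond _ _ _ _ _ _)⁻¹, mul_smul]
      exact hd.smul _
    rw [p.integral_comp_comm hi', h1]
    exact congrArg p h2
  have hfinal : (M.riskNeutral S Pr)[fun ω => R (J ω) • f (J ω) | M.sigH S t]
      =ᵐ[M.riskNeutral S Pr] g := by
    filter_upwards [hpart Complex.reCLM, hpart Complex.imCLM] with ω h1 h2
    exact Complex.ext h1 h2
  have hbayes := condExp_withDensity (hM.sigH_le t) (r := fun ω => R (J ω))
    (fun ω => (hR0 _).le) hRm hRint hR1 (f := fun ω => f (J ω))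
    hfm.stronglyMeasurable fun ω => (hf1 _).le
  have hfw : M.forward S Pr t u
      = (M.riskNeutral S Pr).withDensity fun ω => ENNReal.ofReal (R (J ω)) := by
    simp only [forward, hRJ]
  have hac : M.riskNeutral S Pr ≪
      (M.riskNeutral S Pr).withDensity fun ω => ENNReal.ofReal (R (J ω)) :=
    withDensity_absolutelyContinuous' hRm.ennreal_ofReal.aemeasurable
      (.of_forall fun ω => (ENNReal.ofReal_pos.2 (hR0 _)).ne')
  have hfJ : (fun ω => f (J ω)) = fun ω => Complex.exp (Complex.I *
        ((a ⬝ᵥ S.piVec (M.init ω) t (M.x S t ω) (M.x S (t + 1) ω)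
          + b ⬝ᵥ (M.x S k ω ∘ Sum.inl) : ℝ) : ℂ)) := by
    funext ω
    simp only [f, J, Spec.pathLinear, show (M.base ω).1 = M.init ω from rfl]
    rw [M.pathOf_xPath S ht.le, M.pathOf_xPath S ht, M.pathOf_xPath S hk]
  rw [hfJ] at hbayes
  rw [hfw]
  exact (hac.ae_eq hbayes).trans hfinal

end Elements
end GordonHedge

namespace GordonHedge

/-! ### Closed forms for European payoffs, given the coefficients -/

namespace Spec

variable {n lk ly N T : ℕ} [NeZero T] {𝓩 : Type*} [MeasurableSpace 𝓩] (S : Spec n lk ly N T 𝓩)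

/-- Given the coefficients and the state at `t`, the payoff `φ(P_k)` has the price `V`, and `L` is
the mean of its product with the cumulative prices at `t + 1`, relative to the discount factors. -/
def HasPrice (t k : ℕ) (φ : (Fin n → ℝ) → ℝ)
    (V : 𝓩 → CoefPath n lk ly T → (XIdx n → ℝ) → ℝ)
    (L : 𝓩 → CoefPath n lk ly T → (XIdx n → ℝ) → Fin n → ℝ) : Prop :=
  ∀ (z : 𝓩) (c : CoefPath n lk ly T), (∀ i, (sigFam c i).PosDef) → ∀ η : Fin T → XIdx n → ℝ,
    (Integrable (fun ζ => S.pathD z k (S.contPath z c t η ζ) * φ (S.pathP z k (S.contPath z c t η ζ)))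
        (noiseLaw c) ∧
      ∫ ζ, S.pathD z k (S.contPath z c t η ζ) * φ (S.pathP z k (S.contPath z c t η ζ)) ∂(noiseLaw c)
        = S.pathD z t η * V z c (pathOf (S.x0 z) η t)) ∧
    ∀ a, Integrable (fun ζ => S.pathCum z t (S.contPath z c t η ζ) a
          * (S.pathD z k (S.contPath z c t η ζ) * φ (S.pathP z k (S.contPath z c t η ζ))))
        (noiseLaw c) ∧
      ∫ ζ, S.pathCum z t (S.contPath z c t η ζ) a
          * (S.pathD z k (S.contPath z c t η ζ) * φ (S.pathP z k (S.contPath z c t η ζ)))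
          ∂(noiseLaw c)
        = S.pathD z t η ^ 2 * L z c (pathOf (S.x0 z) η t) a

variable {S} {t k : ℕ} {φ ψ : (Fin n → ℝ) → ℝ}
  {V V' : 𝓩 → CoefPath n lk ly T → (XIdx n → ℝ) → ℝ}
  {L L' : 𝓩 → CoefPath n lk ly T → (XIdx n → ℝ) → Fin n → ℝ}

theorem HasPrice.add (h : S.HasPrice t k φ V L) (h' : S.HasPrice t k ψ V' L') :
    S.HasPrice t k (fun P => φ P + ψ P) (fun z c x => V z c x + V' z c x)
      (fun z c x a => L z c x a + L' z c x a) := by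
  intro z c hc η
  obtain ⟨⟨i1, e1⟩, h2⟩ := h z c hc η
  obtain ⟨⟨i1', e1'⟩, h2'⟩ := h' z c hc η
  simp only [mul_add]
  refine ⟨⟨i1.add i1', ?_⟩, fun a => ?_⟩
  · rw [integral_add i1 i1', e1, e1']
  · obtain ⟨i2, e2⟩ := h2 a
    obtain ⟨i2', e2'⟩ := h2' a
    exact ⟨i2.add i2', by rw [integral_add i2 i2', e2, e2']⟩

theorem HasPrice.const_mul (r : ℝ) (h : S.HasPrice t k φ V L) :
    S.HasPrice t k (fun P => r * φ P) (fun z c x => r * V z c x)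
      (fun z c x a => r * L z c x a) := by
  intro z c hc η
  obtain ⟨⟨i1, e1⟩, h2⟩ := h z c hc η
  simp only [mul_left_comm _ r]
  refine ⟨⟨i1.const_mul r, ?_⟩, fun a => ?_⟩
  · rw [integral_const_mul, e1]
  · obtain ⟨i2, e2⟩ := h2 a
    exact ⟨i2.const_mul r, by rw [integral_const_mul, e2]⟩

/-- Discounting replaces the risk-neutral by the forward moments, so that prices are the bond price
times Gaussian integrals. -/
theorem hasPrice_of_gaussian (ht : t < k) (hk : k ≤ T)
    (hV : ∀ (z : 𝓩) (c : CoefPath n lk ly T), (∀ i, (sigFam c i).PosDef) → ∀ x,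
      Integrable (fun ζ => φ fun i => Real.exp (S.priceMean z c t k k x i
          + linPath (S.priceLoads z c t k i) ζ)) (noiseLaw c) ∧
      V z c x = S.bond z c t k x * ∫ ζ, φ (fun i => Real.exp (S.priceMean z c t k k x i
          + linPath (S.priceLoads z c t k i) ζ)) ∂(noiseLaw c))
    (hL : ∀ (z : 𝓩) (c : CoefPath n lk ly T), (∀ i, (sigFam c i).PosDef) → ∀ x a,
      Integrable (fun ζ => Real.exp (S.piMean z c t k x a + linPath (S.piLoads z c t a) ζ)
          * φ fun i => Real.exp (S.priceMean z c t k k x i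
            + linPath (S.priceLoads z c t k i) ζ)) (noiseLaw c) ∧
      L z c x a = S.bond z c t k x * ∫ ζ, Real.exp (S.piMean z c t k x a
          + linPath (S.piLoads z c t a) ζ) * φ (fun i => Real.exp (S.priceMean z c t k k x i
            + linPath (S.priceLoads z c t k i) ζ)) ∂(noiseLaw c)) :
    S.HasPrice t k φ V L := by
  intro z c hc η
  have htT : t < T := ht.trans_le hk
  set xs := pathOf (S.x0 z) η with hxs
  have hP : ∀ ζ, S.pathP z k (S.contPath z c t η ζ)
      = fun i => Real.exp (S.rnPath z c t xs ζ k (Sum.inl i)) := fun ζ => by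
    funext i
    rw [pathP, S.pathOf_contPath z c t η ζ hk]
  have hC : ∀ ζ a, S.pathCum z t (S.contPath z c t η ζ) a = S.pathD z t η
      * Real.exp (S.piVec z t (xs t) (S.rnPath z c t xs ζ (t + 1)) a) := fun ζ a => by
    rw [pathCum, S.pathD_contPath_of_le z c htT.le _ _ (Nat.le_succ t),
      S.pathOf_contPath_le z c htT.le _ _ le_rfl, S.pathOf_contPath z c t η ζ htT]
  simp only [hP, hC, S.pathD_contPath z c ht.le hk, ← hxs]
  constructor
  · have h := S.integral_discount (z := z) hc xs ht hk
      fun ζ => φ fun i => Real.exp (S.rnPath z c t xs ζ k (Sum.inl i))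
    simp only [S.price_rnPath_fwdShift z c xs _ ht.le hk, smul_eq_mul] at h
    obtain ⟨i0, e0⟩ := hV z c hc (xs t)
    simp only [mul_assoc]
    refine ⟨(h.1.2 i0).const_mul _, ?_⟩
    rw [integral_const_mul, h.2, e0]
  · intro a
    have h := S.integral_discount (z := z) hc xs ht hk
      fun ζ => Real.exp (S.piVec z t (xs t) (S.rnPath z c t xs ζ (t + 1)) a)
        * φ fun i => Real.exp (S.rnPath z c t xs ζ k (Sum.inl i))
    simp only [S.price_rnPath_fwdShift z c xs _ ht.le hk,
      S.piVec_rnPath_fwdShift z c xs _ htT, smul_eq_mul] at h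
    obtain ⟨i0, e0⟩ := hL z c hc (xs t) a
    have e : ∀ ζ, S.pathD z t η * Real.exp (S.piVec z t (xs t) (S.rnPath z c t xs ζ (t + 1)) a)
        * (S.pathD z t η * Real.exp (-∑ β ∈ Finset.Ico t k, S.rnPath z c t xs ζ β (rIdx n))
          * φ fun i => Real.exp (S.rnPath z c t xs ζ k (Sum.inl i)))
        = S.pathD z t η ^ 2 * (Real.exp (-∑ β ∈ Finset.Ico t k, S.rnPath z c t xs ζ β (rIdx n))
          * (Real.exp (S.piVec z t (xs t) (S.rnPath z c t xs ζ (t + 1)) a)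
            * φ fun i => Real.exp (S.rnPath z c t xs ζ k (Sum.inl i)))) := fun ζ => by ring
    simp only [e]
    refine ⟨(h.1.2 i0).const_mul _, ?_⟩
    rw [integral_const_mul, h.2, e0]

/-- A sure payment is priced by the zero-coupon bond. -/
theorem hasPrice_const (ht : t < k) (hk : k ≤ T) (r : ℝ) :
    S.HasPrice t k (fun _ => r) (fun z c x => S.bond z c t k x * r)
      (fun z c x a => S.bond z c t k x * lognMean (S.piMean z c t k x) (S.piCov z c t) a * r) := by
  refine hasPrice_of_gaussian ht hk (fun z c hc x => ?_) fun z c hc x a => ?_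
  · have := isProbabilityMeasure_noiseLaw hc
    exact ⟨integrable_const r, by simp⟩
  · have h1 := integrable_exp_noiseLaw hc (S.piLoads z c t a)
    have h2 := integral_exp_linPath_one hc (S.piLoads z c t a)
    rw [S.covPath_piLoads z c (ht.trans_le hk)] at h2
    simp only [Real.exp_add]
    refine ⟨(h1.const_mul _).mul_const r, ?_⟩
    rw [integral_mul_const, integral_const_mul, h2, lognMean, Real.exp_add]
    ring

/-- The price of a call and its mixed moment with the cumulative prices `e^π`. -/
theorem hasPrice_call (ht : t < k) (hk : k ≤ T) {K : Fin n → ℝ} {i : Fin n} (hK : 0 < K i) :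
    S.HasPrice t k (fun P => max (P i - K i) 0) (fun z c x => S.callPrice z c t k K x i)
      (fun z c x a => S.bondPsiPlus z c t k K x a i) := by
  have htT : t < T := ht.trans_le hk
  refine hasPrice_of_gaussian ht hk (fun z c hc x => ?_) fun z c hc x a => ?_
  · have h := integral_exp_mul_call hc 0 (S.priceLoads z c t k i) (L := K) (μ₁ := (0 : Fin n → ℝ))
      (μ₂ := S.priceMean z c t k k x) (S₁₁ := 0) (S₁₂ := 0) (S₂₂ := S.priceCov z c t k) (a := i)
      (b := i) hK (covPath_zero_left _).symm (covPath_zero_left _).symm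
      (S.covPath_priceLoads z c hk i i).symm (S.covPath_priceLoads_pos hc ht hk i)
    have h0 : ∀ ζ, linPath (0 : Fin T → XIdx n → ℝ) ζ = 0 := fun ζ => by simp [linPath]
    simp only [Pi.zero_apply, h0, add_zero, Real.exp_zero, one_mul] at h
    refine ⟨h.1, ?_⟩
    refine Eq.trans ?_ (congrArg (S.bond z c t k x * ·) h.2.symm)
    simp [callPrice, PsiPlus, lognMean]
  · have h := integral_exp_mul_call hc (S.piLoads z c t a) (S.priceLoads z c t k i) (L := K)
      (μ₁ := S.piMean z c t k x) (μ₂ := S.priceMean z c t k k x) (S₁₁ := S.piCov z c t)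
      (S₁₂ := S.piPriceCov z c t k) (S₂₂ := S.priceCov z c t k) (a := a)
      (b := i) hK (S.covPath_piLoads z c htT a a).symm
      (S.covPath_piLoads_priceLoads z c htT a i).symm
      (S.covPath_priceLoads z c hk i i).symm (S.covPath_priceLoads_pos hc ht hk i)
    exact ⟨h.1, congrArg (S.bond z c t k x * ·) h.2.symm⟩

/-- The price of a put and its mixed moment with the cumulative prices `e^π`. -/
theorem hasPrice_put (ht : t < k) (hk : k ≤ T) {K : Fin n → ℝ} {i : Fin n} (hK : 0 < K i) :
    S.HasPrice t k (fun P => max (K i - P i) 0) (fun z c x => S.putPrice z c t k K x i)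
      (fun z c x a => S.bondPsiMinus z c t k K x a i) := by
  have htT : t < T := ht.trans_le hk
  refine hasPrice_of_gaussian ht hk (fun z c hc x => ?_) fun z c hc x a => ?_
  · have h := integral_exp_mul_put hc 0 (S.priceLoads z c t k i) (L := K) (μ₁ := (0 : Fin n → ℝ))
      (μ₂ := S.priceMean z c t k k x) (S₁₁ := 0) (S₁₂ := 0) (S₂₂ := S.priceCov z c t k) (a := i)
      (b := i) hK (covPath_zero_left _).symm (covPath_zero_left _).symm
      (S.covPath_priceLoads z c hk i i).symm (S.covPath_priceLoads_pos hc ht hk i)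
    have h0 : ∀ ζ, linPath (0 : Fin T → XIdx n → ℝ) ζ = 0 := fun ζ => by simp [linPath]
    simp only [Pi.zero_apply, h0, add_zero, Real.exp_zero, one_mul] at h
    refine ⟨h.1, ?_⟩
    refine Eq.trans ?_ (congrArg (S.bond z c t k x * ·) h.2.symm)
    simp [putPrice, PsiMinus, lognMean]
  · have h := integral_exp_mul_put hc (S.piLoads z c t a) (S.priceLoads z c t k i) (L := K)
      (μ₁ := S.piMean z c t k x) (μ₂ := S.priceMean z c t k k x) (S₁₁ := S.piCov z c t)
      (S₁₂ := S.piPriceCov z c t k) (S₂₂ := S.priceCov z c t k) (a := a)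
      (b := i) hK (S.covPath_piLoads z c htT a a).symm
      (S.covPath_piLoads_priceLoads z c htT a i).symm
      (S.covPath_priceLoads z c hk i i).symm (S.covPath_priceLoads_pos hc ht hk i)
    exact ⟨h.1, congrArg (S.bond z c t k x * ·) h.2.symm⟩

/-- The volatility of the log price ratio in terms of the noise. -/
theorem spreadSd_eq (z : 𝓩) (c : CoefPath n lk ly T) (i j : Fin n) :
    S.spreadSd z c t i j = Real.sqrt (covPath (sigFam c)
      (S.priceLoads z c t T i + (-1 : ℝ) • S.priceLoads z c t T j)
      (S.priceLoads z c t T i + (-1 : ℝ) • S.priceLoads z c t T j)) := by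
  simp only [covPath_add_left, covPath_add_right, covPath_smul_left, covPath_smul_right,
    S.covPath_priceLoads z c le_rfl, spreadSd]
  congr 1
  ring

/-- The log price ratio of two different assets is not degenerate, so the exchange formula divides
by a positive number. -/
theorem spread_covPath_pos {z : 𝓩} {c : CoefPath n lk ly T} (hc : ∀ i, (sigFam c i).PosDef)
    (ht : t < T) {i j : Fin n} (hij : i ≠ j) :
    0 < covPath (sigFam c) (S.priceLoads z c t T i + (-1 : ℝ) • S.priceLoads z c t T j)
        (S.priceLoads z c t T i + (-1 : ℝ) • S.priceLoads z c t T j) := by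
  have e : S.priceLoads z c t T i + (-1 : ℝ) • S.priceLoads z c t T j
      = S.loads z c t T (Pi.single (Sum.inl i) 1 + (-1 : ℝ) • Pi.single (Sum.inl j) 1) := by
    funext m
    simp only [priceLoads, loads, Pi.add_apply, Pi.smul_apply]
    split_ifs
    · rw [Matrix.add_vecMul, Matrix.smul_vecMul]
    · simp
  rw [e]
  refine covPath_self_pos hc (S.loads_ne_zero z c ht le_rfl fun h => ?_)
  have := congrFun h (Sum.inl i)
  simp [hij] at this

/-- The exchange formula with the moments of the log prices inserted. -/
theorem integral_exp_mul_exchange_prices {z : 𝓩} {c : CoefPath n lk ly T}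
    (hc : ∀ i, (sigFam c i).PosDef) (ht : t < T) {i j : Fin n} (hij : i ≠ j) {wi wj : ℝ}
    (hi : 0 < wi) (hj : 0 < wj) (x : XIdx n → ℝ) (w : Fin T → XIdx n → ℝ) (m q ri rj : ℝ)
    (hq : covPath (sigFam c) w w = q)
    (hri : covPath (sigFam c) w (S.priceLoads z c t T i) = ri)
    (hrj : covPath (sigFam c) w (S.priceLoads z c t T j) = rj) :
    Integrable (fun ζ => Real.exp (m + linPath w ζ)
      * max (wi * Real.exp (S.priceMean z c t T T x i + linPath (S.priceLoads z c t T i) ζ)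
        - wj * Real.exp (S.priceMean z c t T T x j + linPath (S.priceLoads z c t T j) ζ)) 0)
      (noiseLaw c) ∧
    ∫ ζ, Real.exp (m + linPath w ζ)
      * max (wi * Real.exp (S.priceMean z c t T T x i + linPath (S.priceLoads z c t T i) ζ)
        - wj * Real.exp (S.priceMean z c t T T x j + linPath (S.priceLoads z c t T j) ζ)) 0
      ∂(noiseLaw c)
      = wi * Real.exp (m + S.priceMean z c t T T x i
            + (q + ri + ri + S.priceCov z c t T i i) / 2)
          * Phi (S.margrabeD z c t i j wi wj x + (ri - rj) / S.spreadSd z c t i j)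
        - wj * Real.exp (m + S.priceMean z c t T T x j
            + (q + rj + rj + S.priceCov z c t T j j) / 2)
          * Phi (S.margrabeD z c t i j wi wj x + (ri - rj) / S.spreadSd z c t i j
              - S.spreadSd z c t i j) := by
  have hpos := S.spread_covPath_pos (z := z) hc ht hij
  obtain ⟨h1, h2⟩ := integral_exp_mul_exchange hc w _ _ hpos m (S.priceMean z c t T T x i)
    (S.priceMean z c t T T x j) hi hj
  refine ⟨h1, h2.trans ?_⟩
  have hσ : 0 < S.spreadSd z c t i j := by
    rw [spreadSd_eq z c]
    exact Real.sqrt_pos.2 hpos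
  have hσ2 : S.spreadSd z c t i j ^ 2 = S.priceCov z c t T i i - S.priceCov z c t T i j
      - S.priceCov z c t T j i + S.priceCov z c t T j j := by
    rw [spreadSd_eq z c, Real.sq_sqrt hpos.le]
    simp only [covPath_add_left, covPath_add_right, covPath_smul_left, covPath_smul_right,
      S.covPath_priceLoads z c le_rfl]
    ring
  have hsymm : S.priceCov z c t T i j = S.priceCov z c t T j i := by
    rw [← S.covPath_priceLoads z c le_rfl, covPath_comm hc, S.covPath_priceLoads z c le_rfl]
  rw [← spreadSd_eq z c]
  simp only [covPath_add_left, covPath_add_right, covPath_smul_left,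
    S.covPath_priceLoads z c le_rfl, hq, hri, hrj, covPath_comm hc (S.priceLoads z c t T _) w]
  rw [margrabeD]
  set σ := S.spreadSd z c t i j
  have e1 : (S.priceMean z c t T T x i - S.priceMean z c t T T x j - Real.log (wj / wi)
        + (ri + -1 * rj + (S.priceCov z c t T i i + -1 * S.priceCov z c t T j i))) / σ
      = (S.priceMean z c t T T x i - S.priceMean z c t T T x j
        + (S.priceCov z c t T i i - S.priceCov z c t T j i) - Real.log (wj / wi)) / σ
        + (ri - rj) / σ := by ring
  -- uses `σ² / σ = σ`
  have e2 : (S.priceMean z c t T T x i - S.priceMean z c t T T x j - Real.log (wj / wi)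
        + (ri + -1 * rj + (S.priceCov z c t T i j + -1 * S.priceCov z c t T j j))) / σ
      = (S.priceMean z c t T T x i - S.priceMean z c t T T x j
        + (S.priceCov z c t T i i - S.priceCov z c t T j i) - Real.log (wj / wi)) / σ
        + (ri - rj) / σ - σ := by
    field_simp
    rw [hσ2, hsymm]
    ring
  rw [e1, e2, ← mul_assoc, ← mul_assoc]
  congr 5 <;> ring

/-- The price of an exchange option and its mixed moment with the cumulative prices `e^π`. -/
theorem hasPrice_margrabe (ht : t < T) {i j : Fin n} (hij : i ≠ j) {wi wj : ℝ} (hi : 0 < wi)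
    (hj : 0 < wj) :
    S.HasPrice t T (fun P => max (wi * P i - wj * P j) 0)
      (fun z c x => S.margrabePrice z c t i j wi wj x)
      (fun z c x a => S.bond z c t T x *
        (wi * lognMean (S.phiMean z c t T i x) (S.phiCov z c t i) a
            * Phi (S.margrabeDTilde z c t i j wi wj x a)
          - wj * lognMean (S.phiMean z c t T j x) (S.phiCov z c t j) a
            * Phi (S.margrabeDTilde z c t i j wi wj x a - S.spreadSd z c t i j))) := by
  refine hasPrice_of_gaussian ht le_rfl (fun z c hc x => ?_) fun z c hc x a => ?_
  · have h := integral_exp_mul_exchange_prices (S := S) (z := z) hc ht hij hi hj x 0 0 0 0 0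
      (covPath_zero_left _) (covPath_zero_left _) (covPath_zero_left _)
    have h0 : ∀ ζ, linPath (0 : Fin T → XIdx n → ℝ) ζ = 0 := fun ζ => by simp [linPath]
    simp only [h0, add_zero, Real.exp_zero, one_mul, zero_add, sub_zero, zero_div] at h
    exact ⟨h.1, congrArg (S.bond z c t T x * ·) h.2.symm⟩
  · have h := integral_exp_mul_exchange_prices (S := S) hc ht hij hi hj x (S.piLoads z c t a)
      (S.piMean z c t T x a) _ _ _ (S.covPath_piLoads z c ht a a)
      (S.covPath_piLoads_priceLoads z c ht a i) (S.covPath_piLoads_priceLoads z c ht a j)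
    exact ⟨h.1, congrArg (S.bond z c t T x * ·) h.2.symm⟩

end Spec
end GordonHedge

namespace GordonHedge

/-! ### Claims that pay a function of the prices -/

namespace Elements

/-- If the gains have conditional mean zero, then their covariance with a claim is the conditional
mean of the product. -/
theorem lambdaBar_of_condExp {n lk ly N T : ℕ} [NeZero T] {𝓩 : Type*} [MeasurableSpace 𝓩]
    {Ω : Type*} {m m₀ : MeasurableSpace Ω} {μ : Measure Ω} [IsProbabilityMeasure μ]
    {M : Elements n lk ly N T 𝓩 Ω} {S : Spec n lk ly N T 𝓩} {t : ℕ}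
    (hG : ∀ a, MemLp (fun ω => M.gain S (t + 1) ω a) 2 μ)
    (h0 : ∀ a, μ[fun ω => M.gain S (t + 1) ω a | m] =ᵐ[μ] 0) {Hbar : Ω → ℝ}
    (hH : MemLp Hbar 2 μ) {Λ : Ω → Fin n → ℝ}
    (h : ∀ a, μ[fun ω => M.gain S (t + 1) ω a * Hbar ω | m] =ᵐ[μ] fun ω => Λ ω a) :
    M.LambdaBar S μ m Hbar t =ᵐ[μ] Λ := by
  have h' : ∀ a, ∀ᵐ ω ∂μ, M.LambdaBar S μ m Hbar t ω a = Λ ω a := fun a =>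
    (condCov_eq_of_condExp_eq_zero (hG a) hH (h0 a)).trans (h a)
  filter_upwards [ae_all_iff.2 h'] with ω hω
  exact funext hω

variable {n lk ly N T : ℕ} [NeZero T] {𝓩 : Type*} [MeasurableSpace 𝓩]
  {Ω : Type*} [MeasurableSpace Ω] {M : Elements n lk ly N T 𝓩 Ω} {S : Spec n lk ly N T 𝓩}
  {Pr : Measure Ω}

/-- The discounted claim that pays `φ(P_k)` at the date `k`. -/
noncomputable def payoff (M : Elements n lk ly N T 𝓩 Ω) (S : Spec n lk ly N T 𝓩) (k : ℕ)
    (φ : (Fin n → ℝ) → ℝ) (ω : Ω) : ℝ :=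
  M.D S k ω * φ (M.P S k ω)

theorem measurable_payoff_sigF (k : ℕ) {φ : (Fin n → ℝ) → ℝ} (hφ : Measurable φ) :
    Measurable[M.sigF S k] (M.payoff S k φ) := by
  have h : Measurable[M.sigF S k] fun ω => M.P S k ω :=
    (@measurable_pi_iff Ω (Fin n) _ (M.sigF S k) _ _).2 fun i => measurable_P_sigF k i
  have h2 : Measurable[M.sigF S k] fun ω => φ (M.P S k ω) := fun _ hA => h (hφ hA)
  exact Measurable.mul (measurable_D_sigF (M := M) (S := S) k) h2

theorem stronglyMeasurable_payoff_sigH {k : ℕ} (hk : k ≤ T) {φ : (Fin n → ℝ) → ℝ}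
    (hφ : Measurable φ) : StronglyMeasurable[M.sigH S T] (M.payoff S k φ) :=
  ((measurable_payoff_sigF k hφ).mono ((sigF_mono hk).trans (sigF_le_sigH T))
    le_rfl).stronglyMeasurable

variable (hM : M.IsModel S Pr)
include hM

/-- Under the posterior law, the mixture is the expectation. -/
theorem IsModel.ae_mixed_eq_integral {t : ℕ} (ht : t ≤ T)
    {X : 𝓩 → CoefPath n lk ly T → (XIdx n → ℝ) → ℝ}
    (hX : ∀ᵐ ω ∂(M.riskNeutral S Pr), Integrable (fun c => X (M.init ω) c (M.x S t ω))
      (S.postLaw t (M.init ω) fun m => M.x S m ω)) :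
    ∀ᵐ ω ∂(M.riskNeutral S Pr), ∀ r : ℝ, M.mixed S t (fun z c x => r * X z c x) ω
      = r * ∫ c, X (M.init ω) c (M.x S t ω) ∂(S.postLaw t (M.init ω) fun m => M.x S m ω) := by
  filter_upwards [hM.ae_evidence ht, hX] with ω hω hi r
  rw [mixed, S.mix_eq_integral ht _ hω.1 hω.2 (hi.const_mul r), integral_const_mul]

section Price

variable {t k : ℕ} {φ : (Fin n → ℝ) → ℝ}
  {V : 𝓩 → CoefPath n lk ly T → (XIdx n → ℝ) → ℝ}
  {L : 𝓩 → CoefPath n lk ly T → (XIdx n → ℝ) → Fin n → ℝ}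

/-- The prices given the coefficients are integrable under the posterior law, so the mixtures are
genuine integrals. -/
theorem IsModel.ae_integrable_price (ht : t < k) (hk : k ≤ T) (hφ : Measurable φ)
    (h : S.HasPrice t k φ V L) (hX : MemLp (M.payoff S k φ) 2 (M.riskNeutral S Pr)) :
    ∀ᵐ ω ∂(M.riskNeutral S Pr), Integrable (fun c => V (M.init ω) c (M.x S t ω))
      (S.postLaw t (M.init ω) fun m => M.x S m ω) := by
  have := hM.isProbabilityMeasure_riskNeutral
  have hint := hX.integrable one_le_two
  have e : M.payoff S k φ = fun ω => S.pathD (M.init ω) k (M.xPath S ω)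
      * φ (S.pathP (M.init ω) k (M.xPath S ω)) := by
    funext ω
    rw [payoff, M.pathD_xPath S (by omega), M.pathP_xPath S hk]
  rw [e] at hint
  obtain ⟨-, h2, -, -⟩ := hM.condExp_of_integral (ht.le.trans hk)
    (Y := fun b => S.pathD b.1 k b.2 * φ (S.pathP b.1 k b.2))
    ((S.measurable_pathD measurable_fst measurable_snd k).mul
      (hφ.comp (S.measurable_pathP measurable_fst measurable_snd k))) hint
    (C := fun ω c => M.D S t ω * V (M.init ω) c (M.x S t ω))
    fun ω c hc => by
      rw [(h _ c hc _).1.2, M.pathD_xPath S (by omega), M.pathOf_xPath S (by omega)]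
  filter_upwards [h2] with ω hω
  have := hω.const_mul (M.D S t ω)⁻¹
  simpa [inv_mul_cancel_left₀ (D_pos t ω).ne'] using this

variable (hgain : ∀ t < T, ∀ i, MemLp (fun ω => M.gain S (t + 1) ω i) 2 (M.riskNeutral S Pr))
include hgain

/-- The mean of the gain times the payoff, given the coefficients and given the prices only. -/
theorem IsModel.condExp_gain_mul_payoff (ht : t < k) (hk : k ≤ T) (hφ : Measurable φ)
    (h : S.HasPrice t k φ V L) (hX : MemLp (M.payoff S k φ) 2 (M.riskNeutral S Pr)) (a : Fin n) :
    ((M.riskNeutral S Pr)[fun ω => M.gain S (t + 1) ω a * M.payoff S k φ ω | M.sigH S t]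
      =ᵐ[M.riskNeutral S Pr] fun ω =>
        M.D S t ω ^ 2 * L (M.init ω) (M.coef ω) (M.x S t ω) a
          - M.discP S t ω a * (M.D S t ω * V (M.init ω) (M.coef ω) (M.x S t ω))) ∧
    (∀ᵐ ω ∂(M.riskNeutral S Pr), Integrable (fun c => L (M.init ω) c (M.x S t ω) a)
      (S.postLaw t (M.init ω) fun m => M.x S m ω)) ∧
    ((M.riskNeutral S Pr)[fun ω => M.gain S (t + 1) ω a * M.payoff S k φ ω | M.sigF S t]
      =ᵐ[M.riskNeutral S Pr] fun ω => S.mix t (M.init ω) (fun m => M.x S m ω) fun c =>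
        M.D S t ω ^ 2 * L (M.init ω) c (M.x S t ω) a
          - M.discP S t ω a * (M.D S t ω * V (M.init ω) c (M.x S t ω))) ∧
    (M.riskNeutral S Pr)[fun ω => M.gain S (t + 1) ω a * M.payoff S k φ ω | M.sigF S t]
      =ᵐ[M.riskNeutral S Pr] fun ω =>
        M.D S t ω ^ 2 * ∫ c, L (M.init ω) c (M.x S t ω) a
            ∂(S.postLaw t (M.init ω) fun m => M.x S m ω)
          - M.discP S t ω a * (M.D S t ω * ∫ c, V (M.init ω) c (M.x S t ω)
            ∂(S.postLaw t (M.init ω) fun m => M.x S m ω)) := by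
  have := hM.isProbabilityMeasure_riskNeutral
  have htT : t < T := ht.trans_le hk
  have hint : Integrable (fun ω => M.gain S (t + 1) ω a * M.payoff S k φ ω)
      (M.riskNeutral S Pr) := (hgain t htT a).integrable_mul hX
  have e : (fun ω => M.gain S (t + 1) ω a * M.payoff S k φ ω) = fun ω =>
      S.pathGain (M.init ω) t (M.xPath S ω) a * (S.pathD (M.init ω) k (M.xPath S ω)
        * φ (S.pathP (M.init ω) k (M.xPath S ω))) := by
    funext ω
    rw [payoff, M.pathD_xPath S (by omega), M.pathP_xPath S hk, M.gain_eq_pathGain S htT]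
  rw [e] at hint ⊢
  obtain ⟨h1, h2, h3, h4⟩ := hM.condExp_of_integral htT.le
    (Y := fun b => S.pathGain b.1 t b.2 a * (S.pathD b.1 k b.2 * φ (S.pathP b.1 k b.2)))
    ((S.measurable_pathGain measurable_fst measurable_snd t a).mul
      ((S.measurable_pathD measurable_fst measurable_snd k).mul
        (hφ.comp (S.measurable_pathP measurable_fst measurable_snd k)))) hint
    (C := fun ω c => M.D S t ω ^ 2 * L (M.init ω) c (M.x S t ω) a
          - M.discP S t ω a * (M.D S t ω * V (M.init ω) c (M.x S t ω)))
    fun ω c hc => by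
      obtain ⟨⟨i1, e1⟩, h2⟩ := h (M.init ω) c hc (M.xPath S ω)
      obtain ⟨i2, e2⟩ := h2 a
      simp only [Spec.pathGain, S.pathD_contPath_of_le _ c htT.le _ _ (Nat.le_succ t),
        S.pathP_contPath_of_le _ c htT.le _ _ le_rfl, sub_mul]
      rw [integral_sub i2 (i1.const_mul _), integral_const_mul, e1, e2,
        M.pathD_xPath S (by omega), M.pathOf_xPath S htT.le, M.pathP_xPath S htT.le, discP]
  have hV := hM.ae_integrable_price ht hk hφ h hX
  have hL : ∀ᵐ ω ∂(M.riskNeutral S Pr), Integrable (fun c => L (M.init ω) c (M.x S t ω) a)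
      (S.postLaw t (M.init ω) fun m => M.x S m ω) := by
    filter_upwards [h2, hV] with ω hω hVω
    have := (hω.add ((hVω.const_mul (M.D S t ω)).const_mul (M.discP S t ω a))).const_mul
      (M.D S t ω ^ 2)⁻¹
    refine this.congr (.of_forall fun c => ?_)
    simp [inv_mul_cancel_left₀ (pow_ne_zero 2 (D_pos t ω).ne')]
  refine ⟨h1, hL, h4, ?_⟩
  filter_upwards [h4, h3, hV, hL] with ω e1 e2 iV iL
  rw [e1, e2, integral_sub (iL.const_mul _) ((iV.const_mul _).const_mul _), integral_const_mul,
    integral_const_mul, integral_const_mul]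

end Price

section Hedging

variable (hgain : ∀ t < T, ∀ i, MemLp (fun ω => M.gain S (t + 1) ω i) 2 (M.riskNeutral S Pr))
include hgain

/-- Once the conditional covariance is known, the hedge is given by the general formula. -/
theorem IsModel.hedgedBy_of_lambdaBar {Hbar : Ω → ℝ} {Λ : ℕ → Ω → Fin n → ℝ}
    (hHm : StronglyMeasurable[M.sigFx S T] Hbar) (hH : MemLp Hbar 2 (M.riskNeutral S Pr))
    (hΛ : ∀ t < T, M.LambdaBar S (M.riskNeutral S Pr) (M.sigFx S t) Hbar t
      =ᵐ[M.riskNeutral S Pr] Λ t) : M.HedgedBy S Pr Hbar Λ := by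
  refine ⟨hM.lrmGivenByFormula hgain hHm hH, fun t ht => ⟨hΛ t ht, ?_⟩⟩
  filter_upwards [hΛ t ht, hM.omegaBar_sigFx hgain ht] with ω h1 h2
  simp only [shares, h1, h2]

end Hedging

end Elements
end GordonHedge

namespace GordonHedge

/-! ### Claims that depend on the lifetime -/

namespace Elements

variable {n lk ly N T : ℕ} [NeZero T] {𝓩 : Type*} [MeasurableSpace 𝓩]
  {Ω : Type*} [MeasurableSpace Ω] {M : Elements n lk ly N T 𝓩 Ω} {S : Spec n lk ly N T 𝓩}
  {Pr : Measure Ω}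

variable (hM : M.IsModel S Pr)
include hM

/-- A market variable is square-integrable as soon as its product with the indicator of a lifetime
event of positive probability is, by independence. -/
theorem IsModel.memLp_of_memLp_mul_indicator {X : Ω → ℝ} (hX : StronglyMeasurable[M.sigH S T] X)
    {B : Set Ω} (hB : MeasurableSet[M.sigLife T] B) (hB0 : Pr B ≠ 0)
    (h : MemLp (fun ω => X ω * B.indicator (fun _ => (1 : ℝ)) ω) 2 (M.riskNeutral S Pr)) :
    MemLp X 2 (M.riskNeutral S Pr) := by
  have hm := hM.sigH_le T
  have hX0 : AEStronglyMeasurable X (M.riskNeutral S Pr) := (hX.mono hm).aestronglyMeasurable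
  rw [memLp_two_iff_integrable_sq hX0]
  rw [memLp_two_iff_integrable_sq h.1] at h
  refine ⟨hX0.pow 2, ?_⟩
  have h2 := h.2
  rw [hasFiniteIntegral_iff_enorm] at h2 ⊢
  have e : ∀ ω, ‖(X ω * B.indicator (fun _ => (1 : ℝ)) ω) ^ 2‖ₑ
      = ‖X ω ^ 2‖ₑ * B.indicator (fun _ => 1) ω := fun ω => by
    by_cases hω : ω ∈ B <;> simp [hω]
  have hXm : Measurable[M.sigH S T] fun ω => ‖X ω ^ 2‖ₑ :=
    measurable_enorm.comp (hX.measurable.pow_const 2)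
  simp only [e] at h2
  rw [lintegral_mul_indicator_eq_lintegral_mul_lintegral_indicator hm 1
    (hM.sigLife_le T _ hB) ?_ hXm, lintegral_indicator_const (hM.sigLife_le T _ hB),
    one_mul, hM.riskNeutral_sigLife hB] at h2
  -- by independence the second moments differ by the factor `P̃(B) > 0`
  · by_contra hinf
    rw [not_lt, top_le_iff] at hinf
    rw [hinf, ENNReal.top_mul hB0] at h2
    exact lt_irrefl _ h2
  · rw [IndepSets_iff]
    intro A B' hA hB'
    rw [Set.mem_singleton_iff.1 hB']
    exact (Indep_iff _ _ _).1 hM.indep_riskNeutral A B hA hB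

variable (hgain : ∀ t < T, ∀ i, MemLp (fun ω => M.gain S (t + 1) ω i) 2 (M.riskNeutral S Pr))
include hgain

/-- One payment, made if a lifetime event `B` occurs: after the payment date it no longer covaries
with the gains; before, the lifetime only contributes the factor `A·w = P̃(B | T_t^x)`. -/
theorem IsModel.condExp_gain_mul_insured {t k : ℕ} (ht : t < T) (hk : k ≤ T)
    {φ : (Fin n → ℝ) → ℝ} (hφ : Measurable φ) {V : 𝓩 → CoefPath n lk ly T → (XIdx n → ℝ) → ℝ}
    {L : 𝓩 → CoefPath n lk ly T → (XIdx n → ℝ) → Fin n → ℝ}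
    (h : t < k → S.HasPrice t k φ V L) {B : Set Ω} (hB : MeasurableSet[M.sigLife T] B)
    (hBk : k ≤ t → MeasurableSet[M.sigLife t] B) {A : Ω → ℝ} {w : ℝ}
    (hw : t < k → (M.riskNeutral S Pr)[B.indicator fun _ => (1 : ℝ) | M.sigLife t]
      =ᵐ[M.riskNeutral S Pr] fun ω => A ω * w)
    (hw0 : t < k → Pr B = 0 → w = 0)
    (hX : MemLp (fun ω => M.payoff S k φ ω * B.indicator (fun _ => (1 : ℝ)) ω) 2
      (M.riskNeutral S Pr)) (a : Fin n) :
    (t < k → (∀ᵐ ω ∂(M.riskNeutral S Pr),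
      Integrable (fun c => V (M.init ω) c (M.x S t ω) * w)
        (S.postLaw t (M.init ω) fun m => M.x S m ω) ∧
      Integrable (fun c => L (M.init ω) c (M.x S t ω) a * w)
        (S.postLaw t (M.init ω) fun m => M.x S m ω))) ∧
    (M.riskNeutral S Pr)[fun ω => M.gain S (t + 1) ω a
        * (M.payoff S k φ ω * B.indicator (fun _ => (1 : ℝ)) ω) | M.sigFx S t]
      =ᵐ[M.riskNeutral S Pr] fun ω => if t < k then
        A ω * (M.D S t ω ^ 2 * ∫ c, L (M.init ω) c (M.x S t ω) a * w
            ∂(S.postLaw t (M.init ω) fun m => M.x S m ω)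
          - M.discP S t ω a * (M.D S t ω * ∫ c, V (M.init ω) c (M.x S t ω) * w
            ∂(S.postLaw t (M.init ω) fun m => M.x S m ω))) else 0 := by
  have := hM.isProbabilityMeasure_riskNeutral
  have hgi := (hgain t ht a).integrable one_le_two
  by_cases htk : t < k
  · simp only [htk, if_true, forall_const]
    -- if `B` is null, both sides vanish; otherwise the payoff itself is square-integrable
    by_cases hB0 : Pr B = 0
    · have hz : (fun ω => M.gain S (t + 1) ω a
          * (M.payoff S k φ ω * B.indicator (fun _ => (1 : ℝ)) ω))
          =ᵐ[M.riskNeutral S Pr] 0 := by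
        have : ∀ᵐ ω ∂(M.riskNeutral S Pr), ω ∉ B := by
          rw [ae_iff]
          simpa [hM.riskNeutral_sigLife hB] using hB0
        filter_upwards [this] with ω hω
        simp [hω]
      rw [hw0 htk hB0]
      refine ⟨by simp, (condExp_congr_ae hz).trans ?_⟩
      rw [condExp_zero]
      exact .of_forall fun ω => by simp
    · have hX2 := hM.memLp_of_memLp_mul_indicator (stronglyMeasurable_payoff_sigH hk hφ) hB hB0 hX
      obtain ⟨-, hL, -, hE⟩ := hM.condExp_gain_mul_payoff hgain htk hk hφ (h htk) hX2 a
      constructor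
      · filter_upwards [hM.ae_integrable_price htk hk hφ (h htk) hX2, hL] with ω h1 h2
        exact ⟨h1.mul_const w, h2.mul_const w⟩
      · have hprod := (hM.condExp_mul_sigFx ht.le
          (X := fun ω => M.gain S (t + 1) ω a * M.payoff S k φ ω)
          (L := B.indicator fun _ => (1 : ℝ))
          ((stronglyMeasurable_gain_sigH ht a).mul (stronglyMeasurable_payoff_sigH hk hφ))
          (stronglyMeasurable_const.indicator hB) ((hgain t ht a).integrable_mul hX2)
          ((integrable_const 1).indicator (hM.sigLife_le T _ hB))).2
        simp only [mul_assoc] at hprod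
        refine hprod.trans ?_
        filter_upwards [hE, hw htk] with ω h1 h2
        rw [h1, h2, integral_mul_const, integral_mul_const]
        ring
  · simp only [htk, if_false, false_imp_iff, true_and]
    -- the payment is known at `t`, and the gain has conditional mean zero
    have hsm : StronglyMeasurable[M.sigFx S t]
        fun ω => M.payoff S k φ ω * B.indicator (fun _ => (1 : ℝ)) ω := by
      refine StronglyMeasurable.mul ?_ ?_
      · exact ((measurable_payoff_sigF k hφ).mono
          ((sigF_mono (not_lt.1 htk)).trans (sigF_le_sigFx t)) le_rfl).stronglyMeasurable
      · exact stronglyMeasurable_const.indicator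
          ((le_sup_right : M.sigLife t ≤ M.sigFx S t) _ (hBk (not_lt.1 htk)))
    refine (condExp_mul_of_stronglyMeasurable_right hsm ((hgain t ht a).integrable_mul hX)
      hgi).trans ?_
    filter_upwards [hM.condExp_gain_sigFx hgain ht a] with ω hω
    simp [hω]

/-- Hedging of a portfolio of payments `φ_k(P_{m_k})`, each made if a lifetime event `B_k` occurs.
`A_t·w_{t,k}` is the probability of `B_k` given the lifetime information at `t`. -/
theorem IsModel.hedgedBy_insured {s : Finset ℕ} {m : ℕ → ℕ} (hm : ∀ k ∈ s, m k ≤ T)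
    {φ : ℕ → (Fin n → ℝ) → ℝ} (hφ : ∀ k, Measurable (φ k)) (hφ0 : ∀ k P, 0 ≤ φ k P)
    {V' : ℕ → ℕ → 𝓩 → CoefPath n lk ly T → (XIdx n → ℝ) → ℝ}
    {L' : ℕ → ℕ → 𝓩 → CoefPath n lk ly T → (XIdx n → ℝ) → Fin n → ℝ}
    (h : ∀ k ∈ s, ∀ t, t < m k → S.HasPrice t (m k) (φ k) (V' t k) (L' t k)) {B : ℕ → Set Ω}
    (hB : ∀ k ∈ s, MeasurableSet[M.sigLife T] (B k))
    (hBk : ∀ k ∈ s, ∀ t, m k ≤ t → MeasurableSet[M.sigLife t] (B k))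
    {A : ℕ → Ω → ℝ} {w : ℕ → ℕ → ℝ}
    (hw : ∀ k ∈ s, ∀ t, t < m k →
      (M.riskNeutral S Pr)[(B k).indicator fun _ => (1 : ℝ) | M.sigLife t]
        =ᵐ[M.riskNeutral S Pr] fun ω => A t ω * w t k)
    (hw0 : ∀ k ∈ s, ∀ t, t < m k → Pr (B k) = 0 → w t k = 0)
    {L : ℕ → 𝓩 → CoefPath n lk ly T → (XIdx n → ℝ) → Fin n → ℝ}
    {V : ℕ → 𝓩 → CoefPath n lk ly T → (XIdx n → ℝ) → ℝ}
    (hL : ∀ t < T, ∀ z c x a, L t z c x a = ∑ k ∈ s with t < m k, L' t k z c x a * w t k)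
    (hV : ∀ t < T, ∀ z c x, V t z c x = ∑ k ∈ s with t < m k, V' t k z c x * w t k)
    {Hbar : Ω → ℝ}
    (hH : ∀ ω, Hbar ω = ∑ k ∈ s, M.payoff S (m k) (φ k) ω
      * (B k).indicator (fun _ => (1 : ℝ)) ω)
    (hH2 : MemLp Hbar 2 (M.riskNeutral S Pr)) :
    M.HedgedBy S Pr Hbar fun t ω => A t ω • M.lambdaMixed S L V t ω := by
  have := hM.isProbabilityMeasure_riskNeutral
  have hnn : ∀ k ω, 0 ≤ M.payoff S (m k) (φ k) ω * (B k).indicator (fun _ => (1 : ℝ)) ω :=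
    fun k ω => mul_nonneg (mul_nonneg (D_pos _ ω).le (hφ0 _ _))
      (Set.indicator_nonneg (fun _ _ => zero_le_one) ω)
  have hsm : ∀ k ∈ s, StronglyMeasurable[M.sigFx S T]
      fun ω => M.payoff S (m k) (φ k) ω * (B k).indicator (fun _ => (1 : ℝ)) ω := fun k hk => by
    refine StronglyMeasurable.mul ?_ ?_
    · exact ((measurable_payoff_sigF (m k) (hφ k)).mono
        ((sigF_mono (hm k hk)).trans (sigF_le_sigFx T)) le_rfl).stronglyMeasurable
    · exact stronglyMeasurable_const.indicator
        ((le_sup_right : M.sigLife T ≤ M.sigFx S T) _ (hB k hk))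
  have hHm : StronglyMeasurable[M.sigFx S T] Hbar := by
    rw [funext hH]
    exact Finset.stronglyMeasurable_fun_sum s hsm
  -- the payments are nonnegative, so that each is dominated by the claim
  have hk2 : ∀ k ∈ s, MemLp
      (fun ω => M.payoff S (m k) (φ k) ω * (B k).indicator (fun _ => (1 : ℝ)) ω) 2
      (M.riskNeutral S Pr) := fun k hk => by
    refine hH2.mono ((hsm k hk).mono (hM.sigFx_le T)).aestronglyMeasurable (.of_forall fun ω => ?_)
    rw [Real.norm_of_nonneg (hnn k ω), Real.norm_of_nonneg
      ((hH ω).symm ▸ Finset.sum_nonneg fun j _ => hnn j ω), hH]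
    exact Finset.single_le_sum (f := fun k => M.payoff S (m k) (φ k) ω
      * (B k).indicator (fun _ => (1 : ℝ)) ω) (fun j _ => hnn j ω) hk
  refine hM.hedgedBy_of_lambdaBar hgain hHm hH2 fun t ht => ?_
  refine lambdaBar_of_condExp (hgain t ht) (hM.condExp_gain_sigFx hgain ht) hH2 fun a => ?_
  have key := fun k hk => hM.condExp_gain_mul_insured hgain ht (hm k hk) (hφ k) (h k hk t) (hB k hk)
    (hBk k hk t) (hw k hk t) (hw0 k hk t) (hk2 k hk) a
  have hVL : ∀ᵐ ω ∂(M.riskNeutral S Pr), ∀ k ∈ s.filter (t < m ·),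
      Integrable (fun c => V' t k (M.init ω) c (M.x S t ω) * w t k)
        (S.postLaw t (M.init ω) fun m => M.x S m ω) ∧
      Integrable (fun c => L' t k (M.init ω) c (M.x S t ω) a * w t k)
        (S.postLaw t (M.init ω) fun m => M.x S m ω) :=
    (Finset.eventually_all _).2 fun k hk =>
      (key k (Finset.mem_filter.1 hk).1).1 (Finset.mem_filter.1 hk).2
  have hVm := hM.ae_mixed_eq_integral ht.le (X := V t) (by
    filter_upwards [hVL] with ω hω
    simp only [hV t ht]
    exact integrable_finsetSum _ fun k hk => (hω k hk).1)
  have hLm := hM.ae_mixed_eq_integral ht.le (X := fun z c x => L t z c x a) (by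
    filter_upwards [hVL] with ω hω
    simp only [hL t ht]
    exact integrable_finsetSum _ fun k hk => (hω k hk).2)
  have hsum : (fun ω => M.gain S (t + 1) ω a * Hbar ω) = ∑ k ∈ s, fun ω =>
      M.gain S (t + 1) ω a * (M.payoff S (m k) (φ k) ω
        * (B k).indicator (fun _ => (1 : ℝ)) ω) := by
    funext ω
    rw [hH, Finset.mul_sum, Finset.sum_apply]
  rw [hsum]
  have hint : ∀ k ∈ s, Integrable (fun ω => M.gain S (t + 1) ω a * (M.payoff S (m k) (φ k) ω
      * (B k).indicator (fun _ => (1 : ℝ)) ω)) (M.riskNeutral S Pr) := fun k hk =>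
    (hgain t ht a).integrable_mul (hk2 k hk)
  refine (condExp_finsetSum hint _).trans ?_
  have hterm := (Finset.eventually_all s).2 fun k hk => (key k hk).2
  filter_upwards [hterm, hVL, hVm, hLm] with ω h1 h2 h3 h4
  have h3' := h3 1
  simp only [one_mul] at h3'
  rw [Finset.sum_apply, Finset.sum_congr rfl h1, Pi.smul_apply, lambdaMixed, h4, h3',
    ← Finset.sum_filter]
  simp only [hL t ht, hV t ht]
  rw [integral_finsetSum _ fun k hk => (h2 k hk).1, integral_finsetSum _ fun k hk => (h2 k hk).2,
    smul_eq_mul, ← Finset.mul_sum, Finset.sum_sub_distrib, ← Finset.mul_sum, ← Finset.mul_sum,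
    ← Finset.mul_sum]

end Elements
end GordonHedge

namespace GordonHedge

/-! ### Options and insurance contracts -/

namespace Elements

variable {n lk ly N T : ℕ} [NeZero T] {𝓩 : Type*} [MeasurableSpace 𝓩]
  {Ω : Type*} [MeasurableSpace Ω] {M : Elements n lk ly N T 𝓩 Ω} {S : Spec n lk ly N T 𝓩}
  {Pr : Measure Ω}

variable (hM : M.IsModel S Pr)
  (hgain : ∀ t < T, ∀ i, MemLp (fun ω => M.gain S (t + 1) ω i) 2 (M.riskNeutral S Pr))
include hM hgain

/-- Claims paid at the horizon whatever the lifetime. -/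
theorem IsModel.hedgedBy_european {φ : (Fin n → ℝ) → ℝ} (hφ : Measurable φ)
    (hφ0 : ∀ P, 0 ≤ φ P) {V : ℕ → 𝓩 → CoefPath n lk ly T → (XIdx n → ℝ) → ℝ}
    {L : ℕ → 𝓩 → CoefPath n lk ly T → (XIdx n → ℝ) → Fin n → ℝ}
    (h : ∀ t < T, S.HasPrice t T φ (V t) (L t))
    (hX : MemLp (M.payoff S T φ) 2 (M.riskNeutral S Pr)) :
    M.HedgedBy S Pr (M.payoff S T φ) (M.lambdaMixed S L V) := by
  have := hM.isProbabilityMeasure_riskNeutral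
  have := hM.prob
  have key := hM.hedgedBy_insured hgain (s := {T}) (m := fun k => k) (φ := fun _ => φ)
    (V' := fun t _ => V t) (L' := fun t _ => L t) (B := fun _ => Set.univ) (A := fun _ _ => 1)
    (w := fun _ _ => 1) (L := L) (V := V) (Hbar := M.payoff S T φ) (by simp) (fun _ => hφ)
    (fun _ => hφ0) (by simpa using h) (fun _ _ => MeasurableSet.univ)
    (fun _ _ _ _ => MeasurableSet.univ)
    (fun k _ t _ => by
      simp only [Set.indicator_univ, mul_one]
      rw [condExp_const (hM.sigLife_le t)])
    (by simp) (fun t ht z c x a => by simp [Finset.filter_singleton, ht])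
    (fun t ht z c x => by simp [Finset.filter_singleton, ht]) (by simp) hX
  simpa only [one_smul] using key

/-- Claims paid at the horizon on survival. -/
theorem IsModel.hedgedBy_endowment {φ : (Fin n → ℝ) → ℝ} (hφ : Measurable φ)
    (hφ0 : ∀ P, 0 ≤ φ P) {V : ℕ → 𝓩 → CoefPath n lk ly T → (XIdx n → ℝ) → ℝ}
    {L : ℕ → 𝓩 → CoefPath n lk ly T → (XIdx n → ℝ) → Fin n → ℝ}
    (h : ∀ t < T, S.HasPrice t T φ (V t) (L t)) {f : ℕ → Ω → ℝ}
    (hf : ∀ ω, f T ω = φ (M.P S T ω))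
    (hX : MemLp (M.endowment S f) 2 (M.riskNeutral S Pr)) :
    M.HedgedBy S Pr (M.endowment S f) fun t ω => M.alive t ω •
      M.lambdaMixed S (fun t z c x a => L t z c x a * M.surv Pr (T - t) t)
        (fun t z c x => V t z c x * M.surv Pr (T - t) t) t ω := by
  have := hM.prob
  refine hM.hedgedBy_insured hgain (s := {T}) (m := fun k => k) (φ := fun _ => φ)
    (V' := fun t _ => V t) (L' := fun t _ => L t) (B := fun _ => {ω | (T : ℝ) < M.life ω})
    (w := fun t _ => M.surv Pr (T - t) t) (by simp) (fun _ => hφ)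
    (fun _ => hφ0) (by simpa using h)
    (fun _ _ => measurableSet_lt_life (Nat.cast_nonneg T) le_rfl)
    (fun k hk t hkt => measurableSet_lt_life (Nat.cast_nonneg T)
      (Nat.cast_le.2 (Finset.mem_singleton.1 hk ▸ hkt)))
    (fun k hk t hkt => hM.condExp_alive (Finset.mem_singleton.1 hk ▸ hkt.le))
    (fun k hk t hkt h0 => ?_) (fun t ht z c x a => by simp [Finset.filter_singleton, ht])
    (fun t ht z c x => by simp [Finset.filter_singleton, ht]) (fun ω => ?_) hX
  · rw [Finset.mem_singleton.1 hk] at hkt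
    rw [surv, Nat.add_sub_cancel' hkt.le, survival, measureReal_def, h0]
    simp
  · rw [Finset.sum_singleton, endowment, hf]
    rfl

/-- Claims paid at the end of the year of death. -/
theorem IsModel.hedgedBy_term {φ : ℕ → (Fin n → ℝ) → ℝ} (hφ : ∀ k, Measurable (φ k))
    (hφ0 : ∀ k P, 0 ≤ φ k P) {V : ℕ → ℕ → 𝓩 → CoefPath n lk ly T → (XIdx n → ℝ) → ℝ}
    {L : ℕ → ℕ → 𝓩 → CoefPath n lk ly T → (XIdx n → ℝ) → Fin n → ℝ}
    (h : ∀ k ≤ T, ∀ t < k, S.HasPrice t k (φ k) (V t k) (L t k)) {f : ℕ → Ω → ℝ}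
    (hf : ∀ k ω, f k ω = φ k (M.P S k ω))
    (hX : MemLp (M.term S f) 2 (M.riskNeutral S Pr)) :
    M.HedgedBy S Pr (M.term S f) fun t ω => M.alive t ω •
      M.lambdaMixed S
        (fun t z c x a => ∑ k ∈ Finset.Ico t T,
          L t (k + 1) z c x a * M.surv Pr (k - t) t * M.mort Pr k)
        (fun t z c x => ∑ k ∈ Finset.Ico t T,
          V t (k + 1) z c x * M.surv Pr (k - t) t * M.mort Pr k) t ω := by
  have := hM.prob
  -- the payment dates `k + 1` after `t` are those with `t ≤ k`
  have hI : ∀ t, (Finset.range T).filter (fun k => t < k + 1) = Finset.Ico t T := fun t => by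
    ext k
    simp only [Finset.mem_filter, Finset.mem_range, Finset.mem_Ico]
    omega
  refine hM.hedgedBy_insured hgain (s := Finset.range T) (m := fun k => k + 1)
    (φ := fun k => φ (k + 1)) (V' := fun t k => V t (k + 1)) (L' := fun t k => L t (k + 1))
    (B := fun k => {ω | ⌊M.life ω⌋₊ = k})
    (w := fun t k => M.surv Pr (k - t) t * M.mort Pr k) (fun k hk => Finset.mem_range.1 hk)
    (fun _ => hφ _) (fun _ => hφ0 _) (fun k hk t ht => h _ (Finset.mem_range.1 hk) t ht)
    (fun k hk => measurableSet_floor_life hM.life_nonneg (Finset.mem_range.1 hk))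
    (fun k hk t hkt => measurableSet_floor_life hM.life_nonneg hkt)
    (fun k hk t hkt => hM.condExp_floor_life (Nat.lt_succ_iff.1 hkt) (Finset.mem_range.1 hk))
    (fun k hk t hkt h0 => ?_) (fun t ht z c x a => by simp only [hI, mul_assoc])
    (fun t ht z c x => by simp only [hI, mul_assoc]) (fun ω => ?_) hX
  · rw [← hM.real_floor_life_div (Nat.lt_succ_iff.1 hkt), measureReal_def, h0]
    simp
  · simp only [term, hf]
    rfl

/-- The exchange option: the conditional covariance given `H_t`, given `H_t^x`, and its mixture. -/
theorem IsModel.margrabe {i j : Fin n} (hij : i ≠ j) {wi wj : ℝ} (hi : 0 < wi) (hj : 0 < wj)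
    (hX : MemLp (fun ω => M.D S T ω * max (wi * M.P S T ω i - wj * M.P S T ω j) 0) 2
        (M.riskNeutral S Pr)) :
    (∀ t < T,
        M.LambdaBar S (M.riskNeutral S Pr) (M.sigH S t)
            (fun ω => M.D S T ω * max (wi * M.P S T ω i - wj * M.P S T ω j) 0) t
          =ᵐ[M.riskNeutral S Pr] (fun ω =>
            S.margrabeCov (M.init ω) (M.coef ω) t i j wi wj (M.D S t ω) (M.x S t ω)) ∧
        M.LambdaBar S (M.riskNeutral S Pr) (M.sigHx S t)
            (fun ω => M.D S T ω * max (wi * M.P S T ω i - wj * M.P S T ω j) 0) t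
          =ᵐ[M.riskNeutral S Pr] fun ω =>
            S.margrabeCov (M.init ω) (M.coef ω) t i j wi wj (M.D S t ω) (M.x S t ω)) ∧
      M.HedgedBy S Pr (fun ω => M.D S T ω * max (wi * M.P S T ω i - wj * M.P S T ω j) 0)
        (fun t ω a => M.mixed S t
          (fun z c x => S.margrabeCov z c t i j wi wj (M.D S t ω) x a) ω) := by
  have hφ : Measurable fun P : Fin n → ℝ => max (wi * P i - wj * P j) 0 := by fun_prop
  have hsm : StronglyMeasurable[M.sigH S T]
      fun ω => M.D S T ω * max (wi * M.P S T ω i - wj * M.P S T ω j) 0 :=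
    stronglyMeasurable_payoff_sigH le_rfl hφ
  have hHm : StronglyMeasurable[M.sigFx S T]
      fun ω => M.D S T ω * max (wi * M.P S T ω i - wj * M.P S T ω j) 0 :=
    ((measurable_payoff_sigF T hφ).mono (sigF_le_sigFx T) le_rfl).stronglyMeasurable
  have key := fun t (ht : t < T) a => hM.condExp_gain_mul_payoff hgain ht le_rfl hφ
    (Spec.hasPrice_margrabe (S := S) ht hij hi hj) hX a
  have hcov : ∀ t ω c a, M.D S t ω ^ 2 * (S.bond (M.init ω) c t T (M.x S t ω) *
      (wi * lognMean (S.phiMean (M.init ω) c t T i (M.x S t ω)) (S.phiCov (M.init ω) c t i) a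
          * Phi (S.margrabeDTilde (M.init ω) c t i j wi wj (M.x S t ω) a)
        - wj * lognMean (S.phiMean (M.init ω) c t T j (M.x S t ω)) (S.phiCov (M.init ω) c t j) a
          * Phi (S.margrabeDTilde (M.init ω) c t i j wi wj (M.x S t ω) a
            - S.spreadSd (M.init ω) c t i j)))
      - M.discP S t ω a * (M.D S t ω * S.margrabePrice (M.init ω) c t i j wi wj (M.x S t ω))
      = S.margrabeCov (M.init ω) c t i j wi wj (M.D S t ω) (M.x S t ω) a := fun t ω c a => by
    rw [← mul_assoc]
    rfl
  simp only [hcov] at key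
  have hgx : ∀ t (ht : t < T) a, Integrable (fun ω => M.gain S (t + 1) ω a
      * (M.D S T ω * max (wi * M.P S T ω i - wj * M.P S T ω j) 0)) (M.riskNeutral S Pr) :=
    fun t ht a => (hgain t ht a).integrable_mul hX
  have := hM.isProbabilityMeasure_riskNeutral
  refine ⟨fun t ht => ⟨?_, ?_⟩, ?_⟩
  · exact lambdaBar_of_condExp (hgain t ht) (fun a => (hM.condExp_gain hgain ht a).1) hX
      fun a => (key t ht a).1
  · refine lambdaBar_of_condExp (hgain t ht) (fun a => ?_) hX fun a => ?_
    · exact (hM.condExp_sigHx ht.le (stronglyMeasurable_gain_sigH ht a)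
        ((hgain t ht a).integrable one_le_two)).trans (hM.condExp_gain hgain ht a).1
    · exact (hM.condExp_sigHx ht.le ((stronglyMeasurable_gain_sigH ht a).mul hsm)
        (hgx t ht a)).trans (key t ht a).1
  · refine hM.hedgedBy_of_lambdaBar hgain hHm hX fun t ht =>
      lambdaBar_of_condExp (hgain t ht) (hM.condExp_gain_sigFx hgain ht) hX fun a => ?_
    exact (hM.condExp_sigFx ht.le ((stronglyMeasurable_gain_sigH ht a).mul hsm)
      (hgx t ht a)).trans (key t ht a).2.2.1

end Elements
end GordonHedge

theorem mainTheorem5 {n lk ly N T : ℕ} [NeZero T] {𝓩 : Type*} [MeasurableSpace 𝓩]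
    {Ω : Type*} [MeasurableSpace Ω] (S : Spec n lk ly N T 𝓩) (M : Elements n lk ly N T 𝓩 Ω)
    (Pr : Measure Ω) (hM : M.IsModel S Pr)
    (hgain : ∀ t < T, ∀ i, MemLp (fun ω => M.gain S (t + 1) ω i) 2 (M.riskNeutral S Pr)) :
    -- the matrix `Ω̄`, given `H_t` and given `F_t^x`
    (∀ t < T,
      M.OmegaBar S (M.riskNeutral S Pr) (M.sigH S t) t =ᵐ[M.riskNeutral S Pr] M.omegaH S t ∧
      M.OmegaBar S (M.riskNeutral S Pr) (M.sigFx S t) t =ᵐ[M.riskNeutral S Pr] M.omegaMixed S t ∧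
      ∀ᵐ ω ∂(M.riskNeutral S Pr), IsUnit (M.OmegaBar S (M.riskNeutral S Pr) (M.sigFx S t) t ω).det) ∧
    -- the strategy of a general square-integrable claim
    (∀ Hbar : Ω → ℝ, StronglyMeasurable[M.sigFx S T] Hbar →
      MemLp Hbar 2 (M.riskNeutral S Pr) → M.LRMGivenByFormula S Pr Hbar) ∧
    -- bond price and forward moments
    (∀ t u k : ℕ, t < u → u ≤ T → t < k → k ≤ T →
      M.BondPricing S Pr t u ∧ M.ForwardMoments S Pr t u k) ∧
    -- call options
    (∀ K : Fin n → ℝ, (∀ i, 0 < K i) → ∀ i,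
      MemLp (fun ω => M.D S T ω * max (M.P S T ω i - K i) 0) 2 (M.riskNeutral S Pr) →
      M.HedgedBy S Pr (fun ω => M.D S T ω * max (M.P S T ω i - K i) 0)
        (M.lambdaMixed S (fun t z c x a => S.bondPsiPlus z c t T K x a i)
          (fun t z c x => S.callPrice z c t T K x i))) ∧
    -- put options
    (∀ K : Fin n → ℝ, (∀ i, 0 < K i) → ∀ i,
      MemLp (fun ω => M.D S T ω * max (K i - M.P S T ω i) 0) 2 (M.riskNeutral S Pr) →
      M.HedgedBy S Pr (fun ω => M.D S T ω * max (K i - M.P S T ω i) 0)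
        (M.lambdaMixed S (fun t z c x a => S.bondPsiMinus z c t T K x a i)
          (fun t z c x => S.putPrice z c t T K x i))) ∧
    -- Margrabe exchange options: conditional covariance given `H_t`, and its mixture
    (∀ i j : Fin n, i ≠ j → ∀ wi wj : ℝ, 0 < wi → 0 < wj →
      MemLp (fun ω => M.D S T ω * max (wi * M.P S T ω i - wj * M.P S T ω j) 0) 2
        (M.riskNeutral S Pr) →
      (∀ t < T,
        M.LambdaBar S (M.riskNeutral S Pr) (M.sigH S t)
            (fun ω => M.D S T ω * max (wi * M.P S T ω i - wj * M.P S T ω j) 0) t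
          =ᵐ[M.riskNeutral S Pr] (fun ω =>
            S.margrabeCov (M.init ω) (M.coef ω) t i j wi wj (M.D S t ω) (M.x S t ω)) ∧
        M.LambdaBar S (M.riskNeutral S Pr) (M.sigHx S t)
            (fun ω => M.D S T ω * max (wi * M.P S T ω i - wj * M.P S T ω j) 0) t
          =ᵐ[M.riskNeutral S Pr] fun ω =>
            S.margrabeCov (M.init ω) (M.coef ω) t i j wi wj (M.D S t ω) (M.x S t ω)) ∧
      M.HedgedBy S Pr (fun ω => M.D S T ω * max (wi * M.P S T ω i - wj * M.P S T ω j) 0)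
        (fun t ω a => M.mixed S t
          (fun z c x => S.margrabeCov z c t i j wi wj (M.D S t ω) x a) ω)) ∧
    -- the four insurance products, with units `F*` and guarantees `G*`
    (∀ Fs Gs : ℕ → Fin n → ℝ, (∀ k i, 0 < Fs k i) → (∀ k i, 0 < Gs k i) → ∀ i,
      -- term life insurance, segregated fund contract
      (MemLp (M.term S (M.segregated S Fs Gs i)) 2 (M.riskNeutral S Pr) →
        M.HedgedBy S Pr (M.term S (M.segregated S Fs Gs i)) fun t ω => M.alive t ω •
          M.lambdaMixed S
            (fun t z c x a => ∑ k ∈ Finset.Ico t T, Fs (k + 1) i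
              * S.bondPsiMinus z c t (k + 1) (Elements.strike Fs Gs (k + 1)) x a i
              * M.surv Pr (k - t) t * M.mort Pr k)
            (fun t z c x => ∑ k ∈ Finset.Ico t T, Fs (k + 1) i
              * S.putPrice z c t (k + 1) (Elements.strike Fs Gs (k + 1)) x i
              * M.surv Pr (k - t) t * M.mort Pr k) t ω) ∧
      -- pure endowment insurance, segregated fund contract
      (MemLp (M.endowment S (M.segregated S Fs Gs i)) 2 (M.riskNeutral S Pr) →
        M.HedgedBy S Pr (M.endowment S (M.segregated S Fs Gs i)) fun t ω => M.alive t ω •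
          M.lambdaMixed S
            (fun t z c x a => Fs T i
              * S.bondPsiMinus z c t T (Elements.strike Fs Gs T) x a i * M.surv Pr (T - t) t)
            (fun t z c x => Fs T i
              * S.putPrice z c t T (Elements.strike Fs Gs T) x i * M.surv Pr (T - t) t) t ω) ∧
      -- unit-linked term life insurance
      (MemLp (M.term S (M.unitLinked S Fs Gs i)) 2 (M.riskNeutral S Pr) →
        M.HedgedBy S Pr (M.term S (M.unitLinked S Fs Gs i)) fun t ω => M.alive t ω •
          M.lambdaMixed S
            (fun t z c x a => ∑ k ∈ Finset.Ico t T,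
              (Fs (k + 1) i * S.bondPsiPlus z c t (k + 1) (Elements.strike Fs Gs (k + 1)) x a i
                + S.bond z c t (k + 1) x * lognMean (S.piMean z c t (k + 1) x) (S.piCov z c t) a
                  * Gs (k + 1) i)
              * M.surv Pr (k - t) t * M.mort Pr k)
            (fun t z c x => ∑ k ∈ Finset.Ico t T,
              (Fs (k + 1) i * S.callPrice z c t (k + 1) (Elements.strike Fs Gs (k + 1)) x i
                + S.bond z c t (k + 1) x * Gs (k + 1) i)
              * M.surv Pr (k - t) t * M.mort Pr k) t ω) ∧
      -- unit-linked pure endowment insurance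
      (MemLp (M.endowment S (M.unitLinked S Fs Gs i)) 2 (M.riskNeutral S Pr) →
        M.HedgedBy S Pr (M.endowment S (M.unitLinked S Fs Gs i)) fun t ω => M.alive t ω •
          M.lambdaMixed S
            (fun t z c x a =>
              (Fs T i * S.bondPsiPlus z c t T (Elements.strike Fs Gs T) x a i
                + S.bond z c t T x * lognMean (S.piMean z c t T x) (S.piCov z c t) a * Gs T i)
              * M.surv Pr (T - t) t)
            (fun t z c x =>
              (Fs T i * S.callPrice z c t T (Elements.strike Fs Gs T) x i
                + S.bond z c t T x * Gs T i) * M.surv Pr (T - t) t) t ω)) := by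
  have hmax : ∀ (K : Fin n → ℝ) i, Measurable fun P : Fin n → ℝ => max (P i - K i) 0 :=
    fun K i => by fun_prop
  have hmax' : ∀ (K : Fin n → ℝ) i, Measurable fun P : Fin n → ℝ => max (K i - P i) 0 :=
    fun K i => by fun_prop
  refine ⟨fun t ht => ⟨hM.omegaBar_sigH hgain ht, hM.omegaBar_sigFx hgain ht, ?_⟩,
    fun Hbar hHm hH => hM.lrmGivenByFormula hgain hHm hH,
    fun t u k htu hu htk hk => ⟨hM.bondPricing htu hu, hM.forwardMoments htu hu htk hk⟩,
    fun K hK i hX => hM.hedgedBy_european hgain (hmax K i) (fun _ => le_max_right _ _)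
      (fun t ht => Spec.hasPrice_call ht le_rfl (hK i)) hX,
    fun K hK i hX => hM.hedgedBy_european hgain (hmax' K i) (fun _ => le_max_right _ _)
      (fun t ht => Spec.hasPrice_put ht le_rfl (hK i)) hX,
    fun i j hij wi wj hi hj hX => hM.margrabe hgain hij hi hj hX, fun Fs Gs hF hG i => ?_⟩
  · filter_upwards [hM.ae_posDef_omegaBar hgain ht] with ω hω
    exact isUnit_iff_ne_zero.2 hω.det_pos.ne'
  have hK : ∀ k, 0 < Elements.strike Fs Gs k i := fun k => div_pos (hG k i) (hF k i)
  have hput : ∀ k ≤ T, ∀ t < k, S.HasPrice t k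
      (fun P => Fs k i * max (Elements.strike Fs Gs k i - P i) 0)
      (fun z c x => Fs k i * S.putPrice z c t k (Elements.strike Fs Gs k) x i)
      (fun z c x a => Fs k i * S.bondPsiMinus z c t k (Elements.strike Fs Gs k) x a i) :=
    fun k hk t ht => (Spec.hasPrice_put ht hk (hK k)).const_mul _
  have hcall : ∀ k ≤ T, ∀ t < k, S.HasPrice t k
      (fun P => Fs k i * max (P i - Elements.strike Fs Gs k i) 0 + Gs k i)
      (fun z c x => Fs k i * S.callPrice z c t k (Elements.strike Fs Gs k) x i
        + S.bond z c t k x * Gs k i)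
      (fun z c x a => Fs k i * S.bondPsiPlus z c t k (Elements.strike Fs Gs k) x a i
        + S.bond z c t k x * lognMean (S.piMean z c t k x) (S.piCov z c t) a * Gs k i) :=
    fun k hk t ht => ((Spec.hasPrice_call ht hk (hK k)).const_mul _).add
      (Spec.hasPrice_const ht hk _)
  have hputm : ∀ k, Measurable fun P : Fin n → ℝ =>
      Fs k i * max (Elements.strike Fs Gs k i - P i) 0 := fun k => (hmax' _ i).const_mul _
  have hcallm : ∀ k, Measurable fun P : Fin n → ℝ =>
      Fs k i * max (P i - Elements.strike Fs Gs k i) 0 + Gs k i :=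
    fun k => ((hmax _ i).const_mul _).add_const _
  have hput0 : ∀ k (P : Fin n → ℝ), 0 ≤ Fs k i * max (Elements.strike Fs Gs k i - P i) 0 :=
    fun k P => mul_nonneg (hF k i).le (le_max_right _ _)
  have hcall0 : ∀ k (P : Fin n → ℝ),
      0 ≤ Fs k i * max (P i - Elements.strike Fs Gs k i) 0 + Gs k i :=
    fun k P => add_nonneg (mul_nonneg (hF k i).le (le_max_right _ _)) (hG k i).le
  exact ⟨hM.hedgedBy_term hgain hputm hput0 hput fun _ _ => rfl,
    hM.hedgedBy_endowment hgain (hputm T) (hput0 T) (hput T le_rfl) fun _ => rfl,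
    hM.hedgedBy_term hgain hcallm hcall0 hcall fun _ _ => rfl,
    hM.hedgedBy_endowment hgain (hcallm T) (hcall0 T) (hcall T le_rfl) fun _ => rfl⟩
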